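/- Let $M$ and $N$ be smooth finite-dimensional manifolds, $T>0$, and let $(E,g)$ and $(\check E,\check g)$ be sub-Riemannian structures on $M$ and $N$ (smooth subbundles of the tangent bundles with smooth inner products). Let $\nabla$ and $\check\nabla$ be smooth affine connections on $M$ and $N$, compatible with $(E,g)$ and $(\check E,\check g)$ respectively (that is, the subbundle and its inner product are parallel). Let $o\in M$ and $\check o\in N$, let $\Sigma_t:E_o\to E_o$ and $\check\Sigma_t:\check E_{\check o}\to\check E_{\check o}$, $t\in[0,T]$, be symmetric positive definite maps depending smoothly on $t$, and let $u_t$, $\check u_t$ be smooth time-dependent vector fields on $M$ and $N$. Write $\mathbb H^T(E_o)$ for the Hilbert space of absolutely continuous curves $\omega:[0,T]\to E_o$ with $\omega_0=0$ and square integrable derivative, and assume that for every $\omega\in\mathbb H^T(E_o)$ the equation $$\dot\gamma_t=/\!/_t\,\Sigma_t^{1/2}\dot\omega_t+u_t(\gamma_t),\qquad \gamma_0=o \qquad (1)$$ ($/\!/_t$ denotes $\nabla$-parallel transport along $\gamma$) has a solution on all of $[0,T]$. Let $\pi:M\to N$ be a smooth surjective submersion with $\pi(o)=\check o$, let $\mathcal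 V=\ker\pi_*$, and let $\mathcal H$ be the $g$-orthogonal complement of $E\cap\mathcal V$ within $E$. Assume that * $\pi_*E=\check E$, and $\langle v,w\rangle_g=\langle\pi_*v,\pi_*w\rangle_{\check g}$ for all $v,w\in\mathcal H$ with the same base point; * $\langle\Sigma_tv,w\rangle_g=0$ for $v\in\mathcal H_o$, $w\in E_o\cap\mathcal V_o$, and $\check\Sigma_t\pi_*v=\pi_*\Sigma_tv$ for $v\in\mathcal H_o$; * $\pi_*u_t=\check u_t\circ\pi$ for $t\in[0,T]$; * $\mathcal H$ is parallel with respect to $\nabla$, and $\nabla_v(hY)=h\check\nabla_{\pi_*v}Y$ for every section $Y$ of $\check E$ and every $v\in TM$, where $hY$ is the section of $\mathcal H$ with $\pi_*(hY)=Y\circ\pi$. A curve $\check\gamma:[0,T]\to N$ is called singular if it is the solution of the analogue of (1) on $N$, $$\dot{\check\gamma}_t=/\!\check/_t\,\check\Sigma_t^{1/2}\dot{\check\omega}_t+\check u_t(\check\gamma_t),\qquad \check\gamma_0=\check o,$$ for some $\check\omega\in\mathbb H^T(\check E_{\check o})$ which is not a regular point of the map $\check\Pi:\mathbb H^T(\check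 E_{\check o})\to N$ sending $\check\omega$ to the endpoint $\check\gamma_T$ of this solution (a regular point being one where the differential is surjective). Then a curve $\check\gamma:[0,T]\to N$ is singular if and only if there are an absolutely continuous curve $\gamma:[0,T]\to M$ with square integrable velocity, $\gamma_0=o$ and $\pi(\gamma_t)=\check\gamma_t$ for all $t\in[0,T]$, and an absolutely continuous one-form $\lambda_t\in T^*_{\gamma_t}M$ along $\gamma$ with $\lambda_t\neq0$ for all $t\in[0,T]$, such that $$\dot\gamma_t-u_t(\gamma_t)\in E\ \text{ for a.e. }t,\qquad \frac{D}{dt}\lambda_t+\lambda_t(\nabla u_t)+\lambda_t\big(T^\nabla(\dot\gamma_t,\cdot)\big)=0\ \text{ for a.e. }t,\qquad \lambda_t|_{E}=0\ \text{ for all }t\in[0,T],$$ where $T^\nabla$ is the torsion of $\nabla$, and such that $\lambda_0$ vanishes on $E_o+\mathcal V_o$. -/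

import Mathlib

open Set MeasureTheory
open scoped Manifold ContDiff Topology

noncomputable section

section Curves

variable {F : Type*} [NormedAddCommGroup F] [NormedSpace ℝ F]
  {M : Type*} [TopologicalSpace M] [ChartedSpace F M]

/-- A vector field on `M`, seen as a map into the tangent bundle. -/
abbrev vfMap (X : ∀ x : M, TangentSpace 𝓘(ℝ, F) x) : M → TangentBundle 𝓘(ℝ, F) M :=
  fun x => ⟨x, X x⟩

/-- The velocity `γ̇ t` of a curve. -/
def velocity (F : Type*) [NormedAddCommGroup F] [NormedSpace ℝ F]
    {M : Type*} [TopologicalSpace M] [ChartedSpace F M] (γ : ℝ → M) (t : ℝ) :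
    TangentSpace 𝓘(ℝ, F) (γ t) :=
  mfderiv 𝓘(ℝ, ℝ) 𝓘(ℝ, F) γ t (1 : ℝ)

/-- Curves `[0,T] → M` which are absolutely continuous with square integrable velocity.
This is tested on smooth functions, which is the same as asking it in local coordinates.
Only the values of `γ` on `[0,T]` matter. -/
structure IsH1Curve (F : Type*) [NormedAddCommGroup F] [NormedSpace ℝ F]
    {M : Type*} [TopologicalSpace M] [ChartedSpace F M] (T : ℝ) (γ : ℝ → M) : Prop where
  continuousOn : ContinuousOn γ (Icc 0 T)
  absolutelyContinuous : ∀ f : M → ℝ, ContMDiff 𝓘(ℝ, F) 𝓘(ℝ, ℝ) ∞ f →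
    AbsolutelyContinuousOnInterval (fun t => f (γ t)) 0 T
  memLp_deriv : ∀ f : M → ℝ, ContMDiff 𝓘(ℝ, F) 𝓘(ℝ, ℝ) ∞ f →
    MemLp (deriv fun t => f (γ t)) 2 (volume.restrict (Icc 0 T))

variable [IsManifold 𝓘(ℝ, F) ∞ M]

/-- The second covariant derivative `(∇_v df)(w) = v (W f) - (∇_v W) f` of a function `f`, where
`W` is any local vector field with `W x = w`. -/
def covHessian (cov : CovariantDerivative 𝓘(ℝ, F) F (TangentSpace 𝓘(ℝ, F) : M → Type _))
    (f : M → ℝ) (x : M) (v w : TangentSpace 𝓘(ℝ, F) x) : ℝ :=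
  letI W : ∀ y : M, TangentSpace 𝓘(ℝ, F) y := FiberBundle.extend F w
  letI Wf : M → ℝ := fun y => mfderiv 𝓘(ℝ, F) 𝓘(ℝ, ℝ) f y (W y)
  letI dWf : ℝ := mfderiv 𝓘(ℝ, F) 𝓘(ℝ, ℝ) Wf x v
  letI dfx : ℝ := mfderiv 𝓘(ℝ, F) 𝓘(ℝ, ℝ) f x (cov W x v)
  dWf - dfx

/-- The vector field `t ↦ V t` along `γ` is absolutely continuous and parallel, `D V / dt = 0`
almost everywhere on `[0,T]`. By the Leibniz rule this reads
`d/dt (df (V t)) = (∇_{γ̇ t} df) (V t)` for all smooth functions `f`; for `f` a local coordinate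
`x^k`, this is the usual equation `v̇^k + Γ^k_{ij} γ̇^i v^j = 0`. -/
def IsParallelAlong (cov : CovariantDerivative 𝓘(ℝ, F) F (TangentSpace 𝓘(ℝ, F) : M → Type _))
    (T : ℝ) (γ : ℝ → M) (V : ∀ t : ℝ, TangentSpace 𝓘(ℝ, F) (γ t)) : Prop :=
  ∀ f : M → ℝ, ContMDiff 𝓘(ℝ, F) 𝓘(ℝ, ℝ) ∞ f →
    letI dfV : ℝ → ℝ := fun t => mfderiv 𝓘(ℝ, F) 𝓘(ℝ, ℝ) f (γ t) (V t)
    AbsolutelyContinuousOnInterval dfV 0 T ∧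
    ∀ᵐ t ∂(volume.restrict (Icc 0 T)),
      deriv dfV t = covHessian cov f (γ t) (velocity F γ t) (V t)

/-- The one-form `t ↦ lam t` along `γ` is absolutely continuous, with covariant derivative
`D lam / dt = μ` almost everywhere on `[0,T]`. By the Leibniz rule this reads
`d/dt (lam t W) = μ t W + lam t (∇_{γ̇ t} W)` for all smooth vector fields `W` on `M`. -/
def HasCovDerivAlong (cov : CovariantDerivative 𝓘(ℝ, F) F (TangentSpace 𝓘(ℝ, F) : M → Type _))
    (T : ℝ) (γ : ℝ → M) (lam μ : ∀ t : ℝ, TangentSpace 𝓘(ℝ, F) (γ t) →L[ℝ] ℝ) : Prop :=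
  ∀ W : ∀ x : M, TangentSpace 𝓘(ℝ, F) x, ContMDiff 𝓘(ℝ, F) 𝓘(ℝ, F).tangent ∞ (vfMap W) →
    AbsolutelyContinuousOnInterval (fun t => lam t (W (γ t))) 0 T ∧
    ∀ᵐ t ∂(volume.restrict (Icc 0 T)),
      deriv (fun s => lam s (W (γ s))) t
        = μ t (W (γ t)) + lam t (cov W (γ t) (velocity F γ t))

end Curves

/-- The positive semidefinite symmetric square root of a positive semidefinite symmetric
endomorphism of a finite dimensional inner product space (zero if there is none). -/
def posSqrt {V : Type*} [NormedAddCommGroup V] [InnerProductSpace ℝ V] (A : V →L[ℝ] V) :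
    V →L[ℝ] V :=
  open Classical in
  if h : ∃ S : V →L[ℝ] V, S.IsPositive ∧ S ∘L S = A then h.choose else 0

/-- A sub-Riemannian structure `(E, g)` on `M`: a smooth subbundle `E` of the tangent bundle with a
smooth inner product `g`. Smoothness is expressed by the existence of smooth local orthonormal
frames of `E`. -/
structure SubRiemannianStructure (F : Type*) [NormedAddCommGroup F] [NormedSpace ℝ F]
    (M : Type*) [TopologicalSpace M] [ChartedSpace F M] [IsManifold 𝓘(ℝ, F) ∞ M] where
  E : ∀ x : M, Submodule ℝ (TangentSpace 𝓘(ℝ, F) x)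
  metric : ∀ x : M, E x →ₗ[ℝ] E x →ₗ[ℝ] ℝ
  metric_symm : ∀ x (v w : E x), metric x v w = metric x w v
  metric_pos : ∀ x (v : E x), v ≠ 0 → 0 < metric x v v
  exists_frame : ∀ x : M, ∃ U : Set M, IsOpen U ∧ x ∈ U ∧ ∃ (k : ℕ) (X : Fin k → ∀ y : M, E y),
    (∀ i, ContMDiffOn 𝓘(ℝ, F) 𝓘(ℝ, F).tangent ∞ (vfMap fun y => (X i y).1) U) ∧
    ∀ y ∈ U, (∀ i j, metric y (X i y) (X j y) = if i = j then 1 else 0) ∧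
      Submodule.span ℝ (Set.range fun i => X i y) = ⊤

namespace SubRiemannianStructure

variable {F : Type*} [NormedAddCommGroup F] [NormedSpace ℝ F]
  {M : Type*} [TopologicalSpace M] [ChartedSpace F M] [IsManifold 𝓘(ℝ, F) ∞ M]
  (S : SubRiemannianStructure F M)

/-- The fibre `E_x`, as a Euclidean space with the inner product `g_x`. -/
def Fiber (x : M) : Type _ := S.E x

instance (x : M) : AddCommGroup (S.Fiber x) := inferInstanceAs (AddCommGroup (S.E x))

instance (x : M) : Module ℝ (S.Fiber x) := inferInstanceAs (Module ℝ (S.E x))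

/-- The identification of `E_x` with `S.Fiber x`. -/
def toFiber (x : M) : S.E x ≃ₗ[ℝ] S.Fiber x := LinearEquiv.refl ℝ (S.E x)

/-- The inclusion of `E_x` into the tangent space. -/
def incl (x : M) : S.Fiber x →ₗ[ℝ] TangentSpace 𝓘(ℝ, F) x :=
  (S.E x).subtype ∘ₗ (S.toFiber x).symm.toLinearMap

/-- The inner product `g_x` on `E_x`. -/
@[reducible]
def fiberCore (x : M) : InnerProductSpace.Core ℝ (S.Fiber x) where
  inner v w := S.metric x ((S.toFiber x).symm v) ((S.toFiber x).symm w)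
  conj_inner_symm v w := S.metric_symm x _ _
  re_inner_nonneg v := by
    by_cases h : (S.toFiber x).symm v = 0
    · simp [h]
    · exact (S.metric_pos x _ h).le
  add_left u v w := by simp
  smul_left v w r := by simp
  definite v h := by
    by_contra hv
    exact (S.metric_pos x ((S.toFiber x).symm v) (by simpa using hv)).ne' h

instance (x : M) : NormedAddCommGroup (S.Fiber x) := (S.fiberCore x).toNormedAddCommGroup

instance (x : M) : InnerProductSpace ℝ (S.Fiber x) := InnerProductSpace.ofCore (S.fiberCore x).toCore

/-- The Cameron-Martin space `ℍ^T(E_x)` of absolutely continuous curves `ω` in `E_x` with `ω 0 = 0`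
and square integrable derivative. Such a curve is represented by its derivative, and
`⟨ω, k⟩ = ∫ ⟨ω̇ t, k̇ t⟩ dt` is the inner product of `L²`. -/
abbrev CameronMartin (x : M) (T : ℝ) : Type _ :=
  Lp (S.Fiber x) 2 ((volume : Measure ℝ).restrict (Icc 0 T))

/-- The connection is compatible with `(E, g)`: `E` and `g` are parallel. -/
structure IsCompatible
    (cov : CovariantDerivative 𝓘(ℝ, F) F (TangentSpace 𝓘(ℝ, F) : M → Type _)) : Prop where
  cov_mem : ∀ (X : ∀ y : M, S.E y) (x : M) (v : TangentSpace 𝓘(ℝ, F) x),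
    MDifferentiableAt 𝓘(ℝ, F) 𝓘(ℝ, F).tangent (vfMap fun y => (X y).1) x →
    cov (fun y => (X y).1) x v ∈ S.E x
  cov_metric : ∀ (X Y : ∀ y : M, S.E y) (x : M) (v : TangentSpace 𝓘(ℝ, F) x),
    MDifferentiableAt 𝓘(ℝ, F) 𝓘(ℝ, F).tangent (vfMap fun y => (X y).1) x →
    MDifferentiableAt 𝓘(ℝ, F) 𝓘(ℝ, F).tangent (vfMap fun y => (Y y).1) x →
    ∀ A B : S.E x, A.1 = cov (fun y => (X y).1) x v → B.1 = cov (fun y => (Y y).1) x v →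
    mfderiv 𝓘(ℝ, F) 𝓘(ℝ, ℝ) (fun y => S.metric y (X y) (Y y)) x v
      = S.metric x A (Y x) + S.metric x (X x) B

end SubRiemannianStructure

/-- The data defining developments on `M` over `[0,T]`: a sub-Riemannian structure `(E, g)`, a
smooth connection `∇` compatible with it, a reference point `o`, a smooth time-dependent
covariance `Σ_t : E_o → E_o`, symmetric and invertible with nonnegative eigenvalues, and a smooth
time-dependent vector field `u_t` on `M`. -/
structure DevelopmentData (F : Type*) [NormedAddCommGroup F] [NormedSpace ℝ F]
    (M : Type*) [TopologicalSpace M] [ChartedSpace F M] [IsManifold 𝓘(ℝ, F) ∞ M] (T : ℝ) where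
  sr : SubRiemannianStructure F M
  cov : CovariantDerivative 𝓘(ℝ, F) F (TangentSpace 𝓘(ℝ, F) : M → Type _)
  cov_smooth : CovariantDerivative.ContMDiffCovariantDerivative cov ∞
  cov_compatible : sr.IsCompatible cov
  o : M
  sigma : ℝ → sr.Fiber o →L[ℝ] sr.Fiber o
  sigma_smooth : ContDiffOn ℝ ∞ sigma (Icc 0 T)
  sigma_symm : ∀ t ∈ Icc 0 T, ∀ v w, inner ℝ (sigma t v) w = inner ℝ v (sigma t w)
  sigma_pos : ∀ t ∈ Icc 0 T, ∀ v, v ≠ 0 → 0 < inner ℝ (sigma t v) v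
  u : ℝ → ∀ x : M, TangentSpace 𝓘(ℝ, F) x
  u_smooth : ContMDiffOn (𝓘(ℝ, ℝ).prod 𝓘(ℝ, F)) 𝓘(ℝ, F).tangent ∞
    (fun p : ℝ × M => vfMap (u p.1) p.2) (Icc 0 T ×ˢ univ)

namespace DevelopmentData

variable {F : Type*} [NormedAddCommGroup F] [NormedSpace ℝ F]
  {M : Type*} [TopologicalSpace M] [ChartedSpace F M] [IsManifold 𝓘(ℝ, F) ∞ M] {T : ℝ}
  (D : DevelopmentData F M T)

/-- The Hilbert space `ℍ^T(E_o)`. -/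
abbrev H : Type _ := D.sr.CameronMartin D.o T

/-- `γ` solves `γ̇ t = //_t Σ_t^{1/2} ω̇ t + u_t (γ t)`, `γ 0 = o`, on `[0,T]`, where
`//_t : E_o → T_{γ t} M` denotes parallel transport along `γ`. -/
def IsDevelopment (η : D.H) (γ : ℝ → M) : Prop :=
  IsH1Curve F T γ ∧ γ 0 = D.o ∧
  ∃ P : ∀ t : ℝ, D.sr.Fiber D.o →ₗ[ℝ] TangentSpace 𝓘(ℝ, F) (γ t),
    (∀ v, (⟨γ 0, P 0 v⟩ : TangentBundle 𝓘(ℝ, F) M) = ⟨D.o, D.sr.incl D.o v⟩) ∧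
    (∀ v, IsParallelAlong D.cov T γ fun t => P t v) ∧
    ∀ᵐ t ∂(volume.restrict (Icc 0 T)),
      velocity F γ t = P t (posSqrt (D.sigma t) (η t)) + D.u t (γ t)

/-- The map `Π : ℍ^T(E_o) → M`, `ω ↦ γ T`, where `γ` is the solution of
`γ̇ t = //_t Σ_t^{1/2} ω̇ t + u_t (γ t)`, `γ 0 = o`. -/
def endpointMap (η : D.H) : M :=
  open Classical in
  if h : ∃ γ : ℝ → M, D.IsDevelopment η γ then h.choose T else D.o

/-- `ω` is a regular point of the endpoint map `Π`: its differential at `ω` is surjective. -/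
def IsRegular (η : D.H) : Prop :=
  MDifferentiableAt 𝓘(ℝ, D.H) 𝓘(ℝ, F) D.endpointMap η ∧
  Function.Surjective (mfderiv 𝓘(ℝ, D.H) 𝓘(ℝ, F) D.endpointMap η)

/-- `γ` is singular: it is the development of some `ω` at which `Π` is not regular. -/
def IsSingularCurve (γ : ℝ → M) : Prop :=
  ∃ η : D.H, D.IsDevelopment η γ ∧ ¬ D.IsRegular η

variable [FiniteDimensional ℝ F]

/-- The pair `(γ, lam)`, with `lam` a one-form along the curve `γ`, solves the singular-curve system
`γ̇ t - u_t (γ t) ∈ E`, `D lam / dt + lam (∇ u_t) + lam (T (γ̇ t, ·)) = 0`, `lam|_E = 0`. -/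
structure SolvesSingularSystem (γ : ℝ → M)
    (lam : ∀ t : ℝ, TangentSpace 𝓘(ℝ, F) (γ t) →L[ℝ] ℝ) : Prop where
  isH1Curve : IsH1Curve F T γ
  velocity_sub_mem : ∀ᵐ t ∂(volume.restrict (Icc 0 T)),
    velocity F γ t - D.u t (γ t) ∈ D.sr.E (γ t)
  covDeriv_eq : HasCovDerivAlong D.cov T γ lam fun t =>
    -(lam t ∘L D.cov (D.u t) (γ t) + lam t ∘L D.cov.torsion (γ t) (velocity F γ t))
  vanish : ∀ t ∈ Icc 0 T, ∀ v ∈ D.sr.E (γ t), lam t v = 0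

end DevelopmentData

section Submersion

variable {F : Type*} [NormedAddCommGroup F] [NormedSpace ℝ F]
  {M : Type*} [TopologicalSpace M] [ChartedSpace F M] [IsManifold 𝓘(ℝ, F) ∞ M]
  {F' : Type*} [NormedAddCommGroup F'] [NormedSpace ℝ F']
  {N : Type*} [TopologicalSpace N] [ChartedSpace F' N] [IsManifold 𝓘(ℝ, F') ∞ N]

/-- The vertical space `𝓥_x = ker π_{*,x}`. -/
def vertical (F : Type*) [NormedAddCommGroup F] [NormedSpace ℝ F]
    {M : Type*} [TopologicalSpace M] [ChartedSpace F M]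
    (F' : Type*) [NormedAddCommGroup F'] [NormedSpace ℝ F']
    {N : Type*} [TopologicalSpace N] [ChartedSpace F' N]
    (π : M → N) (x : M) : Submodule ℝ (TangentSpace 𝓘(ℝ, F) x) :=
  LinearMap.ker (mfderiv 𝓘(ℝ, F) 𝓘(ℝ, F') π x).toLinearMap

/-- The space `𝓗_x`, the `g`-orthogonal complement of `𝓥_x ∩ E_x` within `E_x`. -/
def IsHorizontal (F' : Type*) [NormedAddCommGroup F'] [NormedSpace ℝ F']
    {N : Type*} [TopologicalSpace N] [ChartedSpace F' N]
    (S : SubRiemannianStructure F M) (π : M → N) {x : M} (v : S.E x) : Prop :=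
  ∀ w : S.E x, w.1 ∈ vertical F F' π x → S.metric x v w = 0

/-- The data `D` on `M` projects to the data `D'` on `N` along the surjective submersion `π`. -/
structure IsSubmersionOfData {T : ℝ} (π : M → N)
    (D : DevelopmentData F M T) (D' : DevelopmentData F' N T) : Prop where
  smooth : ContMDiff 𝓘(ℝ, F) 𝓘(ℝ, F') ∞ π
  surjective : Function.Surjective π
  submersion : ∀ x, Function.Surjective (mfderiv 𝓘(ℝ, F) 𝓘(ℝ, F') π x)
  map_o : π D.o = D'.o
  /-- `π_*` maps `E` into `Ě`, -/
  map_mem : ∀ x, ∀ v ∈ D.sr.E x, mfderiv 𝓘(ℝ, F) 𝓘(ℝ, F') π x v ∈ D'.sr.E (π x)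
  /-- and onto `Ě`, -/
  map_surj : ∀ x, ∀ w ∈ D'.sr.E (π x), ∃ v ∈ D.sr.E x, mfderiv 𝓘(ℝ, F) 𝓘(ℝ, F') π x v = w
  /-- isometrically on `𝓗`. -/
  isometry : ∀ x (v w : D.sr.E x), IsHorizontal F' D.sr π v → IsHorizontal F' D.sr π w →
    D.sr.metric x v w = D'.sr.metric (π x) ⟨_, map_mem x v.1 v.2⟩ ⟨_, map_mem x w.1 w.2⟩
  /-- `⟨Σ_t v, w⟩ = 0` for `v ∈ 𝓗_o` and `w ∈ E_o ∩ 𝓥_o`. -/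
  sigma_orthogonal : ∀ t ∈ Icc 0 T, ∀ v w : D.sr.E D.o, IsHorizontal F' D.sr π v →
    w.1 ∈ vertical F F' π D.o →
    inner ℝ (D.sigma t (D.sr.toFiber D.o v)) (D.sr.toFiber D.o w) = 0
  /-- `Σ̌_t (π_* v) = π_* (Σ_t v)` for `v ∈ 𝓗_o`; this determines `Σ̌_t`. -/
  sigma_related : ∀ t ∈ Icc 0 T, ∀ (v : D.sr.Fiber D.o) (v' : D'.sr.Fiber D'.o),
    IsHorizontal F' D.sr π ((D.sr.toFiber D.o).symm v) →
    (⟨π D.o, mfderiv 𝓘(ℝ, F) 𝓘(ℝ, F') π D.o (D.sr.incl D.o v)⟩ : TangentBundle 𝓘(ℝ, F') N)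
      = ⟨D'.o, D'.sr.incl D'.o v'⟩ →
    (⟨π D.o, mfderiv 𝓘(ℝ, F) 𝓘(ℝ, F') π D.o (D.sr.incl D.o (D.sigma t v))⟩ :
        TangentBundle 𝓘(ℝ, F') N)
      = ⟨D'.o, D'.sr.incl D'.o (D'.sigma t v')⟩
  /-- `u_t` is `π`-related to `ǔ_t`. -/
  u_related : ∀ t ∈ Icc 0 T, ∀ x,
    mfderiv 𝓘(ℝ, F) 𝓘(ℝ, F') π x (D.u t x) = D'.u t (π x)
  /-- `𝓗` is parallel with respect to `∇`. -/
  horizontal_parallel : ∀ (X : ∀ y : M, D.sr.E y) (x : M) (v : TangentSpace 𝓘(ℝ, F) x),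
    (∀ y, IsHorizontal F' D.sr π (X y)) →
    MDifferentiableAt 𝓘(ℝ, F) 𝓘(ℝ, F).tangent (vfMap fun y => (X y).1) x →
    ∃ A : D.sr.E x, IsHorizontal F' D.sr π A ∧ A.1 = D.cov (fun y => (X y).1) x v
  /-- `∇_v hY = h (∇̌_{π_* v} Y)`: if `X = hY` is the section of `𝓗` which projects to the section
  `Y` of `Ě`, then (the horizontal vector) `∇_v X` projects to `∇̌_{π_* v} Y`. -/
  cov_pullback : ∀ (X : ∀ y : M, D.sr.E y) (Y : ∀ z : N, D'.sr.E z) (x : M)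
    (v : TangentSpace 𝓘(ℝ, F) x),
    (∀ y, IsHorizontal F' D.sr π (X y)) →
    (∀ y, mfderiv 𝓘(ℝ, F) 𝓘(ℝ, F') π y (X y).1 = (Y (π y)).1) →
    MDifferentiableAt 𝓘(ℝ, F') 𝓘(ℝ, F').tangent (vfMap fun z => (Y z).1) (π x) →
    mfderiv 𝓘(ℝ, F) 𝓘(ℝ, F') π x (D.cov (fun y => (X y).1) x v)
      = D'.cov (fun z => (Y z).1) (π x) (mfderiv 𝓘(ℝ, F) 𝓘(ℝ, F') π x v)

end Submersion

end

-- Everything rests on a first-order description of the controls at which the endpoint map fails to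
-- be a submersion. A development, together with the parallel transport P of an orthonormal basis
-- e_i of E_o, solves a differential equation affine in the control. The endpoint map is therefore
-- differentiable, with differential given by the linearized equation. Let X_a be sections spanning
-- E along γ, write γ̇ − u = Σ c_a X_a, and let p be a covector solving the adjoint of the
-- linearized flow of u + Σ c_a X_a. Transported basis vectors stay in E, so they expand in the X_a.
-- Varying Σ w_i P e_i thus produces a vector of E plus Σ c_a times the derivative of X_a along the
-- variation of the base point. The adjoint equation absorbs the second term, so the pairing of p
-- with the variation of γ has as derivative p evaluated on a vector of E (`hasACDeriv_pairing`).
--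
-- If p vanishes on E, the pairing stays zero and p_T annihilates the image of the differential
-- (`not_isRegular_of_isExtremal`). Conversely, let f ≠ 0 annihilate that image and let p be the
-- adjoint solution ending at f. As Σ_t^{1/2} is invertible, a linear feedback produces a control k
-- for which the vector of E above has coefficients β_i = p(P e_i). Then 0 = f(dΠ k) = ∫ Σ β_i², so
-- p vanishes on E (`exists_isExtremal_of_not_isRegular`).
--
-- The torsion equation of the theorem is the same adjoint equation in disguise. If λ vanishes on E,
-- compatibility gives λ(∇_W X_a) = 0, and the formula T(X, W) = ∇_X W − ∇_W X − [X, W] turns the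
-- equation into d/dt λ(W) = λ([u + Σ c_a X_a, W]), which no longer involves the connection
-- (`IsControlledBy.apply_lieTerm_eq`). It is linear, so a solution is determined by its value at
-- any one time.
--
-- The horizontal lift of Ě_ǒ into E_o intertwines the square roots of the covariances, and
-- horizontal parallel fields project to parallel fields. Hence every control on N has a
-- development, the projection of one on M (`exists_development_lift`). Along a curve in M, E is
-- spanned by horizontal lifts of sections of Ě and by vertical sections. These project to sections
-- of Ě and to zero, so adjoint solutions on N pull back to Lie transported one-forms on M
-- (`isLieTransported_pullbackForm`). A pulled back form vanishes on 𝓥 and, since π_*E = Ě, it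
-- vanishes on E exactly when the form on N vanishes on Ě. Conversely, if λ_0 kills 𝓥_o, then it
-- descends to N, and uniqueness identifies λ with the pullback of the adjoint solution starting at
-- the descended covector.
--
-- All the analysis takes place in Euclidean space: `CompactFrame` embeds a neighbourhood of the
-- compact trace of a curve, with smooth functions extended to the ambient space.

universe uM uN

noncomputable section

/-! ### Calculus of absolutely continuous curves in normed spaces; Gronwall's inequality. -/

section ACCalculus

variable {X Y Z : Type*} [NormedAddCommGroup X] [NormedSpace ℝ X]
  [NormedAddCommGroup Y] [NormedSpace ℝ Y] [NormedAddCommGroup Z] [NormedSpace ℝ Z]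

/-- Absolute continuity is inherited by functions whose increments are dominated by those of two
absolutely continuous functions. -/
theorem AbsolutelyContinuousOnInterval.of_dist_le {A B C : Type*} [PseudoMetricSpace A]
    [PseudoMetricSpace B] [PseudoMetricSpace C] {f : ℝ → A} {g : ℝ → B} {h : ℝ → C} {a b : ℝ}
    (hg : AbsolutelyContinuousOnInterval g a b) (hh : AbsolutelyContinuousOnInterval h a b)
    (c d : ℝ) (hd : ∀ x ∈ uIcc a b, ∀ y ∈ uIcc a b,
      dist (f x) (f y) ≤ c * dist (g x) (g y) + d * dist (h x) (h y)) :
    AbsolutelyContinuousOnInterval f a b := by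
  have hlim := (Filter.Tendsto.const_mul c hg).add (Filter.Tendsto.const_mul d hh)
  simp only [mul_zero, add_zero] at hlim
  refine squeeze_zero' (Filter.Eventually.of_forall fun E => Finset.sum_nonneg fun _ _ =>
    dist_nonneg) ?_ hlim
  have : ∀ᶠ (E : ℕ × (ℕ → ℝ × ℝ)) in AbsolutelyContinuousOnInterval.totalLengthFilter ⊓
      Filter.principal (AbsolutelyContinuousOnInterval.disjWithin a b),
      E ∈ AbsolutelyContinuousOnInterval.disjWithin a b :=
    Filter.eventually_inf_principal.mpr (by simp)
  filter_upwards [this] with E hE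
  rw [Finset.mul_sum, Finset.mul_sum, ← Finset.sum_add_distrib]
  exact Finset.sum_le_sum fun i hi => hd _ (hE.1 i hi).1 _ (hE.1 i hi).2

theorem AbsolutelyContinuousOnInterval.congr' {A : Type*} [PseudoMetricSpace A] {f g : ℝ → A}
    {a b : ℝ} (hg : AbsolutelyContinuousOnInterval g a b) (h : ∀ x ∈ uIcc a b, f x = g x) :
    AbsolutelyContinuousOnInterval f a b :=
  hg.of_dist_le hg 1 0 fun x hx y hy => by rw [h x hx, h y hy]; simp

theorem AbsolutelyContinuousOnInterval.const' {A : Type*} [PseudoMetricSpace A] (c : A) (a b : ℝ) :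
    AbsolutelyContinuousOnInterval (fun _ => c) a b := by
  simpa [AbsolutelyContinuousOnInterval] using tendsto_const_nhds

/-- Increments are dominated by those of the integral of `‖f‖`, for which the scalar statement
applies. -/
theorem IntervalIntegrable.absolutelyContinuousOnInterval_integral {f : ℝ → X} {T : ℝ}
    (hT : 0 ≤ T) (h : IntegrableOn f (Icc 0 T)) :
    AbsolutelyContinuousOnInterval (fun t => ∫ s in (0 : ℝ)..t, f s) 0 T := by
  have hi : IntervalIntegrable f volume 0 T :=
    (intervalIntegrable_iff_integrableOn_Icc_of_le hT).2 h
  have hn := hi.norm.absolutelyContinuousOnInterval_intervalIntegral (c := 0) (by simp)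
  refine hn.of_dist_le hn 1 0 fun x hx y hy => ?_
  have hsub : ∀ x ∈ uIcc 0 T, IntervalIntegrable f volume 0 x := fun x hx =>
    hi.mono_set (uIcc_subset_uIcc (by simp) hx)
  rw [dist_eq_norm, dist_eq_norm, intervalIntegral.integral_interval_sub_left (hsub x hx)
    (hsub y hy), intervalIntegral.integral_interval_sub_left (hsub x hx).norm (hsub y hy).norm]
  simpa using intervalIntegral.norm_integral_le_abs_integral_norm

/-- `f` is absolutely continuous on `[0,T]`, with integrable almost everywhere derivative `f'`. -/
structure HasACDeriv (T : ℝ) (f f' : ℝ → X) : Prop where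
  ac : AbsolutelyContinuousOnInterval f 0 T
  integrable : IntegrableOn f' (Icc 0 T)
  hasDerivAt : ∀ᵐ t ∂(volume.restrict (Icc 0 T)), HasDerivAt f (f' t) t

namespace HasACDeriv

variable {T : ℝ} {f f' g g' : ℝ → X}

theorem continuousOn (hT : 0 ≤ T) (h : HasACDeriv T f f') : ContinuousOn f (Icc 0 T) := by
  simpa [uIcc_of_le hT] using h.ac.continuousOn

theorem congr_ae (h : HasACDeriv T f f') (hg : f' =ᵐ[volume.restrict (Icc 0 T)] g') :
    HasACDeriv T f g' where
  ac := h.ac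
  integrable := h.integrable.congr hg
  hasDerivAt := by
    filter_upwards [h.hasDerivAt, hg] with t h1 h2
    rwa [← h2]

/-- The endpoints are a null set, and at interior times a two-sided derivative only sees the values
on the interval. This is what makes data given on `[0,T]` alone sufficient. -/
theorem _root_.ae_restrict_Icc_mem_Ioo (T : ℝ) :
    ∀ᵐ t ∂((volume : Measure ℝ).restrict (Icc 0 T)), t ∈ Ioo 0 T := by
  rw [← Measure.restrict_congr_set (Ioo_ae_eq_Icc (a := (0:ℝ)) (b := T))]
  exact ae_restrict_mem measurableSet_Ioo

theorem congr (hT : 0 ≤ T) (h : HasACDeriv T f f') (hg : ∀ t ∈ Icc 0 T, g t = f t) :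
    HasACDeriv T g f' where
  ac := h.ac.congr' (by rwa [uIcc_of_le hT])
  integrable := h.integrable
  hasDerivAt := by
    filter_upwards [h.hasDerivAt, ae_restrict_Icc_mem_Ioo T] with t h1 h2
    exact h1.congr_of_eventuallyEq (Filter.eventuallyEq_of_mem (Ioo_mem_nhds h2.1 h2.2)
      fun s hs => hg s (Ioo_subset_Icc_self hs))

theorem const (T : ℝ) (c : X) : HasACDeriv T (fun _ => c) (fun _ => 0) where
  ac := .const' c _ _
  integrable := integrableOn_zero
  hasDerivAt := .of_forall fun _ => hasDerivAt_const _ _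

theorem add (hf : HasACDeriv T f f') (hg : HasACDeriv T g g') :
    HasACDeriv T (fun t => f t + g t) (fun t => f' t + g' t) where
  ac := hf.ac.add hg.ac
  integrable := hf.integrable.add hg.integrable
  hasDerivAt := by
    filter_upwards [hf.hasDerivAt, hg.hasDerivAt] with t h1 h2 using h1.add h2

theorem neg (hf : HasACDeriv T f f') : HasACDeriv T (fun t => - f t) (fun t => - f' t) where
  ac := hf.ac.neg
  integrable := hf.integrable.neg
  hasDerivAt := by filter_upwards [hf.hasDerivAt] with t h1 using h1.neg

theorem sub (hf : HasACDeriv T f f') (hg : HasACDeriv T g g') :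
    HasACDeriv T (fun t => f t - g t) (fun t => f' t - g' t) where
  ac := hf.ac.sub hg.ac
  integrable := hf.integrable.sub hg.integrable
  hasDerivAt := by
    filter_upwards [hf.hasDerivAt, hg.hasDerivAt] with t h1 h2 using h1.sub h2

theorem sum {ι : Type*} (s : Finset ι) {f f' : ι → ℝ → X}
    (h : ∀ i ∈ s, HasACDeriv T (f i) (f' i)) :
    HasACDeriv T (fun t => ∑ i ∈ s, f i t) (fun t => ∑ i ∈ s, f' i t) := by
  classical
  induction s using Finset.induction_on with
  | empty => simpa using const T (0 : X)
  | insert a s ha ih =>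
    simp only [Finset.sum_insert ha]
    exact (h a (by simp)).add (ih fun i hi => h i (by simp [hi]))

theorem _root_.integrableOn_bilin (L : X →L[ℝ] Y →L[ℝ] Z) {a : ℝ → X} {w : ℝ → Y}
    (ha : ContinuousOn a (Icc 0 T)) (hw : IntegrableOn w (Icc 0 T)) :
    IntegrableOn (fun t => L (a t) (w t)) (Icc 0 T) := by
  obtain ⟨C, hC⟩ := isCompact_Icc.exists_bound_of_continuousOn ha
  refine Integrable.mono' (hw.norm.const_mul (‖L‖ * C)) ?_ ?_
  · exact L.aestronglyMeasurable_comp₂ (ha.aestronglyMeasurable measurableSet_Icc)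
      hw.aestronglyMeasurable
  · filter_upwards [ae_restrict_mem measurableSet_Icc] with t ht
    refine (L.le_opNorm₂ _ _).trans ?_
    gcongr
    exact hC t ht

/-- The product rule. -/
theorem bilin (hT : 0 ≤ T) (L : X →L[ℝ] Y →L[ℝ] Z) {u u' : ℝ → Y} (hf : HasACDeriv T f f')
    (hu : HasACDeriv T u u') :
    HasACDeriv T (fun t => L (f t) (u t)) (fun t => L (f' t) (u t) + L (f t) (u' t)) where
  ac := by
    obtain ⟨C, hC⟩ := hf.ac.exists_bound
    obtain ⟨D, hD⟩ := hu.ac.exists_bound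
    refine hf.ac.of_dist_le hu.ac (‖L‖ * D) (‖L‖ * C) fun x hx y hy => ?_
    have h1 : L (f x) (u x) - L (f y) (u y) = L (f x - f y) (u x) + L (f y) (u x - u y) := by
      simp
    rw [dist_eq_norm, dist_eq_norm, dist_eq_norm, h1]
    refine (norm_add_le _ _).trans (add_le_add ?_ ?_)
    · refine (L.le_opNorm₂ _ _).trans ?_
      calc ‖L‖ * ‖f x - f y‖ * ‖u x‖ ≤ ‖L‖ * ‖f x - f y‖ * D := by gcongr; exact hD x hx
        _ = _ := by ring
    · refine (L.le_opNorm₂ _ _).trans ?_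
      gcongr
      exact hC y hy
  integrable := by
    have h1 := integrableOn_bilin L.flip (hu.continuousOn hT) hf.integrable
    exact Integrable.add (by simpa [IntegrableOn] using h1) (integrableOn_bilin L (hf.continuousOn hT) hu.integrable)
  hasDerivAt := by
    filter_upwards [hf.hasDerivAt, hu.hasDerivAt] with t h1 h2
    have := (L.hasFDerivAt.comp_hasDerivAt t h1).clm_apply h2
    simpa using this

theorem clm (hT : 0 ≤ T) (L : X →L[ℝ] Y) (hf : HasACDeriv T f f') :
    HasACDeriv T (fun t => L (f t)) (fun t => L (f' t)) := by
  simpa using bilin hT (ContinuousLinearMap.id ℝ (X →L[ℝ] Y)) (const T L) hf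

theorem mul {f f' g g' : ℝ → ℝ} (hT : 0 ≤ T) (hf : HasACDeriv T f f') (hg : HasACDeriv T g g') :
    HasACDeriv T (fun t => f t * g t) (fun t => f' t * g t + f t * g' t) := by
  simpa using bilin hT (ContinuousLinearMap.mul ℝ ℝ) hf hg

theorem const_mul {f f' : ℝ → ℝ} (hT : 0 ≤ T) (c : ℝ) (hf : HasACDeriv T f f') :
    HasACDeriv T (fun t => c * f t) (fun t => c * f' t) := by
  simpa using mul hT (const T c) hf

theorem of_integral [CompleteSpace X] (hT : 0 ≤ T) (c : X) (h : IntegrableOn f' (Icc 0 T)) :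
    HasACDeriv T (fun t => c + ∫ s in (0 : ℝ)..t, f' s) f' where
  ac := (AbsolutelyContinuousOnInterval.const' c 0 T).add
    (IntervalIntegrable.absolutelyContinuousOnInterval_integral hT h)
  integrable := h
  hasDerivAt := by
    have hi : IntervalIntegrable f' volume 0 T :=
      (intervalIntegrable_iff_integrableOn_Icc_of_le hT).2 h
    rw [ae_restrict_iff' measurableSet_Icc]
    filter_upwards [hi.ae_hasDerivAt_integral] with t h1 h2
    exact (h1 (by rwa [uIcc_of_le hT]) 0 (by simp)).const_add c

/-- The difference with the indefinite integral is absolutely continuous with zero derivative almost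
everywhere, hence constant. -/
theorem eq_integral [CompleteSpace X] (hT : 0 ≤ T) (h : HasACDeriv T f f') {t : ℝ}
    (ht : t ∈ Icc 0 T) : f t = f 0 + ∫ s in (0 : ℝ)..t, f' s := by
  have h1 := h.sub (of_integral hT 0 h.integrable)
  obtain ⟨C, hC⟩ := h1.ac.const_of_ae_hasDerivAt_zero (by
    have := h1.hasDerivAt
    rw [ae_restrict_iff' measurableSet_Icc] at this
    filter_upwards [this] with t h2 h3
    simpa using h2 (by rwa [uIcc_of_le hT] at h3))
  have e1 := hC t (by rwa [uIcc_of_le hT])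
  have e0 := hC 0 (by simp)
  simp only [zero_add, intervalIntegral.integral_same, sub_zero] at e1 e0
  rw [e0, ← e1]
  abel

theorem sub_eq_integral [CompleteSpace X] (hT : 0 ≤ T) (h : HasACDeriv T f f') {t : ℝ}
    (ht : t ∈ Icc 0 T) : f t - f 0 = ∫ s in (0 : ℝ)..t, f' s := by
  rw [h.eq_integral hT ht]; abel

theorem eq_of_deriv_zero (hT : 0 ≤ T) (h : HasACDeriv T f f')
    (h0 : ∀ᵐ t ∂(volume.restrict (Icc 0 T)), f' t = 0) {s t : ℝ} (hs : s ∈ Icc 0 T)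
    (ht : t ∈ Icc 0 T) : f s = f t := by
  obtain ⟨C, hC⟩ := h.ac.const_of_ae_hasDerivAt_zero (by
    have := h.hasDerivAt.and h0
    rw [ae_restrict_iff' measurableSet_Icc] at this
    filter_upwards [this] with t h2 h3
    obtain ⟨h4, h5⟩ := h2 (by rwa [uIcc_of_le hT] at h3)
    rwa [h5] at h4)
  rw [uIcc_of_le hT] at hC
  rw [hC s hs, hC t ht]

theorem of_ac {f : ℝ → ℝ} (hT : 0 ≤ T) (h : AbsolutelyContinuousOnInterval f 0 T) :
    HasACDeriv T f (deriv f) where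
  ac := h
  integrable := (intervalIntegrable_iff_integrableOn_Icc_of_le hT).1 h.intervalIntegrable_deriv
  hasDerivAt := by
    rw [ae_restrict_iff' measurableSet_Icc]
    filter_upwards [h.ae_differentiableAt] with t h1 h2
    exact (h1 (by rwa [uIcc_of_le hT])).hasDerivAt

theorem mono {τ : ℝ} (hτ : 0 ≤ τ) (hτT : τ ≤ T) (h : HasACDeriv T f f') : HasACDeriv τ f f' where
  ac := h.ac.mono (by
    rw [uIcc_of_le hτ, uIcc_of_le (hτ.trans hτT)]; exact Icc_subset_Icc le_rfl hτT)
  integrable := h.integrable.mono_set (Icc_subset_Icc le_rfl hτT)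
  hasDerivAt := ae_restrict_of_ae_restrict_of_subset (Icc_subset_Icc le_rfl hτT) h.hasDerivAt

/-- Composition with a `C¹` function. -/
theorem comp_contDiff (hT : 0 ≤ T) {φ : ℝ → X} (hφ : ContDiff ℝ 1 φ) {f f' : ℝ → ℝ}
    (hf : HasACDeriv T f f') :
    HasACDeriv T (fun t => φ (f t)) (fun t => f' t • deriv φ (f t)) where
  ac := by
    obtain ⟨C, hC⟩ := hf.ac.exists_bound
    obtain ⟨K, hK⟩ := (hφ.contDiffOn (s := Icc (-C) C)).exists_lipschitzOnWith one_ne_zero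
      (convex_Icc _ _) isCompact_Icc
    refine hf.ac.of_dist_le hf.ac K 0 fun x hx y hy => ?_
    simpa using hK.dist_le_mul _ (abs_le.1 (hC x hx)) _ (abs_le.1 (hC y hy))
  integrable := by
    have h1 : ContinuousOn (fun t => deriv φ (f t)) (Icc 0 T) :=
      (hφ.continuous_deriv le_rfl).comp_continuousOn (hf.continuousOn hT)
    simpa using integrableOn_bilin (ContinuousLinearMap.lsmul ℝ ℝ : ℝ →L[ℝ] X →L[ℝ] X).flip h1
      hf.integrable
  hasDerivAt := by
    filter_upwards [hf.hasDerivAt] with t h1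
    exact ((hφ.differentiable one_ne_zero) (f t)).hasDerivAt.scomp t h1

/-- Curves in a manifold are tested on scalar functions, so the vector-valued equations are
assembled from their components. Increments in the sup norm are at most the sum of the increments of
the components. -/
theorem pi {ι : Type*} [Fintype ι] {f f' : ℝ → ι → X}
    (h : ∀ i, HasACDeriv T (fun t => f t i) (fun t => f' t i)) : HasACDeriv T f f' where
  ac := by
    have hs : Filter.Tendsto (fun E : ℕ × (ℕ → ℝ × ℝ) => ∑ i, ∑ k ∈ Finset.range E.1,
        dist (f (E.2 k).1 i) (f (E.2 k).2 i)) (AbsolutelyContinuousOnInterval.totalLengthFilter ⊓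
      Filter.principal (AbsolutelyContinuousOnInterval.disjWithin 0 T)) (𝓝 (∑ i : ι, (0:ℝ))) :=
      tendsto_finsetSum _ fun i _ => (h i).ac
    rw [Finset.sum_const_zero] at hs
    refine squeeze_zero (fun E => Finset.sum_nonneg fun _ _ => dist_nonneg) (fun E => ?_) hs
    rw [Finset.sum_comm]
    refine Finset.sum_le_sum fun k _ => ?_
    refine (dist_pi_le_iff (Finset.sum_nonneg fun _ _ => dist_nonneg)).2 fun i => ?_
    exact Finset.single_le_sum (f := fun i => dist (f (E.2 k).1 i) (f (E.2 k).2 i))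
      (fun _ _ => dist_nonneg) (Finset.mem_univ i)
  integrable := Integrable.of_eval fun i => (h i).integrable
  hasDerivAt := by
    have : ∀ᵐ t ∂(volume.restrict (Icc 0 T)), ∀ i, HasDerivAt (fun t => f t i) (f' t i) t :=
      ae_all_iff.2 fun i => (h i).hasDerivAt
    filter_upwards [this] with t ht using hasDerivAt_pi.2 ht

theorem eval (hT : 0 ≤ T) {ι : Type*} [Fintype ι] {f f' : ℝ → ι → X} (h : HasACDeriv T f f')
    (i : ι) : HasACDeriv T (fun t => f t i) (fun t => f' t i) := by
  simpa using h.clm hT (ContinuousLinearMap.proj (R := ℝ) (φ := fun _ : ι => X) i)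

end HasACDeriv

/-- Gronwall's inequality with an integrable rate. -/
theorem gronwall_integral {T c : ℝ} {u m : ℝ → ℝ} (hT : 0 ≤ T) (hu : ContinuousOn u (Icc 0 T))
    (hm : IntegrableOn m (Icc 0 T)) (hm0 : ∀ t, 0 ≤ m t)
    (h : ∀ t ∈ Icc 0 T, u t ≤ c + ∫ s in (0 : ℝ)..t, m s * u s) {t : ℝ} (ht : t ∈ Icc 0 T) :
    u t ≤ c * Real.exp (∫ s in (0 : ℝ)..t, m s) := by
  have hmu : IntegrableOn (fun s => m s * u s) (Icc 0 T) := by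
    simpa [mul_comm] using integrableOn_bilin (ContinuousLinearMap.mul ℝ ℝ) hu hm
  -- With v = c + ∫ m u, the product v · exp(−∫ m) has derivative m (u − v) exp(−∫ m) ≤ 0, because u
  -- ≤ v. It stays below its initial value c.
  have h1 := HasACDeriv.of_integral hT c hmu
  have h2 := (HasACDeriv.of_integral hT 0 hm).neg.comp_contDiff hT
    (Real.contDiff_exp (n := 1))
  have h3 := h1.mul hT h2
  have h4 := h3.sub_eq_integral hT ht
  have h5 : (∫ s in (0 : ℝ)..t, m s * u s * Real.exp (-(0 + ∫ r in (0 : ℝ)..s, m r)) +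
      (c + ∫ r in (0 : ℝ)..s, m r * u r) *
        (-m s • deriv Real.exp (-(0 + ∫ r in (0 : ℝ)..s, m r)))) ≤ 0 := by
    rw [← neg_nonneg, ← intervalIntegral.integral_neg]
    refine intervalIntegral.integral_nonneg_of_ae_restrict ht.1 ?_
    filter_upwards [ae_restrict_mem measurableSet_Icc] with s hs
    have h6 := h s ⟨hs.1, hs.2.trans ht.2⟩
    have h7 := mul_nonneg (hm0 s) (Real.exp_pos (-(0 + ∫ r in (0 : ℝ)..s, m r))).le
    simp only [Real.deriv_exp, smul_eq_mul, Pi.zero_apply]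
    nlinarith
  rw [← h4] at h5
  simp only [zero_add, intervalIntegral.integral_same, neg_zero, Real.exp_zero, add_zero,
    mul_one] at h5
  have h6 := h t ht
  have h8 : (c + ∫ s in (0 : ℝ)..t, m s * u s) ≤ c * Real.exp (∫ s in (0 : ℝ)..t, m s) := by
    rw [Real.exp_neg] at h5
    have := Real.exp_pos (∫ s in (0 : ℝ)..t, m s)
    rw [sub_nonpos, ← div_eq_mul_inv, div_le_iff₀ this] at h5
    exact h5
  exact h6.trans h8

end ACCalculus

/-! ### Linear differential equations with integrable coefficients. -/

section LinearODE

variable {X : Type*} [NormedAddCommGroup X] [NormedSpace ℝ X] [CompleteSpace X] {T : ℝ}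

theorem intervalIntegrable_of_Icc {X : Type*} [NormedAddCommGroup X] {T : ℝ} {f : ℝ → X} (h : IntegrableOn f (Icc 0 T)) {t : ℝ}
    (ht : t ∈ Icc 0 T) : IntervalIntegrable f volume 0 t :=
  (intervalIntegrable_iff_integrableOn_Icc_of_le ht.1).2 (h.mono_set (Icc_subset_Icc le_rfl ht.2))

/-- Linear differential equations with integrable coefficients have solutions. -/
theorem exists_linear_ode (hT : 0 ≤ T) {A : ℝ → X →L[ℝ] X} (hA : IntegrableOn A (Icc 0 T))
    (x : X) : ∃ q : ℝ → X, q 0 = x ∧ HasACDeriv T q (fun t => A t (q t)) := by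
  -- The unknown is p = exp(−2M) q. This weight makes the Picard operator a contraction with
  -- constant 1/2 on all of `[0,T]` at once, however large the integral of `‖A‖` is.
  set M : ℝ → ℝ := fun t => 0 + ∫ s in (0 : ℝ)..t, ‖A s‖ with hMdef
  have hM : HasACDeriv T M (fun t => ‖A t‖) := HasACDeriv.of_integral hT 0 hA.norm
  have hE := (hM.const_mul hT 2).comp_contDiff hT (Real.contDiff_exp (n := 1))
  have hEc : ContinuousOn (fun t => Real.exp (2 * M t)) (Icc 0 T) := hE.continuousOn hT
  have hEm : ContinuousOn (fun t => Real.exp (-(2 * M t))) (Icc 0 T) :=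
    Real.continuous_exp.comp_continuousOn ((hM.const_mul hT 2).continuousOn hT).neg
  let apply' : (X →L[ℝ] X) →L[ℝ] X →L[ℝ] X := ContinuousLinearMap.id ℝ _
  have hint : ∀ p : C(Icc 0 T, X), IntegrableOn
      (fun s => A s (Real.exp (2 * M s) • IccExtend hT p s)) (Icc 0 T) := fun p => by
    have h1 : ContinuousOn (fun s => Real.exp (2 * M s) • IccExtend hT p s) (Icc 0 T) :=
      hEc.smul p.continuous.Icc_extend'.continuousOn
    exact integrableOn_bilin apply'.flip h1 hA
  have hcont : ∀ p : C(Icc 0 T, X), ContinuousOn (fun t => Real.exp (-(2 * M t)) • (x +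
      ∫ s in (0 : ℝ)..t, A s (Real.exp (2 * M s) • IccExtend hT p s))) (Icc 0 T) := fun p =>
    hEm.smul ((HasACDeriv.of_integral hT x (hint p)).continuousOn hT)
  let Ψ : C(Icc 0 T, X) → C(Icc 0 T, X) := fun p => ⟨_, (hcont p).domRestrict⟩
  have hΨ : ContractingWith (1 / 2) Ψ := by
    refine ⟨by rw [div_lt_one] <;> norm_num, LipschitzWith.of_dist_le_mul fun p p' => ?_⟩
    refine (ContinuousMap.dist_le (by positivity)).2 fun t => ?_
    obtain ⟨t, ht⟩ := t
    change dist (Real.exp (-(2 * M t)) • (x + _)) (Real.exp (-(2 * M t)) • (x + _)) ≤ _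
    rw [dist_eq_norm, ← smul_sub, norm_smul, add_sub_add_left_eq_sub,
      ← intervalIntegral.integral_sub (intervalIntegrable_of_Icc (hint p) ht)
        (intervalIntegrable_of_Icc (hint p') ht)]
    -- The bound is half the distance of p and p' times the derivative of exp(2M), so it integrates
    -- to exp(2M t) − 1. The prefactor exp(−2M t) then leaves at most half the distance.
    have h1 : ‖∫ s in (0 : ℝ)..t, (A s (Real.exp (2 * M s) • IccExtend hT p s) -
        A s (Real.exp (2 * M s) • IccExtend hT p' s))‖ ≤
        ∫ s in (0 : ℝ)..t, (dist p p' / 2) * ((2 * ‖A s‖) • deriv Real.exp (2 * M s)) := by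
      refine intervalIntegral.norm_integral_le_of_norm_le ht.1 (.of_forall fun s _ => ?_)
        ((intervalIntegrable_of_Icc hE.integrable ht).const_mul _)
      rw [← map_sub, ← smul_sub]
      refine ((A s).le_opNorm _).trans ?_
      rw [norm_smul, Real.deriv_exp, smul_eq_mul, Real.norm_eq_abs, Real.abs_exp]
      have h2 : ‖IccExtend hT p s - IccExtend hT p' s‖ ≤ dist p p' := by
        rw [← dist_eq_norm]
        exact ContinuousMap.dist_apply_le_dist (projIcc 0 T hT s)
      calc ‖A s‖ * (Real.exp (2 * M s) * ‖IccExtend hT p s - IccExtend hT p' s‖)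
          ≤ ‖A s‖ * (Real.exp (2 * M s) * dist p p') := by gcongr
        _ = _ := by ring
    rw [intervalIntegral.integral_const_mul, ← hE.sub_eq_integral hT ht] at h1
    have h0 : M 0 = 0 := by simp [hMdef]
    rw [h0, mul_zero, Real.exp_zero] at h1
    have h3 : Real.exp (-(2 * M t)) * Real.exp (2 * M t) = 1 := by
      rw [← Real.exp_add]; simp
    have h4 := Real.exp_pos (-(2 * M t))
    rw [Real.norm_eq_abs, Real.abs_exp]
    have h5 : (0 : ℝ) ≤ dist p p' := dist_nonneg
    calc _ ≤ Real.exp (-(2 * M t)) * (dist p p' / 2 * (Real.exp (2 * M t) - 1)) := by gcongr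
      _ = dist p p' / 2 * (Real.exp (-(2 * M t)) * Real.exp (2 * M t)) -
          dist p p' / 2 * Real.exp (-(2 * M t)) := by ring
      _ ≤ _ := by
        rw [h3]; push_cast
        nlinarith [mul_nonneg h5 h4.le]
  obtain ⟨p, hp, -⟩ := hΨ.exists_fixedPoint 0 (edist_ne_top _ _)
  have hq := HasACDeriv.of_integral hT x (hint p)
  refine ⟨_, by simp, hq.congr_ae ?_⟩
  filter_upwards [ae_restrict_mem measurableSet_Icc] with t ht
  have h1 : p ⟨t, ht⟩ = Real.exp (-(2 * M t)) • (x +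
      ∫ s in (0 : ℝ)..t, A s (Real.exp (2 * M s) • IccExtend hT p s)) := by
    conv_lhs => rw [← hp]
    rfl
  congr 1
  rw [IccExtend_of_mem hT _ ht, h1, smul_smul, ← Real.exp_add]
  simp

/-- Fundamental solutions of a linear differential equation and of its adjoint. -/
theorem exists_fundamental_solution [FiniteDimensional ℝ X] (hT : 0 ≤ T) {A : ℝ → X →L[ℝ] X}
    (hA : IntegrableOn A (Icc 0 T)) : ∃ Φ Ψ : ℝ → X →L[ℝ] X, Φ 0 = 1 ∧ Ψ 0 = 1 ∧
      HasACDeriv T Φ (fun t => A t ∘L Φ t) ∧ HasACDeriv T Ψ (fun t => -(Ψ t ∘L A t)) ∧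
      ∀ t ∈ Icc 0 T, Ψ t ∘L Φ t = 1 ∧ Φ t ∘L Ψ t = 1 := by
  let L := ContinuousLinearMap.compL ℝ X X X
  obtain ⟨Φ, hΦ0, hΦ⟩ := exists_linear_ode hT (A := fun t => L (A t))
    (L.integrable_comp hA) (1 : X →L[ℝ] X)
  obtain ⟨Ψ, hΨ0, hΨ⟩ := exists_linear_ode hT (A := fun t => -(L.flip (A t)))
    (L.flip.integrable_comp hA).neg (1 : X →L[ℝ] X)
  refine ⟨Φ, Ψ, hΦ0, hΨ0, hΦ, hΨ, fun t ht => ?_⟩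
  -- (ΨΦ)' = −ΨAΦ + ΨAΦ = 0.
  have h1 := HasACDeriv.bilin hT L hΨ hΦ
  have h2 := h1.eq_of_deriv_zero hT (.of_forall fun t => by
    ext v; simp [L]) ht ⟨le_rfl, hT⟩
  have h3 : Ψ t ∘L Φ t = 1 := by
    have : L (Ψ t) (Φ t) = L (Ψ 0) (Φ 0) := h2
    rw [hΦ0, hΨ0] at this
    ext v
    simpa [L] using congrArg (fun S : X →L[ℝ] X => S v) this
  refine ⟨h3, ?_⟩
  -- In finite dimension a left inverse is also a right inverse.
  have h4 : (Ψ t : X →ₗ[ℝ] X) * (Φ t : X →ₗ[ℝ] X) = 1 := by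
    ext v; simpa using congrArg (fun S : X →L[ℝ] X => S v) h3
  have h5 := mul_eq_one_comm.1 h4
  ext v
  simpa using congrArg (fun S : X →ₗ[ℝ] X => S v) h5

/-- Solutions of a homogeneous linear differential equation are determined by their value at any
time. -/
theorem HasACDeriv.linear_ode_unique [FiniteDimensional ℝ X] (hT : 0 ≤ T) {A : ℝ → X →L[ℝ] X}
    (hA : IntegrableOn A (Icc 0 T)) {q : ℝ → X} (hq : HasACDeriv T q fun t => A t (q t))
    {s t : ℝ} (hs : s ∈ Icc 0 T) (ht : t ∈ Icc 0 T) (h0 : q s = 0) : q t = 0 := by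
  obtain ⟨Φ, Ψ, -, -, -, hΨ, hΦΨ⟩ := exists_fundamental_solution hT hA
  -- Ψq is constant and Ψ is invertible at every time, so a zero propagates both forwards and
  -- backwards.
  have h1 := HasACDeriv.bilin hT (ContinuousLinearMap.id ℝ (X →L[ℝ] X)) hΨ hq
  have h2 : Ψ t (q t) = Ψ s (q s) :=
    h1.eq_of_deriv_zero hT (.of_forall fun t => by simp) ht hs
  rw [h0, map_zero] at h2
  have h3 := congrArg (fun S : X →L[ℝ] X => S (q t)) (hΦΨ t ht).2
  simpa [h2] using h3.symm

/-- Variation of constants. -/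
theorem exists_linear_ode_inhomogeneous [FiniteDimensional ℝ X] (hT : 0 ≤ T)
    {A : ℝ → X →L[ℝ] X} (hA : IntegrableOn A (Icc 0 T)) {f : ℝ → X}
    (hf : IntegrableOn f (Icc 0 T)) :
    ∃ q : ℝ → X, q 0 = 0 ∧ HasACDeriv T q (fun t => A t (q t) + f t) := by
  obtain ⟨Φ, Ψ, hΦ0, -, hΦ, hΨ, hΦΨ⟩ := exists_fundamental_solution hT hA
  let ev := ContinuousLinearMap.id ℝ (X →L[ℝ] X)
  have h1 := HasACDeriv.of_integral hT 0 (integrableOn_bilin ev (hΨ.continuousOn hT) hf)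
  have h2 := HasACDeriv.bilin hT ev hΦ h1
  refine ⟨_, by simp, h2.congr_ae ?_⟩
  filter_upwards [ae_restrict_mem measurableSet_Icc] with t ht
  have h3 := congrArg (fun S : X →L[ℝ] X => S (f t)) (hΦΨ t ht).2
  simp only [ContinuousLinearMap.comp_apply, one_apply_eq_self] at h3
  simp [ev, h3]

end LinearODE

/-! ### Control systems in an open set: stability and uniqueness of solutions. -/

section NonlinearODE

variable {Y Z P : Type*} [NormedAddCommGroup Y] [NormedSpace ℝ Y]
  [NormedAddCommGroup Z] [NormedSpace ℝ Z] [NormedAddCommGroup P] [NormedSpace ℝ P] {T : ℝ}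

/-- A family `G t` of fields of linear maps which is continuously differentiable in the space
variable, jointly continuously with the time variable. -/
structure IsC1Family {W : Type*} [NormedAddCommGroup W] [NormedSpace ℝ W] (T : ℝ) (Ω : Set Z)
    (G : ℝ → Z → W) (DG : ℝ → Z → Z →L[ℝ] W) : Prop where
  isOpen : IsOpen Ω
  continuousOn : ContinuousOn (fun p : ℝ × Z => G p.1 p.2) (Icc 0 T ×ˢ Ω)
  continuousOn_deriv : ContinuousOn (fun p : ℝ × Z => DG p.1 p.2) (Icc 0 T ×ˢ Ω)
  hasFDerivAt : ∀ t ∈ Icc 0 T, ∀ z ∈ Ω, HasFDerivAt (G t) (DG t z) z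

namespace IsC1Family

variable {W : Type*} [NormedAddCommGroup W] [NormedSpace ℝ W] {Ω : Set Z} {G : ℝ → Z → W}
  {DG : ℝ → Z → Z →L[ℝ] W} {z₀ : ℝ → Z}

theorem continuousOn_comp (h : IsC1Family T Ω G DG) {τ : ℝ} (hτ : τ ≤ T) {z : ℝ → Z}
    (hz : ContinuousOn z (Icc 0 τ)) (hzΩ : ∀ t ∈ Icc 0 τ, z t ∈ Ω) :
    ContinuousOn (fun t => G t (z t)) (Icc 0 τ) :=
  h.continuousOn.comp (continuousOn_id.prodMk hz)
    fun t ht => ⟨⟨ht.1, ht.2.trans hτ⟩, hzΩ t ht⟩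

theorem continuousOn_deriv_comp (h : IsC1Family T Ω G DG) (hz₀ : ContinuousOn z₀ (Icc 0 T))
    (hΩ : ∀ t ∈ Icc 0 T, z₀ t ∈ Ω) : ContinuousOn (fun t => DG t (z₀ t)) (Icc 0 T) :=
  h.continuousOn_deriv.comp (continuousOn_id.prodMk hz₀) fun t ht => ⟨ht, hΩ t ht⟩

/-- By continuity the condition holds near each point (t, 0) of time and displacement; compactness
of `[0,T]` gives a tube around the curve of uniform radius. -/
theorem exists_uniform (h : IsC1Family T Ω G DG) (hz₀ : ContinuousOn z₀ (Icc 0 T))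
    (hΩ : ∀ t ∈ Icc 0 T, z₀ t ∈ Ω) {c : ℝ} (hc : 0 < c) :
    ∃ δ > 0, ∀ t ∈ Icc 0 T, ∀ z, ‖z - z₀ t‖ ≤ δ → z ∈ Ω ∧ ‖DG t z - DG t (z₀ t)‖ ≤ c := by
  -- The repeated membership is deliberate: the compactness principle uses full neighbourhoods in
  -- time, while the estimate is only known for times in `[0,T]`.
  have key : ∀ᶠ v in 𝓝 (0 : Z), ∀ t ∈ Icc 0 T, (t ∈ Icc 0 T → z₀ t + v ∈ Ω ∧
      ‖DG t (z₀ t + v) - DG t (z₀ t)‖ ≤ c) := by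
    refine isCompact_Icc.eventually_forall_of_forall_eventually fun t ht => ?_
    have h1 : Filter.Tendsto (fun p : ℝ × Z => (p.1, z₀ p.1 + p.2)) (𝓝[Icc 0 T ×ˢ univ] (t, 0))
        (𝓝 (t, z₀ t)) := by
      have h2 : Filter.Tendsto (fun p : ℝ × Z => z₀ p.1) (𝓝[Icc 0 T ×ˢ univ] (t, 0))
          (𝓝 (z₀ t)) := by
        refine (hz₀ t ht).tendsto.comp ?_
        exact tendsto_nhdsWithin_of_tendsto_nhds_of_eventually_within _
          (continuous_fst.tendsto' (t, (0 : Z)) t rfl |>.mono_left inf_le_left)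
          (by filter_upwards [self_mem_nhdsWithin] with p hp using hp.1)
      have h3 := h2.add (continuous_snd.tendsto' (t, (0 : Z)) 0 rfl |>.mono_left
        (inf_le_left : 𝓝[Icc 0 T ×ˢ univ] (t, (0 : Z)) ≤ _))
      rw [add_zero] at h3
      exact (continuous_fst.tendsto' (t, (0 : Z)) t rfl |>.mono_left inf_le_left).prodMk_nhds h3
    have hopen : ∀ᶠ p in 𝓝[Icc 0 T ×ˢ univ] (t, (0 : Z)), z₀ p.1 + p.2 ∈ Ω := by
      have h4 : Filter.Tendsto (fun p : ℝ × Z => z₀ p.1 + p.2) (𝓝[Icc 0 T ×ˢ univ] (t, 0))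
        (𝓝 (z₀ t)) := (continuous_snd.tendsto _).comp h1
      exact h4.eventually (h.isOpen.mem_nhds (hΩ t ht))
    have h5 : Filter.Tendsto (fun p : ℝ × Z => DG p.1 (z₀ p.1 + p.2) - DG p.1 (z₀ p.1))
        (𝓝[Icc 0 T ×ˢ univ] (t, 0)) (𝓝 (DG t (z₀ t) - DG t (z₀ t))) := by
      refine Filter.Tendsto.sub ?_ ?_
      · refine (h.continuousOn_deriv (t, z₀ t) ⟨ht, hΩ t ht⟩).tendsto.comp
          (tendsto_nhdsWithin_of_tendsto_nhds_of_eventually_within _ h1 ?_)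
        filter_upwards [hopen, self_mem_nhdsWithin] with p hp hp' using ⟨hp'.1, hp⟩
      · refine ((h.continuousOn_deriv_comp hz₀ hΩ) t ht).tendsto.comp ?_
        exact tendsto_nhdsWithin_of_tendsto_nhds_of_eventually_within _
          (continuous_fst.tendsto' (t, (0 : Z)) t rfl |>.mono_left inf_le_left)
          (by filter_upwards [self_mem_nhdsWithin] with p hp using hp.1)
    rw [sub_self] at h5
    have h6 := h5.norm.eventually (eventually_le_nhds (b := c) (by simpa using hc))
    have h7 := hopen.and h6
    rw [eventually_nhdsWithin_iff] at h7
    filter_upwards [(continuous_swap.tendsto ((0 : Z), t)).eventually h7] with p hp hp1 using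
      hp ⟨hp1, trivial⟩
  obtain ⟨δ, hδ, h1⟩ := Metric.eventually_nhds_iff.1 key
  refine ⟨δ / 2, by positivity, fun t ht z hz => ?_⟩
  have := h1 (y := z - z₀ t) (by rw [dist_zero_right]; linarith) t ht ht
  simpa using this

theorem exists_bound (h : IsC1Family T Ω G DG) (hz₀ : ContinuousOn z₀ (Icc 0 T))
    (hΩ : ∀ t ∈ Icc 0 T, z₀ t ∈ Ω) :
    ∃ ε > 0, ∃ L ≥ 0, ∀ t ∈ Icc 0 T, ‖G t (z₀ t)‖ ≤ L ∧ ‖DG t (z₀ t)‖ ≤ L ∧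
      ∀ z, ‖z - z₀ t‖ ≤ ε → z ∈ Ω ∧ ‖G t z - G t (z₀ t)‖ ≤ L * ‖z - z₀ t‖ := by
  obtain ⟨ε, hε, h1⟩ := h.exists_uniform hz₀ hΩ one_pos
  obtain ⟨C, hC⟩ := isCompact_Icc.exists_bound_of_continuousOn (h.continuousOn_comp le_rfl hz₀ hΩ)
  obtain ⟨D, hD⟩ := isCompact_Icc.exists_bound_of_continuousOn (h.continuousOn_deriv_comp hz₀ hΩ)
  -- C bounds G and D bounds DG along the curve; in the tube DG moves by at most 1, which gives D +
  -- 1. The 0 ensures nonnegativity.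
  refine ⟨ε, hε, max (max C (D + 1)) 0, le_max_right _ _, fun t ht => ⟨(hC t ht).trans
    ((le_max_left _ _).trans (le_max_left _ _)), (hD t ht).trans ((by linarith : D ≤ D + 1).trans
    ((le_max_right _ _).trans (le_max_left _ _))), fun z hz => ⟨(h1 t ht z hz).1, ?_⟩⟩⟩
  refine (convex_closedBall (z₀ t) ε).norm_image_sub_le_of_norm_hasFDerivWithin_le
    (f := G t) (f' := DG t) (fun y hy => (h.hasFDerivAt t ht y
      (h1 t ht y (by simpa [dist_eq_norm] using hy)).1).hasFDerivWithinAt) (fun y hy => ?_)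
    (Metric.mem_closedBall_self hε.le) (by simpa [dist_eq_norm] using hz)
  have h2 := (h1 t ht y (by simpa [dist_eq_norm] using hy)).2
  calc ‖DG t y‖ = ‖(DG t y - DG t (z₀ t)) + DG t (z₀ t)‖ := by rw [sub_add_cancel]
    _ ≤ 1 + D := (norm_add_le _ _).trans (add_le_add h2 (hD t ht))
    _ ≤ _ := by rw [add_comm]; exact (le_max_right _ _).trans (le_max_left _ _)

theorem exists_taylor (h : IsC1Family T Ω G DG) (hz₀ : ContinuousOn z₀ (Icc 0 T))
    (hΩ : ∀ t ∈ Icc 0 T, z₀ t ∈ Ω) {c : ℝ} (hc : 0 < c) :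
    ∃ δ > 0, ∀ t ∈ Icc 0 T, ∀ z, ‖z - z₀ t‖ ≤ δ →
      ‖G t z - G t (z₀ t) - DG t (z₀ t) (z - z₀ t)‖ ≤ c * ‖z - z₀ t‖ := by
  obtain ⟨δ, hδ, h1⟩ := h.exists_uniform hz₀ hΩ hc
  refine ⟨δ, hδ, fun t ht z hz => ?_⟩
  exact (convex_closedBall (z₀ t) δ).norm_image_sub_le_of_norm_hasFDerivWithin_le'
    (f := G t) (f' := DG t) (fun y hy => (h.hasFDerivAt t ht y
      (h1 t ht y (by simpa [dist_eq_norm] using hy)).1).hasFDerivWithinAt)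
    (fun y hy => (h1 t ht y (by simpa [dist_eq_norm] using hy)).2)
    (Metric.mem_closedBall_self hδ.le) (by simpa [dist_eq_norm] using hz)

end IsC1Family

/-- `z` solves `ż = G t z (w t)` as long as it stays in `Ω`. -/
def SolvesInside (T : ℝ) (Ω : Set Z) (G : ℝ → Z → Y →L[ℝ] Z) (w : ℝ → Y) (z : ℝ → Z) : Prop :=
  ContinuousOn z (Icc 0 T) ∧ ∀ τ ∈ Icc 0 T, (∀ s ∈ Icc 0 τ, z s ∈ Ω) →
    ∀ t ∈ Icc 0 τ, z t = z 0 + ∫ s in (0 : ℝ)..t, G s (z s) (w s)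

variable {Ω : Set Z} {G : ℝ → Z → Y →L[ℝ] Z} {DG : ℝ → Z → Z →L[ℝ] Y →L[ℝ] Z} {z₀ : ℝ → Z}

theorem IsC1Family.integrableOn (h : IsC1Family T Ω G DG) {τ : ℝ} (hτ : τ ≤ T)
    {z : ℝ → Z} (hz : ContinuousOn z (Icc 0 τ)) (hzΩ : ∀ t ∈ Icc 0 τ, z t ∈ Ω) {w : ℝ → Y}
    (hw : IntegrableOn w (Icc 0 T)) : IntegrableOn (fun s => G s (z s) (w s)) (Icc 0 τ) :=
  integrableOn_bilin (ContinuousLinearMap.id ℝ (Y →L[ℝ] Z)) (h.continuousOn_comp hτ hz hzΩ)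
    (hw.mono_set (Icc_subset_Icc le_rfl hτ))

/-- A continuity argument. As long as z is within ε of z₀ it is in Ω, so it solves the equation and
Gronwall applies. The resulting bound is strictly below ε, so z can never leave the tube. No
assumption is needed on what z does outside Ω. -/
theorem SolvesInside.norm_sub_le [CompleteSpace Z] (hT : 0 ≤ T) (h : IsC1Family T Ω G DG)
    {w w₀ : ℝ → Y}
    {z : ℝ → Z} (hz₀ : SolvesInside T Ω G w₀ z₀) (hΩ : ∀ t ∈ Icc 0 T, z₀ t ∈ Ω)
    (hw₀ : IntegrableOn w₀ (Icc 0 T)) (hw : IntegrableOn w (Icc 0 T))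
    (hz : SolvesInside T Ω G w z) (hinit : z 0 = z₀ 0) {ε L : ℝ} (hL : 0 ≤ L)
    (hεL : ∀ t ∈ Icc 0 T, ‖G t (z₀ t)‖ ≤ L ∧
      ∀ z, ‖z - z₀ t‖ ≤ ε → z ∈ Ω ∧ ‖G t z - G t (z₀ t)‖ ≤ L * ‖z - z₀ t‖)
    (hε : (L * ∫ s in (0 : ℝ)..T, ‖w s - w₀ s‖) * Real.exp (∫ s in (0 : ℝ)..T, L * ‖w s‖) < ε)
    {t : ℝ} (ht : t ∈ Icc 0 T) :
    ‖z t - z₀ t‖ ≤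
      (L * ∫ s in (0 : ℝ)..T, ‖w s - w₀ s‖) * Real.exp (∫ s in (0 : ℝ)..T, L * ‖w s‖) := by
  set β := (L * ∫ s in (0 : ℝ)..T, ‖w s - w₀ s‖) * Real.exp (∫ s in (0 : ℝ)..T, L * ‖w s‖) with hβ
  have hΔ : ContinuousOn (fun t => ‖z t - z₀ t‖) (Icc 0 T) := (hz.1.sub hz₀.1).norm
  have hmono : ∀ {f : ℝ → ℝ}, IntegrableOn f (Icc 0 T) → (∀ s, 0 ≤ f s) → ∀ t ∈ Icc 0 T,
      ∫ s in (0 : ℝ)..t, f s ≤ ∫ s in (0 : ℝ)..T, f s := fun hf hf0 t ht =>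
    intervalIntegral.integral_mono_interval le_rfl ht.1 ht.2 (.of_forall fun s => hf0 s)
      (intervalIntegrable_of_Icc hf ⟨hT, le_rfl⟩)
  -- the estimate holds as long as the distance stays below `ε`
  have step : ∀ τ ∈ Icc 0 T, (∀ s ∈ Icc 0 τ, ‖z s - z₀ s‖ ≤ ε) → ‖z τ - z₀ τ‖ ≤ β := by
    intro τ hτ hs
    have hsub : Icc 0 τ ⊆ Icc 0 T := Icc_subset_Icc le_rfl hτ.2
    have hzΩ : ∀ s ∈ Icc 0 τ, z s ∈ Ω := fun s hs' => ((hεL s (hsub hs')).2 _ (hs s hs')).1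
    have h1 := hz.2 τ hτ hzΩ
    have h2 := hz₀.2 τ hτ fun s hs' => hΩ s (hsub hs')
    have i1 := h.integrableOn hτ.2 (hz.1.mono hsub) hzΩ hw
    have i2 := h.integrableOn hτ.2 (hz₀.1.mono hsub) (fun s hs' => hΩ s (hsub hs')) hw₀
    have i3 : IntegrableOn (fun s => L * ‖w s - w₀ s‖) (Icc 0 T) := (hw.sub hw₀).norm.const_mul L
    have i4 : IntegrableOn (fun s => L * ‖w s‖) (Icc 0 T) := hw.norm.const_mul L
    have i5 : IntegrableOn (fun s => L * ‖w s‖ * ‖z s - z₀ s‖) (Icc 0 τ) := by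
      simpa [mul_comm] using integrableOn_bilin (ContinuousLinearMap.mul ℝ ℝ) (hΔ.mono hsub)
        (i4.mono_set hsub)
    have h3 : ∀ r ∈ Icc 0 τ, ‖z r - z₀ r‖ ≤ (L * ∫ s in (0 : ℝ)..T, ‖w s - w₀ s‖) +
        ∫ s in (0 : ℝ)..r, L * ‖w s‖ * ‖z s - z₀ s‖ := by
      intro r hr
      rw [h1 r hr, h2 r hr, hinit, add_sub_add_left_eq_sub,
        ← intervalIntegral.integral_sub (intervalIntegrable_of_Icc i1 hr)
          (intervalIntegrable_of_Icc i2 hr)]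
      have h4 : ‖∫ s in (0 : ℝ)..r, (G s (z s) (w s) - G s (z₀ s) (w₀ s))‖ ≤
          ∫ s in (0 : ℝ)..r, (L * ‖w s - w₀ s‖ + L * ‖w s‖ * ‖z s - z₀ s‖) := by
        refine intervalIntegral.norm_integral_le_of_norm_le hr.1 (.of_forall fun s hs' => ?_)
          ((intervalIntegrable_of_Icc i3 (hsub hr)).add (intervalIntegrable_of_Icc i5 hr))
        have hs1 : s ∈ Icc 0 τ := ⟨hs'.1.le, hs'.2.trans hr.2⟩
        obtain ⟨b1, b2⟩ := hεL s (hsub hs1)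
        have b3 := (b2 _ (hs s hs1)).2
        have e : G s (z s) (w s) - G s (z₀ s) (w₀ s) =
            G s (z₀ s) (w s - w₀ s) + (G s (z s) - G s (z₀ s)) (w s) := by
          simp
        rw [e]
        refine (norm_add_le _ _).trans (add_le_add ?_ ?_)
        · exact (ContinuousLinearMap.le_opNorm _ _).trans (by gcongr)
        · refine (ContinuousLinearMap.le_opNorm _ _).trans ?_
          calc _ ≤ L * ‖z s - z₀ s‖ * ‖w s‖ := by gcongr
            _ = _ := by ring
      rw [intervalIntegral.integral_add (intervalIntegrable_of_Icc i3 (hsub hr))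
        (intervalIntegrable_of_Icc i5 hr), intervalIntegral.integral_const_mul] at h4
      refine h4.trans (add_le_add ?_ le_rfl)
      exact mul_le_mul_of_nonneg_left (hmono (hw.sub hw₀).norm (fun _ => norm_nonneg _) r (hsub hr))
        hL
    have h4 := gronwall_integral hτ.1 (hΔ.mono hsub) (i4.mono_set hsub)
      (fun s => by positivity) h3 ⟨hτ.1, le_rfl⟩
    refine h4.trans (mul_le_mul_of_nonneg_left (Real.exp_le_exp.2 (hmono i4
      (fun s => by positivity) τ hτ)) (mul_nonneg hL ?_))
    exact intervalIntegral.integral_nonneg hT fun s _ => norm_nonneg _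
  by_contra hcon
  push Not at hcon
  -- A level strictly between the bound β and both ε and the distance at time t. At the first time τ
  -- at which the distance reaches c, the estimate gives c ≤ β, a contradiction.
  obtain ⟨c, hc1, hc2⟩ := exists_between (lt_min hcon hε)
  have hβ0 : 0 ≤ β := mul_nonneg (mul_nonneg hL
    (intervalIntegral.integral_nonneg hT fun s _ => norm_nonneg _)) (Real.exp_pos _).le
  have hsub : Icc 0 t ⊆ Icc 0 T := Icc_subset_Icc le_rfl ht.2
  have hcl : IsCompact (Icc 0 t ∩ (fun t => ‖z t - z₀ t‖) ⁻¹' Ici c) :=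
    isCompact_Icc.of_isClosed_subset
      ((hΔ.mono hsub).preimage_isClosed_of_isClosed isClosed_Icc isClosed_Ici) inter_subset_left
  obtain ⟨τ, ⟨hτ1, hτ2⟩, hτ3⟩ := hcl.exists_isLeast ⟨t, ⟨ht.1, le_rfl⟩, (lt_min_iff.1 hc2).1.le⟩
  have hτ4 : ‖z τ - z₀ τ‖ = c := by
    obtain ⟨s, hs1, hs2⟩ := intermediate_value_Icc hτ1.1
      (hΔ.mono ((Icc_subset_Icc le_rfl hτ1.2).trans hsub))
      (show c ∈ Icc (‖z 0 - z₀ 0‖) (‖z τ - z₀ τ‖) from ⟨by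
        rw [hinit, sub_self, norm_zero]; exact hβ0.trans hc1.le, hτ2⟩)
    have h5 : τ ≤ s := hτ3 ⟨⟨hs1.1, hs1.2.trans hτ1.2⟩, by exact hs2.ge⟩
    rw [← hs2, le_antisymm hs1.2 h5]
  have h6 := step τ (hsub hτ1) fun s hs => by
    by_contra h7
    push Not at h7
    have h8 : τ ≤ s := hτ3 ⟨⟨hs.1, hs.2.trans hτ1.2⟩, ((lt_min_iff.1 hc2).2.trans h7).le⟩
    have h9 : s = τ := le_antisymm hs.2 h8
    rw [h9, hτ4] at h7
    exact absurd ((lt_min_iff.1 hc2).2.trans h7) (lt_irrefl _)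
  rw [hτ4] at h6
  exact absurd (hc1.trans_le h6) (lt_irrefl _)

/-- Uniqueness of solutions. -/
theorem SolvesInside.eqOn [CompleteSpace Z] (hT : 0 ≤ T) (h : IsC1Family T Ω G DG) {w : ℝ → Y}
    {z : ℝ → Z} (hz₀ : SolvesInside T Ω G w z₀) (hΩ : ∀ t ∈ Icc 0 T, z₀ t ∈ Ω)
    (hw : IntegrableOn w (Icc 0 T)) (hz : SolvesInside T Ω G w z) (hinit : z 0 = z₀ 0)
    {t : ℝ} (ht : t ∈ Icc 0 T) : z t = z₀ t := by
  obtain ⟨ε, hε, L, hL, hεL⟩ := h.exists_bound hz₀.1 hΩ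
  have := hz₀.norm_sub_le hT h hΩ hw hw hz hinit hL
    (fun t ht => ⟨(hεL t ht).1, (hεL t ht).2.2⟩) (by simpa using hε) ht
  rw [← sub_eq_zero, ← norm_le_zero_iff]
  simpa using this

end NonlinearODE

/-! ### Differentiable dependence of solutions on the control. -/

section Dependence

variable {Y Z P : Type*} [NormedAddCommGroup Y] [NormedSpace ℝ Y]
  [NormedAddCommGroup Z] [NormedSpace ℝ Z] [NormedAddCommGroup P] [NormedSpace ℝ P] {T : ℝ}
  {Ω : Set Z} {G : ℝ → Z → Y →L[ℝ] Z} {DG : ℝ → Z → Z →L[ℝ] Y →L[ℝ] Z}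

/-- A control depending on a parameter `k` in a way which is linear almost everywhere and bounded
in `L¹`. -/
structure IsLinearControl (T : ℝ) (κ : P → ℝ → Y) : Prop where
  integrable : ∀ k, IntegrableOn (κ k) (Icc 0 T)
  add : ∀ k l, κ (k + l) =ᵐ[volume.restrict (Icc 0 T)] fun t => κ k t + κ l t
  smul : ∀ (c : ℝ) k, κ (c • k) =ᵐ[volume.restrict (Icc 0 T)] fun t => c • κ k t
  bound : ∃ C ≥ 0, ∀ k, ∫ s in (0 : ℝ)..T, ‖κ k s‖ ≤ C * ‖k‖

theorem ae_uIoc_of_ae_Icc {p : ℝ → Prop} (h : ∀ᵐ t ∂(volume.restrict (Icc 0 T)), p t) {t : ℝ}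
    (ht : t ∈ Icc 0 T) : ∀ᵐ s, s ∈ uIoc 0 t → p s := by
  rw [ae_restrict_iff' measurableSet_Icc] at h
  filter_upwards [h] with s hs hs'
  rw [uIoc_of_le ht.1] at hs'
  exact hs ⟨hs'.1.le, hs'.2.trans ht.2⟩

theorem intervalIntegral_congr_ae_Icc {X : Type*} [NormedAddCommGroup X] [NormedSpace ℝ X]
    {f g : ℝ → X} (h : f =ᵐ[volume.restrict (Icc 0 T)] g) {t : ℝ} (ht : t ∈ Icc 0 T) :
    ∫ s in (0 : ℝ)..t, f s = ∫ s in (0 : ℝ)..t, g s :=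
  intervalIntegral.integral_congr_ae (ae_uIoc_of_ae_Icc h ht)

theorem intervalIntegral_mono_Icc {f : ℝ → ℝ} (hT : 0 ≤ T) (hf : IntegrableOn f (Icc 0 T))
    (hf0 : ∀ s, 0 ≤ f s) {t : ℝ} (ht : t ∈ Icc 0 T) :
    ∫ s in (0 : ℝ)..t, f s ≤ ∫ s in (0 : ℝ)..T, f s :=
  intervalIntegral.integral_mono_interval le_rfl ht.1 ht.2 (.of_forall fun s => hf0 s)
    (intervalIntegrable_of_Icc hf ⟨hT, le_rfl⟩)

theorem integrableOn_flip_apply {X : Type*} [NormedAddCommGroup X] [NormedSpace ℝ X]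
    {D : ℝ → X →L[ℝ] Y →L[ℝ] Z} (h : ContinuousOn D (Icc 0 T)) {w : ℝ → Y}
    (hw : IntegrableOn w (Icc 0 T)) : IntegrableOn (fun t => (D t).flip (w t)) (Icc 0 T) := by
  have h2 : ContinuousOn (fun t => (D t).flip) (Icc 0 T) :=
    (ContinuousLinearMap.flipₗᵢ ℝ X Y Z).continuous.comp_continuousOn h
  have := integrableOn_bilin (X := Y →L[ℝ] X →L[ℝ] Z) (Y := Y) (Z := X →L[ℝ] Z)
    (ContinuousLinearMap.id ℝ (Y →L[ℝ] X →L[ℝ] Z)) (a := fun t => (D t).flip) (w := w) (T := T)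
    h2 hw
  exact this

/-- The control is linear in the parameter only up to null sets, as for representatives of L²
classes, but integrals do not see these. The L¹ bound gives continuity. -/
theorem IsLinearControl.exists_integral (hT : 0 ≤ T) {κ : P → ℝ → Y} (hκ : IsLinearControl T κ)
    {b : ℝ → Y →L[ℝ] Z} (hb : ContinuousOn b (Icc 0 T)) :
    ∃ I : ℝ → P →L[ℝ] Z, ∀ t ∈ Icc 0 T, ∀ k, I t k = ∫ s in (0 : ℝ)..t, b s (κ k s) := by
  have hi : ∀ k, IntegrableOn (fun s => b s (κ k s)) (Icc 0 T) := fun k =>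
    integrableOn_bilin (ContinuousLinearMap.id ℝ (Y →L[ℝ] Z)) hb (hκ.integrable k)
  obtain ⟨B, hB⟩ := isCompact_Icc.exists_bound_of_continuousOn hb
  obtain ⟨C, hC0, hC⟩ := hκ.bound
  have hB0 : 0 ≤ B := (norm_nonneg _).trans (hB 0 ⟨le_rfl, hT⟩)
  have key : ∀ t : ℝ, ∃ I : P →L[ℝ] Z, t ∈ Icc 0 T → ∀ k, I k = ∫ s in (0 : ℝ)..t, b s (κ k s) := by
    intro t
    by_cases ht : t ∈ Icc 0 T
    swap
    · exact ⟨0, fun h => absurd h ht⟩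
    let I₀ : P →ₗ[ℝ] Z :=
      { toFun := fun k => ∫ s in (0 : ℝ)..t, b s (κ k s)
        map_add' := fun k l => by
          rw [← intervalIntegral.integral_add (intervalIntegrable_of_Icc (hi k) ht)
            (intervalIntegrable_of_Icc (hi l) ht)]
          refine intervalIntegral_congr_ae_Icc ?_ ht
          filter_upwards [hκ.add k l] with s hs
          rw [hs, map_add]
        map_smul' := fun c k => by
          rw [RingHom.id_apply, ← intervalIntegral.integral_smul]
          refine intervalIntegral_congr_ae_Icc ?_ ht
          filter_upwards [hκ.smul c k] with s hs
          rw [hs, map_smul] }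
    refine ⟨I₀.mkContinuous (B * C) fun k => ?_, fun _ k => rfl⟩
    have h1 : ‖∫ s in (0 : ℝ)..t, b s (κ k s)‖ ≤ ∫ s in (0 : ℝ)..t, B * ‖κ k s‖ := by
      refine intervalIntegral.norm_integral_le_of_norm_le ht.1 (.of_forall fun s hs => ?_)
        ((intervalIntegrable_of_Icc (hκ.integrable k) ht).norm.const_mul B)
      exact (b s).le_of_opNorm_le (hB s ⟨hs.1.le, hs.2.trans ht.2⟩) _
    rw [intervalIntegral.integral_const_mul] at h1
    refine h1.trans ?_
    rw [mul_assoc]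
    refine mul_le_mul_of_nonneg_left ?_ hB0
    exact (intervalIntegral_mono_Icc hT (hκ.integrable k).norm
      (fun _ => norm_nonneg _) ht).trans (hC k)
  choose I hI using key
  exact ⟨I, hI⟩

/-- The linearization of `ż = G t z (w t)` along `z₀`, as a family of linear maps of the
variation of the control. -/
theorem exists_linearization [FiniteDimensional ℝ Z] (hT : 0 ≤ T) (h : IsC1Family T Ω G DG)
    {z₀ : ℝ → Z} (hz₀ : ContinuousOn z₀ (Icc 0 T)) (hΩ : ∀ t ∈ Icc 0 T, z₀ t ∈ Ω) {w₀ : ℝ → Y}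
    (hw₀ : IntegrableOn w₀ (Icc 0 T)) {κ : P → ℝ → Y} (hκ : IsLinearControl T κ) :
    ∃ J : ℝ → P →L[ℝ] Z, ∀ k, J 0 k = 0 ∧ HasACDeriv T (fun t => J t k)
      (fun t => DG t (z₀ t) (J t k) (w₀ t) + G t (z₀ t) (κ k t)) := by
  have hA : IntegrableOn (fun t => (DG t (z₀ t)).flip (w₀ t)) (Icc 0 T) :=
    integrableOn_flip_apply (h.continuousOn_deriv_comp hz₀ hΩ) hw₀
  obtain ⟨Φ, Ψ, -, -, hΦ, hΨ, hΦΨ⟩ := exists_fundamental_solution hT hA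
  have hb : ContinuousOn (fun t => Ψ t ∘L G t (z₀ t)) (Icc 0 T) :=
    (hΨ.continuousOn hT).clm_comp (h.continuousOn_comp le_rfl hz₀ hΩ)
  obtain ⟨I, hI⟩ := hκ.exists_integral hT hb
  -- Variation of constants, J t k = Φ t ∫ Ψ G κ_k, which exhibits J t as a continuous linear map of
  -- k.
  refine ⟨fun t => Φ t ∘L I t, fun k => ?_⟩
  have h1 : HasACDeriv T (fun t => I t k) (fun s => Ψ s (G s (z₀ s) (κ k s))) := by
    have h1 := HasACDeriv.of_integral hT 0
      (integrableOn_bilin (ContinuousLinearMap.id ℝ (Y →L[ℝ] Z)) hb (hκ.integrable k))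
    refine h1.congr hT fun t ht => ?_
    rw [hI t ht k, zero_add]
    rfl
  refine ⟨?_, (HasACDeriv.bilin hT (ContinuousLinearMap.id ℝ (Z →L[ℝ] Z)) hΦ h1).congr_ae ?_⟩
  · rw [ContinuousLinearMap.comp_apply, hI 0 ⟨le_rfl, hT⟩, intervalIntegral.integral_same, map_zero]
  · filter_upwards [ae_restrict_mem measurableSet_Icc] with t ht
    have h3 : Φ t (Ψ t (G t (z₀ t) (κ k t))) = G t (z₀ t) (κ k t) := by
      have := congrArg (fun S : Z →L[ℝ] Z => S (G t (z₀ t) (κ k t))) (hΦΨ t ht).2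
      simpa using this
    simp only [ContinuousLinearMap.id_apply, ContinuousLinearMap.comp_apply, h3,
      ContinuousLinearMap.flip_apply]

/-- Differentiable dependence of the solutions of `ż = G t z (w t)` on the control. -/
theorem SolvesInside.hasFDerivAt [FiniteDimensional ℝ Z] (hT : 0 ≤ T) (h : IsC1Family T Ω G DG)
    {z : P → ℝ → Z} {η₀ : P} {w : P → ℝ → Y} (hz : ∀ η, SolvesInside T Ω G (w η) (z η))
    (hinit : ∀ η, z η 0 = z η₀ 0) (hΩ : ∀ t ∈ Icc 0 T, z η₀ t ∈ Ω)
    (hw : ∀ η, IntegrableOn (w η) (Icc 0 T)) {κ : P → ℝ → Y} (hκ : IsLinearControl T κ)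
    (hwκ : ∀ η, w η =ᵐ[volume.restrict (Icc 0 T)] fun t => w η₀ t + κ (η - η₀) t) :
    (∃ C, ∀ᶠ η in 𝓝 η₀, ∀ t ∈ Icc 0 T, ‖z η t - z η₀ t‖ ≤ C * ‖η - η₀‖) ∧
    ∃ J : ℝ → P →L[ℝ] Z, (∀ t ∈ Icc 0 T, HasFDerivAt (fun η => z η t) (J t) η₀) ∧
      ∀ k, J 0 k = 0 ∧ HasACDeriv T (fun t => J t k)
        (fun t => DG t (z η₀ t) (J t k) (w η₀ t) + G t (z η₀ t) (κ k t)) := by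
  have hz₀ := (hz η₀).1
  obtain ⟨ε, hε, L, hL, hεL⟩ := h.exists_bound hz₀ hΩ
  obtain ⟨C, hC0, hC⟩ := hκ.bound
  set W := ∫ s in (0 : ℝ)..T, ‖w η₀ s‖ with hW
  have hW0 : 0 ≤ W := intervalIntegral.integral_nonneg hT fun s _ => norm_nonneg _
  have hTT : T ∈ Icc 0 T := ⟨hT, le_rfl⟩
  set E := Real.exp (L * (W + C)) with hE
  have hE0 : 0 < E := Real.exp_pos _
  have hdiff : ∀ η, ∫ s in (0 : ℝ)..T, ‖w η s - w η₀ s‖ ≤ C * ‖η - η₀‖ := fun η => by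
    refine le_of_eq_of_le (intervalIntegral_congr_ae_Icc ?_ hTT) (hC (η - η₀))
    filter_upwards [hwκ η] with s hs
    rw [hs, add_sub_cancel_left]
  have hwη : ∀ η, ‖η - η₀‖ ≤ 1 → ∫ s in (0 : ℝ)..T, L * ‖w η s‖ ≤ L * (W + C) := fun η hη => by
    rw [intervalIntegral.integral_const_mul]
    refine mul_le_mul_of_nonneg_left ?_ hL
    have i1 := intervalIntegrable_of_Icc (hw η₀).norm hTT
    have i2 : IntervalIntegrable (fun s => ‖w η s - w η₀ s‖) volume 0 T :=
      intervalIntegrable_of_Icc ((hw η).sub (hw η₀)).norm hTT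
    calc ∫ s in (0 : ℝ)..T, ‖w η s‖
        ≤ ∫ s in (0 : ℝ)..T, (‖w η₀ s‖ + ‖w η s - w η₀ s‖) := by
          refine intervalIntegral.integral_mono_on hT
            (intervalIntegrable_of_Icc (hw η).norm hTT) (i1.add i2) fun s _ => ?_
          simpa using norm_add_le (w η₀ s) (w η s - w η₀ s)
      _ ≤ W + C := by
          rw [intervalIntegral.integral_add i1 i2]
          refine add_le_add le_rfl ((hdiff η).trans ?_)
          simpa using mul_le_mul_of_nonneg_left hη hC0
  -- Lipschitz dependence: the controls differ by at most C‖η − η₀‖ in L¹, and on the unit ball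
  -- around η₀ the Gronwall exponential is at most E.
  have near : ∀ η, ‖η - η₀‖ ≤ 1 → L * C * E * ‖η - η₀‖ < ε → ∀ t ∈ Icc 0 T,
      ‖z η t - z η₀ t‖ ≤ L * C * E * ‖η - η₀‖ := by
    intro η hη1 hη2 t ht
    have h1 : (L * ∫ s in (0 : ℝ)..T, ‖w η s - w η₀ s‖) *
        Real.exp (∫ s in (0 : ℝ)..T, L * ‖w η s‖) ≤ L * C * E * ‖η - η₀‖ := by
      calc _ ≤ (L * (C * ‖η - η₀‖)) * E := by
            gcongr
            · exact hdiff η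
            · exact Real.exp_le_exp.2 (hwη η hη1)
        _ = _ := by ring
    exact ((hz η₀).norm_sub_le hT h hΩ (hw η₀) (hw η) (hz η) (hinit η) hL
      (fun t ht => ⟨(hεL t ht).1, (hεL t ht).2.2⟩) (h1.trans_lt hη2) ht).trans h1
  have hnorm : Filter.Tendsto (fun η : P => ‖η - η₀‖) (𝓝 η₀) (𝓝 0) := by
    have : Continuous fun η : P => ‖η - η₀‖ := by fun_prop
    simpa using this.tendsto η₀
  have evsmall : ∀ c : ℝ, 0 < c → ∀ᶠ η in 𝓝 η₀, ‖η - η₀‖ ≤ c := fun c hc =>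
    hnorm.eventually (eventually_le_nhds hc)
  have evnear : ∀ᶠ η in 𝓝 η₀, ‖η - η₀‖ ≤ 1 ∧ L * C * E * ‖η - η₀‖ < ε := by
    refine (evsmall 1 one_pos).and ?_
    have := hnorm.const_mul (L * C * E)
    rw [mul_zero] at this
    exact this.eventually (eventually_lt_nhds hε)
  refine ⟨⟨L * C * E, evnear.mono fun η hη t ht => near η hη.1 hη.2 t ht⟩, ?_⟩
  obtain ⟨J, hJ⟩ := exists_linearization hT h hz₀ hΩ (hw η₀) hκ
  refine ⟨J, fun t ht => ?_, hJ⟩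
  rw [hasFDerivAt_iff_isLittleO, Asymptotics.isLittleO_iff]
  intro c hc
  -- the remainder estimate
  set K := L * C * E with hK
  have hK0 : 0 ≤ K := by positivity
  -- Makes c' · K · W · exp(L W) ≤ c / 2, so the Taylor remainder costs half of c. The term
  -- quadratic in the increment receives the other half through `ev3`.
  set c' := c / (2 * (K * W + 1) * Real.exp (L * W)) with hc'
  have hc'0 : 0 < c' := by positivity
  obtain ⟨δ, hδ, hTay⟩ := h.exists_taylor hz₀ hΩ hc'0
  have ev2 : ∀ᶠ η in 𝓝 η₀, K * ‖η - η₀‖ ≤ δ := by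
    have := hnorm.const_mul K
    rw [mul_zero] at this
    exact this.eventually (eventually_le_nhds hδ)
  have ev3 : ∀ᶠ η in 𝓝 η₀, (L * K * C * Real.exp (L * W)) * ‖η - η₀‖ ≤ c / 2 := by
    have := hnorm.const_mul (L * K * C * Real.exp (L * W))
    rw [mul_zero] at this
    exact this.eventually (eventually_le_nhds (by positivity))
  filter_upwards [evnear, ev2, ev3] with η hη hη2 hη3
  set k := η - η₀ with hk
  have hzΩ : ∀ s ∈ Icc 0 T, z η s ∈ Ω := fun s hs =>
    ((hεL s hs).2.2 _ ((near η hη.1 hη.2 s hs).trans hη.2.le)).1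
  have i1 := h.integrableOn le_rfl (hz η).1 hzΩ (hw η)
  have i2 := h.integrableOn le_rfl hz₀ hΩ (hw η₀)
  have hJk := (hJ k).2
  have i3 : IntegrableOn (fun s => ‖κ k s‖) (Icc 0 T) := (hκ.integrable k).norm
  have i4 : IntegrableOn (fun s => ‖w η₀ s‖) (Icc 0 T) := (hw η₀).norm
  have hr : ContinuousOn (fun t => ‖z η t - z η₀ t - J t k‖) (Icc 0 T) :=
    (((hz η).1.sub hz₀).sub (hJk.continuousOn hT)).norm
  have i5 : IntegrableOn (fun s => L * ‖w η₀ s‖ * ‖z η s - z η₀ s - J s k‖) (Icc 0 T) := by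
    simpa [mul_comm] using integrableOn_bilin (ContinuousLinearMap.mul ℝ ℝ) hr (i4.const_mul L)
  have i6 : IntegrableOn (fun s => c' * (K * ‖k‖) * ‖w η₀ s‖ + L * (K * ‖k‖) * ‖κ k s‖)
    (Icc 0 T) := (i4.const_mul _).add (i3.const_mul _)
  have main : ∀ t ∈ Icc 0 T, ‖z η t - z η₀ t - J t k‖ ≤
      (c' * (K * ‖k‖) * W + L * (K * ‖k‖) * (C * ‖k‖)) +
        ∫ s in (0 : ℝ)..t, L * ‖w η₀ s‖ * ‖z η s - z η₀ s - J s k‖ := by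
    intro t ht
    rw [(hz η).2 T hTT hzΩ t ht, (hz η₀).2 T hTT hΩ t ht, hinit η, add_sub_add_left_eq_sub,
      hJk.eq_integral hT ht, (hJ k).1, zero_add,
      ← intervalIntegral.integral_sub (intervalIntegrable_of_Icc i1 ht)
        (intervalIntegrable_of_Icc i2 ht),
      ← intervalIntegral.integral_sub ((intervalIntegrable_of_Icc i1 ht).sub
        (intervalIntegrable_of_Icc i2 ht)) (intervalIntegrable_of_Icc hJk.integrable ht)]
    refine (intervalIntegral.norm_integral_le_of_norm_le (g := fun s =>
      (c' * (K * ‖k‖) * ‖w η₀ s‖ + L * (K * ‖k‖) * ‖κ k s‖) +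
        L * ‖w η₀ s‖ * ‖z η s - z η₀ s - J s k‖) ht.1 ?_
      ((intervalIntegrable_of_Icc i6 ht).add (intervalIntegrable_of_Icc i5 ht))).trans ?_
    · have hsub := ae_uIoc_of_ae_Icc (hwκ η) ht
      filter_upwards [hsub] with s hs1 hs2
      rw [uIoc_of_le ht.1] at hs1
      have hs : s ∈ Icc 0 T := ⟨hs2.1.le, hs2.2.trans ht.2⟩
      obtain ⟨b1, b2, b3⟩ := hεL s hs
      have b4 := near η hη.1 hη.2 s hs
      have b5 := hTay s hs (z η s) (b4.trans hη2)
      have b6 := (b3 _ (b4.trans hη.2.le)).2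
      -- Three contributions: the Taylor remainder of G against the old control, the increment of G
      -- against the change of control, which is of second order, and a term linear in the remainder
      -- itself, left to Gronwall.
      have e : G s (z η s) (w η s) - G s (z η₀ s) (w η₀ s) -
          (DG s (z η₀ s) (J s k) (w η₀ s) + G s (z η₀ s) (κ k s)) =
          (G s (z η s) - G s (z η₀ s) - DG s (z η₀ s) (z η s - z η₀ s)) (w η₀ s) +
          (G s (z η s) - G s (z η₀ s)) (κ k s) +
          DG s (z η₀ s) (z η s - z η₀ s - J s k) (w η₀ s) := by
        rw [hs1 hs2]
        simp only [map_add, map_sub, sub_apply]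
        abel
      rw [e]
      refine (norm_add_le _ _).trans (add_le_add ((norm_add_le _ _).trans (add_le_add ?_ ?_)) ?_)
      · refine (ContinuousLinearMap.le_opNorm _ _).trans ?_
        gcongr
        exact b5.trans (by gcongr)
      · refine (ContinuousLinearMap.le_opNorm _ _).trans ?_
        gcongr
        exact b6.trans (by gcongr)
      · refine ((DG s (z η₀ s)).le_opNorm₂ _ _).trans ?_
        calc _ ≤ L * ‖z η s - z η₀ s - J s k‖ * ‖w η₀ s‖ := by gcongr
          _ = _ := by ring
    · rw [intervalIntegral.integral_add (intervalIntegrable_of_Icc i6 ht)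
        (intervalIntegrable_of_Icc i5 ht)]
      refine add_le_add ?_ le_rfl
      rw [intervalIntegral.integral_add (intervalIntegrable_of_Icc (i4.const_mul _) ht)
        (intervalIntegrable_of_Icc (i3.const_mul _) ht), intervalIntegral.integral_const_mul,
        intervalIntegral.integral_const_mul]
      gcongr
      · exact intervalIntegral_mono_Icc hT i4 (fun _ => norm_nonneg _) ht
      · exact (intervalIntegral_mono_Icc hT i3 (fun _ => norm_nonneg _) ht).trans (hC k)
  have hG := gronwall_integral hT hr (i4.const_mul L) (fun s => by positivity) main ht
  have hexp : Real.exp (∫ s in (0 : ℝ)..t, L * ‖w η₀ s‖) ≤ Real.exp (L * W) := by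
    rw [intervalIntegral.integral_const_mul]
    refine Real.exp_le_exp.2 (mul_le_mul_of_nonneg_left ?_ hL)
    exact intervalIntegral_mono_Icc hT i4 (fun _ => norm_nonneg _) ht
  calc ‖z η t - z η₀ t - J t k‖
      ≤ (c' * (K * ‖k‖) * W + L * (K * ‖k‖) * (C * ‖k‖)) * Real.exp (L * W) :=
        hG.trans (by gcongr)
    _ = (c' * (K * W) * Real.exp (L * W)) * ‖k‖ +
        ((L * K * C * Real.exp (L * W)) * ‖k‖) * ‖k‖ := by ring
    _ ≤ c / 2 * ‖k‖ + c / 2 * ‖k‖ := by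
        gcongr
        rw [hc', div_mul_eq_mul_div, div_mul_eq_mul_div, div_le_div_iff₀ (by positivity) two_pos]
        have := Real.exp_pos (L * W)
        nlinarith [mul_pos hc this, mul_nonneg hc.le (mul_nonneg (mul_nonneg hK0 hW0) this.le)]
    _ = c * ‖k‖ := by ring

end Dependence

/-! ### Vector fields as derivations: Lie brackets and covariant Hessians. -/

section Derivations

variable {F : Type*} [NormedAddCommGroup F] [NormedSpace ℝ F]
  {M : Type*} [TopologicalSpace M] [ChartedSpace F M] [IsManifold 𝓘(ℝ, F) ∞ M]
  {x : M} {f g : M → ℝ}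

/-- The differential of f is the fibre part of its smooth tangent map. The parameter manifold is
arbitrary because the drift is a map from `[0,T]` × M, smooth only within that set. -/
theorem ContMDiffWithinAt.mvfderiv_apply {P E H : Type*} [TopologicalSpace P]
    [NormedAddCommGroup E] [NormedSpace ℝ E] [TopologicalSpace H] {I : ModelWithCorners ℝ E H}
    [ChartedSpace H P] {X : P → TangentBundle 𝓘(ℝ, F) M} {p : P} {s : Set P}
    (hX : ContMDiffWithinAt I 𝓘(ℝ, F).tangent ∞ X s p)
    (hf : ContMDiff 𝓘(ℝ, F) 𝓘(ℝ, ℝ) ∞ f) :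
    ContMDiffWithinAt I 𝓘(ℝ, ℝ) ∞ (fun q => mvfderiv 𝓘(ℝ, F) f (X q).1 (X q).2) s p := by
  have h1 := (hf.contMDiff_tangentMap (m := ∞) le_rfl)
  have h2 := (contMDiff_snd_tangentBundle_modelSpace (n := ∞) ℝ 𝓘(ℝ, ℝ)).comp h1
  exact (h2.contMDiffAt (x := X p)).comp_contMDiffWithinAt p hX

theorem ContMDiffAt.mvfderiv_vf {W : ∀ y : M, TangentSpace 𝓘(ℝ, F) y}
    (hW : ContMDiffAt 𝓘(ℝ, F) 𝓘(ℝ, F).tangent ∞ (vfMap W) x)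
    (hf : ContMDiff 𝓘(ℝ, F) 𝓘(ℝ, ℝ) ∞ f) :
    ContMDiffAt 𝓘(ℝ, F) 𝓘(ℝ, ℝ) ∞ (fun y => mvfderiv 𝓘(ℝ, F) f y (W y)) x :=
  (contMDiffWithinAt_univ.2 hW).mvfderiv_apply hf

theorem ContMDiff.mvfderiv_vf {W : ∀ y : M, TangentSpace 𝓘(ℝ, F) y}
    (hW : ContMDiff 𝓘(ℝ, F) 𝓘(ℝ, F).tangent ∞ (vfMap W))
    (hf : ContMDiff 𝓘(ℝ, F) 𝓘(ℝ, ℝ) ∞ f) :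
    ContMDiff 𝓘(ℝ, F) 𝓘(ℝ, ℝ) ∞ (fun y => mvfderiv 𝓘(ℝ, F) f y (W y)) :=
  fun x => (hW x).mvfderiv_vf hf

theorem MDifferentiableAt.mvfderiv_vf {W : ∀ y : M, TangentSpace 𝓘(ℝ, F) y}
    (hW : MDifferentiableAt 𝓘(ℝ, F) 𝓘(ℝ, F).tangent (vfMap W) x)
    (hf : ContMDiff 𝓘(ℝ, F) 𝓘(ℝ, ℝ) ∞ f) :
    MDifferentiableAt 𝓘(ℝ, F) 𝓘(ℝ, ℝ) (fun y => mvfderiv 𝓘(ℝ, F) f y (W y)) x := by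
  have h1 := (hf.contMDiff_tangentMap (m := ∞) le_rfl)
  have h2 := (contMDiff_snd_tangentBundle_modelSpace (n := ∞) ℝ 𝓘(ℝ, ℝ)).comp h1
  exact ((h2.mdifferentiable (by simp)) (vfMap W x)).comp x hW

theorem mvfderiv_congr_of_eventuallyEq (h : f =ᶠ[𝓝 x] g) :
    mvfderiv 𝓘(ℝ, F) f x = mvfderiv 𝓘(ℝ, F) g x := by
  ext v
  exact DFunLike.congr_fun h.mfderiv_eq v

/-- The tangent space at x is the model space through the preferred chart at x, so no change of
coordinates enters at the centre of that chart. -/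
theorem mvfderiv_comp_extChartAt_symm (hf : MDifferentiableAt 𝓘(ℝ, F) 𝓘(ℝ, ℝ) f x) :
    mvfderiv 𝓘(ℝ, F) f x = fderiv ℝ (f ∘ (extChartAt 𝓘(ℝ, F) x).symm) (extChartAt 𝓘(ℝ, F) x x) := by
  have h := hf.mfderiv
  rw [modelWithCornersSelf_coe, range_id, fderivWithin_univ] at h
  exact h

end Derivations

section Bracket

variable {F : Type*} [NormedAddCommGroup F] [NormedSpace ℝ F] [CompleteSpace F]
  {M : Type*} [TopologicalSpace M] [ChartedSpace F M] [IsManifold 𝓘(ℝ, F) ∞ M]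
  {x : M} {g : M → ℝ}

/-- The chart expression of a vector field. -/
def chartField (x : M) (V : ∀ y : M, TangentSpace 𝓘(ℝ, F) y) : F → F :=
  VectorField.mpullbackWithin 𝓘(ℝ, F) 𝓘(ℝ, F) (extChartAt 𝓘(ℝ, F) x).symm V
    (range 𝓘(ℝ, F))

theorem differentiableAt_chartField {V : ∀ y : M, TangentSpace 𝓘(ℝ, F) y}
    (hV : MDifferentiableAt 𝓘(ℝ, F) 𝓘(ℝ, F).tangent (vfMap V) x) :
    DifferentiableAt ℝ (chartField x V) (extChartAt 𝓘(ℝ, F) x x) := by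
  have h := (mdifferentiableWithinAt_univ.2
    hV).differentiableWithinAt_mpullbackWithin_vectorField
  have e : (extChartAt 𝓘(ℝ, F) x).symm ⁻¹' univ ∩ range 𝓘(ℝ, F) = univ := by simp
  rw [e] at h
  have h' : DifferentiableWithinAt ℝ (chartField x V) univ (extChartAt 𝓘(ℝ, F) x x) := h
  exact differentiableWithinAt_univ.1 h'

theorem chartField_self (V : ∀ y : M, TangentSpace 𝓘(ℝ, F) y) :
    chartField x V (extChartAt 𝓘(ℝ, F) x x) = V x := by
  have h1 : (extChartAt 𝓘(ℝ, F) x).symm (extChartAt 𝓘(ℝ, F) x x) = x := by simp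
  have key : ∀ y : M, y = x → ∀ L : F →L[ℝ] F, L (V y) = L (V x) := by
    rintro y rfl L; rfl
  exact (key _ h1 _).trans (mfderivWithin_extChartAt_symm_inverse_apply (I := 𝓘(ℝ, F)) (V x))

theorem fderiv_chartField {V : ∀ y : M, TangentSpace 𝓘(ℝ, F) y}
    (hg : ContMDiff 𝓘(ℝ, F) 𝓘(ℝ, ℝ) ∞ g) {z : F} (hz : z ∈ (extChartAt 𝓘(ℝ, F) x).target) :
    fderiv ℝ (g ∘ (extChartAt 𝓘(ℝ, F) x).symm) z (chartField x V z) =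
      mvfderiv 𝓘(ℝ, F) g ((extChartAt 𝓘(ℝ, F) x).symm z)
        (V ((extChartAt 𝓘(ℝ, F) x).symm z)) := by
  have h1 := isInvertible_mfderivWithin_extChartAt_symm (I := 𝓘(ℝ, F)) hz
  have h2 := h1.self_apply_inverse (V ((extChartAt 𝓘(ℝ, F) x).symm z))
  have h3 : MDifferentiableAt 𝓘(ℝ, F) 𝓘(ℝ, F) (extChartAt 𝓘(ℝ, F) x).symm z := by
    have := mdifferentiableWithinAt_of_isInvertible_mfderivWithin h1
    rwa [modelWithCornersSelf_coe, range_id, mdifferentiableWithinAt_univ] at this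
  have h4 := mfderiv_comp_apply z ((hg.mdifferentiable (by simp)) _) h3
    (chartField (F := F) x V z)
  have h5 : @Eq (F →L[ℝ] ℝ) (mfderiv 𝓘(ℝ, F) 𝓘(ℝ, ℝ) (g ∘ (extChartAt 𝓘(ℝ, F) x).symm) z)
    (fderiv ℝ (g ∘ (extChartAt 𝓘(ℝ, F) x).symm) z) := mfderiv_eq_fderiv
  refine (congrArg (fun L : F →L[ℝ] ℝ => L (chartField x V z)) h5).symm.trans (h4.trans ?_)
  simp only [modelWithCornersSelf_coe, range_id, mfderivWithin_univ] at h2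
  simp only [chartField, VectorField.mpullbackWithin_apply, modelWithCornersSelf_coe, range_id,
    mfderivWithin_univ]
  exact congrArg (mvfderiv 𝓘(ℝ, F) g ((extChartAt 𝓘(ℝ, F) x).symm z)) h2

/-- In the chart at x, an iterated derivative v(Bg) is D²G(v, B) + DG(DB·v). In the difference the
second derivatives of G cancel by symmetry, leaving DG applied to the coordinate bracket. -/
theorem mvfderiv_mlieBracket {A W : ∀ y : M, TangentSpace 𝓘(ℝ, F) y}
    (hA : MDifferentiableAt 𝓘(ℝ, F) 𝓘(ℝ, F).tangent (vfMap A) x)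
    (hW : MDifferentiableAt 𝓘(ℝ, F) 𝓘(ℝ, F).tangent (vfMap W) x)
    (hg : ContMDiff 𝓘(ℝ, F) 𝓘(ℝ, ℝ) ∞ g) :
    mvfderiv 𝓘(ℝ, F) g x (VectorField.mlieBracket 𝓘(ℝ, F) A W x) =
      mvfderiv 𝓘(ℝ, F) (fun y => mvfderiv 𝓘(ℝ, F) g y (W y)) x (A x) -
      mvfderiv 𝓘(ℝ, F) (fun y => mvfderiv 𝓘(ℝ, F) g y (A y)) x (W x) := by
  set z := extChartAt 𝓘(ℝ, F) x x
  have hz : z ∈ (extChartAt 𝓘(ℝ, F) x).target := mem_extChartAt_target x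
  set G := g ∘ (extChartAt 𝓘(ℝ, F) x).symm with hG
  have hGs : ContDiffAt ℝ ∞ G z := by
    have h1 := contMDiffOn_extChartAt_symm (I := 𝓘(ℝ, F)) (n := ∞) x
    have h2 := (hg.comp_contMDiffOn h1).contDiffOn
    exact h2.contDiffAt ((isOpen_extChartAt_target x).mem_nhds hz)
  have hDG : DifferentiableAt ℝ (fderiv ℝ G) z :=
    (hGs.fderiv_right (m := 1) (by norm_cast)).differentiableAt one_ne_zero
  have key : ∀ {B : ∀ y : M, TangentSpace 𝓘(ℝ, F) y},
      MDifferentiableAt 𝓘(ℝ, F) 𝓘(ℝ, F).tangent (vfMap B) x → ∀ v : F,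
      mvfderiv 𝓘(ℝ, F) (fun y => mvfderiv 𝓘(ℝ, F) g y (B y)) x v =
        fderiv ℝ (fderiv ℝ G) z v (B x) + fderiv ℝ G z (fderiv ℝ (chartField x B) z v) := by
    intro B hB v
    rw [mvfderiv_comp_extChartAt_symm (hB.mvfderiv_vf hg)]
    have h1 : (fun y => mvfderiv 𝓘(ℝ, F) g y (B y)) ∘ (extChartAt 𝓘(ℝ, F) x).symm =ᶠ[𝓝 z]
        fun w => fderiv ℝ G w (chartField x B w) := by
      filter_upwards [(isOpen_extChartAt_target (I := 𝓘(ℝ, F)) x).mem_nhds hz] with w hw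
      exact (fderiv_chartField hg hw).symm
    have h2 := hDG.hasFDerivAt.clm_apply (differentiableAt_chartField hB).hasFDerivAt
    have h3 : fderiv ℝ ((fun y => mvfderiv 𝓘(ℝ, F) g y (B y)) ∘
        (extChartAt 𝓘(ℝ, F) x).symm) z = _ := h1.fderiv_eq.trans h2.fderiv
    have h4 := congrArg (fun L : F →L[ℝ] ℝ => L v) h3
    have h5 : chartField x B z = B x := chartField_self B
    simp only [add_apply, ContinuousLinearMap.comp_apply, h5] at h4
    rw [add_comm]
    exact h4
  have hsymm : fderiv ℝ (fderiv ℝ G) z (A x) (W x) = fderiv ℝ (fderiv ℝ G) z (W x) (A x) :=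
    (hGs.isSymmSndFDerivAt (by simp only [minSmoothness_of_isRCLikeNormedField]; norm_cast)).eq _ _
  have hbr : VectorField.mlieBracket 𝓘(ℝ, F) A W x =
      fderiv ℝ (chartField x W) z (A x) - fderiv ℝ (chartField x A) z (W x) := by
    rw [← VectorField.mlieBracketWithin_univ, VectorField.mlieBracketWithin_apply]
    have h6 : ((mfderiv 𝓘(ℝ, F) 𝓘(ℝ, F) (extChartAt 𝓘(ℝ, F) x) x).inverse : F →L[ℝ] F) =
        ContinuousLinearMap.id ℝ F := by
      rw [mfderiv_extChartAt_self]; exact ContinuousLinearMap.inverse_id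
    refine (congrArg (fun L : F →L[ℝ] F => L _) h6).trans ?_
    rw [ContinuousLinearMap.id_apply]
    have e : (extChartAt 𝓘(ℝ, F) x).symm ⁻¹' univ ∩ range 𝓘(ℝ, F) = univ := by simp
    rw [e]
    change VectorField.lieBracketWithin ℝ (chartField x A) (chartField x W) univ z = _
    rw [VectorField.lieBracketWithin_univ, VectorField.lieBracket_eq]
    change fderiv ℝ (chartField x W) z (chartField x A z) -
      fderiv ℝ (chartField x A) z (chartField x W z) = _
    rw [chartField_self, chartField_self]
  have k := congrArg (fun L : F →L[ℝ] ℝ => L (VectorField.mlieBracket 𝓘(ℝ, F) A W x))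
    (mvfderiv_comp_extChartAt_symm ((hg.mdifferentiable (by simp)) x))
  refine k.trans (Eq.trans ?_ (congrArg₂ (· - ·) (key hW (A x)) (key hA (W x))).symm)
  refine (congrArg (fderiv ℝ G z) hbr).trans ((map_sub _ _ _).trans ?_)
  simp only [hsymm]
  ring

end Bracket

section CovHessian

variable {F : Type*} [NormedAddCommGroup F] [NormedSpace ℝ F]
  {M : Type*} [TopologicalSpace M] [ChartedSpace F M] [IsManifold 𝓘(ℝ, F) ∞ M]
  {cov : CovariantDerivative 𝓘(ℝ, F) F (TangentSpace 𝓘(ℝ, F) : M → Type _)}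
  {x : M} {f g : M → ℝ}

theorem contMDiffAt_cov (hcov : CovariantDerivative.ContMDiffCovariantDerivative cov ∞)
    {V W : ∀ y : M, TangentSpace 𝓘(ℝ, F) y}
    (hV : ContMDiffAt 𝓘(ℝ, F) 𝓘(ℝ, F).tangent ∞ (vfMap V) x)
    (hW : ContMDiff 𝓘(ℝ, F) 𝓘(ℝ, F).tangent ∞ (vfMap W)) :
    ContMDiffAt 𝓘(ℝ, F) 𝓘(ℝ, F).tangent ∞ (vfMap fun y => cov W y (V y)) x := by
  have h1 := hcov.contMDiff.contMDiff (σ := W) (by simpa using hW.contMDiffOn)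
  have h2 := (contMDiffOn_univ.1 h1) x
  exact ContMDiffAt.clm_bundle_apply h2 hV

/-- Replacing W by hW creates the term dh(v) df(W) in both summands, and the two copies cancel. This
is why `covHessian`, defined by one chosen extension, may be computed with any other. -/
theorem tensorialAt_covHessian [FiniteDimensional ℝ F] (hf : ContMDiff 𝓘(ℝ, F) 𝓘(ℝ, ℝ) ∞ f)
    (v : TangentSpace 𝓘(ℝ, F) x) :
    TensorialAt 𝓘(ℝ, F) F (fun W : ∀ y : M, TangentSpace 𝓘(ℝ, F) y =>
      mvfderiv 𝓘(ℝ, F) (fun y => mvfderiv 𝓘(ℝ, F) f y (W y)) x v -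
        mvfderiv 𝓘(ℝ, F) f x (cov W x v)) x where
  smul {h W} hh hW := by
    have e1 := cov.isCovariantDerivativeOnUniv.leibniz hW hh
    have e2 : (fun y => mvfderiv 𝓘(ℝ, F) f y ((h • W) y)) =
        h * fun y => mvfderiv 𝓘(ℝ, F) f y (W y) := by
      ext y; simp
    rw [e2, mvfderiv_mul hh (hW.mvfderiv_vf hf), e1]
    simp
    ring
  add {W W'} hW hW' := by
    have e1 := cov.isCovariantDerivativeOnUniv.add hW hW'
    have e2 : (fun y => mvfderiv 𝓘(ℝ, F) f y ((W + W') y)) =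
        (fun y => mvfderiv 𝓘(ℝ, F) f y (W y)) + fun y => mvfderiv 𝓘(ℝ, F) f y (W' y) := by
      ext y; simp
    rw [e2, mvfderiv_add (hW.mvfderiv_vf hf) (hW'.mvfderiv_vf hf), e1]
    simp
    ring

theorem covHessian_eq [FiniteDimensional ℝ F] (hf : ContMDiff 𝓘(ℝ, F) 𝓘(ℝ, ℝ) ∞ f)
    {W : ∀ y : M, TangentSpace 𝓘(ℝ, F) y}
    (hW : MDifferentiableAt 𝓘(ℝ, F) 𝓘(ℝ, F).tangent (vfMap W) x)
    (v : TangentSpace 𝓘(ℝ, F) x) :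
    covHessian cov f x v (W x) =
      mvfderiv 𝓘(ℝ, F) (fun y => mvfderiv 𝓘(ℝ, F) f y (W y)) x v -
        mvfderiv 𝓘(ℝ, F) f x (cov W x v) :=
  (tensorialAt_covHessian hf v).pointwise (FiberBundle.mdifferentiableAt_extend ..) hW (by simp)

theorem covHessian_eq_mkHom [FiniteDimensional ℝ F] (hf : ContMDiff 𝓘(ℝ, F) 𝓘(ℝ, ℝ) ∞ f)
    (v w : TangentSpace 𝓘(ℝ, F) x) :
    covHessian cov f x v w = TensorialAt.mkHom _ x (tensorialAt_covHessian (cov := cov) hf v) w :=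
  (TensorialAt.mkHom_apply_eq_extend (tensorialAt_covHessian (cov := cov) hf v) w).symm

theorem covHessian_sum_smul [FiniteDimensional ℝ F] (hf : ContMDiff 𝓘(ℝ, F) 𝓘(ℝ, ℝ) ∞ f)
    {ι κ : Type*} (s : Finset ι) (s' : Finset κ) (a : ι → ℝ) (b : κ → ℝ)
    (v : ι → TangentSpace 𝓘(ℝ, F) x) (w : κ → TangentSpace 𝓘(ℝ, F) x) :
    covHessian cov f x (∑ i ∈ s, a i • v i) (∑ j ∈ s', b j • w j) =
      ∑ i ∈ s, ∑ j ∈ s', a i * b j * covHessian cov f x (v i) (w j) := by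
  have h1 : ∀ v : TangentSpace 𝓘(ℝ, F) x, covHessian cov f x v (∑ j ∈ s', b j • w j) =
      ∑ j ∈ s', b j * covHessian cov f x v (w j) := by
    intro v
    simp only [covHessian_eq_mkHom hf, map_sum, map_smul, smul_eq_mul]
  have h2 : ∀ w : TangentSpace 𝓘(ℝ, F) x, covHessian cov f x (∑ i ∈ s, a i • v i) w =
      ∑ i ∈ s, a i * covHessian cov f x (v i) w := by
    intro w
    let Wf : M → ℝ := fun y => mvfderiv 𝓘(ℝ, F) f y (FiberBundle.extend F w y)
    have e : ∀ v, covHessian cov f x v w =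
        mvfderiv 𝓘(ℝ, F) Wf x v - mvfderiv 𝓘(ℝ, F) f x (cov (FiberBundle.extend F w) x v) :=
      fun v => rfl
    simp only [e, map_sum, map_smul, smul_eq_mul, ← Finset.sum_sub_distrib, mul_sub]
  simp only [h1, h2, Finset.mul_sum]
  rw [Finset.sum_comm]
  refine Finset.sum_congr rfl fun i _ => Finset.sum_congr rfl fun j _ => by ring

theorem contMDiffAt_covHessian [FiniteDimensional ℝ F]
    (hcov : CovariantDerivative.ContMDiffCovariantDerivative cov ∞)
    (hf : ContMDiff 𝓘(ℝ, F) 𝓘(ℝ, ℝ) ∞ f) {V W : ∀ y : M, TangentSpace 𝓘(ℝ, F) y}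
    (hV : ContMDiff 𝓘(ℝ, F) 𝓘(ℝ, F).tangent ∞ (vfMap V))
    (hW : ContMDiff 𝓘(ℝ, F) 𝓘(ℝ, F).tangent ∞ (vfMap W)) :
    ContMDiff 𝓘(ℝ, F) 𝓘(ℝ, ℝ) ∞ (fun y => covHessian cov f y (V y) (W y)) := by
  have e : (fun y => covHessian cov f y (V y) (W y)) = fun y =>
      mvfderiv 𝓘(ℝ, F) (fun y => mvfderiv 𝓘(ℝ, F) f y (W y)) y (V y) -
        mvfderiv 𝓘(ℝ, F) f y (cov W y (V y)) :=
    funext fun y => covHessian_eq hf ((hW.mdifferentiable (by simp)) y) _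
  rw [e]
  refine (hV.mvfderiv_vf (hW.mvfderiv_vf hf)).sub ?_
  exact ContMDiff.mvfderiv_vf (fun y => contMDiffAt_cov hcov (hV y) hW) hf

end CovHessian

/-! ### Cutoff functions, local coordinates and dual coframes. -/

section Bumps

variable {F : Type*} [NormedAddCommGroup F] [NormedSpace ℝ F] [FiniteDimensional ℝ F]
  {M : Type*} [TopologicalSpace M] [ChartedSpace F M] [IsManifold 𝓘(ℝ, F) ∞ M] [T2Space M]

theorem exists_smooth_cutoff {x : M} {V : Set M} (hV : V ∈ 𝓝 x) :
    ∃ b : M → ℝ, ContMDiff 𝓘(ℝ, F) 𝓘(ℝ, ℝ) ∞ b ∧ HasCompactSupport b ∧ tsupport b ⊆ V ∧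
      b =ᶠ[𝓝 x] 1 := by
  obtain ⟨b, -, hb⟩ := (SmoothBumpFunction.nhds_basis_tsupport (I := 𝓘(ℝ, F)) x).mem_iff.1 hV
  exact ⟨b, b.contMDiff, b.hasCompactSupport, hb, b.eventuallyEq_one⟩

/-- Finitely many cutoff functions subordinate to a cover of a compact set. -/
theorem exists_finite_cutoffs {K : Set M} (hK : IsCompact K) {V : M → Set M}
    (hV : ∀ x, V x ∈ 𝓝 x) :
    ∃ (t : Finset M) (b c ρ : t → M → ℝ),
      (∀ i, ContMDiff 𝓘(ℝ, F) 𝓘(ℝ, ℝ) ∞ (b i)) ∧ (∀ i, ContMDiff 𝓘(ℝ, F) 𝓘(ℝ, ℝ) ∞ (c i)) ∧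
      (∀ i, ContMDiff 𝓘(ℝ, F) 𝓘(ℝ, ℝ) ∞ (ρ i)) ∧
      (∀ i, HasCompactSupport (b i)) ∧ (∀ i, tsupport (c i) ⊆ tsupport (b i)) ∧
      (∀ i, tsupport (ρ i) ⊆ V i) ∧ (∀ i, ∀ y ∈ tsupport (b i), ρ i =ᶠ[𝓝 y] 1) ∧
      (∀ y ∈ K, 1 ≤ ∑ i, b i y ^ 2) ∧
      ∀ y, 1 / 2 < ∑ i, b i y ^ 2 → ∑ i, b i y * c i y = 1 := by
  choose ρ hρ hρc hρV hρ1 using fun x => exists_smooth_cutoff (F := F) (hV x)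
  -- A second layer of cutoffs, supported where ρ is locally equal to one: near the support of b, a
  -- product ρ · h has the values and the differential of h.
  choose b hb hbc hbV hb1 using fun x => exists_smooth_cutoff (F := F)
    (eventually_eventually_nhds.2 (hρ1 x))
  obtain ⟨t, -, ht⟩ := hK.elim_nhds_subcover (fun x => {y | b x y = 1}) fun x _ => hb1 x
  let s : M → ℝ := fun y => ∑ i : t, b i y ^ 2
  have hs : ContMDiff 𝓘(ℝ, F) 𝓘(ℝ, ℝ) ∞ s := by
    refine contMDiff_finsetSum fun i _ => (hb i).pow 2
  have hs0 : ∀ y, 0 ≤ s y := fun y => Finset.sum_nonneg fun i _ => sq_nonneg _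
  -- A smooth denominator that never vanishes and equals s where s ≥ 1/2. Dividing b by it yields c
  -- with Σ b c = 1 there, without a singularity where all b vanish.
  let d : M → ℝ := fun y => s y + 1 - Real.smoothTransition (2 * s y)
  have hd : ContMDiff 𝓘(ℝ, F) 𝓘(ℝ, ℝ) ∞ d := by
    have h1 : ContDiff ℝ ∞ fun r : ℝ => r + 1 - Real.smoothTransition (2 * r) :=
      (contDiff_id.add contDiff_const).sub
        (Real.smoothTransition.contDiff.comp (contDiff_const.mul contDiff_id))
    exact h1.contMDiff.comp hs
  have hd0 : ∀ y, d y ≠ 0 := fun y => by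
    rcases (hs0 y).eq_or_lt with h | h
    · simp [d, ← h]
    · have := Real.smoothTransition.le_one (2 * s y)
      have : 0 < d y := by simp only [d]; linarith
      exact this.ne'
  refine ⟨t, fun i => b i, fun i y => b i y * (d y)⁻¹, fun i => ρ i, fun i => hb i,
    fun i => (hb i).mul (hd.inv₀ hd0), fun i => hρ i, fun i => hbc i,
    fun i => closure_mono fun y hy => ?_, fun i => hρV i, fun i y hy => ?_, fun y hy => ?_,
    fun y hy => ?_⟩
  · exact left_ne_zero_of_mul hy
  · exact hbV i hy
  · obtain ⟨x, hx, hxy⟩ := mem_iUnion₂.1 (ht hy)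
    have h1 : b x y ^ 2 ≤ ∑ i : t, b i y ^ 2 :=
      Finset.single_le_sum (f := fun i : t => b i y ^ 2) (fun i _ => sq_nonneg _)
        (Finset.mem_univ (⟨x, hx⟩ : t))
    rw [mem_ofPred_eq] at hxy
    rw [hxy] at h1
    simpa using h1
  · have h1 : d y = s y := by
      simp only [d]
      rw [Real.smoothTransition.one_of_one_le (by have : 1 / 2 < s y := hy; linarith)]
      ring
    have h2 : s y ≠ 0 := by have : 1 / 2 < s y := hy; linarith
    have h3 : ∀ i : t, b i y * (b i y * (d y)⁻¹) = b i y ^ 2 * (s y)⁻¹ := fun i => by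
      rw [h1]; ring
    rw [Finset.sum_congr rfl fun i _ => h3 i, ← Finset.sum_mul]
    exact mul_inv_cancel₀ h2

theorem ContMDiffOn.mul_of_tsupport {b g : M → ℝ} {V : Set M} (hV : IsOpen V)
    (hb : ContMDiff 𝓘(ℝ, F) 𝓘(ℝ, ℝ) ∞ b) (hbV : tsupport b ⊆ V)
    (hg : ContMDiffOn 𝓘(ℝ, F) 𝓘(ℝ, ℝ) ∞ g V) :
    ContMDiff 𝓘(ℝ, F) 𝓘(ℝ, ℝ) ∞ (fun y => b y * g y) := by
  refine contMDiff_of_tsupport fun y hy => ?_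
  have : y ∈ V := hbV (closure_mono (fun z hz => left_ne_zero_of_mul hz) hy)
  exact (hb y).mul (hg.contMDiffAt (hV.mem_nhds this))

/-- Coordinate functions and coordinate vector fields near a point. -/
theorem exists_coordinates (x : M) :
    ∃ (V : Set M) (h : Fin (Module.finrank ℝ F) → M → ℝ)
      (dd : Fin (Module.finrank ℝ F) → ∀ y : M, TangentSpace 𝓘(ℝ, F) y),
      IsOpen V ∧ x ∈ V ∧ V ⊆ (extChartAt 𝓘(ℝ, F) x).source ∧
      (∀ e, ContMDiff 𝓘(ℝ, F) 𝓘(ℝ, ℝ) ∞ (h e)) ∧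
      (∀ e, ContMDiffOn 𝓘(ℝ, F) 𝓘(ℝ, F).tangent ∞ (vfMap (dd e)) V) ∧
      (∀ y ∈ V, ∀ e, h e y = (Module.finBasis ℝ F).coord e (extChartAt 𝓘(ℝ, F) x y)) ∧
      ∀ y ∈ V, ∀ v : TangentSpace 𝓘(ℝ, F) y, v = ∑ e, mvfderiv 𝓘(ℝ, F) (h e) y v • dd e y := by
  obtain ⟨b, hb, hbc, hbV, hb1⟩ := exists_smooth_cutoff (F := F) (extChartAt_source_mem_nhds (I := 𝓘(ℝ, F)) x)
  obtain ⟨V, hV1, hVo, hxV⟩ := eventually_nhds_iff.1 hb1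
  set B := Module.finBasis ℝ F
  let φ : Fin (Module.finrank ℝ F) → M → ℝ := fun e y => B.coord e (extChartAt 𝓘(ℝ, F) x y)
  have hφ : ∀ e, ContMDiffOn 𝓘(ℝ, F) 𝓘(ℝ, ℝ) ∞ (φ e) (extChartAt 𝓘(ℝ, F) x).source := by
    intro e
    have h1 : ContMDiffOn 𝓘(ℝ, F) 𝓘(ℝ, F) ∞ (extChartAt 𝓘(ℝ, F) x) (chartAt F x).source :=
      contMDiffOn_extChartAt
    rw [← extChartAt_source 𝓘(ℝ, F)] at h1
    exact (LinearMap.toContinuousLinearMap (B.coord e)).contDiff.contMDiff.comp_contMDiffOn h1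
  have hsrc : IsOpen (extChartAt 𝓘(ℝ, F) x).source := isOpen_extChartAt_source x
  let t := trivializationAt F (TangentSpace 𝓘(ℝ, F) : M → Type _) x
  have hbase : t.baseSet = (extChartAt 𝓘(ℝ, F) x).source := by
    rw [extChartAt_source]; rfl
  refine ⟨V ∩ (extChartAt 𝓘(ℝ, F) x).source, fun e y => b y * φ e y,
    fun e y => t.localFrame B e y, hVo.inter hsrc, ⟨hxV, mem_extChartAt_source x⟩,
    inter_subset_right, fun e => ContMDiffOn.mul_of_tsupport hsrc hb hbV (hφ e), fun e => ?_,
    fun y hy e => ?_, fun y hy v => ?_⟩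
  · refine ContMDiffOn.mono ?_ inter_subset_right
    rw [← hbase]
    exact t.contMDiffOn_localFrame_baseSet ∞ B e
  · change b y * φ e y = φ e y
    rw [hV1 y hy.1, Pi.one_apply, one_mul]
  · have hy' : y ∈ t.baseSet := by rw [hbase]; exact hy.2
    have h3 : t.continuousLinearMapAt ℝ y v = mfderiv 𝓘(ℝ, F) 𝓘(ℝ, F) (extChartAt 𝓘(ℝ, F) x) y v := by
      have h := TangentBundle.continuousLinearMapAt_trivializationAt (I := 𝓘(ℝ, F)) (x₀ := x) (x := y)
        (by rwa [← extChartAt_source 𝓘(ℝ, F), ← hbase])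
      exact DFunLike.congr_fun h v
    have h4 : t.continuousLinearMapAt ℝ y v = (t ⟨y, v⟩).2 := by
      rw [Bundle.Trivialization.continuousLinearMapAt_apply, t.linearMapAt_apply, if_pos hy']
    have hsum := t.eq_sum_localFrameCoeff_smul (I := 𝓘(ℝ, F)) (b := B) (s := FiberBundle.extend F v) hy'
    rw [FiberBundle.extend_apply_self] at hsum
    refine hsum.trans (Finset.sum_congr rfl fun e _ => ?_)
    congr 1
    have h2 : (fun y => b y * φ e y) =ᶠ[𝓝 y] φ e := by
      filter_upwards [hVo.mem_nhds hy.1] with z hz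
      rw [hV1 z hz, Pi.one_apply, one_mul]
    have h5 := t.localFrameCoeff_eq_coeff (I := 𝓘(ℝ, F)) (b := B) (s := FiberBundle.extend F v) hy' (i := e)
    have h9 : (⟨y, FiberBundle.extend F v y⟩ : TangentBundle 𝓘(ℝ, F) M) = ⟨y, v⟩ := by
      rw [FiberBundle.extend_apply_self]
    rw [FiberBundle.extend_apply_self] at h5
    change _ = B.repr (t ⟨y, FiberBundle.extend F v y⟩).2 e at h5
    rw [h9, ← h4, h3] at h5
    rw [h5]
    refine Eq.trans ?_ (DFunLike.congr_fun (mvfderiv_congr_of_eventuallyEq h2) v).symm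
    have h6 : MDifferentiableAt 𝓘(ℝ, F) 𝓘(ℝ, F) (extChartAt 𝓘(ℝ, F) x) y :=
      mdifferentiableAt_extChartAt (by rw [← extChartAt_source 𝓘(ℝ, F)]; exact hy.2)
    let L : F →L[ℝ] ℝ := LinearMap.toContinuousLinearMap (B.coord e)
    have h7 := mfderiv_comp_apply y (L.differentiableAt.mdifferentiableAt) h6 v
    refine Eq.symm (h7.trans ?_)
    have h8 : @Eq (F →L[ℝ] ℝ) (mfderiv 𝓘(ℝ, F) 𝓘(ℝ, ℝ) L (extChartAt 𝓘(ℝ, F) x y)) L :=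
      mfderiv_eq_fderiv.trans L.fderiv
    exact congrArg (fun A : F →L[ℝ] ℝ => A _) h8

/-- A smooth coframe dual to an independent family of vector fields. -/
theorem exists_local_coframe {x : M} {V : Set M} (hV : IsOpen V) (hxV : x ∈ V) {ι : Type*}
    [Fintype ι] {h : ι → M → ℝ} (hh : ∀ e, ContMDiff 𝓘(ℝ, F) 𝓘(ℝ, ℝ) ∞ (h e))
    (hinj : ∀ v : TangentSpace 𝓘(ℝ, F) x, (∀ e, mvfderiv 𝓘(ℝ, F) (h e) x v = 0) → v = 0)
    {k : ℕ} {X : Fin k → ∀ y : M, TangentSpace 𝓘(ℝ, F) y}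
    (hX : ∀ i, ContMDiffOn 𝓘(ℝ, F) 𝓘(ℝ, F).tangent ∞ (vfMap (X i)) V)
    (hind : LinearIndependent ℝ fun i => X i x) :
    ∃ (V' : Set M) (θ : Fin k → ι → M → ℝ), IsOpen V' ∧ x ∈ V' ∧ V' ⊆ V ∧
      (∀ i e, ContMDiffOn 𝓘(ℝ, F) 𝓘(ℝ, ℝ) ∞ (θ i e) V') ∧
      ∀ y ∈ V', ∀ c : Fin k → ℝ, ∀ i,
        ∑ e, θ i e y * mvfderiv 𝓘(ℝ, F) (h e) y (∑ j, c j • X j y) = c i := by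
  classical
  let Q : ι → Fin k → (Fin k → ℝ) →L[ℝ] ι → ℝ := fun e j =>
    (ContinuousLinearMap.proj j : (Fin k → ℝ) →L[ℝ] ℝ).smulRight (Pi.single e 1)
  let L : M → (Fin k → ℝ) →L[ℝ] ι → ℝ := fun y =>
    ∑ e, ∑ j, mvfderiv 𝓘(ℝ, F) (h e) y (X j y) • Q e j
  have hL : ∀ y c, L y c = fun e => mvfderiv 𝓘(ℝ, F) (h e) y (∑ j, c j • X j y) := by
    intro y c
    ext e
    simp only [L, Q, sum_apply, Finset.sum_apply, smul_apply, map_sum, map_smul,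
      ContinuousLinearMap.smulRight_apply, ContinuousLinearMap.proj_apply, Pi.smul_apply,
      smul_eq_mul]
    rw [Finset.sum_eq_single e (fun e' _ hne => by simp [hne.symm]) (by simp)]
    exact Finset.sum_congr rfl fun j _ => by simp [mul_comm]
  have hLs : ContMDiffOn 𝓘(ℝ, F) 𝓘(ℝ, (Fin k → ℝ) →L[ℝ] ι → ℝ) ∞ L V := by
    refine contMDiffOn_finsetSum fun e _ => contMDiffOn_finsetSum fun j _ => ?_
    exact ContMDiffOn.smul (fun y hy => (hX j y hy).mvfderiv_apply (hh e)) contMDiffOn_const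
  have hLinj : Function.Injective (L x).toLinearMap := by
    rw [← LinearMap.ker_eq_bot, LinearMap.ker_eq_bot']
    intro c hc
    have h0 : ∑ j, c j • X j x = 0 := hinj _ fun e => by
      have := congrFun ((hL x c).symm.trans hc) e
      simpa using this
    exact funext fun j => Fintype.linearIndependent_iff.1 hind c h0 j
  -- L y sends coefficients to the components of the combination of the X j. A left inverse R at x
  -- alone suffices: R ∘ L y is the identity at x, hence invertible nearby, and (R ∘ L y)⁻¹ ∘ R is a
  -- smooth left inverse of L y.
  obtain ⟨R, hR⟩ := (L x).toLinearMap.exists_leftInverse_of_injective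
    (LinearMap.ker_eq_bot.2 hLinj)
  let R₀ : (ι → ℝ) →L[ℝ] Fin k → ℝ := LinearMap.toContinuousLinearMap R
  let N : M → (Fin k → ℝ) →L[ℝ] Fin k → ℝ := fun y => R₀ ∘L L y
  have hNs : ContMDiffOn 𝓘(ℝ, F) 𝓘(ℝ, (Fin k → ℝ) →L[ℝ] Fin k → ℝ) ∞ N V :=
    (ContinuousLinearMap.compL ℝ (Fin k → ℝ) (ι → ℝ) (Fin k → ℝ) R₀).contDiff.contMDiff.comp_contMDiffOn hLs
  have hNx : N x = 1 := by
    ext1 c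
    exact DFunLike.congr_fun hR c
  refine ⟨V ∩ N ⁻¹' {a | IsUnit a}, fun i e y => Ring.inverse (N y) (R₀ (Pi.single e 1)) i,
    hNs.continuousOn.isOpen_inter_preimage hV Units.isOpen, ⟨hxV, ?_⟩, inter_subset_left,
    fun i e y hy => ?_, fun y hy c i => ?_⟩
  · change IsUnit (N x)
    rw [hNx]; exact isUnit_one
  · obtain ⟨u, hu⟩ := hy.2
    have h1 : ContDiffAt ℝ ∞ Ring.inverse (N y) := hu ▸ contDiffAt_ringInverse ℝ u
    have h2 := h1.contMDiffAt.comp_contMDiffWithinAt y ((hNs y hy.1).mono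
      (inter_subset_left (s := V) (t := N ⁻¹' {a | IsUnit a})))
    let ev : ((Fin k → ℝ) →L[ℝ] Fin k → ℝ) →L[ℝ] ℝ :=
      (ContinuousLinearMap.proj i : (Fin k → ℝ) →L[ℝ] ℝ) ∘L
        ContinuousLinearMap.apply ℝ (Fin k → ℝ) (R₀ (Pi.single e 1))
    exact ev.contDiff.contMDiff.contMDiffAt.comp_contMDiffWithinAt y h2
  · have h1 : Ring.inverse (N y) (R₀ (L y c)) = c := by
      have := congrArg (fun A : (Fin k → ℝ) →L[ℝ] Fin k → ℝ => A c) (Ring.inverse_mul_cancel (N y) hy.2)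
      exact this
    have h2 : L y c = ∑ e, mvfderiv 𝓘(ℝ, F) (h e) y (∑ j, c j • X j y) • Pi.single (M := fun _ => ℝ) e (1 : ℝ) := by
      rw [hL]
      ext e
      simp [Finset.sum_apply, Pi.single_apply]
    have h3 := congrFun h1 i
    rw [h2, map_sum, map_sum, Finset.sum_apply] at h3
    rw [← h3]
    refine Finset.sum_congr rfl fun e _ => ?_
    rw [map_smul, map_smul, Pi.smul_apply, smul_eq_mul, mul_comm]

end Bumps

/-! ### Frames of E, and a Euclidean embedding near a compact set. -/

namespace SubRiemannianStructure

variable {F : Type*} [NormedAddCommGroup F] [NormedSpace ℝ F]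
  {M : Type uM} [TopologicalSpace M] [ChartedSpace F M] [IsManifold 𝓘(ℝ, F) ∞ M]
  (S : SubRiemannianStructure F M)

theorem eq_sum_metric_smul {y : M} {k : ℕ} {X : Fin k → S.E y}
    (ho : ∀ i j, S.metric y (X i) (X j) = if i = j then 1 else 0)
    (hs : Submodule.span ℝ (Set.range X) = ⊤) (v : S.E y) :
    v = ∑ i, S.metric y v (X i) • X i := by
  have hv : v ∈ Submodule.span ℝ (Set.range X) := by rw [hs]; trivial
  obtain ⟨c, rfl⟩ := (Submodule.mem_span_range_iff_exists_fun ℝ).1 hv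
  refine Finset.sum_congr rfl fun i _ => ?_
  congr 1
  simp [ho]

theorem linearIndependent_of_orthonormal {y : M} {k : ℕ} {X : Fin k → S.E y}
    (ho : ∀ i j, S.metric y (X i) (X j) = if i = j then 1 else 0) :
    LinearIndependent ℝ fun i => (X i).1 := by
  have h : LinearIndependent ℝ X := by
    rw [Fintype.linearIndependent_iff]
    intro c hc i
    have := congrArg (fun v => S.metric y v (X i)) hc
    simpa [ho] using this
  exact h.map' (S.E y).subtype (Submodule.ker_subtype _)

variable [FiniteDimensional ℝ F] [T2Space M]

/-- Near each point there are an orthonormal frame of `E`, coordinates, and a smooth dual coframe. -/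
theorem exists_local_data (x : M) :
    ∃ (V : Set M) (h : Fin (Module.finrank ℝ F) → M → ℝ)
      (dd : Fin (Module.finrank ℝ F) → ∀ y : M, TangentSpace 𝓘(ℝ, F) y) (k : ℕ)
      (X : Fin k → ∀ y : M, S.E y) (θ : Fin k → Fin (Module.finrank ℝ F) → M → ℝ),
      IsOpen V ∧ x ∈ V ∧ V ⊆ (extChartAt 𝓘(ℝ, F) x).source ∧
      (∀ e, ContMDiff 𝓘(ℝ, F) 𝓘(ℝ, ℝ) ∞ (h e)) ∧
      (∀ e, ContMDiffOn 𝓘(ℝ, F) 𝓘(ℝ, F).tangent ∞ (vfMap (dd e)) V) ∧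
      (∀ y ∈ V, ∀ e, h e y = (Module.finBasis ℝ F).coord e (extChartAt 𝓘(ℝ, F) x y)) ∧
      (∀ y ∈ V, ∀ v : TangentSpace 𝓘(ℝ, F) y, v = ∑ e, mvfderiv 𝓘(ℝ, F) (h e) y v • dd e y) ∧
      (∀ i, ContMDiffOn 𝓘(ℝ, F) 𝓘(ℝ, F).tangent ∞ (vfMap fun y => (X i y).1) V) ∧
      (∀ i e, ContMDiffOn 𝓘(ℝ, F) 𝓘(ℝ, ℝ) ∞ (θ i e) V) ∧
      (∀ y ∈ V, ∀ v : S.E y, v = ∑ i, S.metric y v (X i y) • X i y) ∧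
      ∀ y ∈ V, ∀ v : S.E y, ∀ i,
        ∑ e, θ i e y * mvfderiv 𝓘(ℝ, F) (h e) y v.1 = S.metric y v (X i y) := by
  obtain ⟨V₁, h, dd, hV₁, hxV₁, hsrc, hh, hdd, hφ, hrec⟩ := exists_coordinates (F := F) x
  obtain ⟨U, hU, hxU, k, X, hX, hon⟩ := S.exists_frame x
  obtain ⟨V, θ, hV, hxV, hVs, hθ, hθX⟩ := exists_local_coframe (hV₁.inter hU) ⟨hxV₁, hxU⟩ hh
    (fun v hv => by rw [hrec x hxV₁ v]; simp [hv])
    (fun i => (hX i).mono inter_subset_right)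
    (S.linearIndependent_of_orthonormal (hon x hxU).1)
  have hexp : ∀ y ∈ V, ∀ v : S.E y, v = ∑ i, S.metric y v (X i y) • X i y := fun y hy v =>
    S.eq_sum_metric_smul (hon y (hVs hy).2).1 (hon y (hVs hy).2).2 v
  refine ⟨V, h, dd, k, X, θ, hV, hxV, fun y hy => hsrc (hVs hy).1, hh,
    fun e => (hdd e).mono fun y hy => (hVs hy).1, fun y hy => hφ y (hVs hy).1,
    fun y hy => hrec y (hVs hy).1, fun i => (hX i).mono fun y hy => (hVs hy).2, hθ, hexp,
    fun y hy v i => ?_⟩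
  have h1 := hθX y hy (fun j => S.metric y v (X j y)) i
  have h2 : ∑ j, S.metric y v (X j y) • (X j y).1 = v.1 := by
    conv_rhs => rw [hexp y hy v]
    simp
  rwa [h2] at h1

/-- In an orthonormal frame the metric is the sum of products of coefficients, and these are smooth
functions of the section because a smooth coframe computes them. -/
theorem contMDiffAt_metric {x : M} {A B : ∀ y : M, S.E y}
    (hA : ContMDiffAt 𝓘(ℝ, F) 𝓘(ℝ, F).tangent ∞ (vfMap fun y => (A y).1) x)
    (hB : ContMDiffAt 𝓘(ℝ, F) 𝓘(ℝ, F).tangent ∞ (vfMap fun y => (B y).1) x) :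
    ContMDiffAt 𝓘(ℝ, F) 𝓘(ℝ, ℝ) ∞ (fun y => S.metric y (A y) (B y)) x := by
  obtain ⟨V, h, dd, k, X, θ, hV, hxV, -, hh, -, -, -, hX, hθ, hexp, hco⟩ := S.exists_local_data x
  have e : (fun y => S.metric y (A y) (B y)) =ᶠ[𝓝 x] fun y =>
      ∑ i, (∑ e, θ i e y * mvfderiv 𝓘(ℝ, F) (h e) y (A y).1) *
        ∑ e, θ i e y * mvfderiv 𝓘(ℝ, F) (h e) y (B y).1 := by
    filter_upwards [hV.mem_nhds hxV] with y hy
    simp only [hco y hy]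
    conv_lhs => rw [hexp y hy (B y)]
    rw [map_sum]
    exact Finset.sum_congr rfl fun i _ => by rw [map_smul, smul_eq_mul, mul_comm]
  refine ContMDiffAt.congr_of_eventuallyEq ?_ e
  have hθ' : ∀ i e, ContMDiffAt 𝓘(ℝ, F) 𝓘(ℝ, ℝ) ∞ (θ i e) x := fun i e =>
    (hθ i e).contMDiffAt (hV.mem_nhds hxV)
  refine contMDiffAt_finsetSum fun i _ => ContMDiffAt.mul ?_ ?_ <;>
    refine contMDiffAt_finsetSum fun e _ => ContMDiffAt.mul (hθ' i e) ?_
  exacts [hA.mvfderiv_vf (hh e), hB.mvfderiv_vf (hh e)]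

end SubRiemannianStructure

/-- Finitely many smooth functions `f j` on `M` embedding a neighbourhood of `K`, with vector
fields `W j` reconstructing tangent vectors from their components, sections `X a` of `E` spanning
`E` and smooth coefficients `θ` of the elements of `E` with respect to them. -/
structure CompactFrame {F : Type*} [NormedAddCommGroup F] [NormedSpace ℝ F]
    {M : Type uM} [TopologicalSpace M] [ChartedSpace F M] [IsManifold 𝓘(ℝ, F) ∞ M]
    (S : SubRiemannianStructure F M) (T : ℝ) (K : Set M) where
  J : Type uM
  A : Type uM
  fintypeJ : Fintype J
  fintypeA : Fintype A
  f : J → M → ℝ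
  W : J → ∀ y : M, TangentSpace 𝓘(ℝ, F) y
  X : A → ∀ y : M, S.E y
  θ : A → J → M → ℝ
  O : Set (J → ℝ)
  isOpen_O : IsOpen O
  mem_O : ∀ y ∈ K, (fun j => f j y) ∈ O
  contMDiff_f : ∀ j, ContMDiff 𝓘(ℝ, F) 𝓘(ℝ, ℝ) ∞ (f j)
  contMDiff_W : ∀ j, ContMDiff 𝓘(ℝ, F) 𝓘(ℝ, F).tangent ∞ (vfMap (W j))
  contMDiff_X : ∀ a, ContMDiff 𝓘(ℝ, F) 𝓘(ℝ, F).tangent ∞ (vfMap fun y => (X a y).1)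
  contMDiff_θ : ∀ a j, ContMDiff 𝓘(ℝ, F) 𝓘(ℝ, ℝ) ∞ (θ a j)
  eq_sum_W : ∀ y, (fun j => f j y) ∈ O → ∀ v : TangentSpace 𝓘(ℝ, F) y,
    v = ∑ j, mvfderiv 𝓘(ℝ, F) (f j) y v • W j y
  eq_sum_X : ∀ y, (fun j => f j y) ∈ O → ∀ v : S.E y,
    v.1 = ∑ a, (∑ j, θ a j y * mvfderiv 𝓘(ℝ, F) (f j) y v.1) • (X a y).1
  exists_extension : ∀ g : ℝ → M → ℝ,
    ContMDiffOn (𝓘(ℝ, ℝ).prod 𝓘(ℝ, F)) 𝓘(ℝ, ℝ) ∞ (fun p : ℝ × M => g p.1 p.2)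
      (Icc 0 T ×ˢ univ) →
    ∃ G : ℝ × (J → ℝ) → ℝ, ContDiffOn ℝ ∞ G (Icc 0 T ×ˢ univ) ∧
      ∀ t ∈ Icc 0 T, ∀ y, (fun j => f j y) ∈ O → G (t, fun j => f j y) = g t y

attribute [instance] CompactFrame.fintypeJ CompactFrame.fintypeA

section Existence

variable {F : Type*} [NormedAddCommGroup F] [NormedSpace ℝ F] [FiniteDimensional ℝ F]
  {M : Type uM} [TopologicalSpace M] [ChartedSpace F M] [IsManifold 𝓘(ℝ, F) ∞ M] [T2Space M]

/-- The chart expression of c · g is extended by zero. The image of the support of c is compact,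
hence closed, so the extension vanishes near every point outside the chart target. -/
theorem contDiffOn_chart_extension {T : ℝ} {x : M} {c : M → ℝ}
    (hc : ContMDiff 𝓘(ℝ, F) 𝓘(ℝ, ℝ) ∞ c) (hcc : IsCompact (tsupport c))
    (hcs : tsupport c ⊆ (extChartAt 𝓘(ℝ, F) x).source) {g : ℝ → M → ℝ}
    (hg : ContMDiffOn (𝓘(ℝ, ℝ).prod 𝓘(ℝ, F)) 𝓘(ℝ, ℝ) ∞ (fun p : ℝ × M => g p.1 p.2)
      (Icc 0 T ×ˢ univ)) :
    ∃ H : ℝ × F → ℝ, ContDiffOn ℝ ∞ H (Icc 0 T ×ˢ univ) ∧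
      ∀ t, ∀ y ∈ (extChartAt 𝓘(ℝ, F) x).source, H (t, extChartAt 𝓘(ℝ, F) x y) = c y * g t y := by
  classical
  set φ := extChartAt 𝓘(ℝ, F) x
  let H : ℝ × F → ℝ := fun p => if p.2 ∈ φ.target then c (φ.symm p.2) * g p.1 (φ.symm p.2) else 0
  have hopen : IsOpen φ.target := isOpen_extChartAt_target x
  have hK : IsClosed (φ '' tsupport c) :=
    (hcc.image_of_continuousOn ((continuousOn_extChartAt x).mono hcs)).isClosed
  refine ⟨H, ?_, fun t y hy => ?_⟩
  · rintro ⟨t, z⟩ ⟨ht, -⟩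
    by_cases hz : z ∈ φ.target
    · have h1 : ContMDiffOn 𝓘(ℝ, ℝ × F) (𝓘(ℝ, ℝ).prod 𝓘(ℝ, F)) ∞
          (fun p : ℝ × F => ((p.1, φ.symm p.2) : ℝ × M)) (univ ×ˢ φ.target) := by
        refine ContMDiffOn.prodMk (contDiff_fst.contMDiff.contMDiffOn) ?_
        exact (contMDiffOn_extChartAt_symm x).comp contDiff_snd.contMDiff.contMDiffOn
          fun p hp => hp.2
      have h2 : ContDiffOn ℝ ∞ (fun p : ℝ × F => g p.1 (φ.symm p.2)) (Icc 0 T ×ˢ φ.target) := by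
        have hs : (Icc 0 T ×ˢ φ.target : Set (ℝ × F)) ⊆ univ ×ˢ φ.target :=
          fun p hp => ⟨mem_univ _, hp.2⟩
        have h1' := h1.mono hs
        have h0 : MapsTo (fun p : ℝ × F => ((p.1, φ.symm p.2) : ℝ × M)) (Icc 0 T ×ˢ φ.target)
            (Icc 0 T ×ˢ univ) := fun p hp => ⟨hp.1, mem_univ _⟩
        exact (hg.comp h1' h0).contDiffOn
      have h3 : ContDiffOn ℝ ∞ (fun p : ℝ × F => c (φ.symm p.2)) (univ ×ˢ φ.target) := by
        refine ContMDiffOn.contDiffOn ?_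
        exact hc.comp_contMDiffOn ((contMDiffOn_extChartAt_symm x).comp
          contDiff_snd.contMDiff.contMDiffOn fun p hp => hp.2)
      have h4 := ((h3.mono (prod_mono (subset_univ (Icc 0 T)) subset_rfl)).mul h2) (t, z) ⟨ht, hz⟩
      have hn : univ ×ˢ φ.target ∈ 𝓝 ((t, z) : ℝ × F) :=
        (isOpen_univ.prod hopen).mem_nhds ⟨mem_univ _, hz⟩
      have h5 : ContDiffWithinAt ℝ ∞ (fun p : ℝ × F => c (φ.symm p.2) * g p.1 (φ.symm p.2))
          (Icc 0 T ×ˢ univ) (t, z) := by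
        refine h4.mono_of_mem_nhdsWithin ?_
        filter_upwards [self_mem_nhdsWithin, mem_nhdsWithin_of_mem_nhds hn] with p hp hp'
        exact ⟨hp.1, hp'.2⟩
      refine h5.congr_of_eventuallyEq ?_ (if_pos hz)
      filter_upwards [mem_nhdsWithin_of_mem_nhds hn] with p hp
      exact if_pos hp.2
    · have hz' : z ∉ φ '' tsupport c := fun ⟨y, hy, e⟩ => hz (e ▸ φ.map_source (hcs hy))
      have hn : univ ×ˢ (φ '' tsupport c)ᶜ ∈ 𝓝 ((t, z) : ℝ × F) :=
        (isOpen_univ.prod hK.isOpen_compl).mem_nhds ⟨mem_univ _, hz'⟩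
      have h0 : ∀ p ∈ (univ ×ˢ (φ '' tsupport c)ᶜ : Set (ℝ × F)), H p = 0 := by
        intro p hp
        by_cases hp2 : p.2 ∈ φ.target
        · simp only [H, if_pos hp2]
          have : c (φ.symm p.2) = 0 := by
            by_contra hne
            exact hp.2 ⟨φ.symm p.2, subset_tsupport _ hne, φ.right_inv hp2⟩
          rw [this, zero_mul]
        · exact if_neg hp2
      refine (contDiffWithinAt_const (c := (0 : ℝ))).congr_of_eventuallyEq ?_ (h0 _ ⟨mem_univ _, hz'⟩)
      filter_upwards [mem_nhdsWithin_of_mem_nhds hn] with p hp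
      exact h0 p hp
  · simp only [H, if_pos (φ.map_source hy), φ.left_inv hy]

/-- Each cutoff index i contributes b_i itself and the functions ρ_i h_{i,e}, which on the support
of b_i are the chart coordinates. Tangent vectors and elements of E are reconstructed chart by chart
and averaged with the weights b_i c_i. These sum to one where Σ b_i² > 1/2, an open condition on the
embedded point satisfied on K. Overcomplete families are harmless, since only reconstruction
formulas are used. -/
theorem exists_compactFrame (S : SubRiemannianStructure F M) (T : ℝ) {K : Set M}
    (hK : IsCompact K) : Nonempty (CompactFrame S T K) := by
  classical
  choose V h dd k X θ hV hxV hsrc hh hdd hφ hrec hX hθ hexp hco using S.exists_local_data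
  obtain ⟨t, b, c, ρ, hb, hc, hρ, hbc, hcb, hρV, hρ1, hK1, hK2⟩ :=
    exists_finite_cutoffs (F := F) hK (fun x => (hV x).mem_nhds (hxV x))
  have hbV : ∀ i, tsupport (b i) ⊆ V i := fun i y hy => by
    have := (hρ1 i y hy).eq_of_nhds
    exact hρV i (subset_tsupport _ (by rw [Function.mem_support, this]; exact one_ne_zero))
  have hcV : ∀ i, tsupport (c i) ⊆ V i := fun i => (hcb i).trans (hbV i)
  have hc0 : ∀ i y, y ∉ tsupport (b i) → c i y = 0 := fun i y hy => by
    by_contra hne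
    exact hy (hcb i (subset_tsupport _ hne))
  let d := Module.finrank ℝ F
  let fJ : t × Option (Fin d) → M → ℝ := fun j => match j with
    | (i, none) => b i
    | (i, some e) => fun y => ρ i y * h i e y
  have hf : ∀ j, ContMDiff 𝓘(ℝ, F) 𝓘(ℝ, ℝ) ∞ (fJ j) := by
    rintro ⟨i, _ | e⟩
    · exact hb i
    · exact (hρ i).mul (hh i e)
  have hfd : ∀ i e, ∀ y ∈ tsupport (b i), mvfderiv 𝓘(ℝ, F) (fJ (i, some e)) y =
      mvfderiv 𝓘(ℝ, F) (h i e) y := fun i e y hy => by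
    refine mvfderiv_congr_of_eventuallyEq ?_
    filter_upwards [hρ1 i y hy] with z hz
    change ρ i z * h i e z = _
    rw [hz, Pi.one_apply, one_mul]
  let WJ : t × Option (Fin d) → ∀ y : M, TangentSpace 𝓘(ℝ, F) y := fun j => match j with
    | (i, none) => fun _ => 0
    | (i, some e) => fun y => (b i y * c i y) • dd i e y
  let XA : (Σ i : t, Fin (k i)) → ∀ y : M, S.E y := fun a y => b a.1 y • X a.1 a.2 y
  let θA : (Σ i : t, Fin (k i)) → t × Option (Fin d) → M → ℝ := fun a j => match j with
    | (_, none) => fun _ => 0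
    | (i, some e) => fun y => if i = a.1 then c a.1 y * θ a.1 a.2 e y else 0
  let O : Set (t × Option (Fin d) → ℝ) := {q | 1 / 2 < ∑ i, q (i, none) ^ 2}
  have hO : ∀ y, (fun j => fJ j y) ∈ O → ∑ i, b i y * c i y = 1 := fun y hy => hK2 y hy
  refine ⟨{ J := t × Option (Fin d), A := Σ i : t, Fin (k i), fintypeJ := inferInstance, fintypeA := inferInstance, f := fJ, W := WJ, X := XA, θ := θA, O := O, isOpen_O := ?_, mem_O := ?_, contMDiff_f := hf, contMDiff_W := ?_, contMDiff_X := ?_, contMDiff_θ := ?_, eq_sum_W := ?_, eq_sum_X := ?_, exists_extension := ?_ }⟩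
  · exact isOpen_lt continuous_const (by fun_prop)
  · intro y hy
    have := hK1 y hy
    change 1 / 2 < ∑ i, b i y ^ 2
    linarith
  · rintro ⟨i, _ | e⟩
    · exact Bundle.contMDiff_zeroSection ℝ _
    · refine ContMDiffOn.smul_section_of_tsupport (u := V i) ((hb i).mul (hc i)).contMDiffOn (hV i) ?_ (hdd i e)
      exact (closure_mono fun y hy => left_ne_zero_of_mul hy).trans (hbV i)
  · rintro ⟨i, a⟩
    exact ContMDiffOn.smul_section_of_tsupport (u := V i) (hb i).contMDiffOn (hV i) (hbV i) (hX i a)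
  · rintro ⟨i', a⟩ ⟨i, _ | e⟩
    · exact contMDiff_const
    · by_cases hi : i = i'
      · have : θA ⟨i', a⟩ (i, some e) = fun y => c i' y * θ i' a e y := by
          ext y; exact if_pos hi
        rw [this]
        exact ContMDiffOn.mul_of_tsupport (hV i') (hc i') (hcV i') (hθ i' a e)
      · have : θA ⟨i', a⟩ (i, some e) = fun y => 0 := by
          ext y; exact if_neg hi
        rw [this]
        exact contMDiff_const
  · intro y hy v
    have h1 : ∀ i : t, ∑ e : Option (Fin d), mvfderiv 𝓘(ℝ, F) (fJ (i, e)) y v • WJ (i, e) y =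
        (b i y * c i y) • v := by
      intro i
      rw [Fintype.sum_option]
      change _ • (0 : TangentSpace 𝓘(ℝ, F) y) + ∑ e, mvfderiv 𝓘(ℝ, F) (fJ (i, some e)) y v •
        ((b i y * c i y) • dd i e y) = _
      rw [smul_zero, zero_add]
      by_cases hi : y ∈ tsupport (b i)
      · conv_rhs => rw [hrec i y (hbV i hi) v, Finset.smul_sum]
        refine Finset.sum_congr rfl fun e _ => ?_
        rw [hfd i e y hi, smul_comm]
      · rw [hc0 i y hi]; simp
    rw [Fintype.sum_prod_type]
    simp only [h1]
    rw [← Finset.sum_smul, hO y hy, one_smul]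
  · intro y hy v
    have h1 : ∀ (i : t) (a : Fin (k i)), ∑ j, θA ⟨i, a⟩ j y * mvfderiv 𝓘(ℝ, F) (fJ j) y v.1 =
        c i y * S.metric y v (X i a y) := by
      intro i a
      rw [Fintype.sum_prod_type, Finset.sum_eq_single i]
      · rw [Fintype.sum_option]
        change 0 * _ + ∑ e, (if i = i then c i y * θ i a e y else 0) *
          mvfderiv 𝓘(ℝ, F) (fJ (i, some e)) y v.1 = _
        simp only [if_true, zero_mul, zero_add]
        by_cases hi : y ∈ tsupport (b i)
        · rw [← hco i y (hbV i hi) v a, Finset.mul_sum]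
          refine Finset.sum_congr rfl fun e _ => ?_
          rw [hfd i e y hi, mul_assoc]
        · rw [hc0 i y hi]; simp
      · intro i' _ hne
        rw [Fintype.sum_option]
        change 0 * _ + ∑ e, (if i' = i then c i y * θ i a e y else 0) * _ = _
        simp [hne]
      · simp
    have h2 : ∀ i : t, ∑ a : Fin (k i), (∑ j, θA ⟨i, a⟩ j y * mvfderiv 𝓘(ℝ, F) (fJ j) y v.1) •
        (XA ⟨i, a⟩ y).1 = (b i y * c i y) • v.1 := by
      intro i
      simp only [h1]
      change ∑ a, (c i y * S.metric y v (X i a y)) • (b i y • X i a y : S.E y).1 = _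
      by_cases hi : y ∈ tsupport (b i)
      · conv_rhs => rw [hexp i y (hbV i hi) v]
        simp only [Submodule.coe_smul, Submodule.coe_sum, Finset.smul_sum, smul_smul]
        refine Finset.sum_congr rfl fun a _ => ?_
        congr 1; ring
      · rw [hc0 i y hi]; simp
    rw [← Finset.univ_sigma_univ, Finset.sum_sigma]
    refine Eq.symm ((Finset.sum_congr rfl fun i _ => h2 i).trans ?_)
    rw [← Finset.sum_smul, hO y hy, one_smul]
  · intro g hg
    choose H hH hHg using fun i : t => contDiffOn_chart_extension (x := i.1) (hc i)
      ((hbc i).isCompact.of_isClosed_subset (isClosed_tsupport _) (hcb i))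
      ((hcV i).trans (hsrc i)) hg
    let B := Module.finBasis ℝ F
    let l : t → (t × Option (Fin d) → ℝ) → F := fun i q => ∑ e, q (i, some e) • B e
    have hl : ∀ i, ContDiff ℝ ∞ (l i) := fun i => by
      refine ContDiff.sum fun e _ => ContDiff.smul ?_ contDiff_const
      exact contDiff_apply ℝ ℝ _
    -- The coordinate q(i, none) is b_i on M; it switches off the i-th summand wherever the q(i,
    -- some e) are no longer chart coordinates. The factor c_i is contained in H i.
    refine ⟨fun p => ∑ i, p.2 (i, none) * H i (p.1, l i p.2), ?_, fun s _ y hy => ?_⟩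
    · refine ContDiffOn.sum fun i _ => ContDiffOn.mul ?_ ?_
      · exact ((contDiff_apply ℝ ℝ _).comp contDiff_snd).contDiffOn
      · exact (hH i).comp (contDiff_fst.prodMk ((hl i).comp contDiff_snd)).contDiffOn
          fun p hp => ⟨hp.1, mem_univ _⟩
    · have h1 : ∀ i : t, b i y * H i (s, l i fun j => fJ j y) = b i y * c i y * g s y := by
        intro i
        by_cases hi : y ∈ tsupport (b i)
        · have h2 : (l i fun j => fJ j y) = extChartAt 𝓘(ℝ, F) i.1 y := by
            have h3 : ∀ e, fJ (i, some e) y = B.repr (extChartAt 𝓘(ℝ, F) i.1 y) e := fun e => by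
              change ρ i y * h i e y = _
              rw [(hρ1 i y hi).eq_of_nhds, Pi.one_apply, one_mul, hφ i y (hbV i hi)]
              rfl
            simp only [l, h3]
            exact B.sum_repr _
          rw [h2, hHg i s y (hsrc i (hbV i hi)), mul_assoc]
        · have : b i y = 0 := image_eq_zero_of_notMem_tsupport hi
          rw [this]; ring
      change ∑ i, b i y * H i (s, l i fun j => fJ j y) = g s y
      simp only [h1]
      rw [← Finset.sum_mul, hO y hy, one_mul]

end Existence

/-! ### Continuity and differentiability read through the embedding. -/

section Chart

variable {F : Type*} [NormedAddCommGroup F] [NormedSpace ℝ F]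
  {M : Type*} [TopologicalSpace M] [ChartedSpace F M] [IsManifold 𝓘(ℝ, F) ∞ M]
  {x : M} {f g : M → ℝ}

theorem MDifferentiableAt.hasFDerivAt_chart (hf : MDifferentiableAt 𝓘(ℝ, F) 𝓘(ℝ, ℝ) f x) :
    HasFDerivAt (f ∘ (extChartAt 𝓘(ℝ, F) x).symm) (mvfderiv 𝓘(ℝ, F) f x : F →L[ℝ] ℝ)
      (extChartAt 𝓘(ℝ, F) x x) := by
  have h := hf.differentiableWithinAt_writtenInExtChartAt
  rw [modelWithCornersSelf_coe, range_id, differentiableWithinAt_univ] at h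
  have h2 : HasFDerivAt (f ∘ (extChartAt 𝓘(ℝ, F) x).symm) _ (extChartAt 𝓘(ℝ, F) x x) :=
    h.hasFDerivAt
  exact h2.congr_fderiv (mvfderiv_comp_extChartAt_symm hf).symm

theorem mvfderiv_comp_curve {E : Type*} [NormedAddCommGroup E] [NormedSpace ℝ E] {c : E → M}
    {z : E} (hf : MDifferentiableAt 𝓘(ℝ, F) 𝓘(ℝ, ℝ) f (c z))
    (hc : MDifferentiableAt 𝓘(ℝ, E) 𝓘(ℝ, F) c z) :
    HasFDerivAt (fun w => f (c w))
      ((mvfderiv 𝓘(ℝ, F) f (c z) : F →L[ℝ] ℝ) ∘L (mfderiv 𝓘(ℝ, E) 𝓘(ℝ, F) c z : E →L[ℝ] F)) z := by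
  exact (hf.hasMFDerivAt.comp z hc.hasMFDerivAt).hasFDerivAt

end Chart

namespace CompactFrame

variable {F : Type*} [NormedAddCommGroup F] [NormedSpace ℝ F]
  {M : Type uM} [TopologicalSpace M] [ChartedSpace F M] [IsManifold 𝓘(ℝ, F) ∞ M]
  {S : SubRiemannianStructure F M} {T : ℝ} {K : Set M} (𝓕 : CompactFrame S T K)

/-- The map into Euclidean space with components `f j`. -/
def emb (y : M) : 𝓕.J → ℝ := fun j => 𝓕.f j y

/-- The differential of `emb`. -/
def demb (y : M) : TangentSpace 𝓘(ℝ, F) y →L[ℝ] 𝓕.J → ℝ :=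
  ContinuousLinearMap.pi fun j => mvfderiv 𝓘(ℝ, F) (𝓕.f j) y

theorem demb_apply (y : M) (v : TangentSpace 𝓘(ℝ, F) y) (j : 𝓕.J) :
    𝓕.demb y v j = mvfderiv 𝓘(ℝ, F) (𝓕.f j) y v := rfl

theorem sum_demb {y : M} (hy : 𝓕.emb y ∈ 𝓕.O) (v : TangentSpace 𝓘(ℝ, F) y) :
    ∑ j, 𝓕.demb y v j • 𝓕.W j y = v :=
  (𝓕.eq_sum_W y hy v).symm

theorem demb_injective {y : M} (hy : 𝓕.emb y ∈ 𝓕.O) : Function.Injective (𝓕.demb y) := by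
  intro v w h
  rw [← 𝓕.sum_demb hy v, ← 𝓕.sum_demb hy w, h]

theorem continuous_emb : Continuous 𝓕.emb :=
  continuous_pi fun j => (𝓕.contMDiff_f j).continuous

theorem isOpen_preimage : IsOpen (𝓕.emb ⁻¹' 𝓕.O) := 𝓕.isOpen_O.preimage 𝓕.continuous_emb

theorem exists_smooth_extension (hT : 0 ≤ T) {g : M → ℝ} (hg : ContMDiff 𝓘(ℝ, F) 𝓘(ℝ, ℝ) ∞ g) :
    ∃ G : (𝓕.J → ℝ) → ℝ, ContDiff ℝ ∞ G ∧ ∀ y, 𝓕.emb y ∈ 𝓕.O → G (𝓕.emb y) = g y := by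
  obtain ⟨G, hG, hGg⟩ := 𝓕.exists_extension (fun _ => g)
    (hg.comp contMDiff_snd).contMDiffOn
  have h0 : (0 : ℝ) ∈ Icc 0 T := ⟨le_rfl, hT⟩
  refine ⟨fun q => G (0, q), ?_, fun y hy => hGg 0 h0 y hy⟩
  rw [← contDiffOn_univ]
  exact hG.comp (contDiff_const.prodMk contDiff_id).contDiffOn fun q _ => ⟨h0, mem_univ _⟩

/-- As O is open, g coincides with G ∘ `emb` near y, and the chain rule applies in the chart at y.
-/
theorem mvfderiv_eq_fderiv {y : M} (hy : 𝓕.emb y ∈ 𝓕.O) {g : M → ℝ} {G : (𝓕.J → ℝ) → ℝ}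
    (hGg : ∀ z, 𝓕.emb z ∈ 𝓕.O → G (𝓕.emb z) = g z) (hG : DifferentiableAt ℝ G (𝓕.emb y))
    (v : TangentSpace 𝓘(ℝ, F) y) :
    mvfderiv 𝓘(ℝ, F) g y v = fderiv ℝ G (𝓕.emb y) (𝓕.demb y v) := by
  set φ := extChartAt 𝓘(ℝ, F) y
  have hφ : φ.symm (φ y) = y := extChartAt_to_inv y
  have h1 : HasFDerivAt (𝓕.emb ∘ φ.symm) (𝓕.demb y : F →L[ℝ] 𝓕.J → ℝ) (φ y) :=
    hasFDerivAt_pi.2 fun j => (((𝓕.contMDiff_f j).mdifferentiable (by simp)) y).hasFDerivAt_chart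
  have h2 : HasFDerivAt (G ∘ (𝓕.emb ∘ φ.symm))
      (fderiv ℝ G (𝓕.emb y) ∘L (𝓕.demb y : F →L[ℝ] 𝓕.J → ℝ)) (φ y) := by
    refine HasFDerivAt.comp (φ y) ?_ h1
    have : (𝓕.emb ∘ φ.symm) (φ y) = 𝓕.emb y := congrArg 𝓕.emb hφ
    rw [this]
    exact hG.hasFDerivAt
  have hcont : ContinuousAt φ.symm (φ y) := continuousAt_extChartAt_symm y
  have h3 : (g ∘ φ.symm) =ᶠ[𝓝 (φ y)] G ∘ (𝓕.emb ∘ φ.symm) := by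
    have : φ.symm ⁻¹' (𝓕.emb ⁻¹' 𝓕.O) ∈ 𝓝 (φ y) :=
      hcont (𝓕.isOpen_preimage.mem_nhds (by rw [hφ]; exact hy))
    filter_upwards [this] with z hz
    exact (hGg _ hz).symm
  have hgm : MDifferentiableAt 𝓘(ℝ, F) 𝓘(ℝ, ℝ) g y := by
    have h4 : MDifferentiableAt 𝓘(ℝ, F) 𝓘(ℝ, ℝ) (G ∘ 𝓕.emb) y := by
      refine MDifferentiableAt.comp y hG.mdifferentiableAt ?_
      exact (contMDiff_pi_space.2 𝓕.contMDiff_f).mdifferentiable (by simp) y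
    refine h4.congr_of_eventuallyEq ?_
    filter_upwards [𝓕.isOpen_preimage.mem_nhds hy] with z hz
    exact (hGg z hz).symm
  have h6 := h2.congr_of_eventuallyEq h3
  have h5 : @Eq (F →L[ℝ] ℝ) (mvfderiv 𝓘(ℝ, F) g y) _ := 
    (mvfderiv_comp_extChartAt_symm hgm).trans (HasFDerivAt.fderiv (E := F) h6)
  exact congrArg (fun L : F →L[ℝ] ℝ => L v) h5

variable [FiniteDimensional ℝ F] [T2Space M]

/-- A cutoff supported in a given neighbourhood of x is a smooth function of the embedded point, so
it is nonzero at c a as soon as the embedded points are close. -/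
theorem tendsto_of_emb (hT : 0 ≤ T) {x : M} (hx : 𝓕.emb x ∈ 𝓕.O) {α : Type*} {l : Filter α}
    {c : α → M} (h : Filter.Tendsto (fun a => 𝓕.emb (c a)) l (𝓝 (𝓕.emb x))) :
    Filter.Tendsto c l (𝓝 x) := by
  intro V hV
  obtain ⟨b, hb, -, hbV, hb1⟩ := exists_smooth_cutoff (F := F) hV
  obtain ⟨G, hG, hGb⟩ := 𝓕.exists_smooth_extension hT hb
  have h1 : Filter.Tendsto (fun a => G (𝓕.emb (c a))) l (𝓝 (G (𝓕.emb x))) :=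
    (hG.continuous.tendsto _).comp h
  have hx1 : G (𝓕.emb x) ≠ 0 := by rw [hGb x hx, hb1.eq_of_nhds]; exact one_ne_zero
  change ∀ᶠ a in l, c a ∈ V
  have h2 : ∀ᶠ a in l, 𝓕.emb (c a) ∈ 𝓕.O := h (𝓕.isOpen_O.mem_nhds hx)
  filter_upwards [h1.eventually_ne hx1, h2] with a ha1 ha2
  rw [hGb _ ha2] at ha1
  exact hbV (subset_tsupport _ ha1)

/-- The constant sequence y converges to x by `tendsto_of_emb`, and limits are unique. -/
theorem emb_inj (hT : 0 ≤ T) {x y : M} (hx : 𝓕.emb x ∈ 𝓕.O) (h : 𝓕.emb y = 𝓕.emb x) : y = x := by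
  have : Filter.Tendsto (fun _ : ℕ => y) Filter.atTop (𝓝 x) :=
    𝓕.tendsto_of_emb hT hx (by rw [h]; exact tendsto_const_nhds)
  exact tendsto_nhds_unique tendsto_const_nhds this

/-- The chart coordinates at c z are smooth functions of the finitely many components of `emb`. The
parameter space E may be infinite-dimensional, as it is for controls. -/
theorem mdifferentiableAt_of_emb (hT : 0 ≤ T) {E : Type*} [NormedAddCommGroup E] [NormedSpace ℝ E]
    {c : E → M} {z : E} (hz : 𝓕.emb (c z) ∈ 𝓕.O) (hc : ContinuousAt c z)
    (h : ∀ j, DifferentiableAt ℝ (fun w => 𝓕.f j (c w)) z) :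
    MDifferentiableAt 𝓘(ℝ, E) 𝓘(ℝ, F) c z := by
  obtain ⟨V, η, dd, hV, hxV, hVs, hη, -, hco, -⟩ := exists_coordinates (F := F) (c z)
  refine mdifferentiableAt_iff_target.2 ⟨hc, ?_⟩
  rw [mdifferentiableAt_iff_differentiableAt]
  choose G hG hGη using fun e => 𝓕.exists_smooth_extension hT (hη e)
  have h1 : DifferentiableAt ℝ (fun w => 𝓕.emb (c w)) z := differentiableAt_pi.2 h
  have h2 : DifferentiableAt ℝ (fun w => ∑ e, G e (𝓕.emb (c w)) • Module.finBasis ℝ F e) z := by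
    refine DifferentiableAt.fun_sum fun e _ => DifferentiableAt.smul_const ?_ _
    exact ((hG e).differentiable (by simp) _).comp z h1
  refine h2.congr_of_eventuallyEq ?_
  filter_upwards [hc (hV.mem_nhds hxV), hc (𝓕.isOpen_preimage.mem_nhds hz)] with w hw1 hw2
  simp only [hGη _ _ hw2, hco _ hw1]
  exact ((Module.finBasis ℝ F).sum_repr _).symm

end CompactFrame

/-! ### Curves with square integrable velocity. -/

section Curves

variable {F : Type*} [NormedAddCommGroup F] [NormedSpace ℝ F]
  {M : Type uM} [TopologicalSpace M] [ChartedSpace F M] [IsManifold 𝓘(ℝ, F) ∞ M]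
  {T : ℝ} {γ : ℝ → M}

/-- The image of a curve defined on `[0,T]`. -/
abbrev trace (T : ℝ) (γ : ℝ → M) : Set M := γ '' Icc 0 T

theorem IsH1Curve.isCompact_trace (hγ : IsH1Curve F T γ) : IsCompact (trace T γ) :=
  isCompact_Icc.image_of_continuousOn hγ.continuousOn

theorem CompactFrame.emb_mem {S : SubRiemannianStructure F M} (𝓕 : CompactFrame S T (trace T γ)) {t : ℝ} (ht : t ∈ Icc 0 T) :
    𝓕.emb (γ t) ∈ 𝓕.O := 𝓕.mem_O _ (mem_image_of_mem γ ht)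

theorem hasDerivAt_comp_curve {g : M → ℝ} (hg : ContMDiff 𝓘(ℝ, F) 𝓘(ℝ, ℝ) ∞ g) {t : ℝ}
    (hγ : MDifferentiableAt 𝓘(ℝ, ℝ) 𝓘(ℝ, F) γ t) :
    HasDerivAt (fun s => g (γ s)) (mvfderiv 𝓘(ℝ, F) g (γ t) (velocity F γ t)) t :=
  (mvfderiv_comp_curve (hg.mdifferentiable (by simp) _) hγ).hasDerivAt

variable [FiniteDimensional ℝ F] [T2Space M]

/-- The exceptional null set depends on the test function, but the finitely many embedding functions
already control the curve. -/
theorem IsH1Curve.ae_mdifferentiableAt (hγ : IsH1Curve F T γ) (hT : 0 < T)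
    {S : SubRiemannianStructure F M} (𝓕 : CompactFrame S T (trace T γ)) :
    ∀ᵐ t ∂(volume.restrict (Icc 0 T)), t ∈ Ioo 0 T ∧ MDifferentiableAt 𝓘(ℝ, ℝ) 𝓘(ℝ, F) γ t := by
  have h1 : ∀ j, ∀ᵐ t ∂(volume.restrict (Icc 0 T)), DifferentiableAt ℝ (fun s => 𝓕.f j (γ s)) t := by
    intro j
    have := HasACDeriv.of_ac hT.le (hγ.absolutelyContinuous _ (𝓕.contMDiff_f j))
    filter_upwards [this.hasDerivAt] with t ht using ht.differentiableAt
  filter_upwards [ae_restrict_Icc_mem_Ioo T, ae_all_iff.2 h1] with t ht h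
  refine ⟨ht, 𝓕.mdifferentiableAt_of_emb hT.le (𝓕.emb_mem (Ioo_subset_Icc_self ht)) ?_ h⟩
  exact hγ.continuousOn.continuousAt (Icc_mem_nhds ht.1 ht.2)

theorem IsH1Curve.hasACDeriv (hγ : IsH1Curve F T γ) (hT : 0 < T)
    {S : SubRiemannianStructure F M} (𝓕 : CompactFrame S T (trace T γ)) {g : M → ℝ}
    (hg : ContMDiff 𝓘(ℝ, F) 𝓘(ℝ, ℝ) ∞ g) :
    HasACDeriv T (fun t => g (γ t)) fun t => mvfderiv 𝓘(ℝ, F) g (γ t) (velocity F γ t) := by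
  refine (HasACDeriv.of_ac hT.le (hγ.absolutelyContinuous _ hg)).congr_ae ?_
  filter_upwards [hγ.ae_mdifferentiableAt hT 𝓕] with t ht
  exact (hasDerivAt_comp_curve hg ht.2).deriv

theorem IsH1Curve.memLp (hγ : IsH1Curve F T γ) (hT : 0 < T)
    {S : SubRiemannianStructure F M} (𝓕 : CompactFrame S T (trace T γ)) {g : M → ℝ}
    (hg : ContMDiff 𝓘(ℝ, F) 𝓘(ℝ, ℝ) ∞ g) :
    MemLp (fun t => mvfderiv 𝓘(ℝ, F) g (γ t) (velocity F γ t)) 2 (volume.restrict (Icc 0 T)) := by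
  refine (hγ.memLp_deriv g hg).ae_eq ?_
  filter_upwards [hγ.ae_mdifferentiableAt hT 𝓕] with t ht
  exact (hasDerivAt_comp_curve hg ht.2).deriv

end Curves

/-! ### Parallel transport as a linear differential equation. -/

section Matrices

variable {ι κ : Type*} [Fintype ι] [Fintype κ]

/-- The continuous linear map with a given matrix. -/
def matCLM (a : ι → κ → ℝ) : (κ → ℝ) →L[ℝ] ι → ℝ :=
  ContinuousLinearMap.pi fun i => ∑ j, a i j • ContinuousLinearMap.proj j

@[simp]
theorem matCLM_apply (a : ι → κ → ℝ) (q : κ → ℝ) (i : ι) : matCLM a q i = ∑ j, a i j * q j := by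
  simp [matCLM]

theorem matCLM_eq_sum [DecidableEq ι] (a : ι → κ → ℝ) : matCLM a = ∑ i, ∑ j, a i j •
    (ContinuousLinearMap.proj j : (κ → ℝ) →L[ℝ] ℝ).smulRight (Pi.single i (1 : ℝ) : ι → ℝ) := by
  ext q i
  rw [matCLM_apply]
  simp only [sum_apply, Finset.sum_apply, smul_apply, ContinuousLinearMap.smulRight_apply,
    ContinuousLinearMap.proj_apply, Pi.smul_apply, smul_eq_mul]
  rw [Finset.sum_eq_single i (fun i' _ hne => by simp [hne.symm]) (by simp)]
  simp

theorem integrableOn_matCLM {a : ℝ → ι → κ → ℝ} {s : Set ℝ}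
    (h : ∀ i j, IntegrableOn (fun t => a t i j) s) : IntegrableOn (fun t => matCLM (a t)) s := by
  classical
  have hE : ∀ (i : ι) (j : κ) (E : (κ → ℝ) →L[ℝ] ι → ℝ),
      Integrable (fun t => a t i j • E) (volume.restrict s) :=
    fun i j E => ((ContinuousLinearMap.id ℝ ℝ).smulRight E).integrable_comp (h i j)
  let E : ι → κ → (κ → ℝ) →L[ℝ] ι → ℝ := fun i j =>
    (ContinuousLinearMap.proj j : (κ → ℝ) →L[ℝ] ℝ).smulRight (Pi.single i (1 : ℝ) : ι → ℝ)
  have h1 : ∀ i, Integrable (fun t => ∑ j, a t i j • E i j) (volume.restrict s) := fun i =>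
    integrable_finsetSum (f := fun j t => a t i j • E i j) Finset.univ fun j _ => hE i j (E i j)
  have h2 : Integrable (fun t => ∑ i, ∑ j, a t i j • E i j) (volume.restrict s) :=
    integrable_finsetSum (f := fun i t => ∑ j, a t i j • E i j) Finset.univ fun i _ => h1 i
  refine Integrable.congr h2 (.of_forall fun t => ?_)
  exact (matCLM_eq_sum (a t)).symm

/-- Linear differential equations can be solved with data prescribed at any time. -/
theorem exists_linear_ode_at {X : Type*} [NormedAddCommGroup X] [NormedSpace ℝ X]
    [FiniteDimensional ℝ X] {T : ℝ} (hT : 0 ≤ T) {A : ℝ → X →L[ℝ] X}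
    (hA : IntegrableOn A (Icc 0 T)) {t₀ : ℝ} (ht₀ : t₀ ∈ Icc 0 T) (x : X) :
    ∃ q : ℝ → X, q t₀ = x ∧ HasACDeriv T q (fun t => A t (q t)) := by
  obtain ⟨Φ, Ψ, -, -, hΦ, -, hΦΨ⟩ := exists_fundamental_solution hT hA
  refine ⟨fun t => Φ t (Ψ t₀ x), ?_, ?_⟩
  · exact congrArg (fun S : X →L[ℝ] X => S x) (hΦΨ t₀ ht₀).2
  · exact hΦ.clm hT (ContinuousLinearMap.apply ℝ X (Ψ t₀ x))

end Matrices

section Parallel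

variable {F : Type*} [NormedAddCommGroup F] [NormedSpace ℝ F] [FiniteDimensional ℝ F]
  {M : Type uM} [TopologicalSpace M] [ChartedSpace F M] [IsManifold 𝓘(ℝ, F) ∞ M]
  {cov : CovariantDerivative 𝓘(ℝ, F) F (TangentSpace 𝓘(ℝ, F) : M → Type _)}

theorem covHessian_sum_right {x : M} {f : M → ℝ} (hf : ContMDiff 𝓘(ℝ, F) 𝓘(ℝ, ℝ) ∞ f) {κ : Type*}
    (s : Finset κ) (b : κ → ℝ) (v : TangentSpace 𝓘(ℝ, F) x) (w : κ → TangentSpace 𝓘(ℝ, F) x) :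
    covHessian cov f x v (∑ j ∈ s, b j • w j) = ∑ j ∈ s, b j * covHessian cov f x v (w j) := by
  simpa using covHessian_sum_smul (cov := cov) hf ({()} : Finset Unit) s (fun _ => 1) b
    (fun _ => v) w

variable {T : ℝ} {γ : ℝ → M}

theorem IsParallelAlong.hasACDeriv {V : ∀ t, TangentSpace 𝓘(ℝ, F) (γ t)}
    (hV : IsParallelAlong cov T γ V) (hT : 0 ≤ T) {f : M → ℝ}
    (hf : ContMDiff 𝓘(ℝ, F) 𝓘(ℝ, ℝ) ∞ f) :
    HasACDeriv T (fun t => mvfderiv 𝓘(ℝ, F) f (γ t) (V t))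
      fun t => covHessian cov f (γ t) (velocity F γ t) (V t) :=
  (HasACDeriv.of_ac hT (hV f hf).1).congr_ae (hV f hf).2

theorem isParallelAlong_of_hasACDeriv {V : ∀ t, TangentSpace 𝓘(ℝ, F) (γ t)}
    (h : ∀ f : M → ℝ, ContMDiff 𝓘(ℝ, F) 𝓘(ℝ, ℝ) ∞ f →
      HasACDeriv T (fun t => mvfderiv 𝓘(ℝ, F) f (γ t) (V t))
        fun t => covHessian cov f (γ t) (velocity F γ t) (V t)) :
    IsParallelAlong cov T γ V := fun f hf => by
  refine ⟨(h f hf).ac, ?_⟩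
  filter_upwards [(h f hf).hasDerivAt] with t ht using ht.deriv

theorem IsParallelAlong.sum_smul {ι : Type*} (s : Finset ι)
    {V : ι → ∀ t, TangentSpace 𝓘(ℝ, F) (γ t)} (hT : 0 ≤ T) (c : ι → ℝ)
    (hV : ∀ i ∈ s, IsParallelAlong cov T γ (V i)) :
    IsParallelAlong cov T γ fun t => ∑ i ∈ s, c i • V i t := by
  refine isParallelAlong_of_hasACDeriv fun f hf => ?_
  have := HasACDeriv.sum s fun i hi => ((hV i hi).hasACDeriv hT hf).const_mul hT (c i)
  simpa only [map_sum, map_smul, smul_eq_mul, covHessian_sum_right hf] using this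

namespace CompactFrame

variable {S : SubRiemannianStructure F M} {K : Set M} (𝓕 : CompactFrame S T K)

/-- The components of the connection in the embedding. -/
def christoffel (cov : CovariantDerivative 𝓘(ℝ, F) F (TangentSpace 𝓘(ℝ, F) : M → Type _))
    (j k l : 𝓕.J) (y : M) : ℝ :=
  covHessian cov (𝓕.f j) y (𝓕.W k y) (𝓕.W l y)

theorem contMDiff_christoffel (hcov : CovariantDerivative.ContMDiffCovariantDerivative cov ∞)
    (j k l : 𝓕.J) : ContMDiff 𝓘(ℝ, F) 𝓘(ℝ, ℝ) ∞ (𝓕.christoffel cov j k l) :=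
  contMDiffAt_covHessian hcov (𝓕.contMDiff_f j) (𝓕.contMDiff_W k) (𝓕.contMDiff_W l)

theorem covHessian_eq_sum {y : M} (hy : 𝓕.emb y ∈ 𝓕.O) (j : 𝓕.J)
    (v w : TangentSpace 𝓘(ℝ, F) y) :
    covHessian cov (𝓕.f j) y v w =
      ∑ k, ∑ l, 𝓕.demb y v k * 𝓕.demb y w l * 𝓕.christoffel cov j k l y := by
  conv_lhs => rw [← 𝓕.sum_demb hy v, ← 𝓕.sum_demb hy w]
  exact covHessian_sum_smul (𝓕.contMDiff_f j) _ _ _ _ _ _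

end CompactFrame

variable [T2Space M] {S : SubRiemannianStructure F M} (𝓕 : CompactFrame S T (trace T γ))

theorem IsH1Curve.continuousOn_comp (hγ : IsH1Curve F T γ) {g : M → ℝ}
    (hg : ContMDiff 𝓘(ℝ, F) 𝓘(ℝ, ℝ) ∞ g) : ContinuousOn (fun t => g (γ t)) (Icc 0 T) :=
  hg.continuous.comp_continuousOn hγ.continuousOn

theorem integrableOn_mul_of_continuousOn {a b : ℝ → ℝ} (ha : ContinuousOn a (Icc 0 T))
    (hb : IntegrableOn b (Icc 0 T)) : IntegrableOn (fun t => a t * b t) (Icc 0 T) :=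
  integrableOn_bilin (ContinuousLinearMap.mul ℝ ℝ) ha hb

/-- The matrix of the parallel transport equation along `γ`. -/
def CompactFrame.transportMatrix
    (cov : CovariantDerivative 𝓘(ℝ, F) F (TangentSpace 𝓘(ℝ, F) : M → Type _)) (t : ℝ) :
    (𝓕.J → ℝ) →L[ℝ] 𝓕.J → ℝ :=
  matCLM fun j l => ∑ k, 𝓕.christoffel cov j k l (γ t) * 𝓕.demb (γ t) (velocity F γ t) k

theorem CompactFrame.integrableOn_transportMatrix (hγ : IsH1Curve F T γ) (hT : 0 < T)
    (hcov : CovariantDerivative.ContMDiffCovariantDerivative cov ∞) :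
    IntegrableOn (𝓕.transportMatrix cov) (Icc 0 T) :=
  integrableOn_matCLM fun j l => integrable_finsetSum _ fun k _ =>
    integrableOn_mul_of_continuousOn (hγ.continuousOn_comp (𝓕.contMDiff_christoffel hcov j k l))
      (hγ.hasACDeriv hT 𝓕 (𝓕.contMDiff_f k)).integrable

theorem CompactFrame.covHessian_eq_transportMatrix {t : ℝ} (ht : t ∈ Icc 0 T) (j : 𝓕.J)
    (w : TangentSpace 𝓘(ℝ, F) (γ t)) :
    covHessian cov (𝓕.f j) (γ t) (velocity F γ t) w =
      𝓕.transportMatrix cov t (𝓕.demb (γ t) w) j := by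
  rw [𝓕.covHessian_eq_sum (𝓕.emb_mem ht), Finset.sum_comm, CompactFrame.transportMatrix,
    matCLM_apply]
  refine Finset.sum_congr rfl fun l _ => ?_
  rw [Finset.sum_mul]
  exact Finset.sum_congr rfl fun k _ => by ring

theorem IsParallelAlong.hasACDeriv_demb {V : ∀ t, TangentSpace 𝓘(ℝ, F) (γ t)}
    (hV : IsParallelAlong cov T γ V) (hT : 0 ≤ T) :
    HasACDeriv T (fun t => 𝓕.demb (γ t) (V t))
      fun t => 𝓕.transportMatrix cov t (𝓕.demb (γ t) (V t)) := by
  refine HasACDeriv.pi fun j => (hV.hasACDeriv hT (𝓕.contMDiff_f j)).congr_ae ?_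
  filter_upwards [ae_restrict_mem measurableSet_Icc] with t ht
  exact 𝓕.covHessian_eq_transportMatrix ht j _

/-- The embedded difference solves the homogeneous transport equation, and the embedding is
injective on tangent vectors. -/
theorem IsParallelAlong.eq_of_eq {S : SubRiemannianStructure F M}
    (𝓕 : CompactFrame S T (trace T γ)) (hγ : IsH1Curve F T γ) (hT : 0 < T)
    (hcov : CovariantDerivative.ContMDiffCovariantDerivative cov ∞)
    {V V' : ∀ t, TangentSpace 𝓘(ℝ, F) (γ t)} (hV : IsParallelAlong cov T γ V)
    (hV' : IsParallelAlong cov T γ V') {s t : ℝ} (hs : s ∈ Icc 0 T) (ht : t ∈ Icc 0 T)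
    (h : V s = V' s) : V t = V' t := by
  have h1 := (hV.hasACDeriv_demb 𝓕 hT.le).sub (hV'.hasACDeriv_demb 𝓕 hT.le)
  have h2 := HasACDeriv.linear_ode_unique hT.le (𝓕.integrableOn_transportMatrix hγ hT hcov)
    (q := fun t => 𝓕.demb (γ t) (V t) - 𝓕.demb (γ t) (V' t)) (by simpa only [map_sub] using h1)
    hs ht (by rw [h, sub_self])
  exact 𝓕.demb_injective (𝓕.emb_mem ht) (sub_eq_zero.1 h2)

/-- Parallel transport within a parallel subbundle. -/
theorem exists_isParallelAlong (hγ : IsH1Curve F T γ) (hT : 0 < T)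
    (hcov : CovariantDerivative.ContMDiffCovariantDerivative cov ∞)
    {B : ∀ y : M, Submodule ℝ (TangentSpace 𝓘(ℝ, F) y)} {A : Type*} [Fintype A]
    {Y : A → ∀ y : M, TangentSpace 𝓘(ℝ, F) y} {θ : A → 𝓕.J → M → ℝ}
    (hY : ∀ a, ContMDiff 𝓘(ℝ, F) 𝓘(ℝ, F).tangent ∞ (vfMap (Y a)))
    (hθ : ∀ a j, ContMDiff 𝓘(ℝ, F) 𝓘(ℝ, ℝ) ∞ (θ a j)) (hYB : ∀ a y, Y a y ∈ B y)
    (hexp : ∀ t ∈ Icc 0 T, ∀ v ∈ B (γ t),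
      v = ∑ a, (∑ j, θ a j (γ t) * 𝓕.demb (γ t) v j) • Y a (γ t))
    (hB : ∀ a y v, cov (Y a) y v ∈ B y) {t₀ : ℝ} (ht₀ : t₀ ∈ Icc 0 T)
    {w : TangentSpace 𝓘(ℝ, F) (γ t₀)} (hw : w ∈ B (γ t₀)) :
    ∃ V : ∀ t, TangentSpace 𝓘(ℝ, F) (γ t), V t₀ = w ∧ IsParallelAlong cov T γ V ∧
      ∀ t, V t ∈ B (γ t) := by
  -- Coefficients of ∇_γ̇ Y_b in the family Y, available because B is parallel. Solving ċ = −m c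
  -- makes Σ c_a Y_a parallel, and it lies in B by construction. The Y_a need not be independent:
  -- any choice of coefficients works.
  let m : ℝ → A → A → ℝ := fun t a b =>
    ∑ j, θ a j (γ t) * 𝓕.demb (γ t) (cov (Y b) (γ t) (velocity F γ t)) j
  have hm : ∀ a b, IntegrableOn (fun t => m t a b) (Icc 0 T) := by
    intro a b
    have h1 : IntegrableOn (fun t => ∑ j, ∑ k, (θ a j (γ t) * mvfderiv 𝓘(ℝ, F) (𝓕.f j) (γ t)
        (cov (Y b) (γ t) (𝓕.W k (γ t)))) * 𝓕.demb (γ t) (velocity F γ t) k) (Icc 0 T) := by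
      refine integrable_finsetSum _ fun j _ => integrable_finsetSum _ fun k _ =>
        integrableOn_mul_of_continuousOn ?_ (hγ.hasACDeriv hT 𝓕 (𝓕.contMDiff_f k)).integrable
      refine ContinuousOn.mul (hγ.continuousOn_comp (hθ a j)) (hγ.continuousOn_comp
        (g := fun y => mvfderiv 𝓘(ℝ, F) (𝓕.f j) y (cov (Y b) y (𝓕.W k y))) ?_)
      exact ContMDiff.mvfderiv_vf (fun y => contMDiffAt_cov hcov (𝓕.contMDiff_W k y) (hY b))
        (𝓕.contMDiff_f j)
    refine h1.congr_fun (fun t ht => ?_) measurableSet_Icc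
    refine Finset.sum_congr rfl fun j _ => ?_
    conv_rhs => rw [← 𝓕.sum_demb (𝓕.emb_mem ht) (velocity F γ t)]
    rw [map_sum, map_sum, Finset.sum_apply, Finset.mul_sum]
    refine Finset.sum_congr rfl fun k _ => ?_
    rw [map_smul, map_smul, Pi.smul_apply, smul_eq_mul]
    simp only [CompactFrame.demb_apply]
    ring
  obtain ⟨c, hc0, hc⟩ := exists_linear_ode_at hT.le (integrableOn_matCLM hm).neg ht₀
    (fun a => ∑ j, θ a j (γ t₀) * 𝓕.demb (γ t₀) w j)
  refine ⟨fun t => ∑ a, c t a • Y a (γ t), ?_, isParallelAlong_of_hasACDeriv fun f hf => ?_,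
    fun t => Submodule.sum_mem _ fun a _ => Submodule.smul_mem _ _ (hYB a _)⟩
  · change ∑ a, c t₀ a • Y a (γ t₀) = w
    rw [hc0]; exact (hexp t₀ ht₀ w hw).symm
  have h1 := HasACDeriv.sum Finset.univ fun a _ => (hc.eval hT.le a).mul hT.le
    (hγ.hasACDeriv hT 𝓕 ((hY a).mvfderiv_vf hf))
  simp only [map_sum, map_smul, smul_eq_mul]
  refine h1.congr_ae ?_
  filter_upwards [ae_restrict_mem measurableSet_Icc] with t ht
  have h2 : ∀ b, mvfderiv 𝓘(ℝ, F) f (γ t) (cov (Y b) (γ t) (velocity F γ t)) =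
      ∑ a, m t a b * mvfderiv 𝓘(ℝ, F) f (γ t) (Y a (γ t)) := fun b => by
    conv_lhs => rw [hexp t ht _ (hB b (γ t) (velocity F γ t))]
    simp only [map_sum, map_smul, smul_eq_mul, m]
  have h3 : ∀ a, mvfderiv 𝓘(ℝ, F) (fun y => mvfderiv 𝓘(ℝ, F) f y (Y a y)) (γ t)
      (velocity F γ t) = covHessian cov f (γ t) (velocity F γ t) (Y a (γ t)) +
        ∑ b, m t b a * mvfderiv 𝓘(ℝ, F) f (γ t) (Y b (γ t)) := fun a => by
    rw [covHessian_eq hf ((hY a).mdifferentiable (by simp) _), h2, sub_add_cancel]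
  rw [covHessian_sum_right hf]
  simp only [h3, neg_apply, Pi.neg_apply, matCLM_apply, mul_add, Finset.sum_add_distrib, neg_mul,
    Finset.sum_neg_distrib, Finset.sum_mul, Finset.mul_sum]
  have h4 : ∑ a, ∑ b, c t a * (m t b a * mvfderiv 𝓘(ℝ, F) f (γ t) (Y b (γ t))) =
      ∑ a, ∑ b, m t a b * c t b * mvfderiv 𝓘(ℝ, F) f (γ t) (Y a (γ t)) := by
    rw [Finset.sum_comm]
    exact Finset.sum_congr rfl fun _ _ => Finset.sum_congr rfl fun _ _ => by ring
  rw [h4]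
  ring

end Parallel

/-! ### Positive square roots: existence, invertibility and continuity. -/

section SquareRoot

variable {V : Type*} [NormedAddCommGroup V] [InnerProductSpace ℝ V] [FiniteDimensional ℝ V]
  {V' : Type*} [NormedAddCommGroup V'] [InnerProductSpace ℝ V'] [FiniteDimensional ℝ V']

theorem exists_eigenbasis {S : V →L[ℝ] V} (hS : ∀ v w, inner ℝ (S v) w = inner ℝ v (S w)) :
    ∃ (b : OrthonormalBasis (Fin (Module.finrank ℝ V)) ℝ V) (μ : Fin (Module.finrank ℝ V) → ℝ),
      ∀ i, S (b i) = μ i • b i := by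
  have h : S.toLinearMap.IsSymmetric := hS
  exact ⟨h.eigenvectorBasis rfl, h.eigenvalues rfl, fun i => h.apply_eigenvectorBasis rfl i⟩

theorem OrthonormalBasis.ext_clm {ι : Type*} [Fintype ι] (b : OrthonormalBasis ι ℝ V)
    {Y Z : V →L[ℝ] V'} (h : ∀ i, Y (b i) = Z (b i)) : Y = Z := by
  have : Y.toLinearMap = Z.toLinearMap := b.toBasis.ext fun i => by simpa using h i
  exact ContinuousLinearMap.coe_injective this

/-- A map intertwining the squares of positive maps intertwines the maps. -/
theorem comp_eq_of_sq_comp_eq {S : V →L[ℝ] V} {S' : V' →L[ℝ] V'} (hS : S.IsPositive)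
    (hS' : S'.IsPositive) (hinj : ∀ v, S' v = 0 → v = 0) {h : V' →L[ℝ] V}
    (hh : S ∘L S ∘L h = h ∘L S' ∘L S') : S ∘L h = h ∘L S' := by
  obtain ⟨b, μ, hb⟩ := exists_eigenbasis (fun v w => hS'.isSymmetric v w)
  refine b.ext_clm fun i => ?_
  have hμ : 0 < μ i := by
    have h1 := hS'.inner_nonneg_left (b i)
    rw [hb, real_inner_smul_left, real_inner_self_eq_norm_sq, b.norm_eq_one] at h1
    rcases (by simpa using h1 : 0 ≤ μ i).eq_or_lt with h0 | h0
    · have := hinj (b i) (by rw [hb, ← h0, zero_smul])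
      exact absurd this (b.orthonormal.ne_zero i)
    · exact h0
  -- Since S² h b_i = μ² h b_i, this vector satisfies S y = −μ y. With μ > 0 and S ≥ 0, that forces
  -- y = 0.
  set y := S (h (b i)) - μ i • h (b i)
  have h1 : S y = -(μ i • y) := by
    have h2 : S (S (h (b i))) = μ i • μ i • h (b i) := by
      have := congrArg (fun L : V' →L[ℝ] V => L (b i)) hh
      simpa [hb] using this
    simp only [y, map_sub, map_smul, h2, smul_sub]
    abel
  have h3 := hS.inner_nonneg_left y
  rw [h1, inner_neg_left, real_inner_smul_left, real_inner_self_eq_norm_sq] at h3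
  have h4 : ‖y‖ = 0 := by
    by_contra hne
    have : 0 < ‖y‖ ^ 2 := by positivity
    nlinarith
  have h5 : y = 0 := norm_eq_zero.1 h4
  simpa [hb] using sub_eq_zero.1 h5

section PosSqrt

variable {A : V →L[ℝ] V}

/-- A root diagonal in an eigenbasis shows that the choice in `posSqrt` is not the default 0.
Positivity and the square are all that is used of the chosen root later on. -/
theorem posSqrt_spec (hA : ∀ v w, inner ℝ (A v) w = inner ℝ v (A w))
    (hpos : ∀ v, v ≠ 0 → 0 < inner ℝ (A v) v) :
    (posSqrt A).IsPositive ∧ posSqrt A ∘L posSqrt A = A := by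
  have h : ∃ S : V →L[ℝ] V, S.IsPositive ∧ S ∘L S = A := by
    obtain ⟨b, μ, hb⟩ := exists_eigenbasis hA
    have hμ : ∀ i, 0 < μ i := fun i => by
      have := hpos (b i) (b.orthonormal.ne_zero i)
      rw [hb, real_inner_smul_left, real_inner_self_eq_norm_sq, b.norm_eq_one] at this
      simpa using this
    let S : V →L[ℝ] V := ∑ i, √(μ i) • (innerSL ℝ (b i)).smulRight (b i)
    have hS : ∀ v, S v = ∑ i, (√(μ i) * inner ℝ (b i) v) • b i := fun v => by
      simp [S, smul_smul]
    have hSb : ∀ i, S (b i) = √(μ i) • b i := fun i => by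
      rw [hS, Finset.sum_eq_single i]
      · rw [real_inner_self_eq_norm_sq, b.norm_eq_one]; simp
      · intro j _ hj
        rw [b.orthonormal.2 hj]; simp
      · simp
    have hSin : ∀ v w, inner ℝ (S v) w = ∑ i, √(μ i) * inner ℝ (b i) v * inner ℝ (b i) w :=
      fun v w => by
        rw [hS, sum_inner]
        exact Finset.sum_congr rfl fun i _ => real_inner_smul_left _ _ _
    refine ⟨S, (ContinuousLinearMap.isPositive_iff _).2 ⟨fun v w => ?_, fun v => ?_⟩,
      b.ext_clm fun i => ?_⟩
    · change inner ℝ (S v) w = inner ℝ v (S w)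
      rw [hSin, real_inner_comm, hSin]
      exact Finset.sum_congr rfl fun i _ => by ring
    · rw [hSin]
      refine Finset.sum_nonneg fun i _ => ?_
      rw [mul_assoc]
      exact mul_nonneg (Real.sqrt_nonneg _) (mul_self_nonneg _)
    · rw [ContinuousLinearMap.comp_apply, hSb, map_smul, hSb, smul_smul,
        Real.mul_self_sqrt (hμ i).le, hb]
  rw [posSqrt, dif_pos h]
  exact h.choose_spec

theorem posSqrt_injective (hA : ∀ v w, inner ℝ (A v) w = inner ℝ v (A w))
    (hpos : ∀ v, v ≠ 0 → 0 < inner ℝ (A v) v)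
    (v : V) (hv : posSqrt A v = 0) : v = 0 := by
  by_contra hne
  have h1 := hpos v hne
  have h2 := congrArg (fun L : V →L[ℝ] V => L v) (posSqrt_spec hA hpos).2
  simp only [ContinuousLinearMap.comp_apply, hv, map_zero] at h2
  rw [← h2, inner_zero_left] at h1
  exact lt_irrefl _ h1

theorem isUnit_posSqrt (hA : ∀ v w, inner ℝ (A v) w = inner ℝ v (A w))
    (hpos : ∀ v, v ≠ 0 → 0 < inner ℝ (A v) v) :
    IsUnit (posSqrt A) := by
  have hinj : Function.Injective (posSqrt A).toLinearMap := by
    rw [← LinearMap.ker_eq_bot, LinearMap.ker_eq_bot']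
    exact posSqrt_injective hA hpos
  let e := LinearEquiv.ofInjectiveEndo (posSqrt A).toLinearMap hinj
  refine ⟨⟨posSqrt A, LinearMap.toContinuousLinearMap e.symm.toLinearMap, ?_, ?_⟩, rfl⟩
  · ext1 v; exact e.apply_symm_apply v
  · ext1 v; exact e.symm_apply_apply v

end PosSqrt

theorem norm_le_of_forall_eigenvalue {Y : V →L[ℝ] V}
    (hY : ∀ v w, inner ℝ (Y v) w = inner ℝ v (Y w)) {C : ℝ} (hC : 0 ≤ C)
    (h : ∀ (v : V) (μ : ℝ), ‖v‖ = 1 → Y v = μ • v → |μ| ≤ C) : ‖Y‖ ≤ C := by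
  obtain ⟨b, μ, hb⟩ := exists_eigenbasis hY
  refine Y.opNorm_le_bound hC fun x => ?_
  have h1 : ‖Y x‖ ^ 2 ≤ (C * ‖x‖) ^ 2 := by
    rw [mul_pow, ← b.sum_sq_norm_inner_right (Y x), ← b.sum_sq_norm_inner_right x, Finset.mul_sum]
    refine Finset.sum_le_sum fun i _ => ?_
    rw [← hY, hb, real_inner_smul_left, norm_mul, mul_pow]
    gcongr
    exact h (b i) (μ i) (b.norm_eq_one i) (hb i)
  exact (sq_le_sq₀ (norm_nonneg _) (by positivity)).1 h1

/-- If v is a unit eigenvector of √A_r − √A_t with eigenvalue μ, then ⟨(A_r − A_t)v, v⟩ = μ(⟨√A_r v,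
v⟩ + ⟨√A_t v, v⟩). The bracket is at least the lower bound m of √A_t, so the difference of the roots
is at most ‖A_r − A_t‖ / m. -/
theorem continuousOn_posSqrt {A : ℝ → V →L[ℝ] V} {s : Set ℝ} (hc : ContinuousOn A s)
    (hA : ∀ t ∈ s, ∀ v w, inner ℝ (A t v) w = inner ℝ v (A t w))
    (hpos : ∀ t ∈ s, ∀ v, v ≠ 0 → 0 < inner ℝ (A t v) v) :
    ContinuousOn (fun t => posSqrt (A t)) s := by
  intro t ht
  have hSp := fun r hr => posSqrt_spec (hA r hr) (hpos r hr)
  obtain ⟨m, hm, hSm⟩ : ∃ m > 0, ∀ v, m * ‖v‖ ^ 2 ≤ inner ℝ (posSqrt (A t) v) v := by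
    obtain ⟨b, μ, hb⟩ := exists_eigenbasis (fun v w => (hSp t ht).1.isSymmetric v w)
    have hμ : ∀ i, 0 < μ i := fun i => by
      have h1 := (hSp t ht).1.inner_nonneg_left (b i)
      rw [hb, real_inner_smul_left, real_inner_self_eq_norm_sq, b.norm_eq_one] at h1
      refine lt_of_le_of_ne (by simpa using h1) fun h0 => b.orthonormal.ne_zero i ?_
      exact posSqrt_injective (hA t ht) (hpos t ht) _ (by rw [hb, ← h0, zero_smul])
    have h2 : ∀ᶠ m in 𝓝[>] (0 : ℝ), ∀ i, m ≤ μ i :=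
      Filter.eventually_all.2 fun i => nhdsWithin_le_nhds ((eventually_lt_nhds (hμ i)).mono
        fun _ h => h.le)
    obtain ⟨m, h3, hm⟩ := (h2.and self_mem_nhdsWithin).exists
    refine ⟨m, hm, fun v => ?_⟩
    rw [← b.sum_inner_mul_inner, ← b.sum_sq_norm_inner_right v, Finset.mul_sum]
    refine Finset.sum_le_sum fun i _ => ?_
    have h4 : inner ℝ (posSqrt (A t) v) (b i) = μ i * inner ℝ (b i) v := by
      rw [(hSp t ht).1.inner_left_eq_inner_right, hb, real_inner_smul_right, real_inner_comm]
    rw [h4, Real.norm_eq_abs, sq_abs, mul_assoc, ← sq]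
    exact mul_le_mul_of_nonneg_right (h3 i) (sq_nonneg _)
  have hbound : ∀ r ∈ s, ‖posSqrt (A r) - posSqrt (A t)‖ ≤ ‖A r - A t‖ / m := by
    intro r hr
    refine norm_le_of_forall_eigenvalue (fun v w => ?_) (by positivity) fun v μ hv hμ => ?_
    · simp only [sub_apply, inner_sub_left, inner_sub_right,
        (hSp t ht).1.inner_left_eq_inner_right, (hSp r hr).1.inner_left_eq_inner_right]
    set St := posSqrt (A t)
    set Sr := posSqrt (A r)
    have hrv : Sr v = St v + μ • v := by
      rw [← hμ]; simp
    have h1 : inner ℝ ((A r - A t) v) v = μ * (inner ℝ (Sr v) v + inner ℝ (St v) v) := by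
      rw [← (hSp t ht).2, ← (hSp r hr).2]
      change inner ℝ (Sr (Sr v) - St (St v)) v = _
      have : Sr (Sr v) = Sr (St v) + μ • Sr v := by
        conv_lhs => rw [hrv]
        rw [map_add, map_smul]
      rw [inner_sub_left, this, inner_add_left, real_inner_smul_left,
        (hSp r hr).1.inner_left_eq_inner_right, (hSp t ht).1.inner_left_eq_inner_right (St v),
        hrv, inner_add_right, real_inner_smul_right]
      rw [inner_add_left, real_inner_smul_left]
      ring
    have h2 := (hSp r hr).1.inner_nonneg_left v
    have h3 := hSm v
    rw [hv] at h3
    have h4 : |inner ℝ ((A r - A t) v) v| ≤ ‖A r - A t‖ := by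
      refine (abs_real_inner_le_norm _ _).trans ?_
      have := (A r - A t).le_opNorm v
      rw [hv] at this ⊢
      simpa using this
    rw [h1, abs_mul] at h4
    rw [le_div_iff₀ hm]
    refine le_trans ?_ h4
    refine mul_le_mul_of_nonneg_left ?_ (abs_nonneg _)
    exact le_trans (by linarith) (le_abs_self _)
  rw [ContinuousWithinAt, tendsto_iff_norm_sub_tendsto_zero]
  refine squeeze_zero' (.of_forall fun _ => norm_nonneg _)
    (by filter_upwards [self_mem_nhdsWithin] with r hr using hbound r hr) ?_
  have := (tendsto_iff_norm_sub_tendsto_zero.1 (hc t ht)).div_const m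
  simpa using this

end SquareRoot

/-! ### Square integrable controls and the control system for developments. -/

section SquareIntegrable

variable {X Y Z : Type*} [NormedAddCommGroup X] [NormedSpace ℝ X] [NormedAddCommGroup Y]
  [NormedSpace ℝ Y] [NormedAddCommGroup Z] [NormedSpace ℝ Z] {T : ℝ}

theorem memLp_bilin (L : X →L[ℝ] Y →L[ℝ] Z) {a : ℝ → X} {w : ℝ → Y}
    (ha : ContinuousOn a (Icc 0 T)) (hw : MemLp w 2 (volume.restrict (Icc 0 T))) :
    MemLp (fun t => L (a t) (w t)) 2 (volume.restrict (Icc 0 T)) := by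
  obtain ⟨C, hC⟩ := isCompact_Icc.exists_bound_of_continuousOn ha
  have h1 := integrableOn_bilin L ha (hw.integrable (by norm_num))
  refine MemLp.of_le_mul (c := ‖L‖ * C) hw h1.aestronglyMeasurable ?_
  filter_upwards [ae_restrict_mem measurableSet_Icc] with t ht
  refine (L.le_opNorm₂ _ _).trans ?_
  gcongr
  exact hC t ht

/-- Hölder's inequality on an interval of finite measure: the Hilbert norm controls the L¹ norm,
which is the one the differential equations need. -/
theorem exists_integral_norm_le (V : Type*) [NormedAddCommGroup V] [NormedSpace ℝ V] (hT : 0 ≤ T) :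
    ∃ C ≥ 0, ∀ k : Lp V 2 ((volume : Measure ℝ).restrict (Icc 0 T)),
      ∫ s in (0 : ℝ)..T, ‖k s‖ ≤ C * ‖k‖ := by
  set μ := (volume : Measure ℝ).restrict (Icc 0 T)
  refine ⟨(μ univ ^ (1 / (1 : ENNReal).toReal - 1 / (2 : ENNReal).toReal)).toReal,
    ENNReal.toReal_nonneg, fun k => ?_⟩
  have h1 : ∫ s in (0 : ℝ)..T, ‖k s‖ = (eLpNorm k 1 μ).toReal := by
    rw [intervalIntegral.integral_of_le hT, ← integral_Icc_eq_integral_Ioc,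
      eLpNorm_one_eq_lintegral_enorm, integral_norm_eq_lintegral_enorm]
    exact (Lp.memLp k).aestronglyMeasurable
  have h2 := eLpNorm_le_eLpNorm_mul_rpow_measure_univ (p := 1) (q := 2) (by norm_num)
    (Lp.memLp k).aestronglyMeasurable
  rw [h1, Lp.norm_def, ← ENNReal.toReal_mul, mul_comm]
  refine ENNReal.toReal_mono ?_ h2
  refine ENNReal.mul_ne_top (Lp.memLp k).2.ne (ENNReal.rpow_ne_top_of_nonneg ?_ (measure_ne_top _ _))
  norm_num

end SquareIntegrable

section ControlSystems

variable {Z : Type*} [NormedAddCommGroup Z] [NormedSpace ℝ Z] {T : ℝ} {ι : Type*} [Fintype ι]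

/-- The control system `z' = ∑ m, w m • V m (t, z)`. -/
def controlField (V : ι → ℝ × Z → Z) (t : ℝ) (z : Z) : (ι → ℝ) →L[ℝ] Z :=
  ∑ m, ContinuousLinearMap.smulRightL ℝ (ι → ℝ) Z (ContinuousLinearMap.proj m) (V m (t, z))

theorem controlField_apply (V : ι → ℝ × Z → Z) (t : ℝ) (z : Z) (w : ι → ℝ) :
    controlField V t z w = ∑ m, w m • V m (t, z) := by
  simp [controlField]

/-- The derivative of `controlField` in the space variable. -/
def controlFieldDeriv (T : ℝ) (V : ι → ℝ × Z → Z) (t : ℝ) (z : Z) : Z →L[ℝ] (ι → ℝ) →L[ℝ] Z :=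
  ∑ m, ContinuousLinearMap.smulRightL ℝ (ι → ℝ) Z (ContinuousLinearMap.proj m) ∘L
    (fderivWithin ℝ (V m) (Icc 0 T ×ˢ univ) (t, z) ∘L ContinuousLinearMap.inr ℝ ℝ Z)

variable {V : ι → ℝ × Z → Z} {Ω : Set Z}

/-- The fields are smooth only on the closed slab, so the derivative in space is a restriction of
the derivative within it. Since T > 0, the slab has unique derivatives, which gives continuity up to
the end times. -/
theorem isC1Family_controlField (hT : 0 < T) (hΩ : IsOpen Ω)
    (hV : ∀ m, ContDiffOn ℝ ∞ (V m) (Icc 0 T ×ˢ univ)) :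
    IsC1Family T Ω (controlField V) (controlFieldDeriv T V) where
  isOpen := hΩ
  continuousOn := by
    refine continuousOn_finsetSum _ fun m _ => ?_
    exact (ContinuousLinearMap.continuous _).comp_continuousOn
      ((hV m).continuousOn.mono (prod_mono_right (subset_univ _)))
  continuousOn_deriv := by
    refine continuousOn_finsetSum _ fun m _ => continuousOn_const.clm_comp
      (ContinuousOn.clm_comp ?_ continuousOn_const)
    have hu : UniqueDiffOn ℝ (Icc 0 T ×ˢ (univ : Set Z)) :=
      (uniqueDiffOn_Icc hT).prod uniqueDiffOn_univ
    exact ((hV m).continuousOn_fderivWithin hu (by simp)).mono (prod_mono_right (subset_univ _))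
  hasFDerivAt t ht z _ := by
    refine HasFDerivAt.fun_sum fun m _ => ?_
    refine (ContinuousLinearMap.hasFDerivAt _).comp z ?_
    have h1 := ((hV m).differentiableOn (by simp) (t, z) ⟨ht, mem_univ _⟩).hasFDerivWithinAt
    have h2 : HasFDerivWithinAt (fun z : Z => (t, z)) (ContinuousLinearMap.inr ℝ ℝ Z) univ z :=
      (hasFDerivAt_prodMk_right t z).hasFDerivWithinAt
    exact hasFDerivWithinAt_univ.1 (h1.comp z h2 fun y _ => ⟨ht, mem_univ _⟩)

theorem SolvesInside.of_hasACDeriv {Y : Type*} [NormedAddCommGroup Y] [NormedSpace ℝ Y]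
    [CompleteSpace Z] (hT : 0 ≤ T) {G : ℝ → Z → Y →L[ℝ] Z} {w : ℝ → Y} {z z' : ℝ → Z}
    (h : HasACDeriv T z z')
    (h' : ∀ᵐ t ∂(volume.restrict (Icc 0 T)), z t ∈ Ω → z' t = G t (z t) (w t)) :
    SolvesInside T Ω G w z := by
  refine ⟨h.continuousOn hT, fun τ hτ hΩ t ht => ?_⟩
  rw [(h.mono hτ.1 hτ.2).eq_integral hτ.1 ht]
  congr 1
  refine intervalIntegral_congr_ae_Icc (T := τ) ?_ ht
  filter_upwards [ae_restrict_of_ae_restrict_of_subset (Icc_subset_Icc le_rfl hτ.2) h',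
    ae_restrict_mem measurableSet_Icc] with s hs hs'
  exact hs (hΩ s hs')

end ControlSystems

section DevelopmentField

variable {J I : Type*} [Fintype J] [Fintype I] {T : ℝ}

/-- The velocity, as a function of the state, with constant control `m`. -/
def devVelocity (U : J → ℝ × (J → ℝ) → ℝ) (m : Option I) (p : ℝ × (Option I → J → ℝ)) : J → ℝ :=
  m.elim (fun j => U j (p.1, p.2 none)) fun i => p.2 (some i)

/-- The vector fields of the control system for developments, in coordinates: `p.2 none` is the
position and `p.2 (some i)` is the parallel transport of the `i`-th basis vector. -/
def devField (U : J → ℝ × (J → ℝ) → ℝ) (H : J → J → J → (J → ℝ) → ℝ) (m : Option I)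
    (p : ℝ × (Option I → J → ℝ)) : Option I → J → ℝ := fun m' =>
  m'.elim (devVelocity U m p) fun i j =>
    ∑ k, ∑ l, H j k l (p.2 none) * devVelocity U m p k * p.2 (some i) l

variable {U : J → ℝ × (J → ℝ) → ℝ} {H : J → J → J → (J → ℝ) → ℝ}

theorem contDiff_coord (m : Option I) (j : J) :
    ContDiff ℝ ∞ fun p : ℝ × (Option I → J → ℝ) => p.2 m j :=
  (contDiff_apply_apply ℝ ℝ m j).comp contDiff_snd

theorem contDiffOn_devVelocity (hU : ∀ j, ContDiffOn ℝ ∞ (U j) (Icc 0 T ×ˢ univ)) (m : Option I)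
    (j : J) : ContDiffOn ℝ ∞ (fun p : ℝ × (Option I → J → ℝ) => devVelocity U m p j)
      (Icc 0 T ×ˢ univ) := by
  rcases m with _ | i
  · refine (hU j).comp (t := Icc 0 T ×ˢ univ) (ContDiff.contDiffOn ?_) fun p hp => ⟨hp.1, mem_univ _⟩
    exact contDiff_fst.prodMk ((contDiff_apply ℝ (J → ℝ) none).comp contDiff_snd)
  · exact (contDiff_coord _ _).contDiffOn

theorem contDiffOn_devField (hU : ∀ j, ContDiffOn ℝ ∞ (U j) (Icc 0 T ×ˢ univ))
    (hH : ∀ j k l, ContDiff ℝ ∞ (H j k l)) (m : Option I) :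
    ContDiffOn ℝ ∞ (devField U H m) (Icc 0 T ×ˢ univ) := by
  refine contDiffOn_pi.2 fun m' => contDiffOn_pi.2 fun j => ?_
  rcases m' with _ | i
  · exact contDiffOn_devVelocity hU m j
  · refine ContDiffOn.sum fun k _ => ContDiffOn.sum fun l _ => ContDiffOn.mul (ContDiffOn.mul ?_
      (contDiffOn_devVelocity hU m k)) (contDiff_coord _ _).contDiffOn
    exact ((hH j k l).comp ((contDiff_apply ℝ (J → ℝ) none).comp contDiff_snd)).contDiffOn

end DevelopmentField

variable {F : Type*} [NormedAddCommGroup F] [NormedSpace ℝ F] [FiniteDimensional ℝ F]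
  {M : Type uM} [TopologicalSpace M] [ChartedSpace F M] [IsManifold 𝓘(ℝ, F) ∞ M] {T : ℝ}

instance SubRiemannianStructure.finiteDimensional_fiber (S : SubRiemannianStructure F M) (x : M) :
    FiniteDimensional ℝ (S.Fiber x) :=
  haveI : FiniteDimensional ℝ (TangentSpace 𝓘(ℝ, F) x) := inferInstanceAs (FiniteDimensional ℝ F)
  (S.toFiber x).finiteDimensional

/-! ### Developments as solutions of a control system in Euclidean space. -/

namespace DevelopmentData

variable (D : DevelopmentData F M T)

/-- `γ` is the development of `η`, with parallel transport `P`. -/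
structure IsDevelopmentWith (η : D.H) (γ : ℝ → M)
    (P : ∀ t : ℝ, D.sr.Fiber D.o →ₗ[ℝ] TangentSpace 𝓘(ℝ, F) (γ t)) : Prop where
  isH1Curve : IsH1Curve F T γ
  start : γ 0 = D.o
  init : ∀ v, (⟨γ 0, P 0 v⟩ : TangentBundle 𝓘(ℝ, F) M) = ⟨D.o, D.sr.incl D.o v⟩
  parallel : ∀ v, IsParallelAlong D.cov T γ fun t => P t v
  velocity_eq : ∀ᵐ t ∂(volume.restrict (Icc 0 T)),
    velocity F γ t = P t (posSqrt (D.sigma t) (η t)) + D.u t (γ t)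

variable {D} in
theorem IsDevelopment.exists_with {η : D.H} {γ : ℝ → M} (h : D.IsDevelopment η γ) :
    ∃ P, D.IsDevelopmentWith η γ P := by
  obtain ⟨h1, h2, P, h3, h4, h5⟩ := h
  exact ⟨P, h1, h2, h3, h4, h5⟩

variable {D} in
theorem IsDevelopmentWith.isDevelopment {η : D.H} {γ : ℝ → M} {P}
    (h : D.IsDevelopmentWith η γ P) : D.IsDevelopment η γ :=
  ⟨h.isH1Curve, h.start, P, h.init, h.parallel, h.velocity_eq⟩

theorem continuousOn_posSqrt_sigma : ContinuousOn (fun t => posSqrt (D.sigma t)) (Icc 0 T) :=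
  continuousOn_posSqrt D.sigma_smooth.continuousOn D.sigma_symm D.sigma_pos

theorem isUnit_posSqrt_sigma {t : ℝ} (ht : t ∈ Icc 0 T) : IsUnit (posSqrt (D.sigma t)) :=
  isUnit_posSqrt (D.sigma_symm t ht) (D.sigma_pos t ht)

/-- An orthonormal basis of `E_o`. -/
def basis : OrthonormalBasis (Fin (Module.finrank ℝ (D.sr.Fiber D.o))) ℝ (D.sr.Fiber D.o) :=
  stdOrthonormalBasis ℝ _

/-- The index set of the basis. -/
abbrev BasisIndex : Type := Fin (Module.finrank ℝ (D.sr.Fiber D.o))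

/-- The components of `Σ_t^{1/2} k_t`. -/
def controlCoord (k : D.H) (t : ℝ) (i : D.BasisIndex) : ℝ :=
  inner ℝ (D.basis i) (posSqrt (D.sigma t) (k t))

theorem sum_controlCoord (k : D.H) (t : ℝ) :
    ∑ i, D.controlCoord k t i • D.basis i = posSqrt (D.sigma t) (k t) :=
  D.basis.sum_repr' _

theorem memLp_controlCoord (k : D.H) (i : D.BasisIndex) :
    MemLp (fun t => D.controlCoord k t i) 2 (volume.restrict (Icc 0 T)) := by
  have h1 := memLp_bilin (ContinuousLinearMap.id ℝ (D.sr.Fiber D.o →L[ℝ] D.sr.Fiber D.o))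
    D.continuousOn_posSqrt_sigma (Lp.memLp k)
  exact memLp_bilin (innerSL ℝ) (a := fun _ => D.basis i) continuousOn_const h1

/-- The control associated with `η`. -/
def control (η : D.H) (t : ℝ) (m : Option D.BasisIndex) : ℝ := m.elim 1 (D.controlCoord η t)

/-- The variation of the control. -/
def controlVar (k : D.H) (t : ℝ) (m : Option D.BasisIndex) : ℝ := m.elim 0 (D.controlCoord k t)

theorem integrableOn_control (η : D.H) : IntegrableOn (D.control η) (Icc 0 T) := by
  refine Integrable.of_eval fun m => ?_
  rcases m with _ | i
  · exact integrable_const (1 : ℝ)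
  · exact (D.memLp_controlCoord η i).integrable (by norm_num)

/-- The drift carries the fixed control 1, hence variation 0. The remaining components are linear in
k through Σ_t^{1/2}, which is bounded on `[0,T]`. -/
theorem isLinearControl_controlVar (hT : 0 ≤ T) : IsLinearControl T D.controlVar where
  integrable k := by
    refine Integrable.of_eval fun m => ?_
    rcases m with _ | i
    · exact integrable_zero _ _ _
    · exact (D.memLp_controlCoord k i).integrable (by norm_num)
  add k l := by
    filter_upwards [Lp.coeFn_add k l] with t ht
    funext m
    rcases m with _ | i
    · exact (add_zero _).symm
    · change inner ℝ _ (posSqrt (D.sigma t) ((k + l : D.H) t)) = inner ℝ _ _ + inner ℝ _ _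
      rw [ht, Pi.add_apply, map_add, inner_add_right]
  smul c k := by
    filter_upwards [Lp.coeFn_smul c k] with t ht
    funext m
    rcases m with _ | i
    · exact (mul_zero _).symm
    · change inner ℝ _ (posSqrt (D.sigma t) ((c • k : D.H) t)) = c * inner ℝ _ _
      rw [ht, Pi.smul_apply, map_smul, real_inner_smul_right]
  bound := by
    obtain ⟨C, hC, hk⟩ := exists_integral_norm_le (D.sr.Fiber D.o) hT
    obtain ⟨B, hB⟩ := isCompact_Icc.exists_bound_of_continuousOn D.continuousOn_posSqrt_sigma
    have hB0 : 0 ≤ B := (norm_nonneg _).trans (hB 0 ⟨le_rfl, hT⟩)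
    refine ⟨B * C, by positivity, fun k => ?_⟩
    have hki : IntegrableOn (fun t => ‖k t‖) (Icc 0 T) :=
      ((Lp.memLp k).integrable (by norm_num)).norm
    have h1 : ∀ t ∈ Icc 0 T, ‖D.controlVar k t‖ ≤ B * ‖k t‖ := fun t ht => by
      refine (pi_norm_le_iff_of_nonneg (by positivity)).2 fun m => ?_
      rcases m with _ | i
      · change ‖(0 : ℝ)‖ ≤ _
        rw [norm_zero]; positivity
      · refine (norm_inner_le_norm _ _).trans ?_
        rw [D.basis.norm_eq_one, one_mul]
        exact ((posSqrt (D.sigma t)).le_opNorm _).trans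
          (mul_le_mul_of_nonneg_right (hB t ht) (norm_nonneg _))
    have h2 : ∫ s in (0 : ℝ)..T, ‖D.controlVar k s‖ ≤ ∫ s in (0 : ℝ)..T, B * ‖k s‖ := by
      refine intervalIntegral.integral_mono_on_of_le_Ioo hT ?_ ?_ fun t ht =>
        h1 t (Ioo_subset_Icc_self ht)
      · refine intervalIntegrable_of_Icc (T := T) ?_ ⟨hT, le_rfl⟩
        refine Integrable.norm (Integrable.of_eval fun m => ?_)
        rcases m with _ | i
        · exact integrable_zero _ _ _
        · exact (D.memLp_controlCoord k i).integrable (by norm_num)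
      · exact intervalIntegrable_of_Icc (hki.const_mul B) ⟨hT, le_rfl⟩
    refine h2.trans ?_
    rw [intervalIntegral.integral_const_mul, mul_assoc]
    exact mul_le_mul_of_nonneg_left (hk k) hB0

theorem control_eq_add (η η₀ : D.H) : D.control η =ᵐ[volume.restrict (Icc 0 T)] fun t =>
    D.control η₀ t + D.controlVar (η - η₀) t := by
  filter_upwards [Lp.coeFn_sub η η₀] with t ht
  funext m
  rcases m with _ | i
  · exact (add_zero _).symm
  · change inner ℝ _ _ = inner ℝ _ _ + inner ℝ _ (posSqrt (D.sigma t) ((η - η₀ : D.H) t))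
    rw [ht, Pi.sub_apply, map_sub, inner_sub_right, add_sub_cancel]

variable {D} in
theorem IsDevelopmentWith.velocity_eq_sum {η : D.H} {γ : ℝ → M} {P}
    (h : D.IsDevelopmentWith η γ P) : ∀ᵐ t ∂(volume.restrict (Icc 0 T)),
      velocity F γ t = ∑ i, D.controlCoord η t i • P t (D.basis i) + D.u t (γ t) := by
  filter_upwards [h.velocity_eq] with t ht
  rw [ht, ← D.sum_controlCoord, map_sum]
  simp only [map_smul]

/-- Extensions to Euclidean space of the coefficients of the equation for developments. -/
structure IsCoefficients {K : Set M} (𝓕 : CompactFrame D.sr T K)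
    (U : 𝓕.J → ℝ × (𝓕.J → ℝ) → ℝ) (H : 𝓕.J → 𝓕.J → 𝓕.J → (𝓕.J → ℝ) → ℝ) : Prop where
  contDiffOn_U : ∀ j, ContDiffOn ℝ ∞ (U j) (Icc 0 T ×ˢ univ)
  U_eq : ∀ j, ∀ t ∈ Icc 0 T, ∀ y, 𝓕.emb y ∈ 𝓕.O →
    U j (t, 𝓕.emb y) = mvfderiv 𝓘(ℝ, F) (𝓕.f j) y (D.u t y)
  contDiff_H : ∀ j k l, ContDiff ℝ ∞ (H j k l)
  H_eq : ∀ j k l y, 𝓕.emb y ∈ 𝓕.O → H j k l (𝓕.emb y) = 𝓕.christoffel D.cov j k l y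

theorem contMDiffOn_mvfderiv_u {f : M → ℝ} (hf : ContMDiff 𝓘(ℝ, F) 𝓘(ℝ, ℝ) ∞ f) :
    ContMDiffOn (𝓘(ℝ, ℝ).prod 𝓘(ℝ, F)) 𝓘(ℝ, ℝ) ∞
      (fun p : ℝ × M => mvfderiv 𝓘(ℝ, F) f p.2 (D.u p.1 p.2)) (Icc 0 T ×ˢ univ) :=
  fun p hp => (D.u_smooth p hp).mvfderiv_apply hf

theorem exists_coefficients (hT : 0 ≤ T) {K : Set M} (𝓕 : CompactFrame D.sr T K) :
    ∃ U H, D.IsCoefficients 𝓕 U H := by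
  choose U hU hUeq using fun j => 𝓕.exists_extension
    (fun t y => mvfderiv 𝓘(ℝ, F) (𝓕.f j) y (D.u t y)) (D.contMDiffOn_mvfderiv_u (𝓕.contMDiff_f j))
  choose H hH hHeq using fun j k l =>
    𝓕.exists_smooth_extension hT (𝓕.contMDiff_christoffel D.cov_smooth j k l)
  exact ⟨U, H, hU, hUeq, hH, hHeq⟩

/-- The state of the control system for developments. -/
def state {K : Set M} (𝓕 : CompactFrame D.sr T K) {γ : ℝ → M}
    (P : ∀ t : ℝ, D.sr.Fiber D.o →ₗ[ℝ] TangentSpace 𝓘(ℝ, F) (γ t)) (t : ℝ) :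
    Option D.BasisIndex → 𝓕.J → ℝ :=
  fun m => m.elim (𝓕.emb (γ t)) fun i => 𝓕.demb (γ t) (P t (D.basis i))

/-- The open set of states whose position is in the domain of the frame. -/
def stateDomain {K : Set M} (𝓕 : CompactFrame D.sr T K) : Set (Option D.BasisIndex → 𝓕.J → ℝ) :=
  {z | z none ∈ 𝓕.O}

theorem isOpen_stateDomain {K : Set M} (𝓕 : CompactFrame D.sr T K) : IsOpen (D.stateDomain 𝓕) :=
  𝓕.isOpen_O.preimage (continuous_apply none)

variable {D} {K : Set M} {𝓕 : CompactFrame D.sr T K} {U : 𝓕.J → ℝ × (𝓕.J → ℝ) → ℝ}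
  {H : 𝓕.J → 𝓕.J → 𝓕.J → (𝓕.J → ℝ) → ℝ}

theorem IsCoefficients.isC1Family (hT : 0 < T) (h : D.IsCoefficients 𝓕 U H) :
    IsC1Family T (D.stateDomain 𝓕) (controlField (devField U H))
      (controlFieldDeriv T (devField (I := D.BasisIndex) U H)) :=
  isC1Family_controlField hT (D.isOpen_stateDomain 𝓕)
    fun m => contDiffOn_devField h.contDiffOn_U h.contDiff_H m

variable [T2Space M]

theorem IsDevelopmentWith.hasACDeriv_comp {η : D.H} {γ : ℝ → M} {P}
    (h : D.IsDevelopmentWith η γ P) (hT : 0 < T) {g : M → ℝ}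
    (hg : ContMDiff 𝓘(ℝ, F) 𝓘(ℝ, ℝ) ∞ g) :
    HasACDeriv T (fun t => g (γ t)) fun t => mvfderiv 𝓘(ℝ, F) g (γ t) (velocity F γ t) := by
  obtain ⟨𝓕⟩ := exists_compactFrame D.sr T h.isH1Curve.isCompact_trace
  exact h.isH1Curve.hasACDeriv hT 𝓕 hg

/-- The position moves with velocity u + Σ w_i P e_i, and each P e_i by the Christoffel terms, which
are linear in that velocity; together they form a system affine in w. The frame 𝓕 need not be
adapted to γ, since the equation is only claimed while γ is in its domain. One frame, built around a
single development, thus serves all nearby controls. -/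
theorem IsDevelopmentWith.solvesInside {η : D.H} {γ : ℝ → M} {P}
    (h : D.IsDevelopmentWith η γ P) (hT : 0 < T) (hc : D.IsCoefficients 𝓕 U H) :
    SolvesInside T (D.stateDomain 𝓕) (controlField (devField U H)) (D.control η)
      (D.state 𝓕 P) := by
  have h1 : HasACDeriv T (D.state 𝓕 P) (fun t m => m.elim (𝓕.demb (γ t) (velocity F γ t))
      fun i j => covHessian D.cov (𝓕.f j) (γ t) (velocity F γ t) (P t (D.basis i))) := by
    refine HasACDeriv.pi fun m => HasACDeriv.pi fun j => ?_
    rcases m with _ | i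
    · exact h.hasACDeriv_comp hT (𝓕.contMDiff_f j)
    · exact (h.parallel (D.basis i)).hasACDeriv hT.le (𝓕.contMDiff_f j)
  refine SolvesInside.of_hasACDeriv hT.le h1 ?_
  filter_upwards [h.velocity_eq_sum, ae_restrict_mem measurableSet_Icc] with t hv ht hO
  have hO' : 𝓕.emb (γ t) ∈ 𝓕.O := hO
  have h2 : ∀ j, 𝓕.demb (γ t) (velocity F γ t) j =
      ∑ m, D.control η t m * devVelocity U m (t, D.state 𝓕 P t) j := by
    intro j
    rw [Fintype.sum_option, hv, map_add, map_sum, add_comm]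
    simp only [map_smul, Pi.add_apply, Finset.sum_apply, Pi.smul_apply, smul_eq_mul]
    congr 1
    have := hc.U_eq j t ht _ hO'
    change _ = 1 * U j (t, 𝓕.emb (γ t))
    rw [one_mul, this]
    rfl
  rw [controlField_apply]
  funext m j
  rw [Finset.sum_apply, Finset.sum_apply]
  rcases m with _ | i
  · exact h2 j
  · change covHessian D.cov (𝓕.f j) (γ t) (velocity F γ t) (P t (D.basis i)) =
      ∑ m, D.control η t m * ∑ k, ∑ l, H j k l (𝓕.emb (γ t)) *
        devVelocity U m (t, D.state 𝓕 P t) k * 𝓕.demb (γ t) (P t (D.basis i)) l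
    have h3 : ∀ k l, 𝓕.demb (γ t) (velocity F γ t) k * 𝓕.demb (γ t) (P t (D.basis i)) l *
        𝓕.christoffel D.cov j k l (γ t) = ∑ m, D.control η t m * (H j k l (𝓕.emb (γ t)) *
          devVelocity U m (t, D.state 𝓕 P t) k * 𝓕.demb (γ t) (P t (D.basis i)) l) := by
      intro k l
      rw [h2, hc.H_eq j k l _ hO', Finset.sum_mul, Finset.sum_mul]
      exact Finset.sum_congr rfl fun m _ => by ring
    rw [𝓕.covHessian_eq_sum hO']
    simp only [h3, Finset.mul_sum]
    conv_rhs => rw [Finset.sum_comm]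
    refine Finset.sum_congr rfl fun k _ => ?_
    rw [Finset.sum_comm]

/-- The initial state does not depend on the development. -/
theorem IsDevelopmentWith.state_zero_eq {η η₀ : D.H} {γ γ₀ : ℝ → M} {P P₀}
    (h : D.IsDevelopmentWith η γ P) (h₀ : D.IsDevelopmentWith η₀ γ₀ P₀) :
    D.state 𝓕 P 0 = D.state 𝓕 P₀ 0 := by
  funext m
  rcases m with _ | i
  · change 𝓕.emb (γ 0) = 𝓕.emb (γ₀ 0)
    rw [h.start, h₀.start]
  · exact congrArg (fun p : TangentBundle 𝓘(ℝ, F) M => 𝓕.demb p.1 p.2)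
      ((h.init (D.basis i)).trans (h₀.init (D.basis i)).symm)

/-- Uniqueness for the control system in a frame around γ₀; that γ stays in its domain is part of
the conclusion of `SolvesInside.eqOn`. -/
theorem IsDevelopment.eq_of_eq {η : D.H} {γ γ₀ : ℝ → M} (h : D.IsDevelopment η γ)
    (h₀ : D.IsDevelopment η γ₀) (hT : 0 < T) {t : ℝ} (ht : t ∈ Icc 0 T) : γ t = γ₀ t := by
  obtain ⟨P, h⟩ := h.exists_with
  obtain ⟨P₀, h₀⟩ := h₀.exists_with
  obtain ⟨𝓕⟩ := exists_compactFrame D.sr T h₀.isH1Curve.isCompact_trace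
  obtain ⟨U, H, hc⟩ := D.exists_coefficients hT.le 𝓕
  have h1 := (h₀.solvesInside hT hc).eqOn hT.le (hc.isC1Family hT) (fun t ht => 𝓕.emb_mem ht)
    (D.integrableOn_control η) (h.solvesInside hT hc) (h.state_zero_eq h₀) ht
  exact 𝓕.emb_inj hT.le (𝓕.emb_mem ht) (congrFun h1 none)

end DevelopmentData

/-! ### Parallel transport of E, and which curves are developments. -/

namespace DevelopmentData

variable {F : Type*} [NormedAddCommGroup F] [NormedSpace ℝ F] [FiniteDimensional ℝ F]
  {M : Type uM} [TopologicalSpace M] [ChartedSpace F M] [IsManifold 𝓘(ℝ, F) ∞ M] {T : ℝ}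
  (D : DevelopmentData F M T)

/-- `P` is the parallel transport of `E_o` along `γ`. -/
structure IsTransport (γ : ℝ → M)
    (P : ∀ t : ℝ, D.sr.Fiber D.o →ₗ[ℝ] TangentSpace 𝓘(ℝ, F) (γ t)) : Prop where
  isH1Curve : IsH1Curve F T γ
  start : γ 0 = D.o
  init : ∀ v, (⟨γ 0, P 0 v⟩ : TangentBundle 𝓘(ℝ, F) M) = ⟨D.o, D.sr.incl D.o v⟩
  parallel : ∀ v, IsParallelAlong D.cov T γ fun t => P t v

variable {D}

theorem IsDevelopmentWith.isTransport {η : D.H} {γ : ℝ → M} {P}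
    (h : D.IsDevelopmentWith η γ P) : D.IsTransport γ P :=
  ⟨h.isH1Curve, h.start, h.init, h.parallel⟩

theorem mem_E_iff_of_eq {S : SubRiemannianStructure F M} {p q : TangentBundle 𝓘(ℝ, F) M}
    (h : p = q) : p.2 ∈ S.E p.1 ↔ q.2 ∈ S.E q.1 := by rw [h]

theorem incl_mem {S : SubRiemannianStructure F M} {x : M} (v : S.Fiber x) : S.incl x v ∈ S.E x :=
  ((S.toFiber x).symm v).2

theorem exists_incl_eq {S : SubRiemannianStructure F M} {x o : M} (h : x = o)
    {w : TangentSpace 𝓘(ℝ, F) x} (hw : w ∈ S.E x) :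
    ∃ v, (⟨x, w⟩ : TangentBundle 𝓘(ℝ, F) M) = ⟨o, S.incl o v⟩ := by
  subst h
  exact ⟨S.toFiber x ⟨w, hw⟩, rfl⟩

theorem exists_eq_incl {S : SubRiemannianStructure F M} {x o : M} (h : x = o) (v : S.Fiber o) :
    ∃ w ∈ S.E x, (⟨x, w⟩ : TangentBundle 𝓘(ℝ, F) M) = ⟨o, S.incl o v⟩ := by
  subst h
  exact ⟨_, incl_mem v, rfl⟩

theorem incl_injective (S : SubRiemannianStructure F M) (x : M) : Function.Injective (S.incl x) :=
  Subtype.val_injective.comp (S.toFiber x).symm.injective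

theorem tangentBundle_mk_inj {x : M} {v w : TangentSpace 𝓘(ℝ, F) x}
    (h : (⟨x, v⟩ : TangentBundle 𝓘(ℝ, F) M) = ⟨x, w⟩) : v = w := by
  simpa using h

theorem IsTransport.zero_injective {γ : ℝ → M} {P} (h : D.IsTransport γ P) :
    Function.Injective (P 0) := by
  intro v w hvw
  refine incl_injective D.sr D.o (tangentBundle_mk_inj ?_)
  rw [← h.init, ← h.init, hvw]

variable [T2Space M]

/-- Parallel transport within `E`. -/
theorem exists_isParallelAlong_E {γ : ℝ → M} (hγ : IsH1Curve F T γ) (hT : 0 < T) {t₀ : ℝ}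
    (ht₀ : t₀ ∈ Icc 0 T) {w : TangentSpace 𝓘(ℝ, F) (γ t₀)} (hw : w ∈ D.sr.E (γ t₀)) :
    ∃ V : ∀ t, TangentSpace 𝓘(ℝ, F) (γ t), V t₀ = w ∧ IsParallelAlong D.cov T γ V ∧
      ∀ t, V t ∈ D.sr.E (γ t) := by
  obtain ⟨𝓕⟩ := exists_compactFrame D.sr T hγ.isCompact_trace
  exact exists_isParallelAlong 𝓕 hγ hT D.cov_smooth (B := D.sr.E) 𝓕.contMDiff_X 𝓕.contMDiff_θ
    (fun a y => (𝓕.X a y).2) (fun t ht v hv => 𝓕.eq_sum_X _ (𝓕.emb_mem ht) ⟨v, hv⟩)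
    (fun a y v => D.cov_compatible.cov_mem (𝓕.X a) y v ((𝓕.contMDiff_X a).mdifferentiable (by simp) y))
    ht₀ hw

theorem eq_of_isParallelAlong {γ : ℝ → M} (hγ : IsH1Curve F T γ) (hT : 0 < T)
    {V V' : ∀ t, TangentSpace 𝓘(ℝ, F) (γ t)} (hV : IsParallelAlong D.cov T γ V)
    (hV' : IsParallelAlong D.cov T γ V') {s t : ℝ} (hs : s ∈ Icc 0 T) (ht : t ∈ Icc 0 T)
    (h : V s = V' s) : V t = V' t := by
  obtain ⟨𝓕⟩ := exists_compactFrame D.sr T hγ.isCompact_trace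
  exact hV.eq_of_eq 𝓕 hγ hT D.cov_smooth hV' hs ht h

/-- A parallel field with values in E and the same initial value exists, and parallel fields are
unique. -/
theorem IsTransport.mem_E {γ : ℝ → M} {P} (h : D.IsTransport γ P) (hT : 0 < T) {t : ℝ}
    (ht : t ∈ Icc 0 T) (v : D.sr.Fiber D.o) : P t v ∈ D.sr.E (γ t) := by
  have h0 : (0 : ℝ) ∈ Icc 0 T := ⟨le_rfl, hT.le⟩
  obtain ⟨V, hV0, hV, hVE⟩ := exists_isParallelAlong_E (D := D) h.isH1Curve hT h0
    ((mem_E_iff_of_eq (h.init v)).2 (incl_mem v))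
  rw [← eq_of_isParallelAlong h.isH1Curve hT hV (h.parallel v) h0 ht hV0]
  exact hVE t

/-- Transport w back to time 0 within E, which identifies the preimage in E_o. -/
theorem IsTransport.exists_eq {γ : ℝ → M} {P} (h : D.IsTransport γ P) (hT : 0 < T) {t : ℝ}
    (ht : t ∈ Icc 0 T) {w : TangentSpace 𝓘(ℝ, F) (γ t)} (hw : w ∈ D.sr.E (γ t)) :
    ∃ v, P t v = w := by
  have h0 : (0 : ℝ) ∈ Icc 0 T := ⟨le_rfl, hT.le⟩
  obtain ⟨V, hVt, hV, hVE⟩ := exists_isParallelAlong_E (D := D) h.isH1Curve hT ht hw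
  obtain ⟨v, hv⟩ := exists_incl_eq h.start (hVE 0)
  refine ⟨v, ?_⟩
  rw [← hVt]
  refine eq_of_isParallelAlong h.isH1Curve hT (h.parallel v) hV h0 ht (tangentBundle_mk_inj ?_)
  rw [hv, h.init]

/-- The inverse of parallel transport extends to a continuous family of linear maps on the
embedding space. -/
theorem IsTransport.exists_inverse {γ : ℝ → M} {P} (h : D.IsTransport γ P) (hT : 0 < T)
    (𝓕 : CompactFrame D.sr T (trace T γ)) :
    ∃ R : ℝ → (𝓕.J → ℝ) →L[ℝ] D.BasisIndex → ℝ, ContinuousOn R (Icc 0 T) ∧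
      ∀ t ∈ Icc 0 T, ∀ w ∈ D.sr.E (γ t), w = ∑ i, R t (𝓕.demb (γ t) w) i • P t (D.basis i) := by
  have h0 : (0 : ℝ) ∈ Icc 0 T := ⟨le_rfl, hT.le⟩
  obtain ⟨Φ, Ψ, -, hΨ0, -, hΨ, -⟩ := exists_fundamental_solution hT.le
    (𝓕.integrableOn_transportMatrix h.isH1Curve hT D.cov_smooth)
  -- The inverse fundamental solution Ψ undoes the transport in the embedding. A left inverse at
  -- time 0, composed with Ψ t, therefore reads off the components at time t continuously.
  have hΨP : ∀ v, ∀ t ∈ Icc 0 T, Ψ t (𝓕.demb (γ t) (P t v)) = 𝓕.demb (γ 0) (P 0 v) := by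
    intro v t ht
    have h1 := HasACDeriv.bilin hT.le (ContinuousLinearMap.id ℝ ((𝓕.J → ℝ) →L[ℝ] 𝓕.J → ℝ)) hΨ
      ((h.parallel v).hasACDeriv_demb 𝓕 hT.le)
    have h2 := h1.eq_of_deriv_zero hT.le (.of_forall fun t => by simp) ht h0
    simpa [hΨ0] using h2
  let L : (D.BasisIndex → ℝ) →ₗ[ℝ] 𝓕.J → ℝ :=
    (𝓕.demb (γ 0)).toLinearMap ∘ₗ P 0 ∘ₗ Fintype.linearCombination ℝ D.basis
  have hL : Function.Injective L := by
    refine (𝓕.demb_injective (𝓕.emb_mem h0)).comp (h.zero_injective.comp ?_)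
    rw [← LinearMap.ker_eq_bot, LinearMap.ker_eq_bot']
    intro c hc
    rw [Fintype.linearCombination_apply] at hc
    exact funext (Fintype.linearIndependent_iff.1 D.basis.orthonormal.linearIndependent c hc)
  obtain ⟨R₀, hR₀⟩ := L.exists_leftInverse_of_injective (LinearMap.ker_eq_bot.2 hL)
  let R₁ := LinearMap.toContinuousLinearMap R₀
  refine ⟨fun t => R₁ ∘L Ψ t, continuousOn_const.clm_comp (hΨ.continuousOn hT.le),
    fun t ht w hw => ?_⟩
  obtain ⟨v, rfl⟩ := h.exists_eq hT ht hw
  set c : D.BasisIndex → ℝ := fun i => inner ℝ (D.basis i) v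
  have hv : ∑ i, c i • D.basis i = v := D.basis.sum_repr' v
  have hR : (R₁ ∘L Ψ t) (𝓕.demb (γ t) (P t v)) = c := by
    change R₀ (Ψ t (𝓕.demb (γ t) (P t v))) = c
    rw [hΨP v t ht]
    have : L c = 𝓕.demb (γ 0) (P 0 v) := by
      change 𝓕.demb (γ 0) (P 0 (Fintype.linearCombination ℝ D.basis c)) = _
      rw [Fintype.linearCombination_apply, hv]
    rw [← this]
    exact DFunLike.congr_fun hR₀ c
  rw [hR]
  conv_lhs => rw [← hv]
  rw [map_sum]
  simp only [map_smul]

variable (D) in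
theorem mk_sum_basis_eq {x : M} (hx : x = D.o) {w : D.BasisIndex → TangentSpace 𝓘(ℝ, F) x}
    (hw : ∀ i, (⟨x, w i⟩ : TangentBundle 𝓘(ℝ, F) M) = ⟨D.o, D.sr.incl D.o (D.basis i)⟩)
    (v : D.sr.Fiber D.o) :
    (⟨x, ∑ i, (inner ℝ (D.basis i) v : ℝ) • w i⟩ : TangentBundle 𝓘(ℝ, F) M) =
      ⟨D.o, D.sr.incl D.o v⟩ := by
  obtain rfl := hx
  congr 1
  conv_rhs => rw [← D.basis.sum_repr' v, map_sum]
  refine Finset.sum_congr rfl fun i _ => ?_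
  rw [map_smul, tangentBundle_mk_inj (hw i)]

theorem exists_isTransport {γ : ℝ → M} (hγ : IsH1Curve F T γ) (hT : 0 < T) (h0 : γ 0 = D.o) :
    ∃ P, D.IsTransport γ P := by
  have ht0 : (0 : ℝ) ∈ Icc 0 T := ⟨le_rfl, hT.le⟩
  choose w hwE hw using fun i => exists_eq_incl h0 (D.basis i)
  choose V hV0 hV hVE using fun i => exists_isParallelAlong_E (D := D) hγ hT ht0 (hwE i)
  let c : D.BasisIndex → D.sr.Fiber D.o →ₗ[ℝ] ℝ := fun i => (innerSL ℝ (D.basis i)).toLinearMap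
  let P : ∀ t : ℝ, D.sr.Fiber D.o →ₗ[ℝ] TangentSpace 𝓘(ℝ, F) (γ t) := fun t =>
    ∑ i, (c i).smulRight (V i t)
  have hP : ∀ t v, P t v = ∑ i, (inner ℝ (D.basis i) v : ℝ) • V i t := fun t v => by
    simp only [P, LinearMap.sum_apply, LinearMap.smulRight_apply]
    rfl
  refine ⟨P, hγ, h0, fun v => ?_, fun v => ?_⟩
  · rw [hP]
    simp only [hV0]
    exact D.mk_sum_basis_eq h0 hw v
  · simp only [hP]
    exact IsParallelAlong.sum_smul _ hT.le _ fun i _ => hV i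

variable (D) in
theorem continuousOn_mvfderiv_u {γ : ℝ → M} (hγ : ContinuousOn γ (Icc 0 T)) {f : M → ℝ}
    (hf : ContMDiff 𝓘(ℝ, F) 𝓘(ℝ, ℝ) ∞ f) :
    ContinuousOn (fun t => mvfderiv 𝓘(ℝ, F) f (γ t) (D.u t (γ t))) (Icc 0 T) := by
  have key : ∀ φ : ℝ × M → ℝ, ContinuousOn φ (Icc 0 T ×ˢ univ) →
      ContinuousOn (fun t => φ (t, γ t)) (Icc 0 T) := fun φ hφ =>
    hφ.comp (continuousOn_id.prodMk hγ) fun t ht => ⟨ht, mem_univ _⟩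
  exact key (fun p => mvfderiv 𝓘(ℝ, F) f p.2 (D.u p.1 p.2))
    (ContMDiffOn.continuousOn (D.contMDiffOn_mvfderiv_u hf))

variable (D) in
-- Σ_t^{1/2} is invertible with continuous inverse on `[0,T]`, so square integrable components can
-- be prescribed freely.
theorem exists_controlCoord_eq {κ : ℝ → D.BasisIndex → ℝ}
    (hκ : MemLp κ 2 (volume.restrict (Icc 0 T))) :
    ∃ k : D.H, ∀ᵐ t ∂(volume.restrict (Icc 0 T)),
      posSqrt (D.sigma t) (k t) = ∑ i, κ t i • D.basis i := by
  let B : (D.BasisIndex → ℝ) →L[ℝ] D.sr.Fiber D.o :=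
    LinearMap.toContinuousLinearMap (Fintype.linearCombination ℝ D.basis)
  have hSi : ContinuousOn (fun t => Ring.inverse (posSqrt (D.sigma t))) (Icc 0 T) := fun t ht => by
    obtain ⟨u, hu⟩ := D.isUnit_posSqrt_sigma ht
    exact ContinuousAt.comp_continuousWithinAt (f := fun t => posSqrt (D.sigma t))
      (hu ▸ NormedRing.inverse_continuousAt u) (D.continuousOn_posSqrt_sigma t ht)
  have h3 := memLp_bilin (ContinuousLinearMap.id ℝ (D.sr.Fiber D.o →L[ℝ] D.sr.Fiber D.o)) hSi
    (memLp_bilin (ContinuousLinearMap.id ℝ ((D.BasisIndex → ℝ) →L[ℝ] D.sr.Fiber D.o))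
      (a := fun _ => B) continuousOn_const hκ)
  refine ⟨h3.toLp, ?_⟩
  filter_upwards [h3.coeFn_toLp, ae_restrict_mem measurableSet_Icc] with t ht htT
  rw [ht]
  have h4 := congrArg (fun A : D.sr.Fiber D.o →L[ℝ] D.sr.Fiber D.o => A (B (κ t)))
    (Ring.mul_inverse_cancel _ (D.isUnit_posSqrt_sigma htT))
  have h5 : posSqrt (D.sigma t) (Ring.inverse (posSqrt (D.sigma t)) (B (κ t))) = B (κ t) := h4
  exact h5.trans (Fintype.linearCombination_apply ℝ _ _)

/-- Curves with square integrable velocity whose velocity differs from `u` by an element of `E` are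
developments. -/
theorem exists_isDevelopment {γ : ℝ → M} (hγ : IsH1Curve F T γ) (hT : 0 < T) (h0 : γ 0 = D.o)
    (hE : ∀ᵐ t ∂(volume.restrict (Icc 0 T)), velocity F γ t - D.u t (γ t) ∈ D.sr.E (γ t)) :
    ∃ η, D.IsDevelopment η γ := by
  obtain ⟨P, hP⟩ := exists_isTransport hγ hT h0
  obtain ⟨𝓕⟩ := exists_compactFrame D.sr T hγ.isCompact_trace
  obtain ⟨R, hR, hRP⟩ := hP.exists_inverse hT 𝓕
  have h1 : MemLp (fun t => 𝓕.demb (γ t) (velocity F γ t - D.u t (γ t))) 2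
      (volume.restrict (Icc 0 T)) := by
    refine MemLp.of_eval fun j => ?_
    have h2 := (hγ.memLp hT 𝓕 (𝓕.contMDiff_f j)).sub
      (memLp_bilin (ContinuousLinearMap.mul ℝ ℝ)
        (D.continuousOn_mvfderiv_u hγ.continuousOn (𝓕.contMDiff_f j)) (memLp_const (1 : ℝ)))
    refine h2.ae_eq (.of_forall fun t => ?_)
    simp only [map_sub, Pi.sub_apply, CompactFrame.demb_apply, ContinuousLinearMap.mul_apply',
      mul_one]
  have h2 := memLp_bilin (ContinuousLinearMap.id ℝ ((𝓕.J → ℝ) →L[ℝ] D.BasisIndex → ℝ)) hR h1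
  obtain ⟨k, hk⟩ := D.exists_controlCoord_eq h2
  refine ⟨k, hγ, h0, P, hP.init, hP.parallel, ?_⟩
  filter_upwards [hk, hE, ae_restrict_mem measurableSet_Icc] with t ht hEt htT
  rw [ht, map_sum]
  simp only [map_smul]
  exact (sub_eq_iff_eq_add.1 (hRP t htT _ hEt))

end DevelopmentData

/-! ### First variation of a development. -/

section Slices

variable {Z W : Type*} [NormedAddCommGroup Z] [NormedSpace ℝ Z] [NormedAddCommGroup W]
  [NormedSpace ℝ W] {T : ℝ}

/-- The derivative in the second variable of a function on `[0,T] × Z`. -/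
def spaceDeriv (T : ℝ) (V : ℝ × Z → W) (t : ℝ) (z : Z) : Z →L[ℝ] W :=
  fderivWithin ℝ V (Icc 0 T ×ˢ univ) (t, z) ∘L ContinuousLinearMap.inr ℝ ℝ Z

theorem hasFDerivAt_spaceDeriv {V : ℝ × Z → W} (hV : ContDiffOn ℝ ∞ V (Icc 0 T ×ˢ univ)) {t : ℝ}
    (ht : t ∈ Icc 0 T) (z : Z) : HasFDerivAt (fun z => V (t, z)) (spaceDeriv T V t z) z := by
  have h1 := (hV.differentiableOn (by simp) (t, z) ⟨ht, mem_univ _⟩).hasFDerivWithinAt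
  have h2 : HasFDerivWithinAt (fun z : Z => (t, z)) (ContinuousLinearMap.inr ℝ ℝ Z) univ z :=
    (hasFDerivAt_prodMk_right t z).hasFDerivWithinAt
  exact hasFDerivWithinAt_univ.1 (h1.comp z h2 fun y _ => ⟨ht, mem_univ _⟩)

theorem continuousOn_spaceDeriv {V : ℝ × Z → W} (hT : 0 < T)
    (hV : ContDiffOn ℝ ∞ V (Icc 0 T ×ˢ univ)) {z : ℝ → Z} (hz : ContinuousOn z (Icc 0 T)) :
    ContinuousOn (fun t => spaceDeriv T V t (z t)) (Icc 0 T) := by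
  have hu : UniqueDiffOn ℝ (Icc 0 T ×ˢ (univ : Set Z)) :=
    (uniqueDiffOn_Icc hT).prod uniqueDiffOn_univ
  have h1 := hV.continuousOn_fderivWithin hu (by simp)
  exact (h1.comp (continuousOn_id.prodMk hz) fun t ht => ⟨ht, mem_univ _⟩).clm_comp
    continuousOn_const

theorem controlFieldDeriv_apply {ι : Type*} [Fintype ι] (V : ι → ℝ × Z → Z) (t : ℝ) (z y : Z)
    (w : ι → ℝ) : controlFieldDeriv T V t z y w = ∑ m, w m • spaceDeriv T (V m) t z y := by
  simp [controlFieldDeriv, spaceDeriv]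

variable {J I : Type*} [Fintype J] [Fintype I] {U : J → ℝ × (J → ℝ) → ℝ}
  {H : J → J → J → (J → ℝ) → ℝ}

/-- Only the position component of the linearized system is ever made explicit. The variation of the
transported basis is obtained from its expansion in sections of E instead, which keeps curvature out
of the computation. -/
theorem spaceDeriv_devField_none (hU : ∀ j, ContDiffOn ℝ ∞ (U j) (Icc 0 T ×ˢ univ))
    (hH : ∀ j k l, ContDiff ℝ ∞ (H j k l)) {t : ℝ} (ht : t ∈ Icc 0 T)
    (z y : Option I → J → ℝ) (m : Option I) (j : J) :
    spaceDeriv T (devField U H m) t z y none j =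
      m.elim (spaceDeriv T (U j) t (z none) (y none)) fun i => y (some i) j := by
  have h := hasFDerivAt_pi'.1 (hasFDerivAt_pi'.1
    (hasFDerivAt_spaceDeriv (contDiffOn_devField hU hH m) ht z) none) j
  rcases m with _ | i
  · have h2 : HasFDerivAt (fun z : Option I → J → ℝ => U j (t, z none)) _ z :=
      HasFDerivAt.comp (g := fun x => U j (t, x)) (f := fun z : Option I → J → ℝ => z none) z
        (hasFDerivAt_spaceDeriv (hU j) ht (z none)) (ContinuousLinearMap.proj (R := ℝ) (φ := fun _ : Option I => J → ℝ) none).hasFDerivAt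
    exact DFunLike.congr_fun (h.unique h2) y
  · have h2 : HasFDerivAt (fun z : Option I → J → ℝ => z (some i) j) _ z :=
      (ContinuousLinearMap.proj (R := ℝ) (φ := fun _ : J => ℝ) j ∘L
        ContinuousLinearMap.proj (R := ℝ) (φ := fun _ : Option I => J → ℝ) (some i)).hasFDerivAt
    exact DFunLike.congr_fun (h.unique h2) y

end Slices

namespace DevelopmentData

variable {F : Type*} [NormedAddCommGroup F] [NormedSpace ℝ F] [FiniteDimensional ℝ F]
  {M : Type uM} [TopologicalSpace M] [ChartedSpace F M] [IsManifold 𝓘(ℝ, F) ∞ M] {T : ℝ}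
  (D : DevelopmentData F M T)

/-- Extensions to Euclidean space of the frame of `E` and of its coefficients. -/
structure IsSectionCoefficients {K : Set M} (𝓕 : CompactFrame D.sr T K)
    (Θ Y : 𝓕.A → 𝓕.J → (𝓕.J → ℝ) → ℝ) : Prop where
  contDiff_Θ : ∀ a j, ContDiff ℝ ∞ (Θ a j)
  Θ_eq : ∀ a j y, 𝓕.emb y ∈ 𝓕.O → Θ a j (𝓕.emb y) = 𝓕.θ a j y
  contDiff_Y : ∀ a j, ContDiff ℝ ∞ (Y a j)
  Y_eq : ∀ a j y, 𝓕.emb y ∈ 𝓕.O → Y a j (𝓕.emb y) = mvfderiv 𝓘(ℝ, F) (𝓕.f j) y (𝓕.X a y).1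

theorem exists_sectionCoefficients (hT : 0 ≤ T) {K : Set M} (𝓕 : CompactFrame D.sr T K) :
    ∃ Θ Y, D.IsSectionCoefficients 𝓕 Θ Y := by
  choose Θ hΘ hΘeq using fun a j => 𝓕.exists_smooth_extension hT (𝓕.contMDiff_θ a j)
  choose Y hY hYeq using fun a j => 𝓕.exists_smooth_extension hT
    ((𝓕.contMDiff_X a).mvfderiv_vf (𝓕.contMDiff_f j))
  exact ⟨Θ, Y, hΘ, hΘeq, hY, hYeq⟩

/-- The coefficient of `X a` in the `i`-th transported basis vector. -/
def stateCoeff {J I : Type*} [Fintype J] (Θ : J → (J → ℝ) → ℝ) (i : I)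
    (z : Option I → J → ℝ) : ℝ :=
  ∑ l, Θ l (z none) * z (some i) l

theorem contDiff_stateCoeff {J I : Type*} [Fintype J] [Fintype I] {Θ : J → (J → ℝ) → ℝ}
    (h : ∀ j, ContDiff ℝ ∞ (Θ j)) (i : I) : ContDiff ℝ ∞ (stateCoeff Θ i) :=
  ContDiff.sum fun l _ => ((h l).comp (contDiff_apply ℝ (J → ℝ) none)).mul
    (contDiff_apply_apply ℝ ℝ (some i) l)

variable {D} [T2Space M]

/-- By uniqueness the endpoint does not depend on the development chosen in the definition, so any
family of developments may be differentiated. -/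
theorem endpointMap_eq {G : D.H → ℝ → M} (hG : ∀ η, D.IsDevelopment η (G η)) (hT : 0 < T) :
    D.endpointMap = fun η => G η T := by
  funext η
  have h : ∃ γ, D.IsDevelopment η γ := ⟨_, hG η⟩
  rw [endpointMap, dif_pos h]
  exact h.choose_spec.eq_of_eq (hG η) hT ⟨hT.le, le_rfl⟩

section Variation

variable {G : D.H → ℝ → M}
  {P : ∀ (η : D.H) (t : ℝ), D.sr.Fiber D.o →ₗ[ℝ] TangentSpace 𝓘(ℝ, F) (G η t)}
  {η₀ : D.H}

theorem exists_variation (hG : ∀ η, D.IsDevelopmentWith η (G η) (P η)) (hT : 0 < T)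
    {𝓕 : CompactFrame D.sr T (trace T (G η₀))}
    {U : 𝓕.J → ℝ × (𝓕.J → ℝ) → ℝ} {H : 𝓕.J → 𝓕.J → 𝓕.J → (𝓕.J → ℝ) → ℝ}
    (hc : D.IsCoefficients 𝓕 U H) :
    ∃ V : ℝ → D.H →L[ℝ] Option D.BasisIndex → 𝓕.J → ℝ,
      (∀ t ∈ Icc 0 T, HasFDerivAt (fun η => D.state 𝓕 (P η) t) (V t) η₀) ∧
      ∀ k, V 0 k = 0 ∧ HasACDeriv T (fun t => V t k) fun t =>
        controlFieldDeriv T (devField U H) t (D.state 𝓕 (P η₀) t) (V t k) (D.control η₀ t) +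
          controlField (devField U H) t (D.state 𝓕 (P η₀) t) (D.controlVar k t) :=
  (SolvesInside.hasFDerivAt hT.le (hc.isC1Family hT) (fun η => (hG η).solvesInside hT hc)
    (fun η => (hG η).state_zero_eq (hG η₀)) (fun _ ht => 𝓕.emb_mem ht)
    (fun η => D.integrableOn_control η) (D.isLinearControl_controlVar hT.le)
    (fun η => D.control_eq_add η η₀)).2

variable {𝓕 : CompactFrame D.sr T (trace T (G η₀))} {t : ℝ}
  {V : D.H →L[ℝ] Option D.BasisIndex → 𝓕.J → ℝ}

theorem mdifferentiableAt_of_variation (hT : 0 < T) (ht : t ∈ Icc 0 T)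
    (hV : HasFDerivAt (fun η => D.state 𝓕 (P η) t) V η₀) :
    MDifferentiableAt 𝓘(ℝ, D.H) 𝓘(ℝ, F) (fun η => G η t) η₀ := by
  have h1 : ContinuousAt (fun η => 𝓕.emb (G η t)) η₀ :=
    (continuous_apply none).continuousAt.comp hV.continuousAt
  refine 𝓕.mdifferentiableAt_of_emb hT.le (𝓕.emb_mem ht)
    (𝓕.tendsto_of_emb hT.le (𝓕.emb_mem ht) h1) fun j => ?_
  exact (hasFDerivAt_pi'.1 (hasFDerivAt_pi'.1 hV none) j).differentiableAt

theorem exists_hasFDerivAt_comp {E : Type*} [NormedAddCommGroup E] [NormedSpace ℝ E] {c : E → M}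
    {z : E} {f : M → ℝ} (hf : ContMDiff 𝓘(ℝ, F) 𝓘(ℝ, ℝ) ∞ f)
    (hc : MDifferentiableAt 𝓘(ℝ, E) 𝓘(ℝ, F) c z) :
    ∃ L : E →L[ℝ] ℝ, HasFDerivAt (fun w => f (c w)) L z ∧
      ∀ k : E, L k = mvfderiv 𝓘(ℝ, F) f (c z) (mfderiv 𝓘(ℝ, E) 𝓘(ℝ, F) c z k) :=
  ⟨_, mvfderiv_comp_curve (hf.mdifferentiable (by simp) _) hc, fun _ => rfl⟩

theorem demb_mfderiv_eq_variation (hT : 0 < T) (ht : t ∈ Icc 0 T)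
    (hV : HasFDerivAt (fun η => D.state 𝓕 (P η) t) V η₀) (k : D.H) :
    𝓕.demb (G η₀ t) (mfderiv 𝓘(ℝ, D.H) 𝓘(ℝ, F) (fun η => G η t) η₀ k) = V k none := by
  funext j
  obtain ⟨L, h1, hL⟩ := exists_hasFDerivAt_comp (𝓕.contMDiff_f j)
    (mdifferentiableAt_of_variation hT ht hV)
  have h2 := hasFDerivAt_pi'.1 (hasFDerivAt_pi'.1 hV none) j
  exact (hL k).symm.trans (DFunLike.congr_fun (h1.unique h2) k)

/-- For every control near η₀ the transported vectors lie in E, so they expand in the sections X_a.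
Differentiating the expansion gives a combination of the X_a plus the derivatives of the X_a along
the variation of the base point; the derivatives of the coefficients remain unspecified. -/
theorem variation_some_eq (hG : ∀ η, D.IsDevelopmentWith η (G η) (P η)) (hT : 0 < T)
    (ht : t ∈ Icc 0 T) {Θ Y : 𝓕.A → 𝓕.J → (𝓕.J → ℝ) → ℝ} (hs : D.IsSectionCoefficients 𝓕 Θ Y)
    (hV : HasFDerivAt (fun η => D.state 𝓕 (P η) t) V η₀) (i : D.BasisIndex) (j : 𝓕.J) (k : D.H) :
    V k (some i) j = ∑ a,
      (fderiv ℝ (stateCoeff (Θ a) i) (D.state 𝓕 (P η₀) t) (V k) * Y a j (𝓕.emb (G η₀ t)) +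
        stateCoeff (Θ a) i (D.state 𝓕 (P η₀) t) *
          fderiv ℝ (Y a j) (𝓕.emb (G η₀ t)) (V k none)) := by
  have h1 := hasFDerivAt_pi'.1 (hasFDerivAt_pi'.1 hV (some i)) j
  have h3 : ∀ a, HasFDerivAt (fun η => stateCoeff (Θ a) i (D.state 𝓕 (P η) t))
      (fderiv ℝ (stateCoeff (Θ a) i) (D.state 𝓕 (P η₀) t) ∘L V) η₀ := fun a =>
    (((contDiff_stateCoeff (hs.contDiff_Θ a) i).differentiable (by simp) _).hasFDerivAt).comp η₀ hV
  have h4 : ∀ a, HasFDerivAt (fun η => Y a j (𝓕.emb (G η t)))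
      (fderiv ℝ (Y a j) (𝓕.emb (G η₀ t)) ∘L
        (ContinuousLinearMap.proj (R := ℝ) (φ := fun _ : Option D.BasisIndex => 𝓕.J → ℝ) none ∘L V))
      η₀ := fun a =>
    (((hs.contDiff_Y a j).differentiable (by simp) _).hasFDerivAt).comp η₀
      (hasFDerivAt_pi'.1 hV none)
  have h5 := HasFDerivAt.fun_sum (u := Finset.univ) fun a _ => (h3 a).mul (h4 a)
  have h6 : (fun η => D.state 𝓕 (P η) t (some i) j) =ᶠ[𝓝 η₀] fun η =>
      ∑ a, stateCoeff (Θ a) i (D.state 𝓕 (P η) t) * Y a j (𝓕.emb (G η t)) := by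
    have hO := hV.continuousAt (D.isOpen_stateDomain 𝓕 |>.mem_nhds (𝓕.emb_mem ht))
    filter_upwards [hO] with η hη
    have hη' : 𝓕.emb (G η t) ∈ 𝓕.O := hη
    have h7 := 𝓕.eq_sum_X _ hη' ⟨_, (hG η).isTransport.mem_E hT ht (D.basis i)⟩
    change mvfderiv 𝓘(ℝ, F) (𝓕.f j) (G η t) (P η t (D.basis i)) = _
    conv_lhs => rw [show P η t (D.basis i) = _ from h7]
    simp only [map_sum, map_smul, smul_eq_mul]
    refine Finset.sum_congr rfl fun a _ => ?_
    rw [hs.Y_eq a j _ hη']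
    congr 1
    refine Finset.sum_congr rfl fun l _ => ?_
    change _ = Θ a l (𝓕.emb (G η t)) * _
    rw [hs.Θ_eq a l _ hη']
    rfl
  have h7 := DFunLike.congr_fun (h1.unique (h5.congr_of_eventuallyEq h6)) k
  refine Eq.trans h7 ?_
  simp only [sum_apply, add_apply, smul_apply, smul_eq_mul, ContinuousLinearMap.comp_apply,
    ContinuousLinearMap.proj_apply]
  exact Finset.sum_congr rfl fun a _ => by ring

end Variation

end DevelopmentData

theorem sum_variation_identity {A I : Type*} [Fintype A] [Fintype I] (w κ : I → ℝ)
    (DC C : A → I → ℝ) (Y DY : A → ℝ) :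
    ∑ i, w i * ∑ a, (DC a i * Y a + C a i * DY a) + ∑ i, κ i * ∑ a, C a i * Y a =
      ∑ a, (∑ i, w i * DC a i + ∑ i, κ i * C a i) * Y a + ∑ a, (∑ i, w i * C a i) * DY a := by
  simp only [Finset.mul_sum, Finset.sum_mul, add_mul, mul_add, Finset.sum_add_distrib]
  have h1 : ∑ i, ∑ a, w i * (DC a i * Y a) = ∑ a, ∑ i, w i * DC a i * Y a := by
    rw [Finset.sum_comm]; simp only [mul_assoc]
  have h2 : ∑ i, ∑ a, w i * (C a i * DY a) = ∑ a, ∑ i, w i * C a i * DY a := by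
    rw [Finset.sum_comm]; simp only [mul_assoc]
  have h3 : ∑ i, ∑ a, κ i * (C a i * Y a) = ∑ a, ∑ i, κ i * C a i * Y a := by
    rw [Finset.sum_comm]; simp only [mul_assoc]
  rw [h1, h2, h3]
  ring

/-! ### The adjoint equation and its pairing with variations. -/

namespace DevelopmentData

variable {F : Type*} [NormedAddCommGroup F] [NormedSpace ℝ F] [FiniteDimensional ℝ F]
  {M : Type uM} [TopologicalSpace M] [ChartedSpace F M] [IsManifold 𝓘(ℝ, F) ∞ M] {T : ℝ}
  (D : DevelopmentData F M T)

section Extremals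

variable {γ : ℝ → M} (𝓕 : CompactFrame D.sr T (trace T γ))

/-- The coefficients of `γ̇ - u` in the frame. -/
def frameCoeff (t : ℝ) (a : 𝓕.A) : ℝ :=
  ∑ j, 𝓕.θ a j (γ t) * 𝓕.demb (γ t) (velocity F γ t - D.u t (γ t)) j

/-- The matrix of the linearized flow of `u + ∑ a, c a • X a`, with `c` the coefficients of
`γ̇ - u`. -/
def varMatrix (t : ℝ) (i j : 𝓕.J) : ℝ :=
  mvfderiv 𝓘(ℝ, F) (fun y => mvfderiv 𝓘(ℝ, F) (𝓕.f i) y (D.u t y)) (γ t) (𝓕.W j (γ t)) +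
    ∑ a, D.frameCoeff 𝓕 t a *
      mvfderiv 𝓘(ℝ, F) (fun y => mvfderiv 𝓘(ℝ, F) (𝓕.f i) y (𝓕.X a y).1) (γ t) (𝓕.W j (γ t))

/-- The adjoint equation along `γ`. -/
def IsExtremal (p : ℝ → 𝓕.J → ℝ) : Prop :=
  HasACDeriv T p fun t j => -∑ i, p t i * D.varMatrix 𝓕 t i j

variable {D} {𝓕}

theorem frameCoeff_spec {t : ℝ} (ht : t ∈ Icc 0 T)
    (h : velocity F γ t - D.u t (γ t) ∈ D.sr.E (γ t)) :
    velocity F γ t - D.u t (γ t) = ∑ a, D.frameCoeff 𝓕 t a • (𝓕.X a (γ t)).1 :=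
  𝓕.eq_sum_X _ (𝓕.emb_mem ht) ⟨_, h⟩

variable {U : 𝓕.J → ℝ × (𝓕.J → ℝ) → ℝ} {H : 𝓕.J → 𝓕.J → 𝓕.J → (𝓕.J → ℝ) → ℝ}

theorem IsCoefficients.mvfderiv_u_eq (hc : D.IsCoefficients 𝓕 U H) {t : ℝ} (ht : t ∈ Icc 0 T)
    (i : 𝓕.J) {y : M} (hy : 𝓕.emb y ∈ 𝓕.O) (v : TangentSpace 𝓘(ℝ, F) y) :
    mvfderiv 𝓘(ℝ, F) (fun y => mvfderiv 𝓘(ℝ, F) (𝓕.f i) y (D.u t y)) y v =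
      spaceDeriv T (U i) t (𝓕.emb y) (𝓕.demb y v) := by
  have h1 := hasFDerivAt_spaceDeriv (hc.contDiffOn_U i) ht (𝓕.emb y)
  rw [𝓕.mvfderiv_eq_fderiv hy (G := fun x => U i (t, x)) (fun z hz => hc.U_eq i t ht z hz)
    h1.differentiableAt v, h1.fderiv]

theorem IsSectionCoefficients.mvfderiv_X_eq {Θ Y : 𝓕.A → 𝓕.J → (𝓕.J → ℝ) → ℝ}
    (hs : D.IsSectionCoefficients 𝓕 Θ Y) (a : 𝓕.A) (j : 𝓕.J) {y : M} (hy : 𝓕.emb y ∈ 𝓕.O)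
    (v : TangentSpace 𝓘(ℝ, F) y) :
    mvfderiv 𝓘(ℝ, F) (fun y => mvfderiv 𝓘(ℝ, F) (𝓕.f j) y (𝓕.X a y).1) y v =
      fderiv ℝ (Y a j) (𝓕.emb y) (𝓕.demb y v) :=
  𝓕.mvfderiv_eq_fderiv hy (fun z hz => hs.Y_eq a j z hz)
    ((hs.contDiff_Y a j).differentiable (by simp) _) v

variable [T2Space M]

theorem continuousOn_mvfderiv_mvfderiv_u (hγ : IsH1Curve F T γ) (hT : 0 < T)
    {f : M → ℝ} (hf : ContMDiff 𝓘(ℝ, F) 𝓘(ℝ, ℝ) ∞ f) {W : ∀ y : M, TangentSpace 𝓘(ℝ, F) y}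
    (hW : ContMDiff 𝓘(ℝ, F) 𝓘(ℝ, F).tangent ∞ (vfMap W)) :
    ContinuousOn (fun t => mvfderiv 𝓘(ℝ, F) (fun y => mvfderiv 𝓘(ℝ, F) f y (D.u t y)) (γ t)
      (W (γ t))) (Icc 0 T) := by
  obtain ⟨𝓕⟩ := exists_compactFrame D.sr T hγ.isCompact_trace
  obtain ⟨U, hU, hUeq⟩ := 𝓕.exists_extension
    (fun t y => mvfderiv 𝓘(ℝ, F) f y (D.u t y)) (D.contMDiffOn_mvfderiv_u hf)
  have h1 : ContinuousOn (fun t => spaceDeriv T U t (𝓕.emb (γ t))) (Icc 0 T) :=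
    continuousOn_spaceDeriv hT hU (𝓕.continuous_emb.comp_continuousOn hγ.continuousOn)
  have h2 : ContinuousOn (fun t => 𝓕.demb (γ t) (W (γ t))) (Icc 0 T) :=
    continuousOn_pi.2 fun j => hγ.continuousOn_comp
      (g := fun y => mvfderiv 𝓘(ℝ, F) (𝓕.f j) y (W y)) (hW.mvfderiv_vf (𝓕.contMDiff_f j))
  refine (h1.clm_apply h2).congr fun t ht => ?_
  have h3 := hasFDerivAt_spaceDeriv hU ht (𝓕.emb (γ t))
  rw [𝓕.mvfderiv_eq_fderiv (𝓕.emb_mem ht) (G := fun x => U (t, x)) (fun z hz => hUeq t ht z hz)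
    h3.differentiableAt, h3.fderiv]

theorem memLp_frameCoeff (hγ : IsH1Curve F T γ) (hT : 0 < T) (a : 𝓕.A) :
    MemLp (fun t => D.frameCoeff 𝓕 t a) 2 (volume.restrict (Icc 0 T)) := by
  refine memLp_finsetSum _ fun j _ => ?_
  refine memLp_bilin (ContinuousLinearMap.mul ℝ ℝ) (hγ.continuousOn_comp (𝓕.contMDiff_θ a j)) ?_
  have h2 := (hγ.memLp hT 𝓕 (𝓕.contMDiff_f j)).sub
    (memLp_bilin (ContinuousLinearMap.mul ℝ ℝ)
      (D.continuousOn_mvfderiv_u hγ.continuousOn (𝓕.contMDiff_f j)) (memLp_const (1 : ℝ)))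
  refine h2.ae_eq (.of_forall fun t => ?_)
  simp only [map_sub, Pi.sub_apply, CompactFrame.demb_apply, ContinuousLinearMap.mul_apply',
    mul_one]

theorem integrableOn_varMatrix (hγ : IsH1Curve F T γ) (hT : 0 < T) (i j : 𝓕.J) :
    IntegrableOn (fun t => D.varMatrix 𝓕 t i j) (Icc 0 T) := by
  refine Integrable.add ?_ (integrable_finsetSum _ fun a _ => ?_)
  · exact (continuousOn_mvfderiv_mvfderiv_u hγ hT (𝓕.contMDiff_f i)
      (𝓕.contMDiff_W j)).integrableOn_Icc
  · have h1 : ContinuousOn (fun t => mvfderiv 𝓘(ℝ, F) (fun y => mvfderiv 𝓘(ℝ, F) (𝓕.f i) y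
        (𝓕.X a y).1) (γ t) (𝓕.W j (γ t))) (Icc 0 T) :=
      hγ.continuousOn_comp (g := fun z => mvfderiv 𝓘(ℝ, F) (fun y => mvfderiv 𝓘(ℝ, F) (𝓕.f i) y
        (𝓕.X a y).1) z (𝓕.W j z))
        ((𝓕.contMDiff_W j).mvfderiv_vf ((𝓕.contMDiff_X a).mvfderiv_vf (𝓕.contMDiff_f i)))
    have h2 := integrableOn_mul_of_continuousOn h1
      ((memLp_frameCoeff (D := D) hγ hT a).integrable (by norm_num))
    exact h2.congr (.of_forall fun t => mul_comm _ _)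

theorem exists_isExtremal (hγ : IsH1Curve F T γ) (hT : 0 < T) {t₀ : ℝ} (ht₀ : t₀ ∈ Icc 0 T)
    (x : 𝓕.J → ℝ) : ∃ p, p t₀ = x ∧ D.IsExtremal 𝓕 p := by
  obtain ⟨p, hp0, hp⟩ := exists_linear_ode_at hT.le
    (integrableOn_matCLM (a := fun t j i => -D.varMatrix 𝓕 t i j)
      fun j i => (integrableOn_varMatrix hγ hT i j).neg) ht₀ x
  refine ⟨p, hp0, hp.congr_ae (.of_forall fun t => ?_)⟩
  funext j
  simp only [matCLM_apply, ← Finset.sum_neg_distrib]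
  exact Finset.sum_congr rfl fun i _ => by ring

end Extremals

section Pairing

variable {D} [T2Space M] {G : D.H → ℝ → M}
  {P : ∀ (η : D.H) (t : ℝ), D.sr.Fiber D.o →ₗ[ℝ] TangentSpace 𝓘(ℝ, F) (G η t)}
  {η₀ : D.H} {𝓕 : CompactFrame D.sr T (trace T (G η₀))}
  {U : 𝓕.J → ℝ × (𝓕.J → ℝ) → ℝ} {H : 𝓕.J → 𝓕.J → 𝓕.J → (𝓕.J → ℝ) → ℝ}
  {Θ Y : 𝓕.A → 𝓕.J → (𝓕.J → ℝ) → ℝ} {V : ℝ → D.H →L[ℝ] Option D.BasisIndex → 𝓕.J → ℝ}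

/-- The rate of change of the variation in the directions of the frame, for the variation `y` of
the state and the variation `κ` of the control. -/
def variationRate (Θ : 𝓕.A → 𝓕.J → (𝓕.J → ℝ) → ℝ) (w κ : D.BasisIndex → ℝ)
    (z y : Option D.BasisIndex → 𝓕.J → ℝ) (a : 𝓕.A) : ℝ :=
  ∑ i, w i * fderiv ℝ (stateCoeff (Θ a) i) z y + ∑ i, κ i * stateCoeff (Θ a) i z

theorem state_some_eq (hG : ∀ η, D.IsDevelopmentWith η (G η) (P η)) (hT : 0 < T)
    (hs : D.IsSectionCoefficients 𝓕 Θ Y) {t : ℝ} (ht : t ∈ Icc 0 T) (i : D.BasisIndex) :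
    P η₀ t (D.basis i) =
      ∑ a, stateCoeff (Θ a) i (D.state 𝓕 (P η₀) t) • (𝓕.X a (G η₀ t)).1 := by
  refine (𝓕.eq_sum_X _ (𝓕.emb_mem ht) ⟨_, (hG η₀).isTransport.mem_E hT ht (D.basis i)⟩).trans ?_
  refine Finset.sum_congr rfl fun a _ => ?_
  congr 1
  refine Finset.sum_congr rfl fun l _ => ?_
  change _ = Θ a l (𝓕.emb (G η₀ t)) * _
  rw [hs.Θ_eq a l _ (𝓕.emb_mem ht)]
  rfl

/-- The position variation obeys the linearized flow of u + Σ c_a X_a up to a vector of E, by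
`variation_some_eq`. The adjoint equation cancels the flow part exactly, and p evaluated on the
vector of E remains. -/
theorem hasACDeriv_pairing (hG : ∀ η, D.IsDevelopmentWith η (G η) (P η)) (hT : 0 < T)
    (hc : D.IsCoefficients 𝓕 U H) (hs : D.IsSectionCoefficients 𝓕 Θ Y)
    (hV : ∀ t ∈ Icc 0 T, HasFDerivAt (fun η => D.state 𝓕 (P η) t) (V t) η₀) {k : D.H}
    (hVk : HasACDeriv T (fun t => V t k) fun t =>
        controlFieldDeriv T (devField U H) t (D.state 𝓕 (P η₀) t) (V t k) (D.control η₀ t) +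
          controlField (devField U H) t (D.state 𝓕 (P η₀) t) (D.controlVar k t))
    {p : ℝ → 𝓕.J → ℝ} (hp : D.IsExtremal 𝓕 p) :
    HasACDeriv T (fun t => ∑ j, p t j * V t k none j) fun t =>
      ∑ a, variationRate Θ (D.controlCoord η₀ t) (D.controlCoord k t) (D.state 𝓕 (P η₀) t)
        (V t k) a * ∑ j, p t j * mvfderiv 𝓘(ℝ, F) (𝓕.f j) (G η₀ t) (𝓕.X a (G η₀ t)).1 := by
  have h1 := HasACDeriv.sum Finset.univ fun j _ =>
    (hp.eval hT.le j).mul hT.le ((hVk.eval hT.le none).eval hT.le j)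
  refine h1.congr_ae ?_
  filter_upwards [(hG η₀).velocity_eq_sum, ae_restrict_mem measurableSet_Icc] with t hv ht
  set z := D.state 𝓕 (P η₀) t
  set y := V t k
  set w := D.controlCoord η₀ t
  set κ := D.controlCoord k t
  have hO := 𝓕.emb_mem ht
  have hz : z none = 𝓕.emb (G η₀ t) := rfl
  have hξ : 𝓕.demb (G η₀ t) (mfderiv 𝓘(ℝ, D.H) 𝓘(ℝ, F) (fun η => G η t) η₀ k) = y none :=
    demb_mfderiv_eq_variation hT ht (hV t ht) k
  have hy : ∀ i j, y (some i) j = ∑ a, (fderiv ℝ (stateCoeff (Θ a) i) z y *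
      Y a j (𝓕.emb (G η₀ t)) + stateCoeff (Θ a) i z *
        fderiv ℝ (Y a j) (𝓕.emb (G η₀ t)) (y none)) :=
    fun i j => variation_some_eq hG hT ht hs (hV t ht) i j k
  set v := mfderiv 𝓘(ℝ, D.H) 𝓘(ℝ, F) (fun η => G η t) η₀ k
  have hc_a : ∀ a, D.frameCoeff 𝓕 t a = ∑ i, w i * stateCoeff (Θ a) i z := by
    intro a
    have h2 : velocity F (G η₀) t - D.u t (G η₀ t) = ∑ i, w i • P η₀ t (D.basis i) := by
      rw [hv, add_sub_cancel_right]
    rw [frameCoeff, h2]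
    simp only [map_sum, map_smul, Finset.sum_apply, Pi.smul_apply, smul_eq_mul, Finset.mul_sum]
    rw [Finset.sum_comm]
    refine Finset.sum_congr rfl fun i _ => ?_
    rw [stateCoeff, Finset.mul_sum]
    refine Finset.sum_congr rfl fun l _ => ?_
    rw [hz, hs.Θ_eq a l _ hO]
    change _ * (_ * 𝓕.demb (G η₀ t) (P η₀ t (D.basis i)) l) =
      _ * (_ * 𝓕.demb (G η₀ t) (P η₀ t (D.basis i)) l)
    ring
  have hQ : ∀ i j, z (some i) j = ∑ a, stateCoeff (Θ a) i z * Y a j (𝓕.emb (G η₀ t)) := by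
    intro i j
    change 𝓕.demb (G η₀ t) (P η₀ t (D.basis i)) j = _
    rw [state_some_eq hG hT hs ht i]
    simp only [map_sum, map_smul, Finset.sum_apply, Pi.smul_apply, smul_eq_mul]
    exact Finset.sum_congr rfl fun a _ => by rw [hs.Y_eq a j _ hO]; rfl
  -- `varMatrix` is defined by intrinsic derivatives along the W l. As y none is the image of the
  -- tangent vector v, contracting with it rebuilds the derivative along v, which is the derivative
  -- of the Euclidean extensions along y none.
  have hL : ∀ j, ∑ l, D.varMatrix 𝓕 t j l * y none l = spaceDeriv T (U j) t (z none) (y none) +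
      ∑ a, (∑ i, w i * stateCoeff (Θ a) i z) * fderiv ℝ (Y a j) (𝓕.emb (G η₀ t)) (y none) := by
    intro j
    have h3 : ∀ g : M → ℝ, ∑ l, mvfderiv 𝓘(ℝ, F) g (G η₀ t) (𝓕.W l (G η₀ t)) * y none l =
        mvfderiv 𝓘(ℝ, F) g (G η₀ t) v := by
      intro g
      conv_rhs => rw [← 𝓕.sum_demb hO v, map_sum]
      exact Finset.sum_congr rfl fun l _ => by rw [map_smul, smul_eq_mul, mul_comm, hξ]
    simp only [varMatrix, add_mul, Finset.sum_add_distrib, h3, Finset.sum_mul]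
    rw [hc.mvfderiv_u_eq ht j hO, hξ, hz, Finset.sum_comm]
    congr 1
    refine Finset.sum_congr rfl fun a _ => ?_
    simp only [mul_assoc, ← Finset.mul_sum, h3]
    rw [hs.mvfderiv_X_eq a j hO, hξ, hc_a, Finset.sum_mul]
    simp only [mul_assoc]
  have hder : ∀ j, (controlFieldDeriv T (devField U H) t z y (D.control η₀ t) +
      controlField (devField U H) t z (D.controlVar k t)) none j =
      spaceDeriv T (U j) t (z none) (y none) + (∑ i, w i * y (some i) j +
        ∑ i, κ i * z (some i) j) := by
    intro j
    rw [controlFieldDeriv_apply, controlField_apply]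
    simp only [Pi.add_apply, Finset.sum_apply, Pi.smul_apply, smul_eq_mul]
    rw [Fintype.sum_option, Fintype.sum_option]
    simp only [spaceDeriv_devField_none hc.contDiffOn_U hc.contDiff_H ht]
    change 1 * _ + _ + (0 * _ + _) = _
    rw [one_mul, zero_mul, zero_add, add_assoc]
    rfl
  -- Inserting the expansions of y (some i) and z (some i) in the sections collects all derivatives
  -- of sections into `varMatrix`; the rest is a combination of the X a.
  have hfin : ∀ j, (controlFieldDeriv T (devField U H) t z y (D.control η₀ t) +
      controlField (devField U H) t z (D.controlVar k t)) none j =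
      ∑ l, D.varMatrix 𝓕 t j l * y none l +
        ∑ a, variationRate Θ w κ z y a * Y a j (𝓕.emb (G η₀ t)) := by
    intro j
    rw [hder, hL]
    simp only [hy, hQ]
    rw [sum_variation_identity]
    simp only [variationRate]
    ring
  simp only [hfin]
  have h4 : ∑ j, (-∑ i, p t i * D.varMatrix 𝓕 t i j) * y none j =
      -∑ j, p t j * ∑ l, D.varMatrix 𝓕 t j l * y none l := by
    simp only [neg_mul, Finset.sum_neg_distrib, Finset.sum_mul, Finset.mul_sum, mul_assoc]
    rw [Finset.sum_comm]
  rw [Finset.sum_add_distrib, h4]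
  simp only [mul_add, Finset.sum_add_distrib, neg_add_cancel_left]
  simp only [Finset.mul_sum]
  rw [Finset.sum_comm]
  refine Finset.sum_congr rfl fun a _ => Finset.sum_congr rfl fun j _ => ?_
  rw [hs.Y_eq a j _ hO]
  ring

end Pairing

end DevelopmentData

/-- Closing the loop keeps the equation linear: its matrix is A − C B, still integrable, with
inhomogeneity C β. -/
theorem exists_feedback_ode {Z X : Type*} [NormedAddCommGroup Z] [NormedSpace ℝ Z]
    [FiniteDimensional ℝ Z] [NormedAddCommGroup X] [NormedSpace ℝ X] {T : ℝ} (hT : 0 ≤ T)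
    {A : ℝ → Z →L[ℝ] Z} (hA : IntegrableOn A (Icc 0 T)) {C : ℝ → X →L[ℝ] Z}
    (hC : ContinuousOn C (Icc 0 T)) {B : ℝ → Z →L[ℝ] X} (hB : IntegrableOn B (Icc 0 T))
    {β : ℝ → X} (hβ : ContinuousOn β (Icc 0 T)) :
    ∃ q : ℝ → Z, q 0 = 0 ∧ HasACDeriv T q fun t => A t (q t) + C t (β t - B t (q t)) := by
  have hCB := integrableOn_bilin (ContinuousLinearMap.compL ℝ Z X Z) hC hB
  obtain ⟨q, hq0, hq⟩ := exists_linear_ode_inhomogeneous hT (hA.sub hCB)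
    (hC.clm_apply hβ).integrableOn_Icc
  refine ⟨q, hq0, hq.congr_ae (.of_forall fun t => ?_)⟩
  simp only [Pi.sub_apply, sub_apply, ContinuousLinearMap.compL_apply,
    ContinuousLinearMap.comp_apply, map_sub]
  abel

theorem integrableOn_smul {Z : Type*} [NormedAddCommGroup Z] [NormedSpace ℝ Z] {T : ℝ} {w : ℝ → ℝ}
    {a : ℝ → Z} (hw : IntegrableOn w (Icc 0 T)) (ha : ContinuousOn a (Icc 0 T)) :
    IntegrableOn (fun t => w t • a t) (Icc 0 T) :=
  integrableOn_bilin (ContinuousLinearMap.lsmul ℝ ℝ).flip ha hw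

theorem integrableOn_sum_smul {Z : Type*} [NormedAddCommGroup Z] [NormedSpace ℝ Z] {T : ℝ}
    {A I : Type*} [Fintype A] [Fintype I] {w : I → ℝ → ℝ} {a : A → I → ℝ → Z}
    (hw : ∀ i, IntegrableOn (w i) (Icc 0 T)) (ha : ∀ b i, ContinuousOn (a b i) (Icc 0 T)) :
    IntegrableOn (fun t => ∑ b, ∑ i, w i t • a b i t) (Icc 0 T) :=
  integrable_finsetSum _ fun b _ => integrable_finsetSum _ fun i _ =>
    integrableOn_smul (hw i) (ha b i)

theorem memLp_smul {Z : Type*} [NormedAddCommGroup Z] [NormedSpace ℝ Z] {T : ℝ} {w : ℝ → ℝ}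
    {a : ℝ → Z} (hw : MemLp w 2 (volume.restrict (Icc 0 T))) (ha : ContinuousOn a (Icc 0 T)) :
    MemLp (fun t => w t • a t) 2 (volume.restrict (Icc 0 T)) :=
  memLp_bilin (ContinuousLinearMap.lsmul ℝ ℝ).flip ha hw

theorem sum_mul_sum_comm {A I : Type*} [Fintype A] [Fintype I] (κ : I → ℝ) (c : A → I → ℝ)
    (m : A → ℝ) : ∑ a, (∑ i, κ i * c a i) * m a = ∑ i, κ i * ∑ a, c a i * m a := by
  simp only [Finset.sum_mul, Finset.mul_sum]
  rw [Finset.sum_comm]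
  simp only [mul_assoc]

theorem sum_mul_sum_mul {A I : Type*} [Fintype A] [Fintype I] (w β : I → ℝ) (d r : A → I → ℝ) :
    ∑ a, (∑ m, w m * d a m) * ∑ i, r a i * β i =
      ∑ i, (∑ a, ∑ m, w m * (d a m * r a i)) * β i := by
  have h : ∀ i, (∑ a, ∑ m, w m * (d a m * r a i)) * β i =
      ∑ a, (∑ m, w m * (d a m * r a i)) * β i := fun i => Finset.sum_mul _ _ _
  simp only [h]
  conv_rhs => rw [Finset.sum_comm]
  refine Finset.sum_congr rfl fun a _ => ?_
  rw [Finset.mul_sum]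
  refine Finset.sum_congr rfl fun i _ => ?_
  rw [Finset.sum_mul, Finset.sum_mul]
  exact Finset.sum_congr rfl fun m _ => by ring

theorem exists_functional_of_not_surjective {X Z : Type*} [AddCommGroup X] [Module ℝ X]
    [AddCommGroup Z] [Module ℝ Z] (L : X →ₗ[ℝ] Z) (h : ¬ ∀ v, ∃ k, L k = v) :
    ∃ f : Z →ₗ[ℝ] ℝ, f ≠ 0 ∧ ∀ k, f (L k) = 0 := by
  have hL : LinearMap.range L < ⊤ := lt_top_iff_ne_top.2 fun h2 => h (LinearMap.range_eq_top.1 h2)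
  obtain ⟨f, hf0, hf⟩ := Submodule.exists_le_ker_of_lt_top _ hL
  exact ⟨f, hf0, fun k => hf ⟨k, rfl⟩⟩

/-! ### Singular controls characterized by adjoint solutions vanishing on E. -/

namespace DevelopmentData

variable {F : Type*} [NormedAddCommGroup F] [NormedSpace ℝ F] [FiniteDimensional ℝ F]
  {M : Type uM} [TopologicalSpace M] [ChartedSpace F M] [IsManifold 𝓘(ℝ, F) ∞ M] {T : ℝ}
  {D : DevelopmentData F M T} [T2Space M] {G : D.H → ℝ → M}
  {P : ∀ (η : D.H) (t : ℝ), D.sr.Fiber D.o →ₗ[ℝ] TangentSpace 𝓘(ℝ, F) (G η t)}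
  {η₀ : D.H} {𝓕 : CompactFrame D.sr T (trace T (G η₀))}
  {U : 𝓕.J → ℝ × (𝓕.J → ℝ) → ℝ} {H : 𝓕.J → 𝓕.J → 𝓕.J → (𝓕.J → ℝ) → ℝ}
  {Θ Y : 𝓕.A → 𝓕.J → (𝓕.J → ℝ) → ℝ} {V : ℝ → D.H →L[ℝ] Option D.BasisIndex → 𝓕.J → ℝ}

theorem isRegular_iff (hG : ∀ η, D.IsDevelopmentWith η (G η) (P η)) (hT : 0 < T)
    (hV : HasFDerivAt (fun η => D.state 𝓕 (P η) T) (V T) η₀) :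
    D.IsRegular η₀ ↔ ∀ v : TangentSpace 𝓘(ℝ, F) (G η₀ T), ∃ k : D.H,
      mfderiv 𝓘(ℝ, D.H) 𝓘(ℝ, F) (fun η => G η T) η₀ k = v := by
  have h1 := endpointMap_eq (fun η => (hG η).isDevelopment) hT
  rw [IsRegular, h1, and_iff_right (mdifferentiableAt_of_variation hT ⟨hT.le, le_rfl⟩ hV)]
  rfl

/-- If p kills E, its pairing with every variation is constant, and variations vanish at time 0. So
p_T annihilates the image of the differential without being zero. -/
theorem not_isRegular_of_isExtremal (hG : ∀ η, D.IsDevelopment η (G η)) (hT : 0 < T)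
    {p : ℝ → 𝓕.J → ℝ} (hp : D.IsExtremal 𝓕 p)
    (hpE : ∀ t ∈ Icc 0 T, ∀ v ∈ D.sr.E (G η₀ t), ∑ j, p t j * 𝓕.demb (G η₀ t) v j = 0)
    {v : TangentSpace 𝓘(ℝ, F) (G η₀ T)} (hv : ∑ j, p T j * 𝓕.demb (G η₀ T) v j ≠ 0) :
    ¬ D.IsRegular η₀ := by
  choose P hG using fun η => (hG η).exists_with
  obtain ⟨U, H, hc⟩ := D.exists_coefficients hT.le 𝓕
  obtain ⟨Θ, Y, hs⟩ := D.exists_sectionCoefficients hT.le 𝓕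
  obtain ⟨V, hV, hVk⟩ := exists_variation hG hT hc
  have h0 : (0 : ℝ) ∈ Icc 0 T := ⟨le_rfl, hT.le⟩
  have h1 : T ∈ Icc 0 T := ⟨hT.le, le_rfl⟩
  rw [isRegular_iff hG hT (hV T h1)]
  intro hreg
  obtain ⟨k, hk⟩ := hreg v
  have h2 := (hasACDeriv_pairing hG hT hc hs hV (hVk k).2 hp).eq_of_deriv_zero hT.le
    (by
      filter_upwards [ae_restrict_mem measurableSet_Icc] with t ht
      refine Finset.sum_eq_zero fun a _ => ?_
      exact (congrArg _ (hpE t ht _ (𝓕.X a (G η₀ t)).2)).trans (mul_zero _)) h0 h1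
  rw [(hVk k).1] at h2
  refine hv ?_
  rw [← hk, demb_mfderiv_eq_variation hT h1 (hV T h1) k, ← h2]
  simp

/-- The directions of `E` in which the variation of the frame moves, in the transported basis. -/
def feedback (Θ : 𝓕.A → 𝓕.J → (𝓕.J → ℝ) → ℝ) (P : ∀ t : ℝ, D.sr.Fiber D.o →ₗ[ℝ] TangentSpace 𝓘(ℝ, F) (G η₀ t))
    (R : ℝ → (𝓕.J → ℝ) →L[ℝ] D.BasisIndex → ℝ) (a : 𝓕.A) (i : D.BasisIndex) (t : ℝ) :
    (Option D.BasisIndex → 𝓕.J → ℝ) →L[ℝ] D.BasisIndex → ℝ :=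
  R t ∘L (fderiv ℝ (stateCoeff (Θ a) i) (D.state 𝓕 P t)).smulRight
    (𝓕.demb (G η₀ t) (𝓕.X a (G η₀ t)).1)

theorem continuousOn_state (hG : ∀ η, D.IsDevelopmentWith η (G η) (P η)) (hT : 0 < T) :
    ContinuousOn (D.state 𝓕 (P η₀)) (Icc 0 T) := by
  obtain ⟨U, H, hc⟩ := D.exists_coefficients hT.le 𝓕
  exact ((hG η₀).solvesInside hT hc).1

theorem continuousOn_feedback (hG : ∀ η, D.IsDevelopmentWith η (G η) (P η)) (hT : 0 < T)
    (hs : D.IsSectionCoefficients 𝓕 Θ Y) {R : ℝ → (𝓕.J → ℝ) →L[ℝ] D.BasisIndex → ℝ}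
    (hR : ContinuousOn R (Icc 0 T)) (a : 𝓕.A) (i : D.BasisIndex) :
    ContinuousOn (feedback Θ (P η₀) R a i) (Icc 0 T) := by
  have h1 : ContinuousOn (fun t => fderiv ℝ (stateCoeff (Θ a) i) (D.state 𝓕 (P η₀) t))
      (Icc 0 T) := ((contDiff_stateCoeff (hs.contDiff_Θ a) i).continuous_fderiv
        (by simp)).comp_continuousOn (continuousOn_state hG hT)
  have h2 : ContinuousOn (fun t => 𝓕.demb (G η₀ t) (𝓕.X a (G η₀ t)).1) (Icc 0 T) :=
    continuousOn_pi.2 fun j => (hG η₀).isH1Curve.continuousOn_comp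
      (g := fun y => mvfderiv 𝓘(ℝ, F) (𝓕.f j) y (𝓕.X a y).1)
      ((𝓕.contMDiff_X a).mvfderiv_vf (𝓕.contMDiff_f j))
  exact hR.clm_comp (((ContinuousLinearMap.smulRightL ℝ _ _).continuous.comp_continuousOn
    h1).clm_apply h2)

/-- A control whose variation moves in `E` with prescribed components. -/
theorem exists_feedback_control (hG : ∀ η, D.IsDevelopmentWith η (G η) (P η)) (hT : 0 < T)
    (hc : D.IsCoefficients 𝓕 U H) (hs : D.IsSectionCoefficients 𝓕 Θ Y)
    (hVk : ∀ k, V 0 k = 0 ∧ HasACDeriv T (fun t => V t k) fun t =>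
        controlFieldDeriv T (devField U H) t (D.state 𝓕 (P η₀) t) (V t k) (D.control η₀ t) +
          controlField (devField U H) t (D.state 𝓕 (P η₀) t) (D.controlVar k t))
    {R : ℝ → (𝓕.J → ℝ) →L[ℝ] D.BasisIndex → ℝ} (hR : ContinuousOn R (Icc 0 T))
    {β : ℝ → D.BasisIndex → ℝ} (hβ : ContinuousOn β (Icc 0 T)) :
    ∃ k : D.H, ∀ᵐ t ∂(volume.restrict (Icc 0 T)), D.controlCoord k t +
      ∑ a, ∑ i, D.controlCoord η₀ t i • feedback Θ (P η₀) R a i t (V t k) = β t := by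
  have hz := continuousOn_state (𝓕 := 𝓕) hG hT (η₀ := η₀)
  have hfam := hc.isC1Family hT
  have hO : ∀ t ∈ Icc 0 T, D.state 𝓕 (P η₀) t ∈ D.stateDomain 𝓕 := fun t ht => 𝓕.emb_mem ht
  have hA0 : IntegrableOn (fun t => (controlFieldDeriv T (devField U H) t
      (D.state 𝓕 (P η₀) t)).flip (D.control η₀ t)) (Icc 0 T) :=
    integrableOn_flip_apply (hfam.continuousOn_deriv_comp hz hO) (D.integrableOn_control η₀)
  let e : (D.BasisIndex → ℝ) →L[ℝ] Option D.BasisIndex → ℝ :=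
    ContinuousLinearMap.pi fun m => m.elim 0 fun i => ContinuousLinearMap.proj i
  have hC : ContinuousOn (fun t => controlField (devField U H) t (D.state 𝓕 (P η₀) t) ∘L e)
      (Icc 0 T) := (hfam.continuousOn_comp le_rfl hz hO).clm_comp continuousOn_const
  let B : ℝ → (Option D.BasisIndex → 𝓕.J → ℝ) →L[ℝ] D.BasisIndex → ℝ := fun t =>
    ∑ a, ∑ i, D.controlCoord η₀ t i • feedback Θ (P η₀) R a i t
  have hB : IntegrableOn B (Icc 0 T) :=
    integrableOn_sum_smul (fun i => (D.memLp_controlCoord η₀ i).integrable (by norm_num))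
      fun a i => continuousOn_feedback hG hT hs hR a i
  -- The feedback term involves the variation caused by the control being sought. The closed-loop
  -- equation is solved first, and the control is then read off as β − B q.
  obtain ⟨q, hq0, hq⟩ := exists_feedback_ode hT.le hA0 hC hB hβ
  have hqc := hq.continuousOn hT.le
  have hκ : MemLp (fun t => β t - B t (q t)) 2 (volume.restrict (Icc 0 T)) := by
    have h1 : MemLp β 2 (volume.restrict (Icc 0 T)) := by
      have := memLp_smul (memLp_const (1 : ℝ)) hβ
      simpa using this
    refine h1.sub ?_
    simp only [B, sum_apply, smul_apply]
    refine memLp_finsetSum _ fun a _ => memLp_finsetSum _ fun i _ => ?_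
    exact memLp_smul (D.memLp_controlCoord η₀ i)
      ((continuousOn_feedback hG hT hs hR a i).clm_apply hqc)
  obtain ⟨k, hk⟩ := D.exists_controlCoord_eq hκ
  have hk' : ∀ᵐ t ∂(volume.restrict (Icc 0 T)), D.controlCoord k t = β t - B t (q t) := by
    filter_upwards [hk] with t ht
    funext i
    rw [controlCoord, ht]
    simpa using D.basis.orthonormal.inner_right_fintype (β t - B t (q t)) i
  -- Both solve the linearized system with this control and vanish at time 0.
  have hVq : ∀ t ∈ Icc 0 T, V t k = q t := by
    have h1 : HasACDeriv T (fun t => V t k - q t) fun t => (controlFieldDeriv T (devField U H) t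
        (D.state 𝓕 (P η₀) t)).flip (D.control η₀ t) (V t k - q t) := by
      have := (hVk k).2.add (hq.neg)
      refine HasACDeriv.congr_ae (this.congr hT.le fun t _ => sub_eq_add_neg _ _) ?_
      filter_upwards [hk'] with t ht
      have h2 : D.controlVar k t = e (β t - B t (q t)) := by
        rw [← ht]
        funext m
        rcases m with _ | i <;> rfl
      rw [h2]
      simp only [ContinuousLinearMap.flip_apply, ContinuousLinearMap.comp_apply, map_sub]
      abel
    intro t ht
    exact sub_eq_zero.1 (h1.linear_ode_unique hT.le hA0 ⟨le_rfl, hT.le⟩ ht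
      (by rw [(hVk k).1, hq0, sub_zero]))
  refine ⟨k, ?_⟩
  filter_upwards [hk', ae_restrict_mem measurableSet_Icc] with t ht htT
  rw [ht, hVq t htT]
  simp [B]

/-- The variation is steered in the direction in E dual to p itself: the pairing then grows at the
rate Σ β_i², yet it starts at zero and ends at f(dΠ k) = 0. By continuity all β_i vanish. -/
theorem exists_isExtremal_of_not_isRegular (hG : ∀ η, D.IsDevelopment η (G η)) (hT : 0 < T)
    (h : ¬ D.IsRegular η₀) (𝓕 : CompactFrame D.sr T (trace T (G η₀))) :
    ∃ p, D.IsExtremal 𝓕 p ∧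
      (∀ t ∈ Icc 0 T, ∀ v ∈ D.sr.E (G η₀ t), ∑ j, p t j * 𝓕.demb (G η₀ t) v j = 0) ∧
      ∃ v : TangentSpace 𝓘(ℝ, F) (G η₀ T), ∑ j, p T j * 𝓕.demb (G η₀ T) v j ≠ 0 := by
  choose P hG using fun η => (hG η).exists_with
  obtain ⟨U, H, hc⟩ := D.exists_coefficients hT.le 𝓕
  obtain ⟨Θ, Y, hs⟩ := D.exists_sectionCoefficients hT.le 𝓕
  obtain ⟨V, hV, hVk⟩ := exists_variation hG hT hc
  have h0 : (0 : ℝ) ∈ Icc 0 T := ⟨le_rfl, hT.le⟩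
  have h1 : T ∈ Icc 0 T := ⟨hT.le, le_rfl⟩
  rw [isRegular_iff hG hT (hV T h1)] at h
  obtain ⟨f, hf0, hf⟩ := exists_functional_of_not_surjective
    (mfderiv 𝓘(ℝ, D.H) 𝓘(ℝ, F) (fun η => G η T) η₀).toLinearMap h
  -- The components f(W_j) represent f on tangent vectors, because the W_j reconstruct them. The
  -- adjoint equation is solved backwards from these values.
  obtain ⟨p, hpT, hp⟩ := exists_isExtremal (𝓕 := 𝓕) (hG η₀).isH1Curve hT h1
    fun j => f (𝓕.W j (G η₀ T))
  have hpf : ∀ v : TangentSpace 𝓘(ℝ, F) (G η₀ T), ∑ j, p T j * 𝓕.demb (G η₀ T) v j = f v := by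
    intro v
    conv_rhs => rw [← 𝓕.sum_demb (𝓕.emb_mem h1) v, map_sum]
    rw [hpT]
    exact Finset.sum_congr rfl fun j _ => by rw [map_smul, smul_eq_mul, mul_comm]
  refine ⟨p, hp, ?_, ?_⟩
  swap
  · obtain ⟨v, hv⟩ : ∃ v, f v ≠ 0 := by
      by_contra! h3
      exact hf0 (LinearMap.ext h3)
    exact ⟨v, by rwa [hpf]⟩
  obtain ⟨R, hR, hRP⟩ := (hG η₀).isTransport.exists_inverse hT 𝓕
  have hz := continuousOn_state (𝓕 := 𝓕) hG hT (η₀ := η₀)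
  have hpc := hp.continuousOn hT.le
  -- The values of p on the transported basis. As this basis spans E along the curve, p vanishes on
  -- E as soon as β does.
  let β : ℝ → D.BasisIndex → ℝ := fun t i => ∑ j, p t j * D.state 𝓕 (P η₀) t (some i) j
  have hβ : ContinuousOn β (Icc 0 T) := continuousOn_pi.2 fun i => continuousOn_finsetSum _
    fun j _ => (continuousOn_pi.1 hpc j).mul (continuousOn_pi.1 (continuousOn_pi.1 hz (some i)) j)
  have hβE : ∀ t ∈ Icc 0 T, ∀ v ∈ D.sr.E (G η₀ t),
      ∑ j, p t j * 𝓕.demb (G η₀ t) v j = ∑ i, R t (𝓕.demb (G η₀ t) v) i * β t i := by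
    intro t ht v hv
    have h3 := congrArg (𝓕.demb (G η₀ t)) (hRP t ht v hv)
    conv_lhs => rw [h3]
    simp only [map_sum, map_smul, Finset.sum_apply, Pi.smul_apply, smul_eq_mul, Finset.mul_sum, β]
    rw [Finset.sum_comm]
    refine Finset.sum_congr rfl fun i _ => Finset.sum_congr rfl fun j _ => ?_
    change _ = _ * (_ * 𝓕.demb (G η₀ t) (P η₀ t (D.basis i)) j)
    ring
  obtain ⟨k, hk⟩ := exists_feedback_control hG hT hc hs hVk hR hβ
  -- Expressed in the transported basis, the vector of E whose value under p is the rate has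
  -- components control plus feedback, which equal β by the choice of k. Applying p gives Σ β_i².
  have hpair := (hasACDeriv_pairing hG hT hc hs hV (hVk k).2 hp).congr_ae
    (g' := fun t => ∑ i, β t i ^ 2) (by
      filter_upwards [hk, ae_restrict_mem measurableSet_Icc] with t hkt ht
      have h3 : ∀ a, ∑ j, p t j * mvfderiv 𝓘(ℝ, F) (𝓕.f j) (G η₀ t) (𝓕.X a (G η₀ t)).1 =
          ∑ i, R t (𝓕.demb (G η₀ t) (𝓕.X a (G η₀ t)).1) i * β t i :=
        fun a => hβE t ht _ (𝓕.X a (G η₀ t)).2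
      have h4 : ∀ i, β t i = ∑ a, stateCoeff (Θ a) i (D.state 𝓕 (P η₀) t) *
          ∑ j, p t j * mvfderiv 𝓘(ℝ, F) (𝓕.f j) (G η₀ t) (𝓕.X a (G η₀ t)).1 := by
        intro i
        have h5 := congrArg (𝓕.demb (G η₀ t)) (state_some_eq hG hT hs ht i)
        change ∑ j, p t j * 𝓕.demb (G η₀ t) (P η₀ t (D.basis i)) j = _
        rw [h5]
        simp only [map_sum, map_smul, Finset.sum_apply, Pi.smul_apply, smul_eq_mul,
          Finset.mul_sum]
        rw [Finset.sum_comm]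
        refine Finset.sum_congr rfl fun a _ => Finset.sum_congr rfl fun j _ => ?_
        rw [CompactFrame.demb_apply]
        ring
      simp only [variationRate, add_mul, Finset.sum_add_distrib]
      have h6 : ∑ a, (∑ i, D.controlCoord k t i * stateCoeff (Θ a) i (D.state 𝓕 (P η₀) t)) *
          ∑ j, p t j * mvfderiv 𝓘(ℝ, F) (𝓕.f j) (G η₀ t) (𝓕.X a (G η₀ t)).1 =
          ∑ i, D.controlCoord k t i * β t i := by
        simp only [h4]
        exact sum_mul_sum_comm _ _ _
      rw [h6]
      simp only [h3]
      have h7 : ∀ i, β t i ^ 2 = D.controlCoord k t i * β t i + (∑ a, ∑ m, D.controlCoord η₀ t m •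
          feedback Θ (P η₀) R a m t (V t k)) i * β t i := fun i => by
        rw [← add_mul, ← Pi.add_apply, hkt, sq]
      simp only [h7, Finset.sum_add_distrib]
      rw [add_comm]
      congr 1
      simp only [Finset.sum_apply, Pi.smul_apply, smul_eq_mul, feedback,
        ContinuousLinearMap.comp_apply, ContinuousLinearMap.smulRight_apply, map_smul]
      exact sum_mul_sum_mul _ _ _ _)
  have hint := hpair.sub_eq_integral hT.le h1
  have hend : ∑ j, p T j * V T k none j = 0 := by
    rw [← demb_mfderiv_eq_variation hT h1 (hV T h1) k, hpf]
    exact hf k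
  rw [hend, (hVk k).1] at hint
  have hcont : ContinuousOn (fun t => ∑ i, β t i ^ 2) (Icc 0 T) :=
    continuousOn_finsetSum _ fun i _ => (continuousOn_pi.1 hβ i).pow 2
  have hβ0 : ∀ t ∈ Icc 0 T, ∀ i, β t i = 0 := by
    intro t ht i
    by_contra hne
    have hpos := intervalIntegral.integral_pos hT hcont
      (fun t _ => Finset.sum_nonneg fun i _ => sq_nonneg (β t i))
      ⟨t, ht, Finset.sum_pos' (fun i _ => sq_nonneg _) ⟨i, Finset.mem_univ _, by positivity⟩⟩
    rw [← hint] at hpos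
    simp at hpos
  intro t ht v hv
  rw [hβE t ht v hv]
  exact Finset.sum_eq_zero fun i _ => by rw [hβ0 t ht i, mul_zero]

end DevelopmentData

/-! ### Horizontal lifts. -/

section Horizontal

variable {F : Type*} [NormedAddCommGroup F] [NormedSpace ℝ F]
  {M : Type uM} [TopologicalSpace M] [ChartedSpace F M] [IsManifold 𝓘(ℝ, F) ∞ M]
  (F' : Type*) [NormedAddCommGroup F'] [NormedSpace ℝ F']
  {N : Type uN} [TopologicalSpace N] [ChartedSpace F' N]

/-- The horizontal space, as a subspace of the tangent space. -/
def horizontal (S : SubRiemannianStructure F M) (π : M → N) (x : M) :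
    Submodule ℝ (TangentSpace 𝓘(ℝ, F) x) where
  carrier := {v | ∃ A : S.E x, A.1 = v ∧ IsHorizontal F' S π A}
  add_mem' := by
    rintro _ _ ⟨A, rfl, hA⟩ ⟨B, rfl, hB⟩
    exact ⟨A + B, rfl, fun w hw => by rw [map_add, LinearMap.add_apply, hA w hw, hB w hw, add_zero]⟩
  zero_mem' := ⟨0, rfl, fun w _ => by rw [map_zero, LinearMap.zero_apply]⟩
  smul_mem' := by
    rintro c _ ⟨A, rfl, hA⟩
    exact ⟨c • A, rfl, fun w hw => by rw [map_smul, LinearMap.smul_apply, hA w hw, smul_zero]⟩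

theorem IsHorizontal.mem_horizontal {F'} [NormedAddCommGroup F'] [NormedSpace ℝ F']
    [ChartedSpace F' N] {S : SubRiemannianStructure F M} {π : M → N} {x : M}
    {v : S.E x} (h : IsHorizontal F' S π v) : v.1 ∈ horizontal F' S π x := ⟨v, rfl, h⟩

end Horizontal

namespace IsSubmersionOfData

variable {F : Type*} [NormedAddCommGroup F] [NormedSpace ℝ F]
  {M : Type uM} [TopologicalSpace M] [ChartedSpace F M] [IsManifold 𝓘(ℝ, F) ∞ M]
  {F' : Type*} [NormedAddCommGroup F'] [NormedSpace ℝ F']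
  {N : Type uN} [TopologicalSpace N] [ChartedSpace F' N] [IsManifold 𝓘(ℝ, F') ∞ N]
  {T : ℝ} {π : M → N} {D : DevelopmentData F M T} {D' : DevelopmentData F' N T}

theorem mvfderiv_comp (hπ : IsSubmersionOfData π D D') {f : N → ℝ}
    (hf : ContMDiff 𝓘(ℝ, F') 𝓘(ℝ, ℝ) ∞ f) (x : M) (v : TangentSpace 𝓘(ℝ, F) x) :
    mvfderiv 𝓘(ℝ, F) (fun y => f (π y)) x v =
      mvfderiv 𝓘(ℝ, F') f (π x) (mfderiv 𝓘(ℝ, F) 𝓘(ℝ, F') π x v) :=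
  mvfderiv_comp_apply x (hf.mdifferentiable (by simp) _) (hπ.smooth.mdifferentiable (by simp) _) v

theorem contMDiff_comp (hπ : IsSubmersionOfData π D D') {f : N → ℝ}
    (hf : ContMDiff 𝓘(ℝ, F') 𝓘(ℝ, ℝ) ∞ f) : ContMDiff 𝓘(ℝ, F) 𝓘(ℝ, ℝ) ∞ fun y => f (π y) :=
  hf.comp hπ.smooth

/-- The difference is both vertical and orthogonal to vertical vectors, hence has zero length. -/
theorem eq_of_isHorizontal {x : M} {v w : D.sr.E x}
    (hv : IsHorizontal F' D.sr π v) (hw : IsHorizontal F' D.sr π w)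
    (h : mfderiv 𝓘(ℝ, F) 𝓘(ℝ, F') π x v.1 = mfderiv 𝓘(ℝ, F) 𝓘(ℝ, F') π x w.1) : v = w := by
  by_contra hne
  have h1 : (v - w).1 ∈ vertical F F' π x := by
    change mfderiv 𝓘(ℝ, F) 𝓘(ℝ, F') π x (v.1 - w.1) = 0
    rw [map_sub, h, sub_self]
  have h2 := D.sr.metric_pos x (v - w) (sub_ne_zero.2 hne)
  have h3 : D.sr.metric x (v - w) (v - w) = 0 := by
    have h4 : ∀ u, D.sr.metric x (v - w) u = D.sr.metric x v u - D.sr.metric x w u :=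
      fun u => by rw [map_sub]; rfl
    rw [h4, hv _ h1, hw _ h1, sub_zero]
  exact h2.ne' h3

variable [FiniteDimensional ℝ F]

/-- From any preimage in E, subtract its orthogonal projection onto E ∩ 𝓥, which does not change the
image. -/
theorem exists_isHorizontal (hπ : IsSubmersionOfData π D D') (x : M) (w : D'.sr.E (π x)) :
    ∃ v : D.sr.E x, IsHorizontal F' D.sr π v ∧ mfderiv 𝓘(ℝ, F) 𝓘(ℝ, F') π x v.1 = w.1 := by
  obtain ⟨v₀, hv₀, hw⟩ := hπ.map_surj x w.1 w.2
  let K : Submodule ℝ (D.sr.Fiber x) := (vertical F F' π x).comap (D.sr.incl x)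
  let v₁ : D.sr.Fiber x := D.sr.toFiber x ⟨v₀, hv₀⟩
  have h1 : K.starProjection v₁ ∈ K := K.starProjection_apply_mem v₁
  refine ⟨(D.sr.toFiber x).symm (v₁ - K.starProjection v₁), fun u hu => ?_, ?_⟩
  · have h2 := K.sub_starProjection_mem_orthogonal v₁
    have h3 := (Submodule.mem_orthogonal' K _).1 h2 (D.sr.toFiber x u) hu
    exact h3
  · have h2 : mfderiv 𝓘(ℝ, F) 𝓘(ℝ, F') π x (D.sr.incl x (K.starProjection v₁)) = 0 := h1
    change mfderiv 𝓘(ℝ, F) 𝓘(ℝ, F') π x (D.sr.incl x (v₁ - K.starProjection v₁)) = w.1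
    rw [map_sub, map_sub, h2, sub_zero, ← hw]
    rfl

/-- The horizontal lift of an element of `Ě`. -/
def lift (hπ : IsSubmersionOfData π D D') (x : M) (w : D'.sr.E (π x)) : D.sr.E x :=
  (hπ.exists_isHorizontal x w).choose

theorem isHorizontal_lift (hπ : IsSubmersionOfData π D D') (x : M) (w : D'.sr.E (π x)) :
    IsHorizontal F' D.sr π (hπ.lift x w) := (hπ.exists_isHorizontal x w).choose_spec.1

theorem mfderiv_lift (hπ : IsSubmersionOfData π D D') (x : M) (w : D'.sr.E (π x)) :
    mfderiv 𝓘(ℝ, F) 𝓘(ℝ, F') π x (hπ.lift x w).1 = w.1 :=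
  (hπ.exists_isHorizontal x w).choose_spec.2

/-- The lift is the adjoint of π_* on E: replacing v by its horizontal part changes neither side,
and there π_* is isometric. -/
theorem metric_lift (hπ : IsSubmersionOfData π D D') (x : M) (w : D'.sr.E (π x))
    (v : D.sr.E x) : D.sr.metric x (hπ.lift x w) v =
      D'.sr.metric (π x) w ⟨_, hπ.map_mem x v.1 v.2⟩ := by
  set v' := hπ.lift x ⟨_, hπ.map_mem x v.1 v.2⟩
  have h1 : (v - v').1 ∈ vertical F F' π x := by
    change mfderiv 𝓘(ℝ, F) 𝓘(ℝ, F') π x (v.1 - v'.1) = 0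
    rw [map_sub, hπ.mfderiv_lift, sub_self]
  have h2 : D.sr.metric x (hπ.lift x w) v = D.sr.metric x (hπ.lift x w) v' := by
    rw [← sub_eq_zero, ← map_sub]
    exact hπ.isHorizontal_lift x w _ h1
  rw [h2, hπ.isometry x _ _ (hπ.isHorizontal_lift x w) (hπ.isHorizontal_lift x _)]
  congr 1
  · congr 1
    exact Subtype.ext (hπ.mfderiv_lift x w)
  · exact Subtype.ext (hπ.mfderiv_lift x _)

theorem lift_add (hπ : IsSubmersionOfData π D D') (x : M) (w w' : D'.sr.E (π x)) :
    hπ.lift x (w + w') = hπ.lift x w + hπ.lift x w' := by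
  refine eq_of_isHorizontal (hπ.isHorizontal_lift _ _) (fun u hu => ?_) ?_
  · rw [map_add, LinearMap.add_apply, hπ.isHorizontal_lift x w u hu,
      hπ.isHorizontal_lift x w' u hu, add_zero]
  · refine (hπ.mfderiv_lift _ _).trans ?_
    change w.1 + w'.1 = mfderiv 𝓘(ℝ, F) 𝓘(ℝ, F') π x ((hπ.lift x w).1 + (hπ.lift x w').1)
    rw [map_add, hπ.mfderiv_lift, hπ.mfderiv_lift]

theorem lift_smul (hπ : IsSubmersionOfData π D D') (x : M) (c : ℝ) (w : D'.sr.E (π x)) :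
    hπ.lift x (c • w) = c • hπ.lift x w := by
  refine eq_of_isHorizontal (hπ.isHorizontal_lift _ _) (fun u hu => ?_) ?_
  · rw [map_smul, LinearMap.smul_apply, hπ.isHorizontal_lift x w u hu, smul_zero]
  · refine (hπ.mfderiv_lift _ _).trans ?_
    change c • w.1 = mfderiv 𝓘(ℝ, F) 𝓘(ℝ, F') π x (c • (hπ.lift x w).1)
    rw [map_smul, hπ.mfderiv_lift]

theorem eq_lift (hπ : IsSubmersionOfData π D D') {x : M} {v : TangentSpace 𝓘(ℝ, F) x}
    (hv : v ∈ horizontal F' D.sr π x) {w : D'.sr.E (π x)}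
    (h : mfderiv 𝓘(ℝ, F) 𝓘(ℝ, F') π x v = w.1) : v = (hπ.lift x w).1 := by
  obtain ⟨A, rfl, hA⟩ := hv
  rw [eq_of_isHorizontal hA (hπ.isHorizontal_lift x w) (h.trans (hπ.mfderiv_lift x w).symm)]

variable [FiniteDimensional ℝ F'] [T2Space N]

/-- The lift is chosen point by point, but by `metric_lift` its coefficients in an orthonormal frame
X_i of E are the inner products of Y with π_* X_i, which are smooth. -/
theorem contMDiff_lift (hπ : IsSubmersionOfData π D D') {Y : ∀ z : N, D'.sr.E z}
    (hY : ContMDiff 𝓘(ℝ, F') 𝓘(ℝ, F').tangent ∞ (vfMap fun z => (Y z).1)) :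
    ContMDiff 𝓘(ℝ, F) 𝓘(ℝ, F).tangent ∞ (vfMap fun y => (hπ.lift y (Y (π y))).1) := by
  intro x
  obtain ⟨U, hU, hxU, k, X, hX, hon⟩ := D.sr.exists_frame x
  obtain ⟨𝓕⟩ := exists_compactFrame D'.sr T (isCompact_singleton (x := π x))
  have hX' : ∀ i, ContMDiffAt 𝓘(ℝ, F) 𝓘(ℝ, F).tangent ∞ (vfMap fun y => (X i y).1) x :=
    fun i => (hX i).contMDiffAt (hU.mem_nhds hxU)
  let c : Fin k → M → ℝ := fun i y => ∑ a, (∑ j, 𝓕.θ a j (π y) *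
    mvfderiv 𝓘(ℝ, F) (fun y => 𝓕.f j (π y)) y (X i y).1) *
      D'.sr.metric (π y) (Y (π y)) (𝓕.X a (π y))
  have hc : ∀ i, ContMDiffAt 𝓘(ℝ, F) 𝓘(ℝ, ℝ) ∞ (c i) x := by
    intro i
    refine contMDiffAt_finsetSum fun a _ => ContMDiffAt.mul
      (contMDiffAt_finsetSum fun j _ => ContMDiffAt.mul ?_ ?_) ?_
    · exact hπ.contMDiff_comp (𝓕.contMDiff_θ a j) x
    · exact (hX' i).mvfderiv_vf (hπ.contMDiff_comp (𝓕.contMDiff_f j))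
    · exact ContMDiffAt.comp (g := fun z => D'.sr.metric z (Y z) (𝓕.X a z)) x
        (D'.sr.contMDiffAt_metric (hY _) (𝓕.contMDiff_X a _)) (hπ.smooth x)
  have h1 : ContMDiffAt 𝓘(ℝ, F) 𝓘(ℝ, F).tangent ∞
      (vfMap fun y => ∑ i, c i y • (X i y).1) x :=
    ContMDiffAt.sum_section fun i _ => ContMDiffAt.smul_section (hc i) (hX' i)
  refine h1.congr_of_eventuallyEq ?_
  have hO : ∀ᶠ y in 𝓝 x, 𝓕.emb (π y) ∈ 𝓕.O :=
    hπ.smooth.continuous.continuousAt (𝓕.isOpen_preimage.mem_nhds (𝓕.mem_O _ rfl))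
  filter_upwards [hU.mem_nhds hxU, hO] with y hy hyO
  have h2 := D.sr.eq_sum_metric_smul (hon y hy).1 (hon y hy).2 (hπ.lift y (Y (π y)))
  have h3 : ∀ i, D.sr.metric y (hπ.lift y (Y (π y))) (X i y) = c i y := by
    intro i
    have h4 : (⟨_, hπ.map_mem y (X i y).1 (X i y).2⟩ : D'.sr.E (π y)) =
        ∑ a, (∑ j, 𝓕.θ a j (π y) * mvfderiv 𝓘(ℝ, F) (fun y => 𝓕.f j (π y)) y (X i y).1) •
          𝓕.X a (π y) := by
      refine Subtype.ext ?_
      simp only [hπ.mvfderiv_comp (𝓕.contMDiff_f _)]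
      refine (𝓕.eq_sum_X (π y) hyO
        ⟨_, hπ.map_mem y (X i y).1 (X i y).2⟩).trans ?_
      simp
    rw [hπ.metric_lift, h4, map_sum]
    simp only [map_smul, smul_eq_mul, c]
  simp only [h3] at h2
  simp only [vfMap]
  rw [h2]
  simp

theorem cov_lift_mem (hπ : IsSubmersionOfData π D D') {Y : ∀ z : N, D'.sr.E z}
    (hY : ContMDiff 𝓘(ℝ, F') 𝓘(ℝ, F').tangent ∞ (vfMap fun z => (Y z).1)) (x : M)
    (v : TangentSpace 𝓘(ℝ, F) x) :
    D.cov (fun y => (hπ.lift y (Y (π y))).1) x v ∈ horizontal F' D.sr π x := by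
  obtain ⟨A, hA, h⟩ := hπ.horizontal_parallel (fun y => hπ.lift y (Y (π y))) x v
    (fun y => hπ.isHorizontal_lift y _) ((hπ.contMDiff_lift hY).mdifferentiable (by simp) x)
  exact ⟨A, h, hA⟩

/-- By tensoriality any extension of w may be used. The lift of a section of Ě through π_* w is
π-related to that section, and so is its covariant derivative by `cov_pullback`. Only horizontal w
have such an extension, while v is arbitrary. -/
theorem covHessian_comp (hπ : IsSubmersionOfData π D D') {f : N → ℝ}
    (hf : ContMDiff 𝓘(ℝ, F') 𝓘(ℝ, ℝ) ∞ f) {x : M} (v : TangentSpace 𝓘(ℝ, F) x)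
    {w : TangentSpace 𝓘(ℝ, F) x} (hw : w ∈ horizontal F' D.sr π x) :
    covHessian D.cov (fun y => f (π y)) x v w =
      covHessian D'.cov f (π x) (mfderiv 𝓘(ℝ, F) 𝓘(ℝ, F') π x v)
        (mfderiv 𝓘(ℝ, F) 𝓘(ℝ, F') π x w) := by
  obtain ⟨𝓕⟩ := exists_compactFrame D'.sr T (isCompact_singleton (x := π x))
  obtain ⟨A, rfl, hA⟩ := hw
  set w' : D'.sr.E (π x) := ⟨_, hπ.map_mem x A.1 A.2⟩ with hw'
  let Y : ∀ z : N, D'.sr.E z := fun z =>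
    ∑ a, (∑ j, 𝓕.θ a j (π x) * mvfderiv 𝓘(ℝ, F') (𝓕.f j) (π x) w'.1) • 𝓕.X a z
  have hYe : (fun z => (Y z).1) = fun z =>
      ∑ a, (∑ j, 𝓕.θ a j (π x) * mvfderiv 𝓘(ℝ, F') (𝓕.f j) (π x) w'.1) • (𝓕.X a z).1 := by
    funext z
    simp [Y]
  have hYx : Y (π x) = w' := by
    refine Subtype.ext ?_
    rw [congrFun hYe (π x)]
    exact (𝓕.eq_sum_X (π x) (𝓕.mem_O _ rfl) w').symm
  have hY : ContMDiff 𝓘(ℝ, F') 𝓘(ℝ, F').tangent ∞ (vfMap fun z => (Y z).1) := by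
    rw [hYe]
    exact ContMDiff.sum_section fun a _ => ContMDiff.smul_section contMDiff_const (𝓕.contMDiff_X a)
  have hAx : A.1 = (hπ.lift x (Y (π x))).1 := by
    rw [hYx]
    exact hπ.eq_lift hA.mem_horizontal rfl
  have hL := hπ.contMDiff_lift hY
  have h1 := covHessian_eq (cov := D.cov) (hπ.contMDiff_comp hf)
    (hL.mdifferentiable (by simp) x) v
  have h2 := covHessian_eq (cov := D'.cov) hf (hY.mdifferentiable (by simp) (π x))
    (mfderiv 𝓘(ℝ, F) 𝓘(ℝ, F') π x v)
  rw [hAx, h1, hπ.mfderiv_lift, h2]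
  congr 1
  · simp only [hπ.mvfderiv_comp hf, hπ.mfderiv_lift]
    exact hπ.mvfderiv_comp (hY.mvfderiv_vf hf) x v
  · rw [hπ.mvfderiv_comp hf]
    congr 1
    exact hπ.cov_pullback _ Y x v (fun y => hπ.isHorizontal_lift y _)
      (fun y => hπ.mfderiv_lift y _) (hY.mdifferentiable (by simp) _)

end IsSubmersionOfData

/-! ### Projecting developments from M to N. -/

namespace IsSubmersionOfData

variable {F : Type*} [NormedAddCommGroup F] [NormedSpace ℝ F] [FiniteDimensional ℝ F]
  {M : Type uM} [TopologicalSpace M] [ChartedSpace F M] [IsManifold 𝓘(ℝ, F) ∞ M]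
  {F' : Type*} [NormedAddCommGroup F'] [NormedSpace ℝ F']
  {N : Type uN} [TopologicalSpace N] [ChartedSpace F' N] [IsManifold 𝓘(ℝ, F') ∞ N]
  {T : ℝ} {π : M → N} {D : DevelopmentData F M T} {D' : DevelopmentData F' N T}

/-- The horizontal lift of the reference fibre. -/
structure IsFiberLift (π : M → N) (D : DevelopmentData F M T) (D' : DevelopmentData F' N T)
    (L : D'.sr.Fiber D'.o →L[ℝ] D.sr.Fiber D.o) : Prop where
  map_eq : ∀ v, (⟨π D.o, mfderiv 𝓘(ℝ, F) 𝓘(ℝ, F') π D.o (D.sr.incl D.o (L v))⟩ :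
    TangentBundle 𝓘(ℝ, F') N) = ⟨D'.o, D'.sr.incl D'.o v⟩
  isHorizontal : ∀ v, IsHorizontal F' D.sr π ((D.sr.toFiber D.o).symm (L v))

theorem map_eq_sum {𝓕 : CompactFrame D'.sr T K} (hπ : IsSubmersionOfData π D D') {y : M}
    (hy : 𝓕.emb (π y) ∈ 𝓕.O) {v : TangentSpace 𝓘(ℝ, F) y} (hv : v ∈ D.sr.E y) :
    mfderiv 𝓘(ℝ, F) 𝓘(ℝ, F') π y v = ∑ a, (∑ j, 𝓕.θ a j (π y) *
      mvfderiv 𝓘(ℝ, F) (fun y => 𝓕.f j (π y)) y v) • (𝓕.X a (π y)).1 := by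
  simp only [hπ.mvfderiv_comp (𝓕.contMDiff_f _)]
  exact 𝓕.eq_sum_X (π y) hy ⟨_, hπ.map_mem y v hv⟩

theorem eq_sum_lift {𝓕 : CompactFrame D'.sr T K} (hπ : IsSubmersionOfData π D D') {y : M}
    (hy : 𝓕.emb (π y) ∈ 𝓕.O) {v : TangentSpace 𝓘(ℝ, F) y} (hv : v ∈ horizontal F' D.sr π y) :
    v = ∑ a, (∑ j, 𝓕.θ a j (π y) *
      mvfderiv 𝓘(ℝ, F) (fun y => 𝓕.f j (π y)) y v) • (hπ.lift y (𝓕.X a (π y))).1 := by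
  have hvE : v ∈ D.sr.E y := by
    obtain ⟨A, rfl, -⟩ := hv
    exact A.2
  set c := fun a => ∑ j, 𝓕.θ a j (π y) * mvfderiv 𝓘(ℝ, F) (fun y => 𝓕.f j (π y)) y v
  have h1 : (∑ a, c a • (hπ.lift y (𝓕.X a (π y))).1) ∈ horizontal F' D.sr π y :=
    Submodule.sum_mem _ fun a _ => Submodule.smul_mem _ _ (hπ.isHorizontal_lift _ _).mem_horizontal
  have h2 : mfderiv 𝓘(ℝ, F) 𝓘(ℝ, F') π y (∑ a, c a • (hπ.lift y (𝓕.X a (π y))).1) =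
      mfderiv 𝓘(ℝ, F) 𝓘(ℝ, F') π y v := by
    rw [hπ.map_eq_sum hy hvE]
    simp only [map_sum, map_smul, hπ.mfderiv_lift, c]
  exact (hπ.eq_lift hv (w := ⟨_, hπ.map_mem y v hvE⟩) rfl).trans (hπ.eq_lift h1 h2).symm

variable [FiniteDimensional ℝ F']

theorem exists_isFiberLift (hπ : IsSubmersionOfData π D D') : ∃ L, IsFiberLift π D D' L := by
  -- The base points agree only by a proved equation, so the statement is generalized over ǒ to let
  -- it be substituted. The same reason explains the equalities in the tangent bundle.
  have key : ∀ o', π D.o = o' → ∃ L : D'.sr.Fiber o' →L[ℝ] D.sr.Fiber D.o,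
      (∀ v, (⟨π D.o, mfderiv 𝓘(ℝ, F) 𝓘(ℝ, F') π D.o (D.sr.incl D.o (L v))⟩ :
        TangentBundle 𝓘(ℝ, F') N) = ⟨o', D'.sr.incl o' v⟩) ∧
      ∀ v, IsHorizontal F' D.sr π ((D.sr.toFiber D.o).symm (L v)) := by
    rintro _ rfl
    let ℓ : D'.sr.Fiber (π D.o) →ₗ[ℝ] D.sr.Fiber D.o :=
      { toFun := fun v => D.sr.toFiber D.o (hπ.lift D.o ((D'.sr.toFiber (π D.o)).symm v))
        map_add' := fun v w => by rw [map_add, hπ.lift_add, map_add]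
        map_smul' := fun c v => by rw [map_smul, hπ.lift_smul, map_smul, RingHom.id_apply] }
    refine ⟨LinearMap.toContinuousLinearMap ℓ, fun v => ?_, fun v => ?_⟩
    · exact congrArg (fun w => (⟨π D.o, w⟩ : TangentBundle 𝓘(ℝ, F') N)) (hπ.mfderiv_lift _ _)
    · exact hπ.isHorizontal_lift _ _
  obtain ⟨L, h1, h2⟩ := key _ hπ.map_o
  exact ⟨L, h1, h2⟩

/-- Both sides are horizontal, the left one by the orthogonality hypothesis on Σ, and have the same
projection. -/
theorem sigma_fiberLift (hπ : IsSubmersionOfData π D D')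
    {L : D'.sr.Fiber D'.o →L[ℝ] D.sr.Fiber D.o} (hL : IsFiberLift π D D' L) {t : ℝ}
    (ht : t ∈ Icc 0 T) (v : D'.sr.Fiber D'.o) : D.sigma t (L v) = L (D'.sigma t v) := by
  have h1 : IsHorizontal F' D.sr π ((D.sr.toFiber D.o).symm (D.sigma t (L v))) :=
    fun w hw => hπ.sigma_orthogonal t ht _ w (hL.isHorizontal v) hw
  have h2 := (hπ.sigma_related t ht (L v) v (hL.isHorizontal v) (hL.map_eq v)).trans
    (hL.map_eq (D'.sigma t v)).symm
  exact (D.sr.toFiber D.o).symm.injective (eq_of_isHorizontal h1 (hL.isHorizontal _)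
    (DevelopmentData.tangentBundle_mk_inj h2))

/-- The lift intertwines the covariances, hence their positive roots, by `comp_eq_of_sq_comp_eq`. -/
theorem posSqrt_fiberLift (hπ : IsSubmersionOfData π D D')
    {L : D'.sr.Fiber D'.o →L[ℝ] D.sr.Fiber D.o} (hL : IsFiberLift π D D' L) {t : ℝ}
    (ht : t ∈ Icc 0 T) (v : D'.sr.Fiber D'.o) :
    posSqrt (D.sigma t) (L v) = L (posSqrt (D'.sigma t) v) := by
  have h1 := posSqrt_spec (D.sigma_symm t ht) (D.sigma_pos t ht)
  have h2 := posSqrt_spec (D'.sigma_symm t ht) (D'.sigma_pos t ht)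
  refine DFunLike.congr_fun (comp_eq_of_sq_comp_eq h1.1 h2.1
    (posSqrt_injective (D'.sigma_symm t ht) (D'.sigma_pos t ht)) (h := L) ?_) v
  rw [← ContinuousLinearMap.comp_assoc, h1.2, h2.2]
  ext w
  exact hπ.sigma_fiberLift hL ht w

theorem isH1Curve_comp (hπ : IsSubmersionOfData π D D') {γ : ℝ → M} (hγ : IsH1Curve F T γ) :
    IsH1Curve F' T fun t => π (γ t) where
  continuousOn := hπ.smooth.continuous.comp_continuousOn hγ.continuousOn
  absolutelyContinuous f hf := hγ.absolutelyContinuous (fun y => f (π y)) (hπ.contMDiff_comp hf)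
  memLp_deriv f hf := hγ.memLp_deriv (fun y => f (π y)) (hπ.contMDiff_comp hf)

variable [T2Space M] [T2Space N]

theorem velocity_comp (hπ : IsSubmersionOfData π D D') {γ : ℝ → M} (hγ : IsH1Curve F T γ)
    (hT : 0 < T) : ∀ᵐ t ∂(volume.restrict (Icc 0 T)),
      velocity F' (fun t => π (γ t)) t = mfderiv 𝓘(ℝ, F) 𝓘(ℝ, F') π (γ t) (velocity F γ t) := by
  obtain ⟨𝓕⟩ := exists_compactFrame D.sr T hγ.isCompact_trace
  filter_upwards [hγ.ae_mdifferentiableAt hT 𝓕] with t ht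
  exact mfderiv_comp_apply t (hπ.smooth.mdifferentiable (by simp) _) ht.2 _

theorem isParallelAlong_comp (hπ : IsSubmersionOfData π D D') {γ : ℝ → M} (hγ : IsH1Curve F T γ)
    (hT : 0 < T) {V : ∀ t, TangentSpace 𝓘(ℝ, F) (γ t)} (hV : IsParallelAlong D.cov T γ V)
    (hVH : ∀ t ∈ Icc 0 T, V t ∈ horizontal F' D.sr π (γ t)) :
    IsParallelAlong D'.cov T (fun t => π (γ t))
      fun t => mfderiv 𝓘(ℝ, F) 𝓘(ℝ, F') π (γ t) (V t) := by
  intro f hf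
  have h1 := hV _ (hπ.contMDiff_comp hf)
  have e : (fun t => mfderiv 𝓘(ℝ, F) 𝓘(ℝ, ℝ) (fun y => f (π y)) (γ t) (V t)) = fun t =>
      mfderiv 𝓘(ℝ, F') 𝓘(ℝ, ℝ) f (π (γ t)) (mfderiv 𝓘(ℝ, F) 𝓘(ℝ, F') π (γ t) (V t)) :=
    funext fun t => hπ.mvfderiv_comp hf _ _
  simp only [e] at h1
  refine ⟨h1.1, ?_⟩
  filter_upwards [h1.2, hπ.velocity_comp hγ hT, ae_restrict_mem measurableSet_Icc] with t h2 h3 ht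
  rw [h3, ← hπ.covHessian_comp hf _ (hVH t ht)]
  exact h2

/-- 𝓗 is a parallel subbundle spanned along γ by lifts of a frame of Ě, so it carries its own
parallel transport, which by uniqueness agrees with the given one. -/
theorem mem_horizontal_of_isParallelAlong (hπ : IsSubmersionOfData π D D') {γ : ℝ → M}
    (hγ : IsH1Curve F T γ) (hT : 0 < T) {V : ∀ t, TangentSpace 𝓘(ℝ, F) (γ t)}
    (hV : IsParallelAlong D.cov T γ V) (h0 : V 0 ∈ horizontal F' D.sr π (γ 0)) :
    ∀ t ∈ Icc 0 T, V t ∈ horizontal F' D.sr π (γ t) := by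
  have ht0 : (0 : ℝ) ∈ Icc 0 T := ⟨le_rfl, hT.le⟩
  obtain ⟨𝓕⟩ := exists_compactFrame D.sr T hγ.isCompact_trace
  obtain ⟨𝓕'⟩ := exists_compactFrame D'.sr T (hπ.isH1Curve_comp hγ).isCompact_trace
  obtain ⟨V', hV'0, hV', hVH⟩ := exists_isParallelAlong 𝓕 hγ hT D.cov_smooth
    (B := horizontal F' D.sr π) (Y := fun a y => (hπ.lift y (𝓕'.X a (π y))).1)
    (θ := fun a k y => ∑ j, 𝓕'.θ a j (π y) *
      mvfderiv 𝓘(ℝ, F) (fun y => 𝓕'.f j (π y)) y (𝓕.W k y))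
    (fun a => hπ.contMDiff_lift (𝓕'.contMDiff_X a))
    (fun a k => contMDiff_finsetSum fun j _ => (hπ.contMDiff_comp (𝓕'.contMDiff_θ a j)).mul
      ((𝓕.contMDiff_W k).mvfderiv_vf (hπ.contMDiff_comp (𝓕'.contMDiff_f j))))
    (fun a y => (hπ.isHorizontal_lift _ _).mem_horizontal)
    (fun t ht v hv => by
      refine (hπ.eq_sum_lift (𝓕'.emb_mem ht) hv).trans ?_
      refine Finset.sum_congr rfl fun a _ => ?_
      congr 1
      simp only [Finset.sum_mul]
      rw [Finset.sum_comm]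
      refine Finset.sum_congr rfl fun j _ => ?_
      conv_lhs => rw [← 𝓕.sum_demb (𝓕.emb_mem ht) v, map_sum, Finset.mul_sum]
      exact Finset.sum_congr rfl fun k _ => by rw [map_smul, smul_eq_mul]; ring)
    (fun a y v => hπ.cov_lift_mem (𝓕'.contMDiff_X a) y v) ht0 h0
  intro t ht
  rw [hV.eq_of_eq 𝓕 hγ hT D.cov_smooth hV' ht0 ht hV'0.symm]
  exact hVH t

/-- The control is L η', with L the horizontal lift of the reference fibre. The vectors P L v stay
horizontal, so π_* P L is the parallel transport on N, and L commutes with the square roots. -/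
theorem exists_development_lift (hπ : IsSubmersionOfData π D D') (hT : 0 < T) (η' : D'.H) :
    ∃ η : D.H, ∀ γ, D.IsDevelopment η γ → D'.IsDevelopment η' fun t => π (γ t) := by
  obtain ⟨L, hL⟩ := hπ.exists_isFiberLift
  refine ⟨L.compLp η', fun γ hγ => ?_⟩
  obtain ⟨P, hP⟩ := hγ.exists_with
  have hH : ∀ v, ∀ t ∈ Icc 0 T, P t (L v) ∈ horizontal F' D.sr π (γ t) := fun v =>
    hπ.mem_horizontal_of_isParallelAlong hP.isH1Curve hT (hP.parallel (L v)) (by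
      have h1 : ∀ p q : TangentBundle 𝓘(ℝ, F) M, p = q → q.2 ∈ horizontal F' D.sr π q.1 →
          p.2 ∈ horizontal F' D.sr π p.1 := by rintro p _ rfl h; exact h
      exact h1 _ _ (hP.init (L v)) (hL.isHorizontal v).mem_horizontal)
  refine ⟨hπ.isH1Curve_comp hP.isH1Curve, (congrArg π hP.start).trans hπ.map_o,
    fun t => (mfderiv 𝓘(ℝ, F) 𝓘(ℝ, F') π (γ t)).toLinearMap ∘ₗ P t ∘ₗ L.toLinearMap,
    fun v => ?_, fun v => ?_, ?_⟩
  · exact (congrArg (tangentMap 𝓘(ℝ, F) 𝓘(ℝ, F') π) (hP.init (L v))).trans (hL.map_eq v)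
  · exact hπ.isParallelAlong_comp hP.isH1Curve hT (hP.parallel (L v)) (hH v)
  · filter_upwards [hP.velocity_eq, hπ.velocity_comp hP.isH1Curve hT, L.coeFn_compLp η',
      ae_restrict_mem measurableSet_Icc] with t h1 h2 h3 ht
    rw [h2, h1, map_add, hπ.u_related t ht, h3, hπ.posSqrt_fiberLift hL ht]
    rfl

end IsSubmersionOfData

/-! ### The torsion equation as Lie transport. -/

namespace DevelopmentData

variable {F : Type*} [NormedAddCommGroup F] [NormedSpace ℝ F] [FiniteDimensional ℝ F]
  {M : Type uM} [TopologicalSpace M] [ChartedSpace F M] [IsManifold 𝓘(ℝ, F) ∞ M] {T : ℝ}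
  (D : DevelopmentData F M T)

/-- `γ` is a curve with `γ̇ = u + ∑ a, r a • R a`, for sections `R a` of `E`. -/
structure IsControlledBy (γ : ℝ → M) {A : Type*} [Fintype A] (R : A → ∀ y : M, D.sr.E y)
    (r : ℝ → A → ℝ) : Prop where
  isH1Curve : IsH1Curve F T γ
  contMDiff : ∀ a, ContMDiff 𝓘(ℝ, F) 𝓘(ℝ, F).tangent ∞ (vfMap fun y => (R a y).1)
  integrable : ∀ a, IntegrableOn (fun t => r t a) (Icc 0 T)
  velocity_eq : ∀ᵐ t ∂(volume.restrict (Icc 0 T)),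
    velocity F γ t = D.u t (γ t) + ∑ a, r t a • (R a (γ t)).1

/-- The Lie bracket of `u + ∑ a, r a • R a` and `W` along `γ`. -/
def lieTerm (γ : ℝ → M) {A : Type*} [Fintype A] (R : A → ∀ y : M, D.sr.E y) (r : ℝ → A → ℝ)
    (t : ℝ) (W : ∀ y : M, TangentSpace 𝓘(ℝ, F) y) : TangentSpace 𝓘(ℝ, F) (γ t) :=
  VectorField.mlieBracket 𝓘(ℝ, F) (D.u t) W (γ t) +
    ∑ a, r t a • VectorField.mlieBracket 𝓘(ℝ, F) (fun y => (R a y).1) W (γ t)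

/-- The one-form `lam` along `γ` is transported by the flow of `u + ∑ a, r a • R a`. -/
def IsLieTransported (γ : ℝ → M) {A : Type*} [Fintype A] (R : A → ∀ y : M, D.sr.E y)
    (r : ℝ → A → ℝ) (lam : ∀ t : ℝ, TangentSpace 𝓘(ℝ, F) (γ t) →L[ℝ] ℝ) : Prop :=
  ∀ W : ∀ y : M, TangentSpace 𝓘(ℝ, F) y, ContMDiff 𝓘(ℝ, F) 𝓘(ℝ, F).tangent ∞ (vfMap W) →
    HasACDeriv T (fun t => lam t (W (γ t))) fun t => lam t (D.lieTerm γ R r t W)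

theorem contMDiff_u {t : ℝ} (ht : t ∈ Icc 0 T) :
    ContMDiff 𝓘(ℝ, F) 𝓘(ℝ, F).tangent ∞ (vfMap (D.u t)) := by
  have h1 : ContMDiff 𝓘(ℝ, F) (𝓘(ℝ, ℝ).prod 𝓘(ℝ, F)) ∞ fun y : M => (t, y) :=
    contMDiff_const.prodMk contMDiff_id
  exact contMDiffOn_univ.1 (D.u_smooth.comp h1.contMDiffOn fun y _ => ⟨ht, mem_univ _⟩)

variable {D} {γ : ℝ → M} {A : Type*} [Fintype A] {R : A → ∀ y : M, D.sr.E y} {r : ℝ → A → ℝ}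
  {lam mu : ∀ t : ℝ, TangentSpace 𝓘(ℝ, F) (γ t) →L[ℝ] ℝ}

theorem IsControlledBy.mvfderiv_lieTerm (h : D.IsControlledBy γ R r) {t : ℝ} (ht : t ∈ Icc 0 T)
    (hv : velocity F γ t = D.u t (γ t) + ∑ a, r t a • (R a (γ t)).1) {g : M → ℝ}
    (hg : ContMDiff 𝓘(ℝ, F) 𝓘(ℝ, ℝ) ∞ g) {W : ∀ y : M, TangentSpace 𝓘(ℝ, F) y}
    (hW : ContMDiff 𝓘(ℝ, F) 𝓘(ℝ, F).tangent ∞ (vfMap W)) :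
    mvfderiv 𝓘(ℝ, F) g (γ t) (D.lieTerm γ R r t W) =
      mvfderiv 𝓘(ℝ, F) (fun y => mvfderiv 𝓘(ℝ, F) g y (W y)) (γ t) (velocity F γ t) -
        mvfderiv 𝓘(ℝ, F) (fun y => mvfderiv 𝓘(ℝ, F) g y (D.u t y)) (γ t) (W (γ t)) -
        ∑ a, r t a *
          mvfderiv 𝓘(ℝ, F) (fun y => mvfderiv 𝓘(ℝ, F) g y (R a y).1) (γ t) (W (γ t)) := by
  have hW' := hW.mdifferentiable (by simp) (γ t)
  rw [hv, lieTerm, map_add, map_sum, map_add, map_sum]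
  simp only [map_smul, smul_eq_mul]
  rw [mvfderiv_mlieBracket ((D.contMDiff_u ht).mdifferentiable (by simp) _) hW' hg]
  simp only [mvfderiv_mlieBracket ((h.contMDiff _).mdifferentiable (by simp) _) hW' hg, mul_sub,
    Finset.sum_sub_distrib]
  ring

theorem IsLieTransported.sub (h : D.IsLieTransported γ R r lam)
    (h' : D.IsLieTransported γ R r mu) : D.IsLieTransported γ R r fun t => lam t - mu t :=
  fun W hW => (h W hW).sub (h' W hW)

theorem isLieTransported_zero : D.IsLieTransported γ R r fun _ => 0 :=
  fun _ _ => HasACDeriv.const T 0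

variable [T2Space M]

/-- The values of the difference on the W_j satisfy a linear equation. By `mvfderiv_lieTerm` its
matrix only involves continuous functions times the velocity or the coefficients r, apart from a
continuous drift term, so it is integrable. -/
theorem IsLieTransported.eq_of_eq (h : D.IsLieTransported γ R r lam)
    (h' : D.IsLieTransported γ R r mu) (hγ : D.IsControlledBy γ R r) (hT : 0 < T) {s t : ℝ}
    (hs : s ∈ Icc 0 T) (ht : t ∈ Icc 0 T) (heq : lam s = mu s) : lam t = mu t := by
  obtain ⟨𝓕⟩ := exists_compactFrame D.sr T hγ.isH1Curve.isCompact_trace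
  have hH := hγ.isH1Curve
  have hint : ∀ j k, IntegrableOn (fun t => mvfderiv 𝓘(ℝ, F) (𝓕.f k) (γ t)
      (D.lieTerm γ R r t (𝓕.W j))) (Icc 0 T) := by
    intro j k
    have h1 : IntegrableOn (fun t => mvfderiv 𝓘(ℝ, F) (fun y => mvfderiv 𝓘(ℝ, F) (𝓕.f k) y
          (𝓕.W j y)) (γ t) (velocity F γ t) -
        mvfderiv 𝓘(ℝ, F) (fun y => mvfderiv 𝓘(ℝ, F) (𝓕.f k) y (D.u t y)) (γ t) (𝓕.W j (γ t)) -
        ∑ a, r t a * mvfderiv 𝓘(ℝ, F) (fun y => mvfderiv 𝓘(ℝ, F) (𝓕.f k) y (R a y).1) (γ t)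
          (𝓕.W j (γ t))) (Icc 0 T) := by
      refine (Integrable.sub ?_ ?_).sub (integrable_finsetSum _ fun a _ => ?_)
      · exact (hH.hasACDeriv hT 𝓕 ((𝓕.contMDiff_W j).mvfderiv_vf (𝓕.contMDiff_f k))).integrable
      · exact (continuousOn_mvfderiv_mvfderiv_u hH hT (𝓕.contMDiff_f k)
          (𝓕.contMDiff_W j)).integrableOn_Icc
      · have h2 : ContinuousOn (fun t => mvfderiv 𝓘(ℝ, F) (fun y => mvfderiv 𝓘(ℝ, F) (𝓕.f k) y
            (R a y).1) (γ t) (𝓕.W j (γ t))) (Icc 0 T) :=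
          hH.continuousOn_comp (g := fun z => mvfderiv 𝓘(ℝ, F) (fun y => mvfderiv 𝓘(ℝ, F) (𝓕.f k) y
            (R a y).1) z (𝓕.W j z))
            ((𝓕.contMDiff_W j).mvfderiv_vf ((hγ.contMDiff a).mvfderiv_vf (𝓕.contMDiff_f k)))
        exact (integrableOn_mul_of_continuousOn h2 (hγ.integrable a)).congr
          (.of_forall fun t => mul_comm _ _)
    refine Integrable.congr h1 ?_
    filter_upwards [hγ.velocity_eq, ae_restrict_mem measurableSet_Icc] with t hv ht
    exact (hγ.mvfderiv_lieTerm ht hv (𝓕.contMDiff_f k) (𝓕.contMDiff_W j)).symm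
  have hexp : ∀ t ∈ Icc 0 T, ∀ v : TangentSpace 𝓘(ℝ, F) (γ t), (lam t - mu t) v =
      ∑ k, 𝓕.demb (γ t) v k * (lam t - mu t) (𝓕.W k (γ t)) := by
    intro t ht v
    conv_lhs => rw [← 𝓕.sum_demb (𝓕.emb_mem ht) v, map_sum]
    simp only [map_smul, smul_eq_mul]
  have hq : HasACDeriv T (fun t j => (lam t - mu t) (𝓕.W j (γ t))) fun t =>
      matCLM (fun j k => mvfderiv 𝓘(ℝ, F) (𝓕.f k) (γ t) (D.lieTerm γ R r t (𝓕.W j)))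
        (fun j => (lam t - mu t) (𝓕.W j (γ t))) := by
    refine HasACDeriv.congr_ae (HasACDeriv.pi fun j => h.sub h' _ (𝓕.contMDiff_W j)) ?_
    filter_upwards [ae_restrict_mem measurableSet_Icc] with t ht
    funext j
    rw [matCLM_apply]
    exact hexp t ht _
  have h0 := hq.linear_ode_unique hT.le (integrableOn_matCLM hint) hs ht (by
    funext j
    rw [heq, sub_self]
    rfl)
  refine sub_eq_zero.1 (ContinuousLinearMap.ext fun v => ?_)
  rw [hexp t ht v]
  exact Finset.sum_eq_zero fun k _ => by rw [congrFun h0 k]; exact mul_zero _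

/-- Expand the torsion as ∇_X W − ∇_W X − [X, W]. For the drift, ∇u cancels ∇_W u and the bracket
remains. For the sections R_a, the leftover α(∇_W R_a) vanishes because E is parallel and α kills E.
-/
theorem IsControlledBy.apply_lieTerm_eq (h : D.IsControlledBy γ R r) {t : ℝ} (ht : t ∈ Icc 0 T)
    (hv : velocity F γ t = D.u t (γ t) + ∑ a, r t a • (R a (γ t)).1)
    {α : TangentSpace 𝓘(ℝ, F) (γ t) →L[ℝ] ℝ} (hα : ∀ v ∈ D.sr.E (γ t), α v = 0)
    {W : ∀ y : M, TangentSpace 𝓘(ℝ, F) y}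
    (hW : ContMDiff 𝓘(ℝ, F) 𝓘(ℝ, F).tangent ∞ (vfMap W)) :
    (-(α ∘L D.cov (D.u t) (γ t) + α ∘L D.cov.torsion (γ t) (velocity F γ t))) (W (γ t)) +
      α (D.cov W (γ t) (velocity F γ t)) = α (D.lieTerm γ R r t W) := by
  have hW' := hW.mdifferentiable (by simp) (γ t)
  have h1 := D.cov.torsion_apply ((D.contMDiff_u ht).mdifferentiable (by simp) (γ t)) hW'
  have h2 : ∀ a, α (D.cov.torsion (γ t) (R a (γ t)).1 (W (γ t))) =
      α (D.cov W (γ t) (R a (γ t)).1) -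
        α (VectorField.mlieBracket 𝓘(ℝ, F) (fun y => (R a y).1) W (γ t)) := by
    intro a
    have hR := (h.contMDiff a).mdifferentiable (by simp) (γ t)
    have h3 := D.cov.torsion_apply (X := fun y => (R a y).1) hR hW'
    have h4 := hα _ (D.cov_compatible.cov_mem (R a) (γ t) (W (γ t)) hR)
    rw [h3, map_sub, map_sub, h4, sub_zero]
  simp only [neg_apply, add_apply, ContinuousLinearMap.comp_apply]
  rw [hv, lieTerm]
  simp only [map_add, map_sum, map_smul, add_apply, sum_apply, smul_apply, smul_eq_mul, h2, h1,
    map_sub, mul_sub, Finset.sum_sub_distrib]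
  ring

theorem IsControlledBy.isLieTransported_iff (h : D.IsControlledBy γ R r) (hT : 0 < T)
    (hE : ∀ t ∈ Icc 0 T, ∀ v ∈ D.sr.E (γ t), lam t v = 0) :
    D.IsLieTransported γ R r lam ↔ HasCovDerivAlong D.cov T γ lam fun t =>
      -(lam t ∘L D.cov (D.u t) (γ t) + lam t ∘L D.cov.torsion (γ t) (velocity F γ t)) := by
  refine forall₂_congr fun W hW => ⟨fun h1 => ⟨h1.ac, ?_⟩, fun h1 => ?_⟩
  · filter_upwards [h1.hasDerivAt, h.velocity_eq, ae_restrict_mem measurableSet_Icc]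
      with t h2 h3 ht
    rw [h2.deriv, h.apply_lieTerm_eq ht h3 (hE t ht) hW]
  · refine (HasACDeriv.of_ac hT.le h1.1).congr_ae ?_
    filter_upwards [h1.2, h.velocity_eq, ae_restrict_mem measurableSet_Icc] with t h2 h3 ht
    rw [h2, h.apply_lieTerm_eq ht h3 (hE t ht) hW]

end DevelopmentData

/-! ### Pullbacks of adjoint solutions along the submersion. -/

namespace IsSubmersionOfData

variable {F : Type*} [NormedAddCommGroup F] [NormedSpace ℝ F] [FiniteDimensional ℝ F]
  {M : Type uM} [TopologicalSpace M] [ChartedSpace F M] [IsManifold 𝓘(ℝ, F) ∞ M]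
  {F' : Type*} [NormedAddCommGroup F'] [NormedSpace ℝ F'] [FiniteDimensional ℝ F']
  {N : Type uN} [TopologicalSpace N] [ChartedSpace F' N] [IsManifold 𝓘(ℝ, F') ∞ N]
  {T : ℝ} {π : M → N} {D : DevelopmentData F M T} {D' : DevelopmentData F' N T}
  {γ : ℝ → M} {𝓕 : CompactFrame D.sr T (trace T γ)}
  {𝓕' : CompactFrame D'.sr T (trace T fun t => π (γ t))}

variable (𝓕 𝓕') in
/-- Horizontal lifts of the frame of `Ě` and vertical parts of the frame of `E`. -/
def splitFrame (hπ : IsSubmersionOfData π D D') : 𝓕'.A ⊕ 𝓕.A → ∀ y : M, D.sr.E y :=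
  Sum.elim (fun a y => hπ.lift y (𝓕'.X a (π y))) fun b y => 𝓕.X b y -
    ∑ a, (∑ j, 𝓕'.θ a j (π y) * mvfderiv 𝓘(ℝ, F) (fun y => 𝓕'.f j (π y)) y (𝓕.X b y).1) •
      hπ.lift y (𝓕'.X a (π y))

variable (𝓕 𝓕') in
/-- The coefficients of `γ̇ - u` with respect to `splitFrame`. -/
def splitCoeff (t : ℝ) : 𝓕'.A ⊕ 𝓕.A → ℝ :=
  Sum.elim (D'.frameCoeff 𝓕' t) (D.frameCoeff 𝓕 t)

theorem contMDiff_splitFrame [T2Space N] (hπ : IsSubmersionOfData π D D') (m : 𝓕'.A ⊕ 𝓕.A) :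
    ContMDiff 𝓘(ℝ, F) 𝓘(ℝ, F).tangent ∞ (vfMap fun y => (hπ.splitFrame 𝓕 𝓕' m y).1) := by
  rcases m with a | b
  · exact hπ.contMDiff_lift (𝓕'.contMDiff_X a)
  · have e : (fun y => (hπ.splitFrame 𝓕 𝓕' (.inr b) y).1) = (fun y => (𝓕.X b y).1) -
        fun y => ∑ a, (∑ j, 𝓕'.θ a j (π y) *
          mvfderiv 𝓘(ℝ, F) (fun y => 𝓕'.f j (π y)) y (𝓕.X b y).1) •
            (hπ.lift y (𝓕'.X a (π y))).1 := by
      funext y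
      simp [splitFrame]
    rw [e]
    refine ContMDiff.sub_section (𝓕.contMDiff_X b) (ContMDiff.sum_section fun a _ =>
      ContMDiff.smul_section (contMDiff_finsetSum fun j _ => ?_)
        (hπ.contMDiff_lift (𝓕'.contMDiff_X a)))
    exact (hπ.contMDiff_comp (𝓕'.contMDiff_θ a j)).mul
      ((𝓕.contMDiff_X b).mvfderiv_vf (hπ.contMDiff_comp (𝓕'.contMDiff_f j)))

theorem mfderiv_splitFrame_inr (hπ : IsSubmersionOfData π D D') (b : 𝓕.A) {y : M}
    (hy : 𝓕'.emb (π y) ∈ 𝓕'.O) :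
    mfderiv 𝓘(ℝ, F) 𝓘(ℝ, F') π y (hπ.splitFrame 𝓕 𝓕' (.inr b) y).1 = 0 := by
  have h1 := hπ.map_eq_sum hy (𝓕.X b y).2
  have e : (hπ.splitFrame 𝓕 𝓕' (.inr b) y).1 = (𝓕.X b y).1 -
      ∑ a, (∑ j, 𝓕'.θ a j (π y) * mvfderiv 𝓘(ℝ, F) (fun y => 𝓕'.f j (π y)) y (𝓕.X b y).1) •
        (hπ.lift y (𝓕'.X a (π y))).1 := by
    simp [splitFrame]
  rw [e, map_sub, map_sum]
  simp only [map_smul, hπ.mfderiv_lift]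
  rw [h1, sub_self]

variable [T2Space M] [T2Space N]

/-- The lifts subtracted from the frame of E are restored by the coefficients of π_*(γ̇ − u) in the
frame of Ě. The splitting makes each section project to a section of Ě or, over the domain of the
frame, to zero. -/
theorem isControlledBy_splitFrame (hπ : IsSubmersionOfData π D D') (hT : 0 < T)
    (hγ : IsH1Curve F T γ)
    (hE : ∀ᵐ t ∂(volume.restrict (Icc 0 T)), velocity F γ t - D.u t (γ t) ∈ D.sr.E (γ t)) :
    D.IsControlledBy γ (hπ.splitFrame 𝓕 𝓕') (splitCoeff 𝓕 𝓕') where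
  isH1Curve := hγ
  contMDiff := hπ.contMDiff_splitFrame
  integrable := by
    rintro (a | b)
    · exact (DevelopmentData.memLp_frameCoeff (hπ.isH1Curve_comp hγ) hT a).integrable (by norm_num)
    · exact (DevelopmentData.memLp_frameCoeff hγ hT b).integrable (by norm_num)
  velocity_eq := by
    filter_upwards [hE, hπ.velocity_comp hγ hT, ae_restrict_mem measurableSet_Icc] with t h1 h2 ht
    have h3 := DevelopmentData.frameCoeff_spec (𝓕 := 𝓕) ht h1
    have h4 : ∀ a, D'.frameCoeff 𝓕' t a = ∑ b, D.frameCoeff 𝓕 t b * ∑ j, 𝓕'.θ a j (π (γ t)) *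
        mvfderiv 𝓘(ℝ, F) (fun y => 𝓕'.f j (π y)) (γ t) (𝓕.X b (γ t)).1 := by
      intro a
      have h5 : velocity F' (fun t => π (γ t)) t - D'.u t (π (γ t)) =
          mfderiv 𝓘(ℝ, F) 𝓘(ℝ, F') π (γ t) (∑ b, D.frameCoeff 𝓕 t b • (𝓕.X b (γ t)).1) := by
        rw [← h3, map_sub, hπ.u_related t ht, h2]
      rw [DevelopmentData.frameCoeff, h5]
      simp only [CompactFrame.demb_apply, ← hπ.mvfderiv_comp (𝓕'.contMDiff_f _), map_sum, map_smul,
        smul_eq_mul, Finset.mul_sum]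
      rw [Finset.sum_comm]
      exact Finset.sum_congr rfl fun b _ => Finset.sum_congr rfl fun j _ => by ring
    rw [Fintype.sum_sum_type]
    simp only [splitCoeff, splitFrame, Sum.elim_inl, Sum.elim_inr, Submodule.coe_sub,
      Submodule.coe_sum, Submodule.coe_smul, smul_sub, Finset.sum_sub_distrib]
    have h6 : ∑ a, D'.frameCoeff 𝓕' t a • (hπ.lift (γ t) (𝓕'.X a (π (γ t)))).1 =
        ∑ b, D.frameCoeff 𝓕 t b • ∑ a, (∑ j, 𝓕'.θ a j (π (γ t)) *
          mvfderiv 𝓘(ℝ, F) (fun y => 𝓕'.f j (π y)) (γ t) (𝓕.X b (γ t)).1) •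
            (hπ.lift (γ t) (𝓕'.X a (π (γ t)))).1 := by
      simp only [Finset.smul_sum, smul_smul]
      rw [Finset.sum_comm]
      exact Finset.sum_congr rfl fun a _ => by rw [h4, Finset.sum_smul]
    rw [← h3, h6]
    abel

variable (𝓕') in
/-- The pullback to `M` of the covector field with components `p`. -/
def pullbackForm (p : ℝ → 𝓕'.J → ℝ) (t : ℝ) : TangentSpace 𝓘(ℝ, F) (γ t) →L[ℝ] ℝ :=
  ∑ j, p t j • mvfderiv 𝓘(ℝ, F) (fun y => 𝓕'.f j (π y)) (γ t)

theorem pullbackForm_apply (hπ : IsSubmersionOfData π D D') (p : ℝ → 𝓕'.J → ℝ) (t : ℝ)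
    (v : TangentSpace 𝓘(ℝ, F) (γ t)) : pullbackForm 𝓕' p t v =
      ∑ j, p t j * 𝓕'.demb (π (γ t)) (mfderiv 𝓘(ℝ, F) 𝓘(ℝ, F') π (γ t) v) j := by
  simp only [pullbackForm, sum_apply, smul_apply, smul_eq_mul, hπ.mvfderiv_comp (𝓕'.contMDiff_f _)]
  rfl

/-- All fields in the bracket are π-related to fields on N near the curve: u to ǔ, the lifts to the
frame of Ě, the vertical parts to zero. Hence their derivatives against functions pulled back from N
reproduce the adjoint matrix on N. -/
theorem isLieTransported_pullbackForm (hπ : IsSubmersionOfData π D D') (hT : 0 < T)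
    (hγ : IsH1Curve F T γ)
    (hE : ∀ᵐ t ∂(volume.restrict (Icc 0 T)), velocity F γ t - D.u t (γ t) ∈ D.sr.E (γ t))
    {p : ℝ → 𝓕'.J → ℝ} (hp : D'.IsExtremal 𝓕' p) :
    D.IsLieTransported γ (hπ.splitFrame 𝓕 𝓕') (splitCoeff 𝓕 𝓕') (pullbackForm 𝓕' p) := by
  intro W hW
  have hc := hπ.isControlledBy_splitFrame (𝓕 := 𝓕) (𝓕' := 𝓕') hT hγ hE
  have h1 := HasACDeriv.sum Finset.univ fun j _ => (hp.eval hT.le j).mul hT.le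
    (hγ.hasACDeriv hT 𝓕 (hW.mvfderiv_vf (hπ.contMDiff_comp (𝓕'.contMDiff_f j))))
  have e : (fun t => pullbackForm 𝓕' p t (W (γ t))) = fun t => ∑ j, p t j *
      mvfderiv 𝓘(ℝ, F) (fun y => 𝓕'.f j (π y)) (γ t) (W (γ t)) := by
    funext t
    simp [pullbackForm]
  rw [e]
  refine h1.congr_ae ?_
  filter_upwards [hc.velocity_eq, ae_restrict_mem measurableSet_Icc] with t hv ht
  have hO := 𝓕'.emb_mem ht
  set w := mfderiv 𝓘(ℝ, F) 𝓘(ℝ, F') π (γ t) (W (γ t)) with hw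
  have hu : ∀ l, mvfderiv 𝓘(ℝ, F) (fun y => mvfderiv 𝓘(ℝ, F) (fun y => 𝓕'.f l (π y)) y (D.u t y))
      (γ t) (W (γ t)) = mvfderiv 𝓘(ℝ, F') (fun z => mvfderiv 𝓘(ℝ, F') (𝓕'.f l) z (D'.u t z)) (π (γ t)) w := by
    intro l
    simp only [hπ.mvfderiv_comp (𝓕'.contMDiff_f l), hπ.u_related t ht]
    exact hπ.mvfderiv_comp ((D'.contMDiff_u ht).mvfderiv_vf (𝓕'.contMDiff_f l)) (γ t) (W (γ t))
  have hl : ∀ l a, mvfderiv 𝓘(ℝ, F) (fun y => mvfderiv 𝓘(ℝ, F) (fun y => 𝓕'.f l (π y)) y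
      (hπ.splitFrame 𝓕 𝓕' (.inl a) y).1) (γ t) (W (γ t)) =
      mvfderiv 𝓘(ℝ, F') (fun z => mvfderiv 𝓘(ℝ, F') (𝓕'.f l) z (𝓕'.X a z).1) (π (γ t)) w := by
    intro l a
    simp only [hπ.mvfderiv_comp (𝓕'.contMDiff_f l), splitFrame, Sum.elim_inl, hπ.mfderiv_lift]
    exact hπ.mvfderiv_comp ((𝓕'.contMDiff_X a).mvfderiv_vf (𝓕'.contMDiff_f l)) (γ t) (W (γ t))
  have hr : ∀ l b, mvfderiv 𝓘(ℝ, F) (fun y => mvfderiv 𝓘(ℝ, F) (fun y => 𝓕'.f l (π y)) y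
      (hπ.splitFrame 𝓕 𝓕' (.inr b) y).1) (γ t) (W (γ t)) = 0 := by
    intro l b
    -- Verticality holds only where π lands in the domain of the frame on N; this open set contains
    -- γ t, which suffices for a derivative.
    have h2 : (fun y => mvfderiv 𝓘(ℝ, F) (fun y => 𝓕'.f l (π y)) y
        (hπ.splitFrame 𝓕 𝓕' (.inr b) y).1) =ᶠ[𝓝 (γ t)] fun _ => (0 : ℝ) := by
      filter_upwards [(𝓕'.isOpen_preimage.preimage hπ.smooth.continuous).mem_nhds hO] with y hy
      rw [hπ.mvfderiv_comp (𝓕'.contMDiff_f l), hπ.mfderiv_splitFrame_inr b hy, map_zero]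
    rw [mvfderiv_congr_of_eventuallyEq h2, mvfderiv_const]
    rfl
  have hvar : ∀ i, ∑ j, D'.varMatrix 𝓕' t i j * 𝓕'.demb (π (γ t)) w j =
      mvfderiv 𝓘(ℝ, F') (fun z => mvfderiv 𝓘(ℝ, F') (𝓕'.f i) z (D'.u t z)) (π (γ t)) w +
      ∑ a, D'.frameCoeff 𝓕' t a *
        mvfderiv 𝓘(ℝ, F') (fun z => mvfderiv 𝓘(ℝ, F') (𝓕'.f i) z (𝓕'.X a z).1) (π (γ t)) w := by
    intro i
    have h3 : ∀ g : N → ℝ, ∑ j, mvfderiv 𝓘(ℝ, F') g (π (γ t)) (𝓕'.W j (π (γ t))) * 𝓕'.demb (π (γ t)) w j =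
        mvfderiv 𝓘(ℝ, F') g (π (γ t)) w := by
      intro g
      conv_rhs => rw [← 𝓕'.sum_demb hO w, map_sum]
      exact Finset.sum_congr rfl fun j _ => by rw [map_smul, smul_eq_mul, mul_comm]
    simp only [DevelopmentData.varMatrix, add_mul, Finset.sum_add_distrib, Finset.sum_mul]
    rw [h3, Finset.sum_comm]
    simp only [mul_assoc, ← Finset.mul_sum]
    congr 1
    exact Finset.sum_congr rfl fun a _ => by rw [h3]
  have hcomp : ∀ j, mvfderiv 𝓘(ℝ, F) (fun y => 𝓕'.f j (π y)) (γ t) (W (γ t)) = 𝓕'.demb (π (γ t)) w j :=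
    fun j => hπ.mvfderiv_comp (𝓕'.contMDiff_f j) (γ t) (W (γ t))
  have h5 : ∑ j, (-∑ i, p t i * D'.varMatrix 𝓕' t i j) * 𝓕'.demb (π (γ t)) w j =
      -∑ i, p t i * ∑ j, D'.varMatrix 𝓕' t i j * 𝓕'.demb (π (γ t)) w j := by
    simp only [neg_mul, Finset.sum_neg_distrib, Finset.sum_mul, Finset.mul_sum, mul_assoc]
    rw [Finset.sum_comm]
  rw [Finset.sum_add_distrib]
  simp only [hcomp]
  rw [h5]
  simp only [hvar, pullbackForm, sum_apply, smul_apply, smul_eq_mul,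
    hc.mvfderiv_lieTerm ht hv (hπ.contMDiff_comp (𝓕'.contMDiff_f _)) hW, Fintype.sum_sum_type,
    hu, hl, hr, mul_zero, Finset.sum_const_zero, add_zero]
  rw [← Finset.sum_neg_distrib, ← Finset.sum_add_distrib]
  refine Finset.sum_congr rfl fun l _ => ?_
  simp only [splitCoeff, Sum.elim_inl]
  ring

end IsSubmersionOfData

/-! ### Dependence of the notions on the restriction of a curve to `[0,T]`. -/

section Congr

variable {F : Type*} [NormedAddCommGroup F] [NormedSpace ℝ F]
  {M : Type uM} [TopologicalSpace M] [ChartedSpace F M] {T : ℝ} {γ γ' : ℝ → M}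

theorem eventuallyEq_of_eqOn_Icc {X : Type*} {f g : ℝ → X} (h : ∀ t ∈ Icc 0 T, f t = g t) {t : ℝ}
    (ht : t ∈ Ioo 0 T) : f =ᶠ[𝓝 t] g :=
  Filter.eventuallyEq_of_mem (Ioo_mem_nhds ht.1 ht.2) fun s hs => h s (Ioo_subset_Icc_self hs)

theorem IsH1Curve.congr (hγ : IsH1Curve F T γ) (hT : 0 ≤ T) (h : ∀ t ∈ Icc 0 T, γ t = γ' t) :
    IsH1Curve F T γ' where
  continuousOn := hγ.continuousOn.congr fun t ht => (h t ht).symm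
  absolutelyContinuous f hf := (hγ.absolutelyContinuous f hf).congr' (by
    rw [uIcc_of_le hT]
    exact fun t ht => congrArg f (h t ht).symm)
  memLp_deriv f hf := (hγ.memLp_deriv f hf).ae_eq (by
    filter_upwards [ae_restrict_Icc_mem_Ioo T] with t ht
    exact Filter.EventuallyEq.deriv_eq
      (eventuallyEq_of_eqOn_Icc (fun s hs => congrArg f (h s hs)) ht))

theorem tangentBundle_mk_eq {x x' : M} (hx : x = x') (v : F) :
    (⟨x, v⟩ : TangentBundle 𝓘(ℝ, F) M) = ⟨x', v⟩ := by
  subst hx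
  rfl

theorem velocity_congr (h : ∀ t ∈ Icc 0 T, γ t = γ' t) {t : ℝ} (ht : t ∈ Ioo 0 T) :
    (⟨γ t, velocity F γ t⟩ : TangentBundle 𝓘(ℝ, F) M) = ⟨γ' t, velocity F γ' t⟩ := by
  have h0 := (eventuallyEq_of_eqOn_Icc h ht).mfderiv_eq (I := 𝓘(ℝ, ℝ)) (I' := 𝓘(ℝ, F))
  have h1 : @Eq F (velocity F γ t) (velocity F γ' t) := DFunLike.congr_fun h0 (1 : ℝ)
  refine (tangentBundle_mk_eq (F := F) (h t (Ioo_subset_Icc_self ht)) (velocity F γ t)).trans ?_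
  exact congrArg (fun v : F => (⟨γ' t, v⟩ : TangentBundle 𝓘(ℝ, F) M)) h1

variable [IsManifold 𝓘(ℝ, F) ∞ M] [FiniteDimensional ℝ F]

theorem covHessian_congr
    {cov : CovariantDerivative 𝓘(ℝ, F) F (TangentSpace 𝓘(ℝ, F) : M → Type _)} {f : M → ℝ}
    {x x' : M} (hx : x = x') {v w : TangentSpace 𝓘(ℝ, F) x} {v' w' : TangentSpace 𝓘(ℝ, F) x'}
    (hv : (⟨x, v⟩ : TangentBundle 𝓘(ℝ, F) M) = ⟨x', v'⟩)
    (hw : (⟨x, w⟩ : TangentBundle 𝓘(ℝ, F) M) = ⟨x', w'⟩) :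
    covHessian cov f x v w = covHessian cov f x' v' w' := by
  subst hx
  rw [DevelopmentData.tangentBundle_mk_inj hv, DevelopmentData.tangentBundle_mk_inj hw]

theorem IsParallelAlong.congr
    {cov : CovariantDerivative 𝓘(ℝ, F) F (TangentSpace 𝓘(ℝ, F) : M → Type _)}
    {V : ∀ t, TangentSpace 𝓘(ℝ, F) (γ t)} {V' : ∀ t, TangentSpace 𝓘(ℝ, F) (γ' t)}
    (hV : IsParallelAlong cov T γ V) (hT : 0 ≤ T) (h : ∀ t ∈ Icc 0 T, γ t = γ' t)
    (hVV : ∀ t ∈ Icc 0 T, (⟨γ t, V t⟩ : TangentBundle 𝓘(ℝ, F) M) = ⟨γ' t, V' t⟩) :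
    IsParallelAlong cov T γ' V' := by
  intro f hf
  have h1 : ∀ t ∈ Icc 0 T, mfderiv 𝓘(ℝ, F) 𝓘(ℝ, ℝ) f (γ t) (V t) =
      (mfderiv 𝓘(ℝ, F) 𝓘(ℝ, ℝ) f (γ' t) (V' t) : ℝ) := fun t ht =>
    congrArg (fun q : TangentBundle 𝓘(ℝ, F) M => (mfderiv 𝓘(ℝ, F) 𝓘(ℝ, ℝ) f q.1 q.2 : ℝ)) (hVV t ht)
  refine ⟨(hV f hf).1.congr' (by rw [uIcc_of_le hT]; exact fun t ht => (h1 t ht).symm), ?_⟩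
  filter_upwards [(hV f hf).2, ae_restrict_Icc_mem_Ioo T] with t h2 ht
  have ht' := Ioo_subset_Icc_self ht
  rw [← covHessian_congr (h t ht') (velocity_congr h ht) (hVV t ht'), ← h2]
  exact (eventuallyEq_of_eqOn_Icc h1 ht).symm.deriv_eq

end Congr

namespace DevelopmentData

variable {F : Type*} [NormedAddCommGroup F] [NormedSpace ℝ F]
  {M : Type uM} [TopologicalSpace M] [ChartedSpace F M] [IsManifold 𝓘(ℝ, F) ∞ M] {T : ℝ}
  {D : DevelopmentData F M T} {η : D.H} {γ γ' : ℝ → M}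

theorem eq_add_congr [FiniteDimensional ℝ F] {x x' : M} (hx : x = x') {U : ∀ y : M, TangentSpace 𝓘(ℝ, F) y}
    {v w : TangentSpace 𝓘(ℝ, F) x} {v' w' : TangentSpace 𝓘(ℝ, F) x'}
    (hv : (⟨x, v⟩ : TangentBundle 𝓘(ℝ, F) M) = ⟨x', v'⟩)
    (hw : (⟨x, w⟩ : TangentBundle 𝓘(ℝ, F) M) = ⟨x', w'⟩) (h : v = w + U x) : v' = w' + U x' := by
  subst hx
  rw [← tangentBundle_mk_inj hv, ← tangentBundle_mk_inj hw, h]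

theorem IsDevelopment.congr [FiniteDimensional ℝ F] (h : D.IsDevelopment η γ) (hT : 0 ≤ T)
    (e : ∀ t ∈ Icc 0 T, γ t = γ' t) : D.IsDevelopment η γ' := by
  obtain ⟨P, h⟩ := h.exists_with
  -- The transport maps land in tangent spaces at different expressions for the same point. Where
  -- the curves differ, the value is irrelevant and taken to be 0.
  have h1 : ∀ t, ∃ Q : D.sr.Fiber D.o →ₗ[ℝ] TangentSpace 𝓘(ℝ, F) (γ' t), γ t = γ' t →
      ∀ v, (⟨γ t, P t v⟩ : TangentBundle 𝓘(ℝ, F) M) = ⟨γ' t, Q v⟩ := by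
    intro t
    by_cases ht : γ t = γ' t
    · rw [← ht]
      exact ⟨P t, fun _ _ => rfl⟩
    · exact ⟨0, fun h => absurd h ht⟩
  choose Q hQ using h1
  have h0 : (0 : ℝ) ∈ Icc 0 T := ⟨le_rfl, hT⟩
  refine ⟨h.isH1Curve.congr hT e, (e 0 h0).symm.trans h.start, Q,
    fun v => (hQ 0 (e 0 h0) v).symm.trans (h.init v),
    fun v => (h.parallel v).congr hT e fun t ht => hQ t (e t ht) v, ?_⟩
  filter_upwards [h.velocity_eq, ae_restrict_Icc_mem_Ioo T] with t h2 ht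
  have ht' := e t (Ioo_subset_Icc_self ht)
  exact eq_add_congr ht' (velocity_congr e ht) (hQ t ht' _) h2

variable [FiniteDimensional ℝ F] [T2Space M]

theorem IsDevelopment.velocity_sub_mem (h : D.IsDevelopment η γ) (hT : 0 < T) :
    ∀ᵐ t ∂(volume.restrict (Icc 0 T)), velocity F γ t - D.u t (γ t) ∈ D.sr.E (γ t) := by
  obtain ⟨P, h⟩ := h.exists_with
  filter_upwards [h.velocity_eq, ae_restrict_mem measurableSet_Icc] with t h1 ht
  rw [h1, add_sub_cancel_right]
  exact h.isTransport.mem_E hT ht _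

/-- Differentiating the endpoint needs a development for every control, with the prescribed curve at
η so that the frame along its trace can be used. -/
theorem IsDevelopment.exists_family (hcomplete : ∀ η : D.H, ∃ γ, D.IsDevelopment η γ)
    (h : D.IsDevelopment η γ) : ∃ G : D.H → ℝ → M, (∀ η, D.IsDevelopment η (G η)) ∧ G η = γ := by
  classical
  choose G hG using hcomplete
  refine ⟨Function.update G η γ, fun ζ => ?_, Function.update_self ..⟩
  by_cases hζ : ζ = η
  · subst hζ
    rwa [Function.update_self]
  · rw [Function.update_of_ne hζ]
    exact hG ζ

theorem IsDevelopment.not_isRegular (hcomplete : ∀ η : D.H, ∃ γ, D.IsDevelopment η γ)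
    (h : D.IsDevelopment η γ) (hT : 0 < T) {𝓕 : CompactFrame D.sr T (trace T γ)}
    {p : ℝ → 𝓕.J → ℝ} (hp : D.IsExtremal 𝓕 p)
    (hpE : ∀ t ∈ Icc 0 T, ∀ v ∈ D.sr.E (γ t), ∑ j, p t j * 𝓕.demb (γ t) v j = 0)
    {v : TangentSpace 𝓘(ℝ, F) (γ T)} (hv : ∑ j, p T j * 𝓕.demb (γ T) v j ≠ 0) :
    ¬ D.IsRegular η := by
  obtain ⟨G, hG, rfl⟩ := h.exists_family hcomplete
  exact not_isRegular_of_isExtremal hG hT hp hpE hv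

theorem IsDevelopment.exists_isExtremal (hcomplete : ∀ η : D.H, ∃ γ, D.IsDevelopment η γ)
    (h : D.IsDevelopment η γ) (hT : 0 < T) (hη : ¬ D.IsRegular η)
    (𝓕 : CompactFrame D.sr T (trace T γ)) :
    ∃ p, D.IsExtremal 𝓕 p ∧
      (∀ t ∈ Icc 0 T, ∀ v ∈ D.sr.E (γ t), ∑ j, p t j * 𝓕.demb (γ t) v j = 0) ∧
      ∃ v : TangentSpace 𝓘(ℝ, F) (γ T), ∑ j, p T j * 𝓕.demb (γ T) v j ≠ 0 := by
  obtain ⟨G, hG, rfl⟩ := h.exists_family hcomplete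
  exact exists_isExtremal_of_not_isRegular hG hT hη 𝓕

end DevelopmentData

theorem exists_descend {X Z : Type*} [AddCommGroup X] [Module ℝ X] [AddCommGroup Z] [Module ℝ Z]
    {L : X →ₗ[ℝ] Z} (hL : Function.Surjective L) {f : X →ₗ[ℝ] ℝ} (h : ∀ v, L v = 0 → f v = 0) :
    ∃ α : Z →ₗ[ℝ] ℝ, ∀ v, α (L v) = f v := by
  obtain ⟨s, hs⟩ := L.exists_rightInverse_of_surjective (LinearMap.range_eq_top.2 hL)
  refine ⟨f ∘ₗ s, fun v => ?_⟩
  have h1 := h (s (L v) - v) (by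
    rw [map_sub, sub_eq_zero]
    exact DFunLike.congr_fun hs (L v))
  rwa [map_sub, sub_eq_zero] at h1

/-! ### The two implications. -/

namespace IsSubmersionOfData

variable {F : Type*} [NormedAddCommGroup F] [NormedSpace ℝ F] [FiniteDimensional ℝ F]
  {M : Type uM} [TopologicalSpace M] [ChartedSpace F M] [IsManifold 𝓘(ℝ, F) ∞ M] [T2Space M]
  {F' : Type*} [NormedAddCommGroup F'] [NormedSpace ℝ F'] [FiniteDimensional ℝ F']
  {N : Type uN} [TopologicalSpace N] [ChartedSpace F' N] [IsManifold 𝓘(ℝ, F') ∞ N] [T2Space N]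
  {T : ℝ} {π : M → N} {D : DevelopmentData F M T} {D' : DevelopmentData F' N T}

theorem exists_isDevelopment (hπ : IsSubmersionOfData π D D') (hT : 0 < T)
    (hcomplete : ∀ η : D.H, ∃ γ, D.IsDevelopment η γ) (η' : D'.H) :
    ∃ γ', D'.IsDevelopment η' γ' := by
  obtain ⟨η, hη⟩ := hπ.exists_development_lift hT η'
  obtain ⟨γ, hγ⟩ := hcomplete η
  exact ⟨_, hη γ hγ⟩

/-- The curve is the development of the lifted control, and λ is the pullback of an adjoint solution
on N. It kills E because π_* maps E into Ě, and vertical vectors because it is a pullback. -/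
theorem exists_singularSystem (hπ : IsSubmersionOfData π D D') (hT : 0 < T)
    (hcomplete : ∀ η : D.H, ∃ γ, D.IsDevelopment η γ) {γ' : ℝ → N} (h : D'.IsSingularCurve γ') :
    ∃ (γ : ℝ → M) (lam : ∀ t : ℝ, TangentSpace 𝓘(ℝ, F) (γ t) →L[ℝ] ℝ),
        γ 0 = D.o ∧ (∀ t ∈ Icc 0 T, π (γ t) = γ' t) ∧
        D.SolvesSingularSystem γ lam ∧
        (∀ t ∈ Icc 0 T, lam t ≠ 0) ∧
        ∀ v ∈ D.sr.E (γ 0) ⊔ vertical F F' π (γ 0), lam 0 v = 0 := by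
  obtain ⟨η', hη', hnr⟩ := h
  obtain ⟨η, hη⟩ := hπ.exists_development_lift hT η'
  obtain ⟨γ, hγ⟩ := hcomplete η
  have hd := hη γ hγ
  have hE := hγ.velocity_sub_mem hT
  obtain ⟨𝓕⟩ := exists_compactFrame D.sr T hγ.1.isCompact_trace
  obtain ⟨𝓕'⟩ := exists_compactFrame D'.sr T hd.1.isCompact_trace
  obtain ⟨p, hp, hpE, w, hw⟩ := hd.exists_isExtremal (hπ.exists_isDevelopment hT hcomplete) hT
    hnr 𝓕'
  have hvan : ∀ t ∈ Icc 0 T, ∀ v ∈ D.sr.E (γ t), pullbackForm 𝓕' p t v = 0 := fun t ht v hv => by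
    rw [hπ.pullbackForm_apply]
    exact hpE t ht _ (hπ.map_mem _ v hv)
  have hc := hπ.isControlledBy_splitFrame (𝓕 := 𝓕) (𝓕' := 𝓕') hT hγ.1 hE
  have hl := hπ.isLieTransported_pullbackForm (𝓕 := 𝓕) hT hγ.1 hE hp
  refine ⟨γ, pullbackForm 𝓕' p, hγ.2.1, fun t ht => hd.eq_of_eq hη' hT ht,
    ⟨hγ.1, hE, (hc.isLieTransported_iff hT hvan).1 hl, hvan⟩, fun t ht h0 => ?_, fun v hv => ?_⟩
  -- A zero at one time would propagate to time T, where the adjoint solution is nonzero on a vector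
  -- that lifts to M.
  · have h1 := hl.eq_of_eq DevelopmentData.isLieTransported_zero hc hT ht ⟨hT.le, le_rfl⟩ h0
    obtain ⟨v, rfl⟩ := hπ.submersion _ w
    refine hw ?_
    rw [← hπ.pullbackForm_apply, h1]
    rfl
  · obtain ⟨v, hvE, w, hw, rfl⟩ := Submodule.mem_sup.1 hv
    have hw' : mfderiv 𝓘(ℝ, F) 𝓘(ℝ, F') π (γ 0) w = 0 := hw
    rw [map_add, hvan 0 ⟨le_rfl, hT.le⟩ v hvE, zero_add, hπ.pullbackForm_apply, hw', map_zero]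
    simp

/-- The projected curve is a development since π_*(γ̇ − u) is in Ě. λ_0 descends along π_*, and the
adjoint solution on N from that initial covector pulls back to λ. It therefore kills Ě = π_*E and is
nonzero on tangent vectors at time T. -/
theorem isSingularCurve (hπ : IsSubmersionOfData π D D') (hT : 0 < T)
    (hcomplete : ∀ η : D.H, ∃ γ, D.IsDevelopment η γ) {γ' : ℝ → N} {γ : ℝ → M}
    {lam : ∀ t : ℝ, TangentSpace 𝓘(ℝ, F) (γ t) →L[ℝ] ℝ} (h0 : γ 0 = D.o)
    (hγ' : ∀ t ∈ Icc 0 T, π (γ t) = γ' t) (hs : D.SolvesSingularSystem γ lam)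
    (hne : lam T ≠ 0) (hv : ∀ v ∈ vertical F F' π (γ 0), lam 0 v = 0) :
    D'.IsSingularCurve γ' := by
  have ht0 : (0 : ℝ) ∈ Icc 0 T := ⟨le_rfl, hT.le⟩
  have hH := hs.isH1Curve
  have hH' := hπ.isH1Curve_comp hH
  have hE := hs.velocity_sub_mem
  obtain ⟨η', hη'⟩ := DevelopmentData.exists_isDevelopment (D := D') hH' hT
    ((congrArg π h0).trans hπ.map_o) (by
      filter_upwards [hE, hπ.velocity_comp hH hT, ae_restrict_mem measurableSet_Icc] with t h1 h2 ht
      rw [h2, ← hπ.u_related t ht, ← map_sub]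
      exact hπ.map_mem _ _ h1)
  refine ⟨η', hη'.congr hT.le hγ', ?_⟩
  obtain ⟨𝓕⟩ := exists_compactFrame D.sr T hH.isCompact_trace
  obtain ⟨𝓕'⟩ := exists_compactFrame D'.sr T hH'.isCompact_trace
  obtain ⟨α, hα⟩ := exists_descend (L := (mfderiv 𝓘(ℝ, F) 𝓘(ℝ, F') π (γ 0)).toLinearMap)
    (hπ.submersion _) (f := (lam 0).toLinearMap) fun v h => hv v h
  obtain ⟨p, hp0, hp⟩ := DevelopmentData.exists_isExtremal (𝓕 := 𝓕') hH' hT ht0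
    fun j => α (𝓕'.W j (π (γ 0)))
  have hc := hπ.isControlledBy_splitFrame (𝓕 := 𝓕) (𝓕' := 𝓕') hT hH hE
  have hl := hπ.isLieTransported_pullbackForm (𝓕 := 𝓕) hT hH hE hp
  -- The initial components of p are α(W_j), so p pairs with embedded tangent vectors as α does.
  have heq0 : pullbackForm 𝓕' p 0 = lam 0 := by
    refine ContinuousLinearMap.ext fun v => ?_
    rw [hπ.pullbackForm_apply, hp0]
    refine Eq.trans ?_ (hα v)
    change _ = α (mfderiv 𝓘(ℝ, F) 𝓘(ℝ, F') π (γ 0) v)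
    conv_rhs => rw [← 𝓕'.sum_demb (𝓕'.emb_mem ht0) (mfderiv 𝓘(ℝ, F) 𝓘(ℝ, F') π (γ 0) v), map_sum]
    exact Finset.sum_congr rfl fun j _ => by rw [map_smul, smul_eq_mul, mul_comm]
  have heq : ∀ t ∈ Icc 0 T, pullbackForm 𝓕' p t = lam t := fun t ht =>
    hl.eq_of_eq ((hc.isLieTransported_iff hT hs.vanish).2 hs.covDeriv_eq) hc hT ht0 ht heq0
  obtain ⟨v, hvT⟩ : ∃ v, lam T v ≠ 0 := by
    by_contra! h
    exact hne (ContinuousLinearMap.ext h)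
  refine hη'.not_isRegular (hπ.exists_isDevelopment hT hcomplete) hT hp (fun t ht w hw => ?_)
    (v := mfderiv 𝓘(ℝ, F) 𝓘(ℝ, F') π (γ T) v) ?_
  · obtain ⟨v, hvE, rfl⟩ := hπ.map_surj _ w hw
    rw [← hπ.pullbackForm_apply, heq t ht]
    exact hs.vanish t ht v hvE
  · rwa [← hπ.pullbackForm_apply, heq T ⟨hT.le, le_rfl⟩]

end IsSubmersionOfData

end

theorem mainTheorem6
    {F : Type*} [NormedAddCommGroup F] [NormedSpace ℝ F] [FiniteDimensional ℝ F]
    {M : Type*} [TopologicalSpace M] [ChartedSpace F M] [IsManifold 𝓘(ℝ, F) ∞ M]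
    [T2Space M] [SecondCountableTopology M]
    {F' : Type*} [NormedAddCommGroup F'] [NormedSpace ℝ F'] [FiniteDimensional ℝ F']
    {N : Type*} [TopologicalSpace N] [ChartedSpace F' N] [IsManifold 𝓘(ℝ, F') ∞ N]
    [T2Space N] [SecondCountableTopology N]
    (T : ℝ) (hT : 0 < T)
    (D : DevelopmentData F M T) (D' : DevelopmentData F' N T)
    (π : M → N) (hπ : IsSubmersionOfData π D D')
    (hcomplete : ∀ η : D.H, ∃ γ : ℝ → M, D.IsDevelopment η γ)
    (γ' : ℝ → N) :
    D'.IsSingularCurve γ' ↔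
      ∃ (γ : ℝ → M) (lam : ∀ t : ℝ, TangentSpace 𝓘(ℝ, F) (γ t) →L[ℝ] ℝ),
        γ 0 = D.o ∧ (∀ t ∈ Icc 0 T, π (γ t) = γ' t) ∧
        D.SolvesSingularSystem γ lam ∧
        (∀ t ∈ Icc 0 T, lam t ≠ 0) ∧
        ∀ v ∈ D.sr.E (γ 0) ⊔ vertical F F' π (γ 0), lam 0 v = 0 := by
  refine ⟨fun h => hπ.exists_singularSystem hT hcomplete h, ?_⟩
  rintro ⟨γ, lam, h0, hγ', hs, hne, hv⟩
  exact hπ.isSingularCurve hT hcomplete h0 hγ' hs (hne T ⟨hT.le, le_rfl⟩)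
    fun v h => hv v (Submodule.mem_sup_right h)
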